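/- Let $n\ge 1$ be an integer, let $\tau,\delta,\tfrac BA,\sigma>0$, let $m_1,m_2\in[1,2)$ and $s>\max\{\tfrac n2-\sigma,0\}$, and assume $$\frac{2}{\max\{m_1,m_2\}}\ \ge\ \frac{1}{\min\{m_1,m_2\}}+\frac{\sigma}{n}.$$ Write $\mathcal A=(-\Delta)^\sigma$ for the operator with Fourier symbol $|\xi|^{2\sigma}$, $\langle\xi\rangle=\sqrt{1+|\xi|^2}$, $H^r=\langle D\rangle^{-r}L^2(\mathbb R^n)$, $\dot H^r=|D|^{-r}L^2(\mathbb R^n)$, and $$\mathbb D_{s,m}:=(H^{s+\sigma}\cap L^m)\times(H^{s+\sigma}\cap L^m)\times(H^s\cap L^m),$$ with all functions real-valued and with the sum of the norms as the norm. Consider the Cauchy problem for real-valued $u,v$ on $[0,\infty)\times\mathbb R^n$, $$\tau\partial_t^3u+\partial_t^2u+\mathcal Au+(\delta+\tau)\mathcal A\partial_tu=\bigl(1+\tfrac{B}{2A}\bigr)\partial_t\bigl[(\partial_tu)^2-(\partial_tv)^2\bigr],$$ $$\tau\partial_t^3v+\partial_t^2v+\mathcal Av+(\delta+\tau)\mathcal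 A\partial_tv=\bigl(2+\tfrac BA\bigr)\partial_t\bigl(\partial_tu\,\partial_tv\bigr),$$ $$(u,\partial_tu,\partial_t^2u)(0)=(u_0,u_1,u_2),\qquad (v,\partial_tv,\partial_t^2v)(0)=(v_0,v_1,v_2).$$ A pair $(u,v)$ of functions in $\mathcal C^1([0,\infty),L^2)$ is called a Sobolev solution if $\partial_tu,\partial_tv\in \mathcal C([0,\infty),H^{s+\sigma})$ and the two equations, in the form $$\partial_t\bigl(\tau\partial_t^2w-\kappa N\bigr)+\partial_t^2w+\mathcal Aw+(\delta+\tau)\mathcal A\partial_tw=0$$ (where $(w,\kappa,N)$ is $(u,1+\tfrac B{2A},(\partial_tu)^2-(\partial_tv)^2)$ or $(v,2+\tfrac BA,\partial_tu\,\partial_tv)$), and the initial conditions hold when tested against every Schwartz function of $x$, for every $t\ge0$ (with one-sided time derivatives at $t=0$). Then there are constants $\varepsilon_0>0$ and $C>0$, depending only on $n,\tau,\delta,\tfrac BA,\sigma,s,m_1,m_2$, such that for all data $(u_0,u_1,u_2)\in\mathbb D_{s,m_1}$ and $(v_0,v_1,v_2)\in\mathbb D_{s,m_2}$ with $$\varepsilon:=\|(u_0,u_1,u_2)\|_{\mathbb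 D_{s,m_1}}+\|(v_0,v_1,v_2)\|_{\mathbb D_{s,m_2}}+\bigl(\|u_1\|_{H^{s+\sigma}}+\|v_1\|_{H^{s+\sigma}}\bigr)^2\le\varepsilon_0$$ there is exactly one Sobolev solution $(u,v)$, and it satisfies for all $t\ge0$ and $(w,j)\in\{(u,1),(v,2)\}$ $$\|\partial_tw(t)\|_{L^2}\le C(1+t)^{-\frac{n(2-m_j)}{4m_j\sigma}}\,\varepsilon,\qquad \|\partial_tw(t)\|_{\dot H^{s+\sigma}}\le C(1+t)^{-\frac{n(2-m_j)}{4m_j\sigma}-\frac{s+\sigma}{2\sigma}}\,\varepsilon.$$ -/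

import Mathlib

open Set Filter Topology MeasureTheory
open scoped ENNReal FourierTransform SchwartzMap

noncomputable section

/-- The space `ℝⁿ` with its Euclidean norm. -/
abbrev Sp (n : ℕ) : Type := EuclideanSpace ℝ (Fin n)

/-- Real-valued `L²` functions on `ℝⁿ` (all Sobolev spaces below have positive order and are
subspaces of it). -/
abbrev RealL2 (n : ℕ) : Type := Lp (α := Sp n) ℝ 2 volume

/-- The `L²` Fourier transform of a real-valued function. In Mathlib's normalisation
`𝓕 f ξ = ∫ e^{-2πi⟨x, ξ⟩} f x dx`, so `|D|` has the symbol `2π‖ξ‖`. -/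
def fourierL2 {n : ℕ} (f : RealL2 n) : Lp (α := Sp n) ℂ 2 volume :=
  𝓕 (Complex.ofRealCLM.compLp f)

/-- The norm of `H^r = ⟨D⟩^{-r} L²`, with value `∞` outside `H^r`. -/
def sobolevENorm {n : ℕ} (r : ℝ) (f : RealL2 n) : ℝ≥0∞ :=
  eLpNorm (fun ξ : Sp n => (((1 + (2 * Real.pi * ‖ξ‖) ^ 2) ^ (r / 2) : ℝ) : ℂ) * fourierL2 f ξ)
    2 volume

/-- The norm of `Ḣ^r = |D|^{-r} L²`, with value `∞` outside `Ḣ^r`. -/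
def homSobolevENorm {n : ℕ} (r : ℝ) (f : RealL2 n) : ℝ≥0∞ :=
  eLpNorm (fun ξ : Sp n => (((2 * Real.pi * ‖ξ‖) ^ r : ℝ) : ℂ) * fourierL2 f ξ) 2 volume

/-- The norm of `L^m`, with value `∞` outside `L^m`. -/
def lebesgueENorm {n : ℕ} (m : ℝ) (f : RealL2 n) : ℝ≥0∞ :=
  eLpNorm (f : Sp n → ℝ) (ENNReal.ofReal m) volume

/-- The norm of `(H^{s+σ} ∩ L^m) × (H^{s+σ} ∩ L^m) × (H^s ∩ L^m)`. -/
def dataENorm {n : ℕ} (s σ m : ℝ) (w₀ w₁ w₂ : RealL2 n) : ℝ≥0∞ :=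
  (sobolevENorm (s + σ) w₀ + lebesgueENorm m w₀) + (sobolevENorm (s + σ) w₁ + lebesgueENorm m w₁)
    + (sobolevENorm s w₂ + lebesgueENorm m w₂)

/-- Membership in `(H^{s+σ} ∩ L^m) × (H^{s+σ} ∩ L^m) × (H^s ∩ L^m)`. -/
def MemDataSpace {n : ℕ} (s σ m : ℝ) (w₀ w₁ w₂ : RealL2 n) : Prop :=
  (sobolevENorm (s + σ) w₀ < ∞ ∧ lebesgueENorm m w₀ < ∞) ∧
    (sobolevENorm (s + σ) w₁ < ∞ ∧ lebesgueENorm m w₁ < ∞) ∧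
    (sobolevENorm s w₂ < ∞ ∧ lebesgueENorm m w₂ < ∞)

/-- The size of all the initial data. -/
def dataSize {n : ℕ} (s σ m₁ m₂ : ℝ) (u₀ u₁ u₂ v₀ v₁ v₂ : RealL2 n) : ℝ≥0∞ :=
  dataENorm s σ m₁ u₀ u₁ u₂ + dataENorm s σ m₂ v₀ v₁ v₂
    + (sobolevENorm (s + σ) u₁ + sobolevENorm (s + σ) v₁) ^ 2

/-- `U ∈ C([0, ∞), H^r)` (values at negative times are irrelevant). -/
def ContinuousInSobolev {n : ℕ} (r : ℝ) (U : ℝ → RealL2 n) : Prop :=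
  ∀ t ∈ Ici (0 : ℝ), sobolevENorm r (U t) < ∞ ∧
    Tendsto (fun t' => sobolevENorm r (U t' - U t)) (𝓝[Ici 0] t) (𝓝 0)

/-- `(-Δ)^σ φ = 𝓕⁻¹(|ξ|^{2σ} 𝓕 φ)` for a Schwartz function `φ`. -/
def fracLaplacian {n : ℕ} (σ : ℝ) (φ : 𝓢(Sp n, ℂ)) : Sp n → ℂ :=
  𝓕⁻ (fun ξ : Sp n => (((2 * Real.pi * ‖ξ‖) ^ (2 * σ) : ℝ) : ℂ) * 𝓕 (φ : Sp n → ℂ) ξ)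

/-- The distributional pairing `⟨f, g⟩ = ∫ f g dx`. -/
def pairing {n : ℕ} (f : Sp n → ℝ) (g : Sp n → ℂ) : ℂ :=
  ∫ x, (f x : ℂ) * g x

/-- The equation
`τ ∂ₜ³w + ∂ₜ²w + (-Δ)^σ w + (δ + τ) (-Δ)^σ ∂ₜw = κ ∂ₜN` on `[0, ∞) × ℝⁿ`
with `∂ₜ²w(0) = w₂`, in the sense of distributions in space; here `W` is `∂ₜw`.
For a test function `φ`, `p t` is `⟨∂ₜ²w(t), φ⟩`. The time derivatives of `τ ∂ₜ²w` and `κ N` are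
taken together, because each need not exist separately; `(-Δ)^σ` acts on distributions by duality.
At `t = 0` derivatives are one-sided. -/
def SolvesMGT {n : ℕ} (τ δ σ κ : ℝ) (w₂ : RealL2 n) (w W : ℝ → RealL2 n)
    (N : ℝ → Sp n → ℝ) : Prop :=
  ∀ φ : 𝓢(Sp n, ℂ), ∃ p : ℝ → ℂ,
    p 0 = pairing w₂ φ ∧
    ∀ t ∈ Ici (0 : ℝ),
      HasDerivWithinAt (fun r => pairing (W r) φ) (p t) (Ici 0) t ∧
      HasDerivWithinAt (fun r => (τ : ℂ) * p r - (κ : ℂ) * pairing (N r) φ)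
        (-p t - pairing (w t) (fracLaplacian σ φ)
          - ((δ + τ : ℝ) : ℂ) * pairing (W t) (fracLaplacian σ φ)) (Ici 0) t

/-- `(u, v)` is a global Sobolev solution of the coupled JMGT system
`τ ∂ₜ³u + ∂ₜ²u + (-Δ)^σ u + (δ + τ) (-Δ)^σ ∂ₜu = (1 + BA/2) ∂ₜ[(∂ₜu)² - (∂ₜv)²]`,
`τ ∂ₜ³v + ∂ₜ²v + (-Δ)^σ v + (δ + τ) (-Δ)^σ ∂ₜv = (2 + BA) ∂ₜ(∂ₜu ∂ₜv)`
with the given initial data, with time derivatives `∂ₜu = U` and `∂ₜv = V` in `C([0, ∞), H^r)`.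
The number `BA` is the ratio `B/A`. -/
structure IsSobolevSolution {n : ℕ} (τ δ BA σ r : ℝ) (u₀ u₁ u₂ v₀ v₁ v₂ : RealL2 n)
    (u v U V : ℝ → RealL2 n) : Prop where
  deriv_u : ∀ t ∈ Ici (0 : ℝ), HasDerivWithinAt u (U t) (Ici 0) t
  deriv_v : ∀ t ∈ Ici (0 : ℝ), HasDerivWithinAt v (V t) (Ici 0) t
  continuous_U : ContinuousInSobolev r U
  continuous_V : ContinuousInSobolev r V
  init_u : u 0 = u₀
  init_U : U 0 = u₁
  init_v : v 0 = v₀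
  init_V : V 0 = v₁
  eq_u : SolvesMGT τ δ σ (1 + BA / 2) u₂ u U (fun t x => U t x ^ 2 - V t x ^ 2)
  eq_v : SolvesMGT τ δ σ (2 + BA) v₂ v V (fun t x => U t x * V t x)

/-- `‖W(t)‖_{L²} ≤ C (1+t)^{-n(2-m)/(4mσ)} ε` and
`‖W(t)‖_{Ḣ^{s+σ}} ≤ C (1+t)^{-n(2-m)/(4mσ) - (s+σ)/(2σ)} ε` for all `t ≥ 0`. -/
def DecayBounds {n : ℕ} (s σ m C : ℝ) (ε : ℝ≥0∞) (W : ℝ → RealL2 n) : Prop :=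
  ∀ t ∈ Ici (0 : ℝ),
    lebesgueENorm 2 (W t) ≤
      ENNReal.ofReal (C * (1 + t) ^ (-(n * (2 - m) / (4 * m * σ)))) * ε ∧
    homSobolevENorm (s + σ) (W t) ≤
      ENNReal.ofReal (C * (1 + t) ^ (-(n * (2 - m) / (4 * m * σ)) - (s + σ) / (2 * σ))) * ε

end

/-! The forcing stands behind a time derivative, which a choice of unknowns removes. With `X = w + τ
∂ₜw`, `G = ∂ₜw + τ ∂ₜ²w - κN` and `W = ∂ₜw` the equation becomes `X' = G + κN`, `G' = -𝒜(X + δW)`,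
`τW' = G - W + κN`, a first-order system in which `N` enters undifferentiated along `κ(1, 0, 1/τ)`.
At frequency `q = |ξ|^σ` a Lyapunov functional gives decay with rate proportional to `q²/(1+q²)`
(`exists_mode_energy_decay`): low frequencies diffuse like `exp(-μq²t)`, high ones decay
exponentially. Since the forcing vector has no `G` component, the Duhamel kernel carries an
additional factor `q` at low frequencies (`exists_prop_bounds`), worth `(1+t)^(-1/2)`.

Put `r = s + σ`, `R = (1+t)^(-1/(2σ))` and `α = n(2-m)/(4mσ)`. The solution space asks that `∂ₜw`,
multiplied on the Fourier side by `(1+t)^α (1 + (|ξ|/R)^r)`, stay bounded in `L²`; this contains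
both decay estimates at once. Data in `L^m` belong to it because the low-pass filter `(1 +
(|ξ|/R)^r)⁻¹` maps `L^m` to `L²` with norm of order `R^(n(1/m-1/2))`, that is `(1+t)^(-α)`
(`exists_norm_Op_inv_wt_le_lebesgue`, `exists_norm_data_le`).

For the products, `r > n/2` makes the weighted space at scale `R` an algebra with constant of order
`R^(n/2)`, and a product of two `L²` functions has a bounded Fourier transform
(`exists_sobolevMul`). Interpolating, a product of factors with exponents `a` and `b`, seen from a
component with exponent `m`, contributes `(1+s)^(-θ)` with `θ = n(1/a+1/b-1/m)/(2σ)`. The hypothesis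
on `m₁, m₂` gives `θ ≥ 1/2` for the three products that occur (`exponent_conditions`). As `∫₀ᵗ
(1+t-s)^(-1/2) (1+s)^(-1/2) ds` is bounded, the Duhamel integral is a bounded bilinear map
(`exists_duhamelBilin`), and small data are handled by a contraction. The initial value `G(0)`
contains `κN(0)`, which is quadratic in the data; this is the role of the squared term in `ε`.

Weak and mild solutions are compared through the equation integrated twice in time
(`SolvesVolterra`). Restricted to frequencies `|ξ| ≤ R` it is a linear Volterra equation with
bounded operators, which the Duhamel formula solves and for which Gronwall gives uniqueness. So
every Sobolev solution is mild, and mild solutions are unique by a second Gronwall argument with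
bounds on compact time intervals. Smallness is needed for existence only. -/

noncomputable section

/-! ### The Fourier transform on real-valued `L²` functions, and Parseval's formula. -/

section FourierL2

variable {n : ℕ}

/-- The complexification of a real-valued `L²` function. -/
abbrev complexify (f : RealL2 n) : Lp (α := Sp n) ℂ 2 volume :=
  Complex.ofRealCLM.compLp f

lemma complexify_coeFn (f : RealL2 n) : complexify f =ᵐ[volume] fun x => ((f x : ℝ) : ℂ) :=
  Complex.ofRealCLM.coeFn_compLp f

lemma norm_complexify (f : RealL2 n) : ‖complexify f‖ = ‖f‖ := by
  rw [Lp.norm_def, Lp.norm_def]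
  congr 1
  apply eLpNorm_congr_norm_ae
  filter_upwards [complexify_coeFn f] with x hx
  rw [hx]; simp

lemma fourierL2_add (f g : RealL2 n) : fourierL2 (f + g) = fourierL2 f + fourierL2 g := by
  unfold fourierL2
  rw [← FourierTransform.fourier_add]
  congr 1
  exact (Complex.ofRealCLM.compLpₗ 2 volume).map_add f g

lemma fourierL2_smul (c : ℝ) (f : RealL2 n) : fourierL2 (c • f) = c • fourierL2 f := by
  unfold fourierL2
  have : Complex.ofRealCLM.compLp (c • f) = (c : ℂ) • Complex.ofRealCLM.compLp f := by
    rw [show ((c : ℂ) • Complex.ofRealCLM.compLp f) = c • Complex.ofRealCLM.compLp f from by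
      ext1
      filter_upwards [Lp.coeFn_smul (c : ℂ) (Complex.ofRealCLM.compLp f),
        Lp.coeFn_smul c (Complex.ofRealCLM.compLp f)] with x h1 h2
      rw [h1, h2]; simp]
    exact (Complex.ofRealCLM.compLpₗ 2 volume).map_smul c f
  rw [this, FourierTransform.fourier_smul]
  ext1
  filter_upwards [Lp.coeFn_smul (c : ℂ) (𝓕 (Complex.ofRealCLM.compLp f)),
    Lp.coeFn_smul c (𝓕 (Complex.ofRealCLM.compLp f))] with x h1 h2
  rw [h1, h2]; simp

lemma norm_fourierL2 (f : RealL2 n) : ‖fourierL2 f‖ = ‖f‖ := by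
  rw [fourierL2, Lp.norm_fourier_eq]; exact norm_complexify f

variable (n) in
/-- The `L²` Fourier transform as a real-linear isometry. -/
def fourierLI : RealL2 n →ₗᵢ[ℝ] Lp (α := Sp n) ℂ 2 volume where
  toFun := fourierL2
  map_add' := fourierL2_add
  map_smul' := fourierL2_smul
  norm_map' := norm_fourierL2

lemma fourierL2_sub (f g : RealL2 n) : fourierL2 (f - g) = fourierL2 f - fourierL2 g :=
  (fourierLI n).map_sub f g

lemma fourierL2_injective : Function.Injective (fourierL2 (n := n)) :=
  (fourierLI n).injective

lemma ext_fourierL2 {f g : RealL2 n} (h : fourierL2 f =ᵐ[volume] fourierL2 g) : f = g :=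
  fourierL2_injective (Lp.ext h)

lemma fourierL2_add_ae (f g : RealL2 n) :
    fourierL2 (f + g) =ᵐ[volume] fun ξ => fourierL2 f ξ + fourierL2 g ξ := by
  rw [fourierL2_add]; exact Lp.coeFn_add _ _

lemma fourierL2_sub_ae (f g : RealL2 n) :
    fourierL2 (f - g) =ᵐ[volume] fun ξ => fourierL2 f ξ - fourierL2 g ξ := by
  rw [fourierL2_sub]; exact Lp.coeFn_sub _ _

lemma fourierL2_smul_ae (c : ℝ) (f : RealL2 n) :
    fourierL2 (c • f) =ᵐ[volume] fun ξ => (c : ℂ) * fourierL2 f ξ := by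
  rw [fourierL2_smul]
  filter_upwards [Lp.coeFn_smul c (fourierL2 f)] with x hx
  rw [hx]; simp

/-- Locally integrable functions are determined by their pairings with Schwartz functions. -/
lemma ae_eq_of_integral_schwartz {f g : Sp n → ℂ} (hf : LocallyIntegrable f)
    (hg : LocallyIntegrable g) (h : ∀ φ : 𝓢(Sp n, ℂ), ∫ x, φ x * f x = ∫ x, φ x * g x) :
    f =ᵐ[volume] g := by
  apply ae_eq_of_integral_contDiff_smul_eq hf hg
  intro χ hχ hc
  have h1 : HasCompactSupport (Complex.ofRealCLM ∘ χ) := hc.comp_left rfl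
  have h2 : ContDiff ℝ (⊤ : ℕ∞) (Complex.ofRealCLM ∘ χ) := by fun_prop
  simpa using h (h1.toSchwartzMap h2)

lemma locallyIntegrable_L2 (f : Lp (α := Sp n) ℂ 2 volume) : LocallyIntegrable (f : Sp n → ℂ) :=
  (Lp.memLp f).locallyIntegrable (by norm_num)

lemma integral_mul_fourier (f : Lp (α := Sp n) ℂ 2 volume) (φ : 𝓢(Sp n, ℂ)) :
    ∫ ξ, φ ξ * (𝓕 f : Lp (α := Sp n) ℂ 2 volume) ξ = ∫ x, 𝓕 φ x * f x := by
  have h := congrArg (fun T => T φ) (Lp.fourier_toTemperedDistribution_eq f)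
  simpa using h.symm

lemma integral_mul_fourierInv (f : Lp (α := Sp n) ℂ 2 volume) (φ : 𝓢(Sp n, ℂ)) :
    ∫ ξ, φ ξ * (𝓕⁻ f : Lp (α := Sp n) ℂ 2 volume) ξ = ∫ x, 𝓕⁻ φ x * f x := by
  have h := congrArg (fun T => T φ) (Lp.fourierInv_toTemperedDistribution_eq f)
  simpa using h.symm

lemma schwartz_fourierInv_apply (φ : 𝓢(Sp n, ℂ)) (x : Sp n) : 𝓕⁻ φ x = 𝓕 φ (-x) := by
  rw [SchwartzMap.fourierInv_coe, SchwartzMap.fourier_coe]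
  exact Real.fourierInv_eq_fourier_neg _ _

/-- On `L¹ ∩ L²` the `L²` Fourier transform is given by the Fourier integral. -/
lemma fourier_ae_eq_of_integrable (f : Lp (α := Sp n) ℂ 2 volume) (hf : Integrable (f : Sp n → ℂ)) :
    (𝓕 f : Lp (α := Sp n) ℂ 2 volume) =ᵐ[volume] 𝓕 (f : Sp n → ℂ) := by
  have hc : Continuous (𝓕 (f : Sp n → ℂ)) :=
    VectorFourier.fourierIntegral_continuous Real.continuous_fourierChar
      (innerSL ℝ).continuous₂ hf
  apply ae_eq_of_integral_schwartz (locallyIntegrable_L2 _) hc.locallyIntegrable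
  intro φ
  rw [integral_mul_fourier]
  have h := VectorFourier.integral_fourierIntegral_smul_eq_flip (L := innerₗ (Sp n))
    (f := (φ : Sp n → ℂ)) (g := (f : Sp n → ℂ)) (μ := volume) (ν := volume)
    Real.continuous_fourierChar continuous_inner φ.integrable hf
  rw [flip_innerₗ] at h
  exact h

lemma fourierInv_ae_eq_of_integrable (f : Lp (α := Sp n) ℂ 2 volume)
    (hf : Integrable (f : Sp n → ℂ)) :
    (𝓕⁻ f : Lp (α := Sp n) ℂ 2 volume) =ᵐ[volume] 𝓕⁻ (f : Sp n → ℂ) := by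
  have hcF : Continuous (𝓕 (f : Sp n → ℂ)) :=
    VectorFourier.fourierIntegral_continuous Real.continuous_fourierChar
      (innerSL ℝ).continuous₂ hf
  have hc : Continuous (𝓕⁻ (f : Sp n → ℂ)) := by
    have : 𝓕⁻ (f : Sp n → ℂ) = fun x => 𝓕 (f : Sp n → ℂ) (-x) := by
      ext x; exact Real.fourierInv_eq_fourier_neg _ _
    rw [this]; exact hcF.comp continuous_neg
  apply ae_eq_of_integral_schwartz (locallyIntegrable_L2 _) hc.locallyIntegrable
  intro φ
  rw [integral_mul_fourierInv]
  have h := VectorFourier.integral_fourierIntegral_smul_eq_flip (L := innerₗ (Sp n))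
    (f := (φ : Sp n → ℂ)) (g := (f : Sp n → ℂ)) (μ := volume) (ν := volume)
    Real.continuous_fourierChar continuous_inner φ.integrable hf
  -- The inverse transform is the Fourier integral for the bilinear form `-⟨x, ξ⟩`, which is
  -- symmetric like the inner product itself.
  have h' := VectorFourier.integral_fourierIntegral_smul_eq_flip (L := -innerₗ (Sp n))
    (f := (φ : Sp n → ℂ)) (g := (f : Sp n → ℂ)) (μ := volume) (ν := volume)
    Real.continuous_fourierChar (by
      have h0 : Continuous fun p : Sp n × Sp n => -inner ℝ p.1 p.2 := continuous_inner.neg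
      simpa using h0) φ.integrable hf
  have e : (-innerₗ (Sp n)).flip = -innerₗ (Sp n) := by
    ext x y; simp [real_inner_comm]
  rw [e] at h'
  have key : ∀ F : Sp n → ℂ,
      VectorFourier.fourierIntegral Real.fourierChar volume (-innerₗ (Sp n)) F = 𝓕⁻ F := by
    intro F; ext x
    simp [VectorFourier.fourierIntegral, Real.fourierInv_eq]
  rw [key, key] at h'
  simpa [SchwartzMap.fourierInv_coe] using h'

lemma integral_neg_mul (φ : Sp n → ℂ) (g : Sp n → ℂ) :
    ∫ x, φ (-x) * g x = ∫ x, φ x * g (-x) := by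
  rw [← integral_neg_eq_self]; simp

lemma inner_L2_schwartz (f : Lp (α := Sp n) ℂ 2 volume) (φ : 𝓢(Sp n, ℂ)) :
    inner ℂ f (φ.toLp 2) = ∫ x, φ x * (starRingEnd ℂ) (f x) := by
  rw [L2.inner_def]
  apply integral_congr_ae
  filter_upwards [φ.coeFn_toLp 2] with x hx
  rw [hx]; simp

lemma locallyIntegrable_conj {f : Sp n → ℂ} (hf : LocallyIntegrable f) :
    LocallyIntegrable (fun x => (starRingEnd ℂ) (f x)) := by
  intro x
  obtain ⟨U, hU, hi⟩ := hf x
  exact ⟨U, hU, (Complex.conjCLE : ℂ →L[ℝ] ℂ).integrable_comp hi⟩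

lemma locallyIntegrable_comp_neg (f : Lp (α := Sp n) ℂ 2 volume) :
    LocallyIntegrable (fun x : Sp n => f (-x)) :=
  MemLp.locallyIntegrable (p := 2)
    ((Lp.memLp f).comp_measurePreserving (Measure.measurePreserving_neg volume)) (by norm_num)

/-- The Fourier transform of a real-valued function is Hermitian. -/
lemma fourierL2_neg (f : RealL2 n) :
    ∀ᵐ ξ : Sp n, fourierL2 f (-ξ) = (starRingEnd ℂ) (fourierL2 f ξ) := by
  apply ae_eq_of_integral_schwartz (locallyIntegrable_comp_neg _)
    (locallyIntegrable_conj (locallyIntegrable_L2 _))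
  intro φ
  rw [← inner_L2_schwartz, ← integral_neg_mul]
  have e1 : (φ.toLp 2 : Lp (α := Sp n) ℂ 2 volume) = 𝓕 ((𝓕⁻ φ).toLp 2) := by
    rw [SchwartzMap.toLp_fourier_eq]; simp
  rw [e1, fourierL2, Lp.inner_fourier_eq, inner_L2_schwartz]
  -- Reflection is the inverse transform applied twice, so it can be absorbed by moving one
  -- transform to the other factor.
  have e2 : ∀ x, φ (-x) = 𝓕⁻ (𝓕⁻ φ) x := by
    intro x; rw [schwartz_fourierInv_apply]; simp
  simp_rw [e2]
  rw [show (fun ξ : Sp n => 𝓕⁻ (𝓕⁻ φ) ξ * (𝓕 (Complex.ofRealCLM.compLp f) :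
    Lp (α := Sp n) ℂ 2 volume) ξ) = fun ξ => (𝓕⁻ (𝓕⁻ φ)) ξ *
    (𝓕 (Complex.ofRealCLM.compLp f) : Lp (α := Sp n) ℂ 2 volume) ξ from rfl, integral_mul_fourier]
  simp only [FourierTransform.fourier_fourierInv_eq]
  apply integral_congr_ae
  filter_upwards [complexify_coeFn f] with x hx
  rw [hx]; simp

/-- A Hermitian `L²` function is the Fourier transform of a real-valued function. -/
lemma exists_fourierL2_eq (g : Lp (α := Sp n) ℂ 2 volume)
    (hg : ∀ᵐ ξ : Sp n, g (-ξ) = (starRingEnd ℂ) (g ξ)) : ∃ f : RealL2 n, fourierL2 f = g := by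
  -- The Hermitian symmetry of `g` says that its inverse transform equals its own conjugate.
  have hreal : (fun x => (starRingEnd ℂ) ((𝓕⁻ g : Lp (α := Sp n) ℂ 2 volume) x))
      =ᵐ[volume] (𝓕⁻ g : Lp (α := Sp n) ℂ 2 volume) := by
    apply ae_eq_of_integral_schwartz (locallyIntegrable_conj (locallyIntegrable_L2 _))
      (locallyIntegrable_L2 _)
    intro φ
    rw [← inner_L2_schwartz, integral_mul_fourierInv, ← Lp.inner_fourier_eq,
      SchwartzMap.toLp_fourier_eq, FourierTransform.fourier_fourierInv_eq, inner_L2_schwartz]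
    simp_rw [schwartz_fourierInv_apply]
    rw [integral_neg_mul (fun x => 𝓕 φ x)]
    apply integral_congr_ae
    filter_upwards [hg] with x hx
    simp only [hx]
  refine ⟨Complex.reCLM.compLp (𝓕⁻ g : Lp (α := Sp n) ℂ 2 volume), ?_⟩
  have : Complex.ofRealCLM.compLp (Complex.reCLM.compLp (𝓕⁻ g : Lp (α := Sp n) ℂ 2 volume))
      = 𝓕⁻ g := by
    ext1
    filter_upwards [hreal, Complex.ofRealCLM.coeFn_compLp
      (Complex.reCLM.compLp (𝓕⁻ g : Lp (α := Sp n) ℂ 2 volume)),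
      Complex.reCLM.coeFn_compLp (𝓕⁻ g : Lp (α := Sp n) ℂ 2 volume)] with x h1 h2 h3
    rw [h2, h3]
    exact Complex.conj_eq_iff_re.mp h1
  rw [fourierL2, this]; simp

/-- Parseval's formula for the pairing with a Schwartz function. -/
lemma pairing_eq_inner (f : RealL2 n) (φ : 𝓢(Sp n, ℂ)) :
    pairing f φ = inner ℂ (fourierL2 f) ((𝓕 φ).toLp 2) := by
  rw [← SchwartzMap.toLp_fourier_eq, fourierL2, Lp.inner_fourier_eq, inner_L2_schwartz, pairing]
  apply integral_congr_ae
  filter_upwards [complexify_coeFn f] with x hx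
  rw [hx]; simp [mul_comm]

/-- Parseval's formula for the pairing with a function given by its Fourier transform. -/
lemma pairing_fourierInv_eq_inner (f : RealL2 n) (h : Sp n → ℂ) (h1 : Integrable h)
    (h2 : MemLp h 2 volume) :
    pairing f (𝓕⁻ h) = inner ℂ (fourierL2 f) (h2.toLp h) := by
  have e : (h2.toLp h) = 𝓕 (𝓕⁻ (h2.toLp h)) := by simp
  rw [e, fourierL2, Lp.inner_fourier_eq, L2.inner_def, pairing]
  have hi : Integrable (h2.toLp h : Sp n → ℂ) := h1.congr h2.coeFn_toLp.symm
  apply integral_congr_ae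
  filter_upwards [complexify_coeFn f, fourierInv_ae_eq_of_integrable _ hi] with x hx hy
  rw [hx, hy, Real.fourierInv_congr_ae h2.coeFn_toLp]; simp [mul_comm]

end FourierL2

/-! ### Bounded radial Fourier multipliers. -/

section Multipliers

variable {n : ℕ}

/-- The symbol `2π‖ξ‖` of `|D|`. -/
def freq (ξ : Sp n) : ℝ := 2 * Real.pi * ‖ξ‖

lemma freq_nonneg (ξ : Sp n) : 0 ≤ freq ξ := by unfold freq; positivity

lemma freq_neg (ξ : Sp n) : freq (-ξ) = freq ξ := by simp [freq]

lemma continuous_freq : Continuous (freq (n := n)) := by unfold freq; fun_prop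

lemma measurable_freq : Measurable (freq (n := n)) := continuous_freq.measurable

/-- Bounded measurable radial symbols. -/
structure IsSymbol (m : ℝ → ℝ) : Prop where
  measurable : Measurable m
  bounded : ∃ C, ∀ x, 0 ≤ x → |m x| ≤ C

lemma IsSymbol.mul {m m' : ℝ → ℝ} (h : IsSymbol m) (h' : IsSymbol m') :
    IsSymbol (fun x => m x * m' x) := by
  obtain ⟨C, hC⟩ := h.bounded
  obtain ⟨C', hC'⟩ := h'.bounded
  refine ⟨h.measurable.mul h'.measurable, C * C', fun x hx => ?_⟩
  rw [abs_mul]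
  exact mul_le_mul (hC x hx) (hC' x hx) (abs_nonneg _) ((abs_nonneg _).trans (hC x hx))

lemma IsSymbol.add {m m' : ℝ → ℝ} (h : IsSymbol m) (h' : IsSymbol m') :
    IsSymbol (fun x => m x + m' x) := by
  obtain ⟨C, hC⟩ := h.bounded
  obtain ⟨C', hC'⟩ := h'.bounded
  refine ⟨h.measurable.add h'.measurable, C + C', fun x hx => ?_⟩
  exact (abs_add_le _ _).trans (add_le_add (hC x hx) (hC' x hx))

lemma IsSymbol.const (c : ℝ) : IsSymbol (fun _ => c) :=
  ⟨measurable_const, |c|, fun _ _ => le_rfl⟩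

lemma IsSymbol.sub {m m' : ℝ → ℝ} (h : IsSymbol m) (h' : IsSymbol m') :
    IsSymbol (fun x => m x - m' x) := by
  have := h.add ((IsSymbol.const (-1)).mul h')
  simpa [sub_eq_add_neg] using this

/-- A bound of the symbol on the half line gives boundedness of the symbol. -/
lemma IsSymbol.of_le {m : ℝ → ℝ} (hm : Measurable m) {C : ℝ} (h : ∀ x, 0 ≤ x → |m x| ≤ C) :
    IsSymbol m := ⟨hm, C, h⟩

lemma exists_multiplier {m : ℝ → ℝ} (hm : IsSymbol m) (f : RealL2 n) :
    ∃ g : RealL2 n, fourierL2 g =ᵐ[volume] fun ξ => (m (freq ξ) : ℂ) * fourierL2 f ξ := by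
  obtain ⟨C, hC⟩ := hm.bounded
  have hmem : MemLp (fun ξ => (m (freq ξ) : ℂ) * fourierL2 f ξ) 2 volume := by
    refine MemLp.of_le_mul (c := C) (Lp.memLp (fourierL2 f)) ?_ (ae_of_all _ fun ξ => ?_)
    · exact ((Complex.measurable_ofReal.comp
        (hm.measurable.comp measurable_freq)).aestronglyMeasurable).mul
        (Lp.memLp (fourierL2 f)).aestronglyMeasurable
    · rw [norm_mul, Complex.norm_real, Real.norm_eq_abs]
      exact mul_le_mul_of_nonneg_right (hC _ (freq_nonneg ξ)) (norm_nonneg _)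
  obtain ⟨g, hg⟩ := exists_fourierL2_eq (hmem.toLp _) (by
    have h1 := hmem.coeFn_toLp
    have h2 := (Measure.measurePreserving_neg (volume : Measure (Sp n))).quasiMeasurePreserving.ae h1
    filter_upwards [h1, h2, fourierL2_neg f] with ξ h1 h2 h3
    rw [h2, h1, h3, freq_neg]; simp)
  exact ⟨g, by rw [hg]; exact hmem.coeFn_toLp⟩

lemma norm_sq_eq_integral (f : RealL2 n) : ‖f‖ ^ 2 = ∫ ξ, ‖fourierL2 f ξ‖ ^ 2 := by
  rw [← norm_fourierL2, ← @inner_self_eq_norm_sq ℂ, L2.inner_def, ← integral_re]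
  · simp [← Complex.ofReal_pow]
  · exact L2.integrable_inner _ _

lemma integrable_norm_sq (f : RealL2 n) : Integrable fun ξ => ‖fourierL2 f ξ‖ ^ 2 :=
  (memLp_two_iff_integrable_sq_norm (Lp.memLp _).aestronglyMeasurable).mp (Lp.memLp _)

lemma norm_le_of_fourier_le {f g : RealL2 n} {C : ℝ}
    (h : ∀ᵐ ξ, ‖fourierL2 f ξ‖ ≤ C * ‖fourierL2 g ξ‖) : ‖f‖ ≤ C * ‖g‖ := by
  rw [← norm_fourierL2 f, ← norm_fourierL2 g]
  exact Lp.norm_le_mul_norm_of_ae_le_mul h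

/-- The Fourier multiplier operator with symbol `m (2π‖ξ‖)`. -/
def Op (m : ℝ → ℝ) : RealL2 n →L[ℝ] RealL2 n := by
  classical
  exact if hm : IsSymbol m then
    LinearMap.mkContinuousOfExistsBound
      { toFun := fun f => (exists_multiplier hm f).choose
        map_add' := fun f g => by
          apply ext_fourierL2
          filter_upwards [(exists_multiplier hm (f + g)).choose_spec,
            (exists_multiplier hm f).choose_spec, (exists_multiplier hm g).choose_spec,
            fourierL2_add_ae f g, fourierL2_add_ae (exists_multiplier hm f).choose
              (exists_multiplier hm g).choose] with ξ h1 h2 h3 h4 h5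
          rw [h1, h4, h5, h2, h3]; ring
        map_smul' := fun c f => by
          apply ext_fourierL2
          filter_upwards [(exists_multiplier hm (c • f)).choose_spec,
            (exists_multiplier hm f).choose_spec,
            fourierL2_smul_ae c f, fourierL2_smul_ae c (exists_multiplier hm f).choose]
            with ξ h1 h2 h3 h4
          rw [RingHom.id_apply, h1, h3, h4, h2]; ring }
      (by
        obtain ⟨C, hC⟩ := hm.bounded
        refine ⟨C, fun f => norm_le_of_fourier_le ?_⟩
        filter_upwards [(exists_multiplier hm f).choose_spec] with ξ h
        rw [LinearMap.coe_mk, AddHom.coe_mk, h, norm_mul, Complex.norm_real, Real.norm_eq_abs]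
        exact mul_le_mul_of_nonneg_right (hC _ (freq_nonneg ξ)) (norm_nonneg _))
  -- Symbols that are not bounded and measurable give the zero operator, so the calculus of `Op`
  -- below asks for `IsSymbol`.
  else 0

lemma fourierL2_Op {m : ℝ → ℝ} (hm : IsSymbol m) (f : RealL2 n) :
    fourierL2 (Op m f) =ᵐ[volume] fun ξ => (m (freq ξ) : ℂ) * fourierL2 f ξ := by
  have : Op m f = (exists_multiplier hm f).choose := by
    rw [Op, dif_pos hm]; rfl
  rw [this]; exact (exists_multiplier hm f).choose_spec

lemma eq_Op_of_ae {m : ℝ → ℝ} (hm : IsSymbol m) {f g : RealL2 n}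
    (h : fourierL2 g =ᵐ[volume] fun ξ => (m (freq ξ) : ℂ) * fourierL2 f ξ) : g = Op m f :=
  ext_fourierL2 (h.trans (fourierL2_Op hm f).symm)

lemma Op_Op {m m' : ℝ → ℝ} (hm : IsSymbol m) (hm' : IsSymbol m') (f : RealL2 n) :
    Op m (Op m' f) = Op (fun x => m x * m' x) f := by
  apply eq_Op_of_ae (hm.mul hm')
  filter_upwards [fourierL2_Op hm (Op m' f), fourierL2_Op hm' f] with ξ h1 h2
  rw [h1, h2]; push_cast; ring

lemma Op_congr {m m' : ℝ → ℝ} (hm : IsSymbol m) (hm' : IsSymbol m')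
    (h : ∀ x, 0 ≤ x → m x = m' x) : (Op m : RealL2 n →L[ℝ] RealL2 n) = Op m' := by
  ext1 f
  apply eq_Op_of_ae hm'
  filter_upwards [fourierL2_Op hm f] with ξ h1
  rw [h1, h _ (freq_nonneg ξ)]

lemma Op_one : (Op (fun _ => 1) : RealL2 n →L[ℝ] RealL2 n) = ContinuousLinearMap.id ℝ _ := by
  ext1 f
  symm
  apply eq_Op_of_ae (IsSymbol.const 1)
  simp

lemma Op_add {m m' : ℝ → ℝ} (hm : IsSymbol m) (hm' : IsSymbol m') (f : RealL2 n) :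
    Op (fun x => m x + m' x) f = Op m f + Op m' f := by
  symm
  apply eq_Op_of_ae (hm.add hm')
  filter_upwards [fourierL2_Op hm f, fourierL2_Op hm' f, fourierL2_add_ae (Op m f) (Op m' f)]
    with ξ h1 h2 h3
  rw [h3, h1, h2]; push_cast; ring

lemma Op_smul {m : ℝ → ℝ} (hm : IsSymbol m) (c : ℝ) (f : RealL2 n) :
    Op (fun x => c * m x) f = c • Op m f := by
  symm
  apply eq_Op_of_ae ((IsSymbol.const c).mul hm)
  filter_upwards [fourierL2_Op hm f, fourierL2_smul_ae c (Op m f)] with ξ h1 h2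
  rw [h2, h1]; push_cast; ring

lemma Op_sub {m m' : ℝ → ℝ} (hm : IsSymbol m) (hm' : IsSymbol m') (f : RealL2 n) :
    Op (fun x => m x - m' x) f = Op m f - Op m' f := by
  symm
  apply eq_Op_of_ae (hm.sub hm')
  filter_upwards [fourierL2_Op hm f, fourierL2_Op hm' f, fourierL2_sub_ae (Op m f) (Op m' f)]
    with ξ h1 h2 h3
  rw [h3, h1, h2]; push_cast; ring

lemma norm_Op_le {m : ℝ → ℝ} (hm : Measurable m) {C : ℝ} (h : ∀ x, 0 ≤ x → |m x| ≤ C)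
    (f : RealL2 n) : ‖Op m f‖ ≤ C * ‖f‖ := by
  apply norm_le_of_fourier_le
  filter_upwards [fourierL2_Op (.of_le hm h) f] with ξ h1
  rw [h1, norm_mul, Complex.norm_real, Real.norm_eq_abs]
  exact mul_le_mul_of_nonneg_right (h _ (freq_nonneg ξ)) (norm_nonneg _)

lemma norm_Op_le_Op {m m' : ℝ → ℝ} (hm : IsSymbol m) (hm' : IsSymbol m') {C : ℝ}
    (h : ∀ x, 0 ≤ x → |m x| ≤ C * |m' x|) (f : RealL2 n) : ‖Op m f‖ ≤ C * ‖Op m' f‖ := by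
  apply norm_le_of_fourier_le
  filter_upwards [fourierL2_Op hm f, fourierL2_Op hm' f] with ξ h1 h2
  rw [h1, h2, norm_mul, norm_mul, Complex.norm_real, Complex.norm_real, Real.norm_eq_abs,
    Real.norm_eq_abs, ← mul_assoc]
  exact mul_le_mul_of_nonneg_right (h _ (freq_nonneg ξ)) (norm_nonneg _)

lemma enorm_Op {m : ℝ → ℝ} (hm : IsSymbol m) (f : RealL2 n) :
    ‖Op m f‖ₑ = eLpNorm (fun ξ => (m (freq ξ) : ℂ) * fourierL2 f ξ) 2 volume := by
  rw [← eLpNorm_congr_ae (fourierL2_Op hm f), ← Lp.enorm_def, ← ofReal_norm, ← ofReal_norm,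
    norm_fourierL2]

lemma norm_Op_sq {m : ℝ → ℝ} (hm : IsSymbol m) (f : RealL2 n) :
    ‖Op m f‖ ^ 2 = ∫ ξ, m (freq ξ) ^ 2 * ‖fourierL2 f ξ‖ ^ 2 := by
  rw [norm_sq_eq_integral]
  apply integral_congr_ae
  filter_upwards [fourierL2_Op hm f] with ξ h
  simp [h, mul_pow]

/-- Multipliers depend continuously on their symbol for bounded pointwise convergence. -/
lemma tendsto_Op {X : Type*} {l : Filter X} [l.IsCountablyGenerated] {m : X → ℝ → ℝ} {m₀ : ℝ → ℝ}
    (hm : ∀ x, IsSymbol (m x)) (hm₀ : IsSymbol m₀)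
    (hlim : ∀ y, 0 ≤ y → Tendsto (fun x => m x y) l (𝓝 (m₀ y))) {C : ℝ}
    (hC : ∀ᶠ x in l, ∀ y, 0 ≤ y → |m x y| ≤ C) (f : RealL2 n) :
    Tendsto (fun x => Op (m x) f) l (𝓝 (Op m₀ f)) := by
  rw [tendsto_iff_norm_sub_tendsto_zero]
  obtain ⟨C₀, hC₀⟩ := hm₀.bounded
  have hsq : Tendsto (fun x => ‖Op (m x) f - Op m₀ f‖ ^ 2) l (𝓝 0) := by
    have e : ∀ x, ‖Op (m x) f - Op m₀ f‖ ^ 2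
        = ∫ ξ, (m x (freq ξ) - m₀ (freq ξ)) ^ 2 * ‖fourierL2 f ξ‖ ^ 2 := by
      intro x
      rw [← Op_sub (hm x) hm₀, norm_Op_sq ((hm x).sub hm₀)]
    simp_rw [e]
    have : (0 : ℝ) = ∫ ξ : Sp n, (0 : ℝ) := by simp
    rw [this]
    apply tendsto_integral_filter_of_dominated_convergence
      (fun ξ => (C + C₀) ^ 2 * ‖fourierL2 f ξ‖ ^ 2)
    · refine Eventually.of_forall fun x => ?_
      exact ((((hm x).sub hm₀).measurable.comp measurable_freq).pow_const 2).aestronglyMeasurable.mul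
        (integrable_norm_sq f).aestronglyMeasurable
    · filter_upwards [hC] with x hx
      refine ae_of_all _ fun ξ => ?_
      rw [norm_mul, norm_pow, norm_pow, norm_norm, Real.norm_eq_abs]
      gcongr
      exact (abs_sub _ _).trans (add_le_add (hx _ (freq_nonneg ξ)) (hC₀ _ (freq_nonneg ξ)))
    · exact (integrable_norm_sq f).const_mul _
    · refine ae_of_all _ fun ξ => ?_
      have h1 := ((hlim _ (freq_nonneg ξ)).sub_const (m₀ (freq ξ))).pow 2
      simpa using h1.mul_const (‖fourierL2 f ξ‖ ^ 2)
  have := (Real.continuous_sqrt.tendsto 0).comp hsq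
  simpa [Function.comp_def, Real.sqrt_sq] using this

/-- The symbols need not converge uniformly in frequency, so continuity holds only in the strong
sense. Split `Op (m x) (f x)` as `Op (m x) (f x - f x₀) + Op (m x) (f x₀)`: the locally uniform
bound controls the first term and `tendsto_Op` the second. -/
lemma continuous_Op {X : Type*} [TopologicalSpace X] [FirstCountableTopology X] {m : X → ℝ → ℝ}
    (hm : ∀ x, IsSymbol (m x)) (hlim : ∀ y, 0 ≤ y → Continuous fun x => m x y)
    (hC : ∀ x₀, ∃ C, ∀ᶠ x in 𝓝 x₀, ∀ y, 0 ≤ y → |m x y| ≤ C) {f : X → RealL2 n}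
    (hf : Continuous f) : Continuous fun x => Op (m x) (f x) := by
  rw [continuous_iff_continuousAt]
  intro x₀
  obtain ⟨C, hC⟩ := hC x₀
  have h1 : Tendsto (fun x => Op (m x) (f x₀)) (𝓝 x₀) (𝓝 (Op (m x₀) (f x₀))) :=
    tendsto_Op hm (hm x₀) (fun y hy => (hlim y hy).tendsto x₀) hC _
  have h2 : Tendsto (fun x => Op (m x) (f x - f x₀)) (𝓝 x₀) (𝓝 0) := by
    have h3 : Tendsto (fun x => C * ‖f x - f x₀‖) (𝓝 x₀) (𝓝 0) := by
      have := ((hf.tendsto x₀).sub_const (f x₀)).norm.const_mul C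
      simpa using this
    refine squeeze_zero_norm' ?_ h3
    filter_upwards [hC] with x hx
    exact norm_Op_le (hm x).measurable hx _
  have := h2.add h1
  simpa [ContinuousAt, ← map_add] using this

/-- Differentiability in operator norm of multipliers whose symbols are differentiable, uniformly
in the frequency. -/
lemma hasDerivAt_Op {m m' : ℝ → ℝ → ℝ} (hm : ∀ t, IsSymbol (m t)) (hm' : ∀ t, IsSymbol (m' t))
    (hd : ∀ t y, 0 ≤ y → HasDerivAt (fun t => m t y) (m' t y) t) (t₀ : ℝ)
    (hu : ∀ ε > 0, ∃ η > 0, ∀ t, |t - t₀| < η → ∀ y, 0 ≤ y → |m' t y - m' t₀ y| ≤ ε) :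
    HasDerivAt (fun t => (Op (m t) : RealL2 n →L[ℝ] RealL2 n)) (Op (m' t₀)) t₀ := by
  rw [hasDerivAt_iff_isLittleO, Asymptotics.isLittleO_iff]
  intro ε hε
  obtain ⟨η, hη, H⟩ := hu ε hε
  filter_upwards [Metric.ball_mem_nhds t₀ hη] with t ht
  refine ContinuousLinearMap.opNorm_le_bound _ (by positivity) fun f => ?_
  have e : (Op (m t) - Op (m t₀) - (t - t₀) • Op (m' t₀) : RealL2 n →L[ℝ] RealL2 n) f
      = Op (fun y => m t y - m t₀ y - (t - t₀) * m' t₀ y) f := by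
    rw [Op_sub ((hm t).sub (hm t₀)) ((IsSymbol.const _).mul (hm' t₀)), Op_sub (hm t) (hm t₀),
      Op_smul (hm' t₀)]
    rfl
  rw [e]
  refine norm_Op_le (((hm t).sub (hm t₀)).sub ((IsSymbol.const _).mul (hm' t₀))).measurable
    (fun y hy => ?_) f
  -- Mean value inequality for `t ↦ m t y - t · m' t₀ y`, whose derivative is at most `ε` on the
  -- ball for every frequency `y` at once.
  have hmv := (convex_ball t₀ η).norm_image_sub_le_of_norm_hasDerivWithin_le
    (f := fun t => m t y - t * m' t₀ y) (f' := fun t => m' t y - m' t₀ y) (C := ε)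
    (fun s _ => ((hd s y hy).sub (by simpa using (hasDerivAt_id s).mul_const (m' t₀ y))).hasDerivWithinAt)
    (fun s hs => H s (by simpa [Real.dist_eq] using hs) y hy) (Metric.mem_ball_self hη) ht
  rw [Real.norm_eq_abs] at hmv
  convert hmv using 2
  ring

end Multipliers

/-! ### A Lyapunov functional for the linear system at a fixed frequency. -/

section Lyapunov

/-- A linear differential inequality with constant rate. -/
lemma le_exp_of_deriv_le {V V' : ℝ → ℝ} {a : ℝ} (hV : ∀ t, HasDerivAt V (V' t) t)
    (h : ∀ t, V' t ≤ -a * V t) {t : ℝ} (ht : 0 ≤ t) : V t ≤ Real.exp (-a * t) * V 0 := by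
  have hd : ∀ s, HasDerivAt (fun s => Real.exp (a * s) * V s)
      (Real.exp (a * s) * (a * V s + V' s)) s := by
    intro s
    have h1 : HasDerivAt (fun s => Real.exp (a * s)) (Real.exp (a * s) * a) s := by
      simpa using ((hasDerivAt_id s).const_mul a).exp
    exact (h1.mul (hV s)).congr_deriv (by ring)
  have hanti : Antitone fun s => Real.exp (a * s) * V s := by
    apply antitone_of_hasDerivAt_nonpos hd
    intro s
    have := h s
    exact mul_nonpos_of_nonneg_of_nonpos (Real.exp_pos _).le (by linarith)
  have h0 := hanti ht
  simp only [mul_zero, Real.exp_zero, one_mul] at h0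
  have e : V t = Real.exp (-a * t) * (Real.exp (a * t) * V t) := by
    rw [← mul_assoc, ← Real.exp_add]; simp
  rw [e]
  exact mul_le_mul_of_nonneg_left h0 (Real.exp_pos _).le

/-- Solutions of the system `X' = G`, `G' = -kX - δkW`, `τW' = G - W`, with `k = q²`. -/
structure IsModeSolution (τ δ q : ℝ) (X G W : ℝ → ℝ) : Prop where
  deriv_X : ∀ t, HasDerivAt X (G t) t
  deriv_G : ∀ t, HasDerivAt G (-(q ^ 2 * X t) - δ * (q ^ 2 * W t)) t
  deriv_W : ∀ t, HasDerivAt W ((G t - W t) / τ) t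

/-- Here and below `a = qX`, `b = G`, `c = qW`. The energy is natural in `(a, b, c)`, but the
dissipation is diagonal in `(b, c, a - τc)`, where `X - τW` is the position; this lemma and the next
compare the two quadratic forms. -/
lemma lyapunov_equiv {τ δ a b c : ℝ} (hτ : 0 < τ) (hδ : 0 < δ) :
    b ^ 2 + c ^ 2 + (a - τ * c) ^ 2 ≤ (2 + (1 + 2 * τ ^ 2) / (τ * δ)) *
      (a ^ 2 + b ^ 2 + τ * δ * c ^ 2) := by
  have h1 : (1 + 2 * τ ^ 2) / (τ * δ) * (τ * δ * c ^ 2) = (1 + 2 * τ ^ 2) * c ^ 2 := by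
    field_simp
  have h2 : 0 ≤ (1 + 2 * τ ^ 2) / (τ * δ) * (a ^ 2 + b ^ 2) := by positivity
  have h3 : 0 ≤ τ * δ * c ^ 2 := by positivity
  nlinarith [sq_nonneg (a + τ * c), sq_nonneg b]

lemma lyapunov_equiv' {τ δ a b c : ℝ} (hτ : 0 < τ) (hδ : 0 < δ) :
    a ^ 2 + b ^ 2 + τ * δ * c ^ 2 ≤ (2 + 2 * τ ^ 2 + τ * δ) *
      (b ^ 2 + c ^ 2 + (a - τ * c) ^ 2) := by
  have h1 : 0 ≤ τ * δ * (b ^ 2 + (a - τ * c) ^ 2) := by positivity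
  have h2 : 0 ≤ 2 * τ ^ 2 * (b ^ 2 + (a - τ * c) ^ 2) := by positivity
  nlinarith [sq_nonneg (a - 2 * τ * c), sq_nonneg b, sq_nonneg c]

/-- The energy alone dissipates only `c²`. The cross term `-bc` produces `-b²` and the cross term
`eb` produces `-e²`. All remaining terms are absorbed by Young's inequality, at a cost `ηK` in front
of `c²`. The factor `θ` is tuned so that `θq = ρ` stays bounded, while `θ² ≤ ρ` controls the
products `bc` that come without a factor `q`. -/
lemma lyapunov_dissipation {τ δ η K ρ θ q b c e : ℝ} (hτ : 0 < τ) (hη : 0 < η)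
    (hK : K = τ + δ + 1 / τ + 4 * τ + (1 + (τ + δ) ^ 2) / (4 * τ)) (hηK : η * K ≤ δ)
    (hδ : 0 < δ) (hρ0 : 0 ≤ ρ) (hρ1 : ρ ≤ 1) (hθ : θ ^ 2 ≤ ρ) (hθq : θ * q = ρ) :
    -2 * δ * c ^ 2 + θ * (η * (q * (e * c) + q * (τ + δ) * c ^ 2 - q * b ^ 2 / τ + b * c / τ)
      + η / (4 * τ) * (c * b - q * e ^ 2 - q * (τ + δ) * (e * c)))
      ≤ -(δ * c ^ 2 + ρ * (η / (2 * τ)) * b ^ 2 + ρ * (η / (8 * τ)) * e ^ 2) := by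
  have hbc : θ * (b * c) ≤ ρ * b ^ 2 / 4 + c ^ 2 := by
    have : θ ^ 2 * b ^ 2 ≤ ρ * b ^ 2 := mul_le_mul_of_nonneg_right hθ (sq_nonneg _)
    nlinarith [sq_nonneg (θ * b / 2 - c)]
  have hbc' : θ * (b * c) ≤ ρ * b ^ 2 + c ^ 2 := by
    have : 0 ≤ ρ * b ^ 2 := by positivity
    linarith
  have hec : ρ * (e * c) ≤ ρ * (e ^ 2 / (16 * τ)) + 4 * τ * c ^ 2 := by
    have h1 : e * c ≤ e ^ 2 / (16 * τ) + 4 * τ * c ^ 2 := by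
      have : e ^ 2 / (16 * τ) + 4 * τ * c ^ 2 - e * c = (e - 8 * τ * c) ^ 2 / (16 * τ) := by
        field_simp; ring
      have : 0 ≤ (e - 8 * τ * c) ^ 2 / (16 * τ) := by positivity
      linarith
    have h2 : ρ * (4 * τ * c ^ 2) ≤ 4 * τ * c ^ 2 :=
      mul_le_of_le_one_left (by positivity) hρ1
    nlinarith [mul_le_mul_of_nonneg_left h1 hρ0]
  have hec' : -(ρ * ((τ + δ) * (e * c))) ≤ ρ * (e ^ 2 / 4) + (τ + δ) ^ 2 * c ^ 2 := by
    have h1 : -((τ + δ) * (e * c)) ≤ e ^ 2 / 4 + (τ + δ) ^ 2 * c ^ 2 := by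
      nlinarith [sq_nonneg (e / 2 + (τ + δ) * c)]
    have h2 : ρ * ((τ + δ) ^ 2 * c ^ 2) ≤ (τ + δ) ^ 2 * c ^ 2 :=
      mul_le_of_le_one_left (by positivity) hρ1
    nlinarith [mul_le_mul_of_nonneg_left h1 hρ0]
  have hcc : ρ * ((τ + δ) * c ^ 2) ≤ (τ + δ) * c ^ 2 :=
    mul_le_of_le_one_left (by positivity) hρ1
  have e1 : -2 * δ * c ^ 2 + θ * (η * (q * (e * c) + q * (τ + δ) * c ^ 2 - q * b ^ 2 / τ + b * c / τ)
      + η / (4 * τ) * (c * b - q * e ^ 2 - q * (τ + δ) * (e * c)))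
      = -2 * δ * c ^ 2 + η * (ρ * (e * c)) + η * (ρ * ((τ + δ) * c ^ 2)) - η / τ * (ρ * b ^ 2)
        + η / τ * (θ * (b * c)) + η / (4 * τ) * (θ * (b * c)) - η / (4 * τ) * (ρ * e ^ 2)
        + η / (4 * τ) * (-(ρ * ((τ + δ) * (e * c)))) := by
    rw [← hθq]; field_simp; ring
  have k1 := mul_le_mul_of_nonneg_left hec hη.le
  have k2 := mul_le_mul_of_nonneg_left hcc hη.le
  have k3 := mul_le_mul_of_nonneg_left hbc (show 0 ≤ η / τ by positivity)
  have k4 := mul_le_mul_of_nonneg_left hbc' (show 0 ≤ η / (4 * τ) by positivity)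
  have k5 := mul_le_mul_of_nonneg_left hec' (show 0 ≤ η / (4 * τ) by positivity)
  have k6 := mul_le_mul_of_nonneg_right hηK (sq_nonneg c)
  rw [e1]
  have e2 : η * K * c ^ 2 = η * ((τ + δ) * c ^ 2) + η / τ * c ^ 2 + η * (4 * τ * c ^ 2)
      + η / (4 * τ) * c ^ 2 + η / (4 * τ) * ((τ + δ) ^ 2 * c ^ 2) := by
    rw [hK]; field_simp; ring
  have e3 : η * (ρ * (e ^ 2 / (16 * τ)) + 4 * τ * c ^ 2)
      = ρ * (η / (16 * τ)) * e ^ 2 + η * (4 * τ * c ^ 2) := by field_simp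
  have e4 : η / τ * (ρ * b ^ 2 / 4 + c ^ 2) = η / τ * (ρ * b ^ 2) - 3 * (ρ * (η / (4 * τ)) * b ^ 2)
      + η / τ * c ^ 2 := by field_simp; ring
  have e5 : η / (4 * τ) * (ρ * b ^ 2 + c ^ 2) = ρ * (η / (4 * τ)) * b ^ 2 + η / (4 * τ) * c ^ 2 := by
    ring
  have e6 : η / (4 * τ) * (ρ * (e ^ 2 / 4) + (τ + δ) ^ 2 * c ^ 2)
      = ρ * (η / (16 * τ)) * e ^ 2 + η / (4 * τ) * ((τ + δ) ^ 2 * c ^ 2) := by field_simp; ring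
  have e7 : η / (4 * τ) * (ρ * e ^ 2) = ρ * (η / (8 * τ)) * e ^ 2 + 2 * (ρ * (η / (16 * τ)) * e ^ 2) := by
    field_simp; ring
  have e8 : ρ * (η / (2 * τ)) * b ^ 2 = 2 * (ρ * (η / (4 * τ)) * b ^ 2) := by field_simp; ring
  linarith

/-- Keeps the modified functional between one half and three halves of the energy. -/
lemma lyapunov_cross_le {τ η C₁ θ a b c : ℝ} (hτ : 0 < τ) (hη : 0 < η) (hθ0 : 0 ≤ θ) (hθ1 : θ ≤ 1)
    (hηC : (η + η / (4 * τ)) * C₁ ≤ 1) {E : ℝ} (hE : 0 ≤ E)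
    (hSE : b ^ 2 + c ^ 2 + (a - τ * c) ^ 2 ≤ C₁ * E) :
    |θ * (η * (-(b * c)) + η / (4 * τ) * ((a - τ * c) * b))| ≤ E / 2 := by
  generalize a - τ * c = e at *
  have h1 : |b * c| ≤ (b ^ 2 + c ^ 2 + e ^ 2) / 2 := by
    rw [abs_le]
    constructor <;> nlinarith [sq_nonneg (b + c), sq_nonneg (b - c), sq_nonneg e]
  have h2 : |e * b| ≤ (b ^ 2 + c ^ 2 + e ^ 2) / 2 := by
    rw [abs_le]
    constructor <;> nlinarith [sq_nonneg (b + e), sq_nonneg (b - e), sq_nonneg c]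
  have hη' : 0 < η / (4 * τ) := by positivity
  rw [abs_mul, abs_of_nonneg hθ0]
  refine (mul_le_of_le_one_left (abs_nonneg _) hθ1).trans ((abs_add_le _ _).trans ?_)
  rw [abs_mul, abs_mul, abs_neg, abs_of_pos hη, abs_of_pos hη']
  calc η * |b * c| + η / (4 * τ) * |e * b|
      ≤ η * ((b ^ 2 + c ^ 2 + e ^ 2) / 2) + η / (4 * τ) * ((b ^ 2 + c ^ 2 + e ^ 2) / 2) := by
        gcongr
    _ = (η + η / (4 * τ)) * (b ^ 2 + c ^ 2 + e ^ 2) / 2 := by ring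
    _ ≤ (η + η / (4 * τ)) * (C₁ * E) / 2 := by gcongr
    _ = ((η + η / (4 * τ)) * C₁) * E / 2 := by ring
    _ ≤ E / 2 := by
        have := mul_le_mul_of_nonneg_right hηC hE
        linarith

/-- Since `ρ ≤ 1`, the full dissipation of `c²` may be counted at the slower rate `ρ` of the other
two terms. -/
lemma lyapunov_decay_rate {δ τ η d ρ b c e : ℝ} (hd0 : 0 ≤ d) (hd1 : d ≤ δ) (hd2 : d ≤ η / (2 * τ))
    (hd3 : d ≤ η / (8 * τ)) (hρ0 : 0 ≤ ρ) (hρ1 : ρ ≤ 1) :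
    ρ * d * (b ^ 2 + c ^ 2 + e ^ 2) ≤
      δ * c ^ 2 + ρ * (η / (2 * τ)) * b ^ 2 + ρ * (η / (8 * τ)) * e ^ 2 := by
  have a1 : ρ * d ≤ δ := (mul_le_of_le_one_left hd0 hρ1).trans hd1
  have a2 : ρ * d ≤ ρ * (η / (2 * τ)) := mul_le_mul_of_nonneg_left hd2 hρ0
  have a3 : ρ * d ≤ ρ * (η / (8 * τ)) := mul_le_mul_of_nonneg_left hd3 hρ0
  have b1 := mul_le_mul_of_nonneg_right a1 (sq_nonneg c)
  have b2 := mul_le_mul_of_nonneg_right a2 (sq_nonneg b)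
  have b3 := mul_le_mul_of_nonneg_right a3 (sq_nonneg e)
  linarith

/-- The cancellations behind this formula: the energy part loses exactly `2δ(qW)²`, and `X - τW` has
derivative `W`. -/
lemma IsModeSolution.hasDerivAt_lyapunov {τ δ q θ η : ℝ} {X G W : ℝ → ℝ} (hτ : 0 < τ)
    (hs : IsModeSolution τ δ q X G W) (s : ℝ) :
    HasDerivAt (fun s => ((q * X s) ^ 2 + G s ^ 2 + τ * δ * (q * W s) ^ 2)
      + θ * (η * (-(G s * (q * W s))) + η / (4 * τ) * ((q * X s - τ * (q * W s)) * G s)))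
      (-2 * δ * (q * W s) ^ 2 + θ * (η * (q * ((q * X s - τ * (q * W s)) * (q * W s))
        + q * (τ + δ) * (q * W s) ^ 2 - q * G s ^ 2 / τ + G s * (q * W s) / τ)
      + η / (4 * τ) * ((q * W s) * G s - q * (q * X s - τ * (q * W s)) ^ 2
        - q * (τ + δ) * ((q * X s - τ * (q * W s)) * (q * W s))))) s := by
  have hX := (hs.deriv_X s).const_mul q
  have hG := hs.deriv_G s
  have hW := (hs.deriv_W s).const_mul q
  have hEd := ((hX.pow 2).add (hG.pow 2)).add ((hW.pow 2).const_mul (τ * δ))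
  have hPd := (((hG.mul hW).neg.const_mul η).add
    (((hX.sub (hW.const_mul τ)).mul hG).const_mul (η / (4 * τ)))).const_mul θ
  refine (hEd.add hPd).congr_deriv ?_
  simp only [Pi.sub_apply, Nat.cast_ofNat]
  generalize X s = x
  generalize G s = g
  generalize W s = w
  field_simp
  ring

/-- Exponential decay of the modes, with rate proportional to `k / (1 + k)`. -/
lemma exists_mode_energy_decay {τ δ : ℝ} (hτ : 0 < τ) (hδ : 0 < δ) :
    ∃ C > 0, ∃ μ > 0, ∀ q : ℝ, 0 ≤ q → ∀ X G W : ℝ → ℝ, IsModeSolution τ δ q X G W →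
      ∀ t, 0 ≤ t → (q * X t) ^ 2 + G t ^ 2 + (q * W t) ^ 2 ≤
        C * Real.exp (-(μ * (q ^ 2 / (1 + q ^ 2))) * t) *
          ((q * X 0) ^ 2 + G 0 ^ 2 + (q * W 0) ^ 2) := by
  obtain ⟨K, hK⟩ : ∃ K, K = τ + δ + 1 / τ + 4 * τ + (1 + (τ + δ) ^ 2) / (4 * τ) := ⟨_, rfl⟩
  obtain ⟨C₁, hC₁⟩ : ∃ C, C = 2 + (1 + 2 * τ ^ 2) / (τ * δ) := ⟨_, rfl⟩
  obtain ⟨C₂, hC₂⟩ : ∃ C, C = 2 + 2 * τ ^ 2 + τ * δ := ⟨_, rfl⟩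
  have hK0 : 0 < K := by rw [hK]; positivity
  have hC₁0 : 0 < C₁ := by rw [hC₁]; positivity
  have hC₂0 : 0 < C₂ := by rw [hC₂]; positivity
  -- The first bound on `η` lets `δc²` absorb the errors collected in `K`; the second keeps the
  -- cross terms below half the energy.
  obtain ⟨η, hη⟩ : ∃ η, η = min (δ / K) (1 / (C₁ * (1 + 1 / (4 * τ)))) := ⟨_, rfl⟩
  have hη0 : 0 < η := by rw [hη]; positivity
  have hηK : η * K ≤ δ := by
    calc η * K ≤ δ / K * K := mul_le_mul_of_nonneg_right (hη ▸ min_le_left _ _) hK0.le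
      _ = δ := by field_simp
  have hηC : (η + η / (4 * τ)) * C₁ ≤ 1 := by
    calc (η + η / (4 * τ)) * C₁ = η * (C₁ * (1 + 1 / (4 * τ))) := by ring
      _ ≤ 1 / (C₁ * (1 + 1 / (4 * τ))) * (C₁ * (1 + 1 / (4 * τ))) :=
          mul_le_mul_of_nonneg_right (hη ▸ min_le_right _ _) (by positivity)
      _ = 1 := by field_simp
  obtain ⟨d, hd⟩ : ∃ d, d = min δ (min (η / (2 * τ)) (η / (8 * τ))) := ⟨_, rfl⟩
  have hd0 : 0 < d := by rw [hd]; positivity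
  obtain ⟨μ, hμ⟩ : ∃ μ, μ = d / (2 * C₂) := ⟨_, rfl⟩
  have hμ0 : 0 < μ := by rw [hμ]; positivity
  -- The factor `3` is the quotient of `3/2` and `1/2` from comparing the functional with the energy
  -- at times `0` and `t`; the others remove the coefficient `τδ` from the energy.
  refine ⟨3 * ((1 + τ * δ) * (1 + 1 / (τ * δ))), by positivity, μ, hμ0,
    fun q hq X G W hs t ht => ?_⟩
  have hq2 : 0 < 1 + q ^ 2 := by positivity
  obtain ⟨ρ, hρ⟩ : ∃ ρ, ρ = q ^ 2 / (1 + q ^ 2) := ⟨_, rfl⟩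
  obtain ⟨θ, hθ⟩ : ∃ θ, θ = q / (1 + q ^ 2) := ⟨_, rfl⟩
  rw [← hρ]
  have hρ0 : 0 ≤ ρ := by rw [hρ]; positivity
  have hρ1 : ρ ≤ 1 := by rw [hρ, div_le_one hq2]; linarith
  have hθ0 : 0 ≤ θ := by rw [hθ]; positivity
  have hθρ : θ ^ 2 ≤ ρ := by
    rw [hθ, hρ, div_pow, div_le_div_iff₀ (by positivity) hq2]
    have h0 : 0 ≤ q ^ 2 * (1 + q ^ 2) * q ^ 2 := by positivity
    nlinarith
  have hθ1 : θ ≤ 1 := by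
    have := hθρ.trans hρ1
    nlinarith
  have hθq : θ * q = ρ := by rw [hθ, hρ]; ring
  have hE0 : ∀ s, 0 ≤ (q * X s) ^ 2 + G s ^ 2 + τ * δ * (q * W s) ^ 2 := fun s => by positivity
  have hPE : ∀ s, |θ * (η * (-(G s * (q * W s))) + η / (4 * τ) *
      ((q * X s - τ * (q * W s)) * G s))| ≤
      ((q * X s) ^ 2 + G s ^ 2 + τ * δ * (q * W s) ^ 2) / 2 := fun s =>
    lyapunov_cross_le hτ hη0 hθ0 hθ1 hηC (hE0 s) (hC₁ ▸ lyapunov_equiv hτ hδ)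
  have hV := le_exp_of_deriv_le (a := μ * ρ)
    (fun s => hs.hasDerivAt_lyapunov (θ := θ) (η := η) hτ s) (fun s => by
    refine (lyapunov_dissipation hτ hη0 hK hηK hδ hρ0 hρ1 hθρ hθq).trans ?_
    have h1 := lyapunov_decay_rate (b := G s) (c := q * W s) (e := q * X s - τ * (q * W s)) hd0.le
      (hd ▸ min_le_left _ _) (hd ▸ (min_le_right _ _).trans (min_le_left _ _))
      (hd ▸ (min_le_right _ _).trans (min_le_right _ _)) hρ0 hρ1
    have h2 := (abs_le.mp (hPE s)).2
    have h4 := lyapunov_equiv' (a := q * X s) (b := G s) (c := q * W s) hτ hδ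
    rw [← hC₂] at h4
    have h5 := hE0 s
    have h3 : μ * ρ * ((((q * X s) ^ 2 + G s ^ 2 + τ * δ * (q * W s) ^ 2)
      + θ * (η * (-(G s * (q * W s))) + η / (4 * τ) * ((q * X s - τ * (q * W s)) * G s)))) ≤
        μ * ρ * (2 * C₂ * (G s ^ 2 + (q * W s) ^ 2 + (q * X s - τ * (q * W s)) ^ 2)) := by
      gcongr; linarith
    have h6 : μ * ρ * (2 * C₂ * (G s ^ 2 + (q * W s) ^ 2 + (q * X s - τ * (q * W s)) ^ 2))
        = ρ * d * (G s ^ 2 + (q * W s) ^ 2 + (q * X s - τ * (q * W s)) ^ 2) := by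
      rw [hμ]; field_simp
    linarith) ht
  have hPt := (abs_le.mp (hPE t)).1
  have hP0 := (abs_le.mp (hPE 0)).2
  have l2 := mul_le_mul_of_nonneg_left (add_le_add_right hP0
    ((q * X 0) ^ 2 + G 0 ^ 2 + τ * δ * (q * W 0) ^ 2)) (Real.exp_pos (-(μ * ρ) * t)).le
  have l4 : (q * X 0) ^ 2 + G 0 ^ 2 + τ * δ * (q * W 0) ^ 2
      ≤ (1 + τ * δ) * ((q * X 0) ^ 2 + G 0 ^ 2 + (q * W 0) ^ 2) := by
    have : 0 ≤ τ * δ * ((q * X 0) ^ 2 + G 0 ^ 2) := by positivity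
    linarith [sq_nonneg (q * W 0)]
  have l5 : (q * X t) ^ 2 + G t ^ 2 + (q * W t) ^ 2 ≤
      (1 + 1 / (τ * δ)) * ((q * X t) ^ 2 + G t ^ 2 + τ * δ * (q * W t) ^ 2) := by
    have e1 : 1 / (τ * δ) * (τ * δ * (q * W t) ^ 2) = (q * W t) ^ 2 := by field_simp
    have : 0 ≤ 1 / (τ * δ) * ((q * X t) ^ 2 + G t ^ 2) := by positivity
    have : 0 ≤ τ * δ * (q * W t) ^ 2 := by positivity
    linarith
  have l6 := mul_le_mul_of_nonneg_left l4 (Real.exp_pos (-(μ * ρ) * t)).le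
  calc _ ≤ (1 + 1 / (τ * δ)) * ((q * X t) ^ 2 + G t ^ 2 + τ * δ * (q * W t) ^ 2) := l5
    _ ≤ (1 + 1 / (τ * δ)) * (3 * (Real.exp (-(μ * ρ) * t) *
        ((1 + τ * δ) * ((q * X 0) ^ 2 + G 0 ^ 2 + (q * W 0) ^ 2)))) := by
        refine mul_le_mul_of_nonneg_left ?_ (by positivity)
        linarith
    _ = _ := by ring

end Lyapunov

/-! ### Pointwise bounds for the velocity of a mode. -/

section ModeBounds

lemma IsModeSolution.neg {τ δ q : ℝ} {X G W : ℝ → ℝ} (h : IsModeSolution τ δ q X G W) :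
    IsModeSolution τ δ q (fun t => -X t) (fun t => -G t) (fun t => -W t) where
  deriv_X t := (h.deriv_X t).neg
  deriv_G t := (h.deriv_G t).neg.congr_deriv (by ring)
  deriv_W t := (h.deriv_W t).neg.congr_deriv (by ring)

lemma IsModeSolution.const_smul {τ δ q : ℝ} {X G W : ℝ → ℝ} (h : IsModeSolution τ δ q X G W)
    (c : ℝ) :
    IsModeSolution τ δ q (fun t => c * X t) (fun t => c * G t) (fun t => c * W t) where
  deriv_X t := (h.deriv_X t).const_mul c
  deriv_G t := ((h.deriv_G t).const_mul c).congr_deriv (by ring)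
  deriv_W t := ((h.deriv_W t).const_mul c).congr_deriv (by ring)

lemma IsModeSolution.add {τ δ q : ℝ} {X G W X' G' W' : ℝ → ℝ} (h : IsModeSolution τ δ q X G W)
    (h' : IsModeSolution τ δ q X' G' W') :
    IsModeSolution τ δ q (fun t => X t + X' t) (fun t => G t + G' t) (fun t => W t + W' t) where
  deriv_X t := (h.deriv_X t).add (h'.deriv_X t)
  deriv_G t := ((h.deriv_G t).add (h'.deriv_G t)).congr_deriv (by ring)
  deriv_W t := ((h.deriv_W t).add (h'.deriv_W t)).congr_deriv (by ring)

/-- A relaxation equation driven by a slowly decaying source. -/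
lemma relaxation_le {τ M a : ℝ} {G W : ℝ → ℝ} (hτ : 0 < τ) (hM : 0 ≤ M) (ha : a ≤ 1 / (2 * τ))
    (hW : ∀ t, HasDerivAt W ((G t - W t) / τ) t) (hG : ∀ t, 0 ≤ t → G t ≤ M * Real.exp (-a * t))
    {t : ℝ} (ht : 0 ≤ t) : W t ≤ Real.exp (-(t / τ)) * |W 0| + 2 * M * Real.exp (-a * t) := by
  -- After multiplication by `exp(s/τ)`, the subtracted function majorises the source: `a ≤ 1/(2τ)`
  -- gives `1/τ - a ≥ 1/(2τ)`, whence the factor `2`.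
  have hd : ∀ s, HasDerivAt (fun s => Real.exp (s / τ) * W s - 2 * M * Real.exp ((1 / τ - a) * s))
      (Real.exp (s / τ) * (G s / τ) - 2 * M * ((1 / τ - a) * Real.exp ((1 / τ - a) * s))) s := by
    intro s
    have h1 : HasDerivAt (fun s => Real.exp (s / τ)) (Real.exp (s / τ) * (1 / τ)) s :=
      ((hasDerivAt_id s).div_const τ).exp
    have h2 : HasDerivAt (fun s => Real.exp ((1 / τ - a) * s))
        (Real.exp ((1 / τ - a) * s) * (1 / τ - a)) s := by
      simpa using ((hasDerivAt_id s).const_mul (1 / τ - a)).exp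
    refine ((h1.mul (hW s)).sub (h2.const_mul (2 * M))).congr_deriv ?_
    field_simp; ring
  have hanti : AntitoneOn (fun s => Real.exp (s / τ) * W s - 2 * M * Real.exp ((1 / τ - a) * s))
      (Ici 0) := by
    apply antitoneOn_of_deriv_nonpos (convex_Ici 0)
    · exact fun s _ => (hd s).continuousAt.continuousWithinAt
    · exact fun s _ => (hd s).differentiableAt.differentiableWithinAt
    · intro s hs
      rw [interior_Ici] at hs
      rw [(hd s).deriv]
      have e1 : Real.exp ((1 / τ - a) * s) = Real.exp (s / τ) * Real.exp (-a * s) := by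
        rw [← Real.exp_add]; congr 1; ring
      rw [e1]
      have h1 := hG s (le_of_lt hs)
      have h2 : G s / τ ≤ M * Real.exp (-a * s) / τ := by gcongr
      have h3 : M * Real.exp (-a * s) / τ ≤ 2 * M * ((1 / τ - a) * Real.exp (-a * s)) := by
        have h4 : 1 / τ / 2 ≤ 1 / τ - a := by
          have : 1 / τ / 2 = 1 / (2 * τ) := by field_simp
          have : 1 / τ = 2 * (1 / (2 * τ)) := by field_simp
          linarith
        have h5 := mul_le_mul_of_nonneg_left h4 (show 0 ≤ 2 * M * Real.exp (-a * s) by positivity)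
        calc _ = 2 * M * Real.exp (-a * s) * (1 / τ / 2) := by field_simp
          _ ≤ _ := h5
          _ = _ := by ring
      have h6 := mul_le_mul_of_nonneg_left (h2.trans h3) (Real.exp_pos (s / τ)).le
      linarith
  have h0 := hanti (mem_Ici.mpr le_rfl) (mem_Ici.mpr ht) ht
  simp only [zero_div, Real.exp_zero, mul_zero, one_mul, mul_one] at h0
  have h1 : Real.exp (t / τ) * W t ≤ |W 0| + 2 * M * Real.exp ((1 / τ - a) * t) := by
    linarith [le_abs_self (W 0)]
  have h2 := mul_le_mul_of_nonneg_left h1 (Real.exp_pos (-(t / τ))).le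
  have e1 : Real.exp (-(t / τ)) * (Real.exp (t / τ) * W t) = W t := by
    rw [← mul_assoc, ← Real.exp_add]; simp
  have e2 : Real.exp (-(t / τ)) * Real.exp ((1 / τ - a) * t) = Real.exp (-a * t) := by
    rw [← Real.exp_add]; congr 1; ring
  calc W t = _ := e1.symm
    _ ≤ _ := h2
    _ = Real.exp (-(t / τ)) * |W 0| + 2 * M * (Real.exp (-(t / τ)) *
        Real.exp ((1 / τ - a) * t)) := by ring
    _ = _ := by rw [e2]

lemma abs_le_sqrt_mul_exp {C ρ t x a b c S : ℝ} (hC : 0 < C) (hx : x ^ 2 ≤ S)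
    (hS : S ≤ C * Real.exp (-ρ * t) * (a ^ 2 + b ^ 2 + c ^ 2)) :
    |x| ≤ √C * Real.exp (-(ρ / 2) * t) * (|a| + |b| + |c|) := by
  refine abs_le_of_sq_le_sq ?_ (by positivity)
  have e : Real.exp (-ρ * t) = Real.exp (-(ρ / 2) * t) ^ 2 := by
    rw [← Real.exp_nat_mul]; congr 1; push_cast; ring
  rw [mul_pow, mul_pow, Real.sq_sqrt hC.le, ← e]
  refine hx.trans (hS.trans ?_)
  gcongr
  rw [← sq_abs a, ← sq_abs b, ← sq_abs c]
  nlinarith [mul_nonneg (abs_nonneg a) (abs_nonneg b), mul_nonneg (abs_nonneg a) (abs_nonneg c),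
    mul_nonneg (abs_nonneg b) (abs_nonneg c)]

/-- Bounds for the velocity component of the modes: low frequencies gain a factor `q` up to an
exponentially decaying term, high frequencies decay exponentially. -/
lemma exists_mode_bounds {τ δ : ℝ} (hτ : 0 < τ) (hδ : 0 < δ) :
    ∃ C > 0, ∃ μ > 0, μ ≤ 1 / τ ∧ ∀ q : ℝ, 0 ≤ q → ∀ X G W : ℝ → ℝ, IsModeSolution τ δ q X G W →
      ∀ t, 0 ≤ t →
        (q ≤ 1 → |W t| ≤ Real.exp (-(t / τ)) * |W 0| +
          C * Real.exp (-(μ * q ^ 2) * t) * (q * |X 0| + |G 0| + q * |W 0|)) ∧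
        (1 ≤ q → |W t| ≤ C * Real.exp (-μ * t) * (|X 0| + |G 0| / q + |W 0|)) := by
  obtain ⟨C, hC, μ, hμ, H⟩ := exists_mode_energy_decay hτ hδ
  -- A square root halves the rate, and `q²/(1+q²)` is at least `q²/2` for `q ≤ 1` and at least
  -- `1/2` for `q ≥ 1`; together these give `μ/4`. The bound `1/(2τ)` is what `relaxation_le`
  -- requires.
  set ν := min (μ / 4) (1 / (2 * τ)) with hν
  have hν0 : 0 < ν := by positivity
  refine ⟨2 * √C, by positivity, ν, hν0, (min_le_right _ _).trans (by gcongr; linarith),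
    fun q hq X G W hs t ht => ⟨fun hq1 => ?_, fun hq1 => ?_⟩⟩
  · have hrate : ν * q ^ 2 ≤ μ * (q ^ 2 / (1 + q ^ 2)) / 2 := by
      have hq2 : q ^ 2 ≤ 1 := by nlinarith
      have h1 : q ^ 2 / 2 ≤ q ^ 2 / (1 + q ^ 2) := by gcongr; linarith
      have h2 : ν ≤ μ / 4 := min_le_left _ _
      nlinarith [mul_le_mul_of_nonneg_left h1 hμ.le, mul_le_mul_of_nonneg_right h2 (sq_nonneg q)]
    have hrate' : ν * q ^ 2 ≤ 1 / (2 * τ) := by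
      have hq2 : q ^ 2 ≤ 1 := by nlinarith
      exact (mul_le_of_le_one_right hν0.le hq2).trans (min_le_right _ _)
    have key : ∀ X G W : ℝ → ℝ, IsModeSolution τ δ q X G W →
        W t ≤ Real.exp (-(t / τ)) * |W 0| +
          2 * √C * Real.exp (-(ν * q ^ 2) * t) * (q * |X 0| + |G 0| + q * |W 0|) := by
      intro X G W hs
      have := relaxation_le (M := √C * (q * |X 0| + |G 0| + q * |W 0|)) hτ (by positivity) hrate'
        hs.deriv_W (fun s hs0 => ?_) ht
      · calc _ ≤ _ := this
          _ = _ := by ring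
      · have h0 : G s ^ 2 ≤ (q * X s) ^ 2 + G s ^ 2 + (q * W s) ^ 2 := by
          linarith [sq_nonneg (q * X s), sq_nonneg (q * W s)]
        have h1 := abs_le_sqrt_mul_exp hC h0 (H q hq X G W hs s hs0)
        rw [abs_mul, abs_mul, abs_of_nonneg hq] at h1
        refine (le_abs_self _).trans (h1.trans ?_)
        have h2 : Real.exp (-(μ * (q ^ 2 / (1 + q ^ 2)) / 2) * s) ≤ Real.exp (-(ν * q ^ 2) * s) := by
          apply Real.exp_le_exp.mpr
          have := mul_le_mul_of_nonneg_right hrate hs0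
          linarith
        calc _ ≤ √C * Real.exp (-(ν * q ^ 2) * s) * (q * |X 0| + |G 0| + q * |W 0|) := by gcongr
          _ = _ := by ring
    -- The one-sided bound applied to the negated mode gives the other sign.
    refine abs_le'.mpr ⟨key X G W hs, ?_⟩
    have := key _ _ _ hs.neg
    simpa only [abs_neg] using this
  · have hq0 : 0 < q := by linarith
    have hrate : ν ≤ μ * (q ^ 2 / (1 + q ^ 2)) / 2 := by
      have h1 : 1 / 2 ≤ q ^ 2 / (1 + q ^ 2) := by
        rw [div_le_div_iff₀ (by norm_num) (by positivity)]; nlinarith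
      have h2 : ν ≤ μ / 4 := min_le_left _ _
      nlinarith [mul_le_mul_of_nonneg_left h1 hμ.le]
    have h0 : (q * W t) ^ 2 ≤ (q * X t) ^ 2 + G t ^ 2 + (q * W t) ^ 2 := by
      linarith [sq_nonneg (q * X t), sq_nonneg (G t)]
    have h1 := abs_le_sqrt_mul_exp hC h0 (H q hq X G W hs t ht)
    rw [abs_mul, abs_mul, abs_mul, abs_of_nonneg hq] at h1
    have h2 : Real.exp (-(μ * (q ^ 2 / (1 + q ^ 2)) / 2) * t) ≤ Real.exp (-ν * t) := by
      apply Real.exp_le_exp.mpr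
      have := mul_le_mul_of_nonneg_right hrate ht
      linarith
    have h3 : |W t| ≤ √C * Real.exp (-ν * t) * (|X 0| + |G 0| / q + |W 0|) := by
      have h4 : q * |W t| ≤ √C * Real.exp (-ν * t) * (q * |X 0| + |G 0| + q * |W 0|) :=
        h1.trans (by gcongr)
      have h5 : √C * Real.exp (-ν * t) * (q * |X 0| + |G 0| + q * |W 0|)
          = q * (√C * Real.exp (-ν * t) * (|X 0| + |G 0| / q + |W 0|)) := by field_simp
      rw [h5] at h4
      exact le_of_mul_le_mul_left h4 hq0
    refine h3.trans ?_
    have : 0 ≤ √C * Real.exp (-ν * t) * (|X 0| + |G 0| / q + |W 0|) := by positivity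
    linarith

end ModeBounds

/-! ### The matrix exponential of the system and bounds for its velocity row. -/

section Propagator

open scoped Matrix.Norms.Operator

/-- The generator of the first-order system for `(w + τ ∂ₜw, w' + τ w'' - κN, ∂ₜw)` at frequency
`|ξ|^σ = q`. -/
def genMat (τ δ q : ℝ) : Matrix (Fin 3) (Fin 3) ℝ :=
  !![0, 1, 0; -q ^ 2, 0, -(δ * q ^ 2); 0, 1 / τ, -(1 / τ)]

/-- The propagator of the first-order system. -/
def prop (τ δ t q : ℝ) : Matrix (Fin 3) (Fin 3) ℝ := NormedSpace.exp (t • genMat τ δ q)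

lemma prop_zero (τ δ q : ℝ) : prop τ δ 0 q = 1 := by simp [prop, NormedSpace.exp_zero]

lemma prop_add (τ δ s t q : ℝ) : prop τ δ (s + t) q = prop τ δ s q * prop τ δ t q := by
  unfold prop
  rw [add_smul]
  exact Matrix.exp_add_of_commute _ _ (((Commute.refl (genMat τ δ q)).smul_left s).smul_right t)

lemma hasDerivAt_prop (τ δ t q : ℝ) (i j : Fin 3) :
    HasDerivAt (fun t => prop τ δ t q i j) ((genMat τ δ q * prop τ δ t q) i j) t := by
  have h := hasDerivAt_exp_smul_const' (𝕂 := ℝ) (genMat τ δ q) t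
  let L : Matrix (Fin 3) (Fin 3) ℝ →L[ℝ] ℝ :=
    LinearMap.toContinuousLinearMap (Matrix.entryLinearMap ℝ ℝ i j)
  exact L.hasFDerivAt.comp_hasDerivAt t h

lemma continuous_genMat (τ δ : ℝ) : Continuous (genMat τ δ) := by
  refine continuous_matrix fun i j => ?_
  fin_cases i <;> fin_cases j <;> simp [genMat] <;> fun_prop

lemma continuous_prop (τ δ : ℝ) : Continuous fun p : ℝ × ℝ => prop τ δ p.1 p.2 := by
  unfold prop
  exact (NormedSpace.exp_continuous (𝔸 := Matrix (Fin 3) (Fin 3) ℝ)).comp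
    (continuous_fst.smul ((continuous_genMat τ δ).comp continuous_snd))

lemma continuous_prop_apply (τ δ : ℝ) (i j : Fin 3) :
    Continuous fun p : ℝ × ℝ => prop τ δ p.1 p.2 i j :=
  (continuous_prop τ δ).matrix_elem i j

/-- Column `j` is the mode started at the `j`-th unit vector, so the bounds for modes become bounds
for matrix entries. -/
lemma isModeSolution_prop {τ : ℝ} (δ q : ℝ) (j : Fin 3) :
    IsModeSolution τ δ q (fun t => prop τ δ t q 0 j) (fun t => prop τ δ t q 1 j)
      (fun t => prop τ δ t q 2 j) where
  deriv_X t := (hasDerivAt_prop τ δ t q 0 j).congr_deriv (by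
    simp [genMat, Matrix.mul_apply, Fin.sum_univ_three])
  deriv_G t := (hasDerivAt_prop τ δ t q 1 j).congr_deriv (by
    simp [genMat, Matrix.mul_apply, Fin.sum_univ_three]; ring)
  deriv_W t := (hasDerivAt_prop τ δ t q 2 j).congr_deriv (by
    simp [genMat, Matrix.mul_apply, Fin.sum_univ_three]; ring)

/-- The kernel of the Duhamel integral. -/
def duhamelKer (τ δ t q : ℝ) : ℝ := prop τ δ t q 2 0 + (1 / τ) * prop τ δ t q 2 2

/-- The heat-type factor carried by the low frequencies. -/
def lowExp (μ t q : ℝ) : ℝ := if q ≤ 1 then Real.exp (-(μ * q ^ 2) * t) else 0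

lemma lowExp_nonneg (μ t q : ℝ) : 0 ≤ lowExp μ t q := by
  unfold lowExp; split_ifs <;> positivity

/-- The factor `1 + q` in the second bound comes from `|G 0| / q` at high frequencies; it is why the
third datum may have `σ` fewer derivatives. In the last bound the initial vector has no `G`
component, so at low frequencies everything except an exponentially small term carries a factor `q`.
-/
lemma exists_prop_bounds {τ δ : ℝ} (hτ : 0 < τ) (hδ : 0 < δ) :
    ∃ C > 0, ∃ μ > 0, ∀ t, 0 ≤ t → ∀ q, 0 ≤ q →
      |prop τ δ t q 2 0| ≤ C * (Real.exp (-μ * t) + lowExp μ t q) ∧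
      |prop τ δ t q 2 1| * (1 + q) ≤ C * (Real.exp (-μ * t) + lowExp μ t q) ∧
      |prop τ δ t q 2 2| ≤ C * (Real.exp (-μ * t) + lowExp μ t q) ∧
      |duhamelKer τ δ t q| ≤ C * (Real.exp (-μ * t) + q * lowExp μ t q) := by
  obtain ⟨C, hC, μ, hμ, hμτ, H⟩ := exists_mode_bounds hτ hδ
  refine ⟨2 * (1 + C) * (1 + 1 / τ), by positivity, μ, hμ, fun t ht q hq => ?_⟩
  have hexp : Real.exp (-(t / τ)) ≤ Real.exp (-μ * t) := by
    apply Real.exp_le_exp.mpr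
    have := mul_le_mul_of_nonneg_right hμτ ht
    have e : 1 / τ * t = t / τ := by ring
    linarith
  have hτ' : 0 < 1 / τ := by positivity
  have b0 := H q hq _ _ _ (isModeSolution_prop δ q 0) t ht
  have b1 := H q hq _ _ _ (isModeSolution_prop δ q 1) t ht
  have b2 := H q hq _ _ _ (isModeSolution_prop δ q 2) t ht
  -- The Duhamel kernel is the velocity of the mode started at `(1, 0, 1/τ)`.
  have bg := H q hq _ _ _ ((isModeSolution_prop δ q 0).add
    ((isModeSolution_prop δ q 2).const_smul (1 / τ))) t ht
  simp only [prop_zero, Matrix.one_apply, Fin.reduceEq, if_true, if_false, abs_zero, abs_one,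
    mul_zero, mul_one, add_zero, zero_add, zero_div, abs_of_pos hτ'] at b0 b1 b2 bg
  set x := Real.exp (-μ * t)
  have hx : 0 < x := Real.exp_pos _
  have hD1 : 1 ≤ 1 + 1 / τ := by linarith
  rcases le_total q 1 with h1 | h1
  · have e : lowExp μ t q = Real.exp (-(μ * q ^ 2) * t) := by simp [lowExp, h1]
    rw [e]
    set y := Real.exp (-(μ * q ^ 2) * t)
    have hy : 0 < y := Real.exp_pos _
    have c0 := b0.1 h1
    have c1 := b1.1 h1
    have c2 := b2.1 h1
    have cg := bg.1 h1
    have hqy : q * y ≤ y := mul_le_of_le_one_left hy.le h1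
    have hCy := mul_le_mul_of_nonneg_left hqy hC.le
    have hCxy : (1 + C) * (x + y) ≤ (1 + C) * (1 + 1 / τ) * (x + y) := by
      have : 0 ≤ (1 + C) * (1 / τ) * (x + y) := by positivity
      linarith
    have hCx := mul_pos hC hx
    have hCy' := mul_pos hC hy
    refine ⟨by linarith, ?_, by linarith, ?_⟩
    · calc _ ≤ (C * y) * 2 := by gcongr; linarith
        _ ≤ _ := by linarith
    · refine cg.trans ?_
      have h2 : Real.exp (-(t / τ)) * (1 / τ) ≤ x * (1 / τ) := by gcongr
      have hqy0 : 0 ≤ q * y := by positivity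
      have h3 : 0 ≤ C * (1 + 1 / τ) * x := by positivity
      have h4 : 0 ≤ (1 + 1 / τ) * (q * y) := by positivity
      have h5 : 0 ≤ C * (1 + 1 / τ) * (q * y) := by positivity
      have h6 : 0 ≤ x * (1 / τ) := by positivity
      calc _ ≤ x * (1 / τ) + C * y * (q + q * (1 / τ)) := by gcongr
        _ ≤ _ := by linarith
  · have c0 := b0.2 h1
    have c1 := b1.2 h1
    have c2 := b2.2 h1
    have cg := bg.2 h1
    have hl := lowExp_nonneg μ t q
    have hCx : C * x ≤ 2 * (1 + C) * (1 + 1 / τ) * (x + lowExp μ t q) := by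
      have : 0 ≤ (2 + C + 2 * (1 + C) * (1 / τ)) * x := by positivity
      have : 0 ≤ 2 * (1 + C) * (1 + 1 / τ) * lowExp μ t q := by positivity
      linarith
    refine ⟨c0.trans hCx, ?_, c2.trans hCx, ?_⟩
    · have h2 : (1 / q) * (1 + q) ≤ 2 := by
        rw [div_mul_eq_mul_div, one_mul, div_le_iff₀ (by linarith)]; linarith
      calc _ ≤ C * x * (1 / q) * (1 + q) := by gcongr
        _ = C * x * ((1 / q) * (1 + q)) := by ring
        _ ≤ C * x * 2 := by gcongr
        _ ≤ _ := by
          have : 0 ≤ 2 * (1 + C) * (1 / τ) * x + 2 * x := by positivity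
          have : 0 ≤ 2 * (1 + C) * (1 + 1 / τ) * lowExp μ t q := by positivity
          linarith
    · refine cg.trans ?_
      have : 0 ≤ 2 * (1 + C) * (1 + 1 / τ) * (q * lowExp μ t q) := by positivity
      have : 0 ≤ (2 + C) * (1 + 1 / τ) * x := by positivity
      linarith

end Propagator

/-! ### Multipliers restricted to a bounded range of frequencies. -/

section CutSymbols

variable {n : ℕ}

/-- The symbol `f (|ξ|^σ)` cut off to the frequencies `|ξ| ≤ R`. -/
def cutSym (σ R : ℝ) (f : ℝ → ℝ) : ℝ → ℝ := fun x => if x ≤ R then f (x ^ σ) else 0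

lemma measurable_comp_rpow {f : ℝ → ℝ} (hf : Continuous f) (σ : ℝ) :
    Measurable fun x : ℝ => f (x ^ σ) :=
  hf.measurable.comp (measurable_id.pow_const σ)

lemma measurable_cutSym {f : ℝ → ℝ} (hf : Continuous f) (σ R : ℝ) : Measurable (cutSym σ R f) :=
  Measurable.ite measurableSet_Iic (measurable_comp_rpow hf σ) measurable_const

lemma rpow_mem_Icc {σ R x : ℝ} (hσ : 0 < σ) (hx : 0 ≤ x) (hR : x ≤ R) : x ^ σ ∈ Icc 0 (R ^ σ) :=
  ⟨Real.rpow_nonneg hx _, Real.rpow_le_rpow hx hR hσ.le⟩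

lemma isSymbol_cutSym {f : ℝ → ℝ} (hf : Continuous f) {σ : ℝ} (hσ : 0 < σ) (R : ℝ) :
    IsSymbol (cutSym σ R f) := by
  obtain ⟨C, hC⟩ := (isCompact_Icc (a := (0 : ℝ)) (b := R ^ σ)).exists_bound_of_continuousOn
    hf.continuousOn
  refine ⟨measurable_cutSym hf σ R, |C|, fun x hx => ?_⟩
  unfold cutSym
  split_ifs with h
  · exact (hC _ (rpow_mem_Icc hσ hx h)).trans (le_abs_self C)
  · simp

lemma Op_cutSym_mul {f g : ℝ → ℝ} (hf : Continuous f) (hg : Continuous g) {σ : ℝ} (hσ : 0 < σ)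
    (R : ℝ) (u : RealL2 n) :
    Op (cutSym σ R f) (Op (cutSym σ R g) u) = Op (cutSym σ R fun q => f q * g q) u := by
  rw [Op_Op (isSymbol_cutSym hf hσ R) (isSymbol_cutSym hg hσ R)]
  congr 2
  ext x
  unfold cutSym
  split_ifs <;> simp

lemma Op_cutSym_add {f g : ℝ → ℝ} (hf : Continuous f) (hg : Continuous g) {σ : ℝ} (hσ : 0 < σ)
    (R : ℝ) (u : RealL2 n) :
    Op (cutSym σ R fun q => f q + g q) u = Op (cutSym σ R f) u + Op (cutSym σ R g) u := by
  rw [← Op_add (isSymbol_cutSym hf hσ R) (isSymbol_cutSym hg hσ R)]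
  congr 2
  ext x
  unfold cutSym
  split_ifs <;> simp

lemma Op_cutSym_smul {f : ℝ → ℝ} (hf : Continuous f) {σ : ℝ} (hσ : 0 < σ)
    (R c : ℝ) (u : RealL2 n) :
    Op (cutSym σ R fun q => c * f q) u = c • Op (cutSym σ R f) u := by
  rw [← Op_smul (isSymbol_cutSym hf hσ R)]
  congr 2
  ext x
  unfold cutSym
  split_ifs <;> simp

lemma Op_cutSym_zero (σ R : ℝ) (u : RealL2 n) : Op (cutSym σ R fun _ => 0) u = 0 := by
  have : cutSym σ R (fun _ => 0) = fun _ => 0 * (1 : ℝ) := by ext x; simp [cutSym]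
  rw [this, Op_smul (IsSymbol.const 1)]; simp

/-- The cut-off keeps `q` in the compact interval `[0, R^σ]`, so uniform continuity on a rectangle
supplies the uniformity in frequency that operator-norm differentiability needs. -/
lemma exists_cutSym_bound {F : ℝ × ℝ → ℝ} (hF : Continuous F) {σ : ℝ} (hσ : 0 < σ) (R t₀ : ℝ) :
    ∀ ε > 0, ∃ η > 0, ∀ t, |t - t₀| < η → ∀ x, 0 ≤ x →
      |cutSym σ R (fun q => F (t, q)) x - cutSym σ R (fun q => F (t₀, q)) x| ≤ ε := by
  intro ε hε
  have hc := ((isCompact_Icc (a := t₀ - 1) (b := t₀ + 1)).prod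
    (isCompact_Icc (a := (0 : ℝ)) (b := R ^ σ))).uniformContinuousOn_of_continuous hF.continuousOn
  obtain ⟨η, hη, H⟩ := Metric.uniformContinuousOn_iff.mp hc ε hε
  refine ⟨min η 1, by positivity, fun t ht x hx => ?_⟩
  unfold cutSym
  split_ifs with h
  · have h1 : |t - t₀| < 1 := ht.trans_le (min_le_right _ _)
    rw [abs_lt] at h1
    have hq := rpow_mem_Icc hσ hx h
    refine (H (t, x ^ σ) ⟨⟨by linarith, by linarith⟩, hq⟩ (t₀, x ^ σ)
      ⟨⟨by linarith, by linarith⟩, hq⟩ ?_).le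
    rw [Prod.dist_eq, dist_self, max_eq_left dist_nonneg]
    exact ht.trans_le (min_le_left _ _)
  · simpa using hε.le

lemma continuous_section {F : ℝ × ℝ → ℝ} (hF : Continuous F) (t : ℝ) :
    Continuous fun q => F (t, q) := hF.comp (by fun_prop)

lemma continuous_Op_cutSym {F : ℝ × ℝ → ℝ} (hF : Continuous F) {σ : ℝ} (hσ : 0 < σ) (R : ℝ)
    {f : ℝ → RealL2 n} (hf : Continuous f) :
    Continuous fun t => Op (cutSym σ R fun q => F (t, q)) (f t) := by
  refine continuous_Op (fun t => isSymbol_cutSym (continuous_section hF t) hσ R) (fun x hx => ?_)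
    (fun t₀ => ?_) hf
  · unfold cutSym
    split_ifs <;> fun_prop
  · obtain ⟨C, hC⟩ := (isSymbol_cutSym (continuous_section hF t₀) hσ R).bounded
    obtain ⟨η, hη, H⟩ := exists_cutSym_bound hF hσ R t₀ 1 one_pos
    refine ⟨C + 1, ?_⟩
    filter_upwards [Metric.ball_mem_nhds t₀ hη] with t ht x hx
    have h1 := H t ht x hx
    have h2 := hC x hx
    rw [abs_le] at *
    constructor <;> linarith

lemma hasDerivAt_Op_cutSym {F F' : ℝ × ℝ → ℝ} (hF : Continuous F) (hF' : Continuous F') {σ : ℝ}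
    (hσ : 0 < σ) (R : ℝ) (hd : ∀ t q, HasDerivAt (fun t => F (t, q)) (F' (t, q)) t) (t : ℝ) :
    HasDerivAt (fun t => (Op (cutSym σ R fun q => F (t, q)) : RealL2 n →L[ℝ] RealL2 n))
      (Op (cutSym σ R fun q => F' (t, q))) t := by
  refine hasDerivAt_Op (m := fun t => cutSym σ R fun q => F (t, q))
    (m' := fun t => cutSym σ R fun q => F' (t, q))
    (fun t => isSymbol_cutSym (continuous_section hF t) hσ R)
    (fun t => isSymbol_cutSym (continuous_section hF' t) hσ R) (fun t x hx => ?_) t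
    (exists_cutSym_bound hF' hσ R t)
  unfold cutSym
  split_ifs
  · exact hd t _
  · exact hasDerivAt_const _ _

/-- A relation with an unbounded multiplier can be checked below each cut-off, because every
frequency lies below some integer. -/
lemma ae_of_forall_cut {σ : ℝ} (hσ : 0 < σ) {f g : RealL2 n} (p : ℝ → ℝ) (hp : Continuous p)
    (h : ∀ R, Op (cutSym σ R fun _ => 1) f = Op (cutSym σ R p) g) :
    fourierL2 f =ᵐ[volume] fun ξ => (p (freq ξ ^ σ) : ℂ) * fourierL2 g ξ := by
  have H : ∀ᵐ ξ : Sp n, ∀ N : ℕ, freq ξ ≤ N → fourierL2 f ξ = (p (freq ξ ^ σ) : ℂ) * fourierL2 g ξ := by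
    rw [ae_all_iff]
    intro N
    have h1 := fourierL2_Op (isSymbol_cutSym (continuous_const (y := (1 : ℝ))) hσ (N : ℝ)) f
    have h2 := fourierL2_Op (isSymbol_cutSym hp hσ (N : ℝ)) g
    rw [h N] at h1
    filter_upwards [h1, h2] with ξ h1 h2 hξ
    rw [h1] at h2
    simpa [cutSym, hξ] using h2
  filter_upwards [H] with ξ hξ
  obtain ⟨N, hN⟩ := exists_nat_ge (freq ξ)
  exact hξ N hN

end CutSymbols

/-! ### The twice integrated equation, and variation of constants under a frequency cut-off. -/

section Volterra

variable {n : ℕ}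

lemma hasDerivAt_primitive {E : Type*} [NormedAddCommGroup E] [NormedSpace ℝ E] [CompleteSpace E]
    {f : ℝ → E} (hf : Continuous f) (t : ℝ) : HasDerivAt (fun t => ∫ s in (0 : ℝ)..t, f s) (f t) t :=
  intervalIntegral.integral_hasDerivAt_right (hf.intervalIntegrable _ _)
    hf.aestronglyMeasurable.stronglyMeasurableAtFilter hf.continuousAt

lemma continuous_primitive {E : Type*} [NormedAddCommGroup E] [NormedSpace ℝ E] [CompleteSpace E]
    {f : ℝ → E} (hf : Continuous f) : Continuous fun t => ∫ s in (0 : ℝ)..t, f s :=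
  continuous_iff_continuousAt.mpr fun t => (hasDerivAt_primitive hf t).continuousAt

lemma eq_of_hasDerivAt_eq {E : Type*} [NormedAddCommGroup E] [NormedSpace ℝ E]
    {f g f' : ℝ → E} (hf : ∀ t, HasDerivAt f (f' t) t) (hg : ∀ t, HasDerivAt g (f' t) t)
    (h0 : f 0 = g 0) (t : ℝ) : f t = g t := by
  have h : ∀ t, HasDerivAt (fun t => f t - g t) 0 t := fun t =>
    ((hf t).sub (hg t)).congr_deriv (sub_self _)
  have := is_const_of_deriv_eq_zero (fun t => (h t).differentiableAt) (fun t => (h t).deriv) t 0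
  simp only [h0, sub_self] at this
  exact sub_eq_zero.mp this

/-- The position `w(t) = w₀ + ∫₀ᵗ W`. -/
def position (w₀ : RealL2 n) (W : ℝ → RealL2 n) (t : ℝ) : RealL2 n := w₀ + ∫ s in (0 : ℝ)..t, W s

/-- The quantity `∫₀ᵗ (w + (δ + τ) W)` on which `(-Δ)^σ` acts. -/
def stress (τ δ : ℝ) (w₀ : RealL2 n) (W : ℝ → RealL2 n) (t : ℝ) : RealL2 n :=
  ∫ s in (0 : ℝ)..t, (position w₀ W s + (δ + τ) • W s)

/-- The equation integrated twice in time, on the Fourier side. Here `G₀` is the initial value of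
`τ ∂ₜW + W - κN`. -/
def SolvesVolterra (τ δ σ κ : ℝ) (w₀ W₀ G₀ : RealL2 n) (W N : ℝ → RealL2 n) : Prop :=
  ∀ t, 0 ≤ t →
    fourierL2 (τ • (W t - W₀) - t • G₀ + (∫ s in (0 : ℝ)..t, W s) - κ • ∫ s in (0 : ℝ)..t, N s)
      =ᵐ[volume] fun ξ => ((-(freq ξ ^ σ) ^ 2 : ℝ) : ℂ) *
        fourierL2 (∫ s in (0 : ℝ)..t, stress τ δ w₀ W s) ξ

lemma continuous_position {w₀ : RealL2 n} {W : ℝ → RealL2 n} (hW : Continuous W) :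
    Continuous (position w₀ W) := continuous_const.add (continuous_primitive hW)

lemma continuous_stress {τ δ : ℝ} {w₀ : RealL2 n} {W : ℝ → RealL2 n} (hW : Continuous W) :
    Continuous (stress τ δ w₀ W) :=
  continuous_primitive (by have := continuous_position (w₀ := w₀) hW; fun_prop)

/-- The solution of the first-order system with the frequencies above `R` removed, forced by
`κ(1, 0, 1/τ) N`. -/
def cutCoeff (τ δ σ κ R : ℝ) (y₀ : Fin 3 → RealL2 n) (N : ℝ → RealL2 n) (j : Fin 3) (t : ℝ) :
    RealL2 n :=
  y₀ j + ∫ s in (0 : ℝ)..t, κ • Op (cutSym σ R fun q =>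
    prop τ δ (-s) q j 0 + 1 / τ * prop τ δ (-s) q j 2) (N s)

/-- The components of the solution of the cut-off first-order system. -/
def cutSol (τ δ σ κ R : ℝ) (y₀ : Fin 3 → RealL2 n) (N : ℝ → RealL2 n) (i : Fin 3) (t : ℝ) :
    RealL2 n :=
  ∑ j, Op (cutSym σ R fun q => prop τ δ t q i j) (cutCoeff τ δ σ κ R y₀ N j t)

lemma continuous_forcing_symbol (τ δ : ℝ) (j : Fin 3) : Continuous fun p : ℝ × ℝ =>
    prop τ δ (-p.1) p.2 j 0 + 1 / τ * prop τ δ (-p.1) p.2 j 2 := by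
  have h : ∀ i, Continuous fun p : ℝ × ℝ => prop τ δ (-p.1) p.2 j i := fun i =>
    (continuous_prop_apply τ δ j i).comp (f := fun p : ℝ × ℝ => (-p.1, p.2)) (by fun_prop)
  exact (h 0).add ((h 2).const_mul _)

lemma hasDerivAt_cutCoeff {τ δ σ κ R : ℝ} (hσ : 0 < σ) (y₀ : Fin 3 → RealL2 n)
    {N : ℝ → RealL2 n} (hN : Continuous N) (j : Fin 3) (t : ℝ) :
    HasDerivAt (cutCoeff τ δ σ κ R y₀ N j) (κ • Op (cutSym σ R fun q =>
      prop τ δ (-t) q j 0 + 1 / τ * prop τ δ (-t) q j 2) (N t)) t :=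
  (hasDerivAt_primitive
    ((continuous_Op_cutSym (continuous_forcing_symbol τ δ j) hσ R hN).const_smul κ) t).const_add _

lemma continuous_genMat_mul_prop (τ δ : ℝ) (i j : Fin 3) :
    Continuous fun p : ℝ × ℝ => (genMat τ δ p.2 * prop τ δ p.1 p.2) i j :=
  (((continuous_genMat τ δ).comp continuous_snd).matrix_mul (continuous_prop τ δ)).matrix_elem i j

lemma prop_mul_prop_neg (τ δ t s q : ℝ) (i l : Fin 3) :
    ∑ j, prop τ δ t q i j * prop τ δ (-s) q j l = prop τ δ (t - s) q i l := by
  rw [sub_eq_add_neg, prop_add, Matrix.mul_apply]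

lemma Op_cutSym_sum {ι : Type*} (S : Finset ι) {f : ι → ℝ → ℝ} (hf : ∀ i, Continuous (f i)) {σ : ℝ}
    (hσ : 0 < σ) (R : ℝ) (u : RealL2 n) :
    Op (cutSym σ R fun q => ∑ i ∈ S, f i q) u = ∑ i ∈ S, Op (cutSym σ R (f i)) u := by
  classical
  induction S using Finset.induction_on with
  | empty => simpa using Op_cutSym_zero σ R u
  | insert a S ha ih =>
    simp_rw [Finset.sum_insert ha]
    rw [Op_cutSym_add (hf a) (continuous_finsetSum S fun i _ => hf i) hσ, ih]

lemma continuous_prop_right (τ δ t : ℝ) (i j : Fin 3) : Continuous fun q => prop τ δ t q i j :=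
  continuous_section (continuous_prop_apply τ δ i j) t

lemma continuous_forcing_right (τ δ t : ℝ) (j : Fin 3) : Continuous fun q =>
    prop τ δ t q j 0 + 1 / τ * prop τ δ t q j 2 :=
  (continuous_prop_right τ δ t j 0).add ((continuous_prop_right τ δ t j 2).const_mul _)

/-- The group law `prop t * prop (-s) = prop (t - s)` recombines variation of constants into the
Duhamel kernel. -/
lemma sum_Op_cutSym_forcing {τ δ σ R : ℝ} (hσ : 0 < σ) (t s : ℝ) (i : Fin 3) (u : RealL2 n) :
    ∑ j, Op (cutSym σ R fun q => prop τ δ t q i j) (Op (cutSym σ R fun q =>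
      prop τ δ (-s) q j 0 + 1 / τ * prop τ δ (-s) q j 2) u) =
    Op (cutSym σ R fun q => prop τ δ (t - s) q i 0 + 1 / τ * prop τ δ (t - s) q i 2) u := by
  have h : ∀ j, Op (cutSym σ R fun q => prop τ δ t q i j) (Op (cutSym σ R fun q =>
      prop τ δ (-s) q j 0 + 1 / τ * prop τ δ (-s) q j 2) u) = Op (cutSym σ R fun q =>
      prop τ δ t q i j * (prop τ δ (-s) q j 0 + 1 / τ * prop τ δ (-s) q j 2)) u := fun j =>
    Op_cutSym_mul (continuous_prop_right τ δ t i j) (continuous_forcing_right τ δ (-s) j) hσ R u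
  simp_rw [h]
  rw [← Op_cutSym_sum (f := fun j q => prop τ δ t q i j *
    (prop τ δ (-s) q j 0 + 1 / τ * prop τ δ (-s) q j 2)) Finset.univ
    (fun j => (continuous_prop_right τ δ t i j).mul (continuous_forcing_right τ δ (-s) j)) hσ]
  congr 3
  ext q
  simp_rw [← prop_mul_prop_neg, Finset.mul_sum, ← Finset.sum_add_distrib]
  exact Finset.sum_congr rfl fun j _ => by ring

/-- Variation of constants: `cutSol` is `exp(tA)` applied to `y₀ + ∫₀ᵗ exp(-sA) F(s) ds` with `F =
κ(1, 0, 1/τ)N`, so the product rule gives `Ay + F`. The cut-off makes the backward propagator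
bounded and `exp(tA)` differentiable in operator norm. -/
lemma hasDerivAt_cutSol {τ δ σ κ R : ℝ} (hσ : 0 < σ) (y₀ : Fin 3 → RealL2 n)
    {N : ℝ → RealL2 n} (hN : Continuous N) (i : Fin 3) (t : ℝ) :
    HasDerivAt (cutSol τ δ σ κ R y₀ N i)
      (∑ l, Op (cutSym σ R fun q => genMat τ δ q i l) (cutSol τ δ σ κ R y₀ N l t)
        + κ • Op (cutSym σ R fun _ => (1 : Matrix (Fin 3) (Fin 3) ℝ) i 0
          + 1 / τ * (1 : Matrix (Fin 3) (Fin 3) ℝ) i 2) (N t)) t := by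
  have hd : ∀ j, HasDerivAt (fun t => Op (cutSym σ R fun q => prop τ δ t q i j)
      (cutCoeff τ δ σ κ R y₀ N j t)) (Op (cutSym σ R fun q => (genMat τ δ q * prop τ δ t q) i j)
      (cutCoeff τ δ σ κ R y₀ N j t) + Op (cutSym σ R fun q => prop τ δ t q i j)
      (κ • Op (cutSym σ R fun q =>
      prop τ δ (-t) q j 0 + 1 / τ * prop τ δ (-t) q j 2) (N t))) t := fun j =>
    (hasDerivAt_Op_cutSym (continuous_prop_apply τ δ i j) (continuous_genMat_mul_prop τ δ i j) hσ R
      (fun t q => hasDerivAt_prop τ δ t q i j) t).clm_apply (hasDerivAt_cutCoeff hσ y₀ hN j t)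
  refine (HasDerivAt.fun_sum fun j (_ : j ∈ Finset.univ) => hd j).congr_deriv ?_
  rw [Finset.sum_add_distrib]
  congr 1
  · have hg : ∀ l, Continuous fun q => genMat τ δ q i l := fun l =>
      (continuous_genMat τ δ).matrix_elem i l
    have h1 : ∀ j, Op (cutSym σ R fun q => (genMat τ δ q * prop τ δ t q) i j)
        (cutCoeff τ δ σ κ R y₀ N j t) = ∑ l, Op (cutSym σ R fun q => genMat τ δ q i l)
          (Op (cutSym σ R fun q => prop τ δ t q l j) (cutCoeff τ δ σ κ R y₀ N j t)) := by
      intro j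
      simp_rw [fun l => Op_cutSym_mul (hg l) (continuous_prop_right τ δ t l j) hσ R
        (cutCoeff τ δ σ κ R y₀ N j t)]
      rw [← Op_cutSym_sum (f := fun l q => genMat τ δ q i l * prop τ δ t q l j) Finset.univ
        (fun l => (hg l).mul (continuous_prop_right τ δ t l j)) hσ]
      rfl
    simp_rw [h1]
    rw [Finset.sum_comm]
    simp_rw [← map_sum]
    rfl
  · simp_rw [map_smul]
    rw [← Finset.smul_sum, sum_Op_cutSym_forcing hσ]
    simp [prop_zero]

end Volterra

/-! ### The Duhamel formula and its truncations. -/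

section Mild

variable {n : ℕ}

/-- The symbol of the `(∂ₜw, j)` entry of the propagator. -/
def propSym (τ δ σ : ℝ) (j : Fin 3) (t : ℝ) : ℝ → ℝ := fun x => prop τ δ (max t 0) (x ^ σ) 2 j

/-- The symbol of the kernel of the Duhamel integral. -/
def kerSym (τ δ σ t : ℝ) : ℝ → ℝ := fun x => duhamelKer τ δ (max t 0) (x ^ σ)

/-- The solution formula for `∂ₜw` given the initial values of `w + τ ∂ₜw`, of
`∂ₜw + τ ∂ₜ²w - κN`, of `∂ₜw`, and the forcing `N`. -/
def mild (τ δ σ κ : ℝ) (X₀ G₀ W₀ : RealL2 n) (N : ℝ → RealL2 n) (t : ℝ) : RealL2 n :=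
  Op (propSym τ δ σ 0 t) X₀ + Op (propSym τ δ σ 1 t) G₀ + Op (propSym τ δ σ 2 t) W₀
    + κ • ∫ s in (0 : ℝ)..t, Op (kerSym τ δ σ (t - s)) (N s)

lemma continuous_duhamelKer (τ δ : ℝ) : Continuous fun p : ℝ × ℝ => duhamelKer τ δ p.1 p.2 :=
  (continuous_prop_apply τ δ 2 0).add ((continuous_prop_apply τ δ 2 2).const_mul _)

lemma measurable_propSym (τ δ σ : ℝ) (j : Fin 3) (t : ℝ) : Measurable (propSym τ δ σ j t) :=
  measurable_comp_rpow (continuous_prop_right τ δ (max t 0) 2 j) σ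

lemma measurable_kerSym (τ δ σ t : ℝ) : Measurable (kerSym τ δ σ t) :=
  measurable_comp_rpow (continuous_section (continuous_duhamelKer τ δ) (max t 0)) σ

lemma continuous_propSym (τ δ σ : ℝ) (j : Fin 3) (x : ℝ) :
    Continuous fun t => propSym τ δ σ j t x :=
  (continuous_prop_apply τ δ 2 j).comp (f := fun t : ℝ => (max t 0, x ^ σ)) (by fun_prop)

lemma continuous_kerSym (τ δ σ : ℝ) (x : ℝ) : Continuous fun t => kerSym τ δ σ t x :=
  (continuous_duhamelKer τ δ).comp (f := fun t : ℝ => (max t 0, x ^ σ)) (by fun_prop)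

lemma lowExp_le_one {μ t q : ℝ} (hμ : 0 ≤ μ) (ht : 0 ≤ t) : lowExp μ t q ≤ 1 := by
  unfold lowExp
  split_ifs
  · apply Real.exp_le_one_iff.mpr
    have : 0 ≤ μ * q ^ 2 * t := by positivity
    linarith
  · exact zero_le_one

lemma mul_lowExp_le_one {μ t q : ℝ} (hμ : 0 ≤ μ) (ht : 0 ≤ t) :
    q * lowExp μ t q ≤ 1 := by
  by_cases h : q ≤ 1
  · exact mul_le_one₀ h (lowExp_nonneg _ _ _) (lowExp_le_one hμ ht)
  · simp [lowExp, h]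

/-- The propagator symbols and the Duhamel kernel are uniformly bounded. -/
lemma exists_sym_bound {τ δ : ℝ} (hτ : 0 < τ) (hδ : 0 < δ) (σ : ℝ) :
    ∃ C > 0, ∀ t x, 0 ≤ x → (∀ j, |propSym τ δ σ j t x| ≤ C) ∧ |kerSym τ δ σ t x| ≤ C := by
  obtain ⟨C, hC, μ, hμ, H⟩ := exists_prop_bounds hτ hδ
  refine ⟨2 * C, by positivity, fun t x hx => ?_⟩
  have ht : 0 ≤ max t 0 := le_max_right _ _
  have hq : 0 ≤ x ^ σ := Real.rpow_nonneg hx _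
  obtain ⟨h0, h1, h2, hg⟩ := H _ ht _ hq
  have he : Real.exp (-μ * max t 0) ≤ 1 := by
    apply Real.exp_le_one_iff.mpr
    have : 0 ≤ μ * max t 0 := by positivity
    linarith
  have hl := lowExp_le_one (q := x ^ σ) hμ.le ht
  have hl' := mul_lowExp_le_one (q := x ^ σ) hμ.le ht
  have hb : C * (Real.exp (-μ * max t 0) + lowExp μ (max t 0) (x ^ σ)) ≤ 2 * C := by
    calc _ ≤ C * (1 + 1) := by gcongr
      _ = _ := by ring
  refine ⟨fun j => ?_, ?_⟩
  · fin_cases j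
    · exact h0.trans hb
    · refine le_trans ?_ (h1.trans hb)
      exact le_mul_of_one_le_right (abs_nonneg _) (by linarith)
    · exact h2.trans hb
  · refine hg.trans ?_
    calc _ ≤ C * (1 + 1) := by gcongr
      _ = _ := by ring

variable {τ δ σ κ : ℝ}

lemma isSymbol_propSym (hτ : 0 < τ) (hδ : 0 < δ) (σ : ℝ) (j : Fin 3) (t : ℝ) :
    IsSymbol (propSym τ δ σ j t) := by
  obtain ⟨C, -, H⟩ := exists_sym_bound hτ hδ σ
  exact .of_le (measurable_propSym τ δ σ j t) fun x hx => (H t x hx).1 j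

lemma isSymbol_kerSym (hτ : 0 < τ) (hδ : 0 < δ) (σ t : ℝ) : IsSymbol (kerSym τ δ σ t) := by
  obtain ⟨C, -, H⟩ := exists_sym_bound hτ hδ σ
  exact .of_le (measurable_kerSym τ δ σ t) fun x hx => (H t x hx).2

lemma continuous_Op_propSym (hτ : 0 < τ) (hδ : 0 < δ) (σ : ℝ) (j : Fin 3) (u : RealL2 n) :
    Continuous fun t => Op (propSym τ δ σ j t) u := by
  obtain ⟨C, -, H⟩ := exists_sym_bound hτ hδ σ
  exact continuous_Op (fun t => isSymbol_propSym hτ hδ σ j t)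
    (fun x _ => continuous_propSym τ δ σ j x)
    (fun t₀ => ⟨C, Eventually.of_forall fun t x hx => (H t x hx).1 j⟩) continuous_const

lemma continuous_Op_kerSym (hτ : 0 < τ) (hδ : 0 < δ) (σ : ℝ) {N : ℝ → RealL2 n}
    (hN : Continuous N) :
    Continuous fun p : ℝ × ℝ => Op (kerSym τ δ σ (p.1 - p.2)) (N p.2) := by
  obtain ⟨C, -, H⟩ := exists_sym_bound hτ hδ σ
  refine continuous_Op (m := fun p : ℝ × ℝ => kerSym τ δ σ (p.1 - p.2))
    (fun p => isSymbol_kerSym hτ hδ σ _) (fun x _ => ?_)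
    (fun t₀ => ⟨C, Eventually.of_forall fun p x hx => (H _ x hx).2⟩) (hN.comp continuous_snd)
  exact (continuous_kerSym τ δ σ x).comp (continuous_fst.sub continuous_snd)

lemma continuous_mild (hτ : 0 < τ) (hδ : 0 < δ) (σ κ : ℝ) (X₀ G₀ W₀ : RealL2 n)
    {N : ℝ → RealL2 n} (hN : Continuous N) : Continuous (mild τ δ σ κ X₀ G₀ W₀ N) := by
  have h := intervalIntegral.continuous_parametric_intervalIntegral_of_continuous (μ := volume)
    (a₀ := (0 : ℝ)) (f := fun t s => Op (kerSym τ δ σ (t - s)) (N s)) (s := fun t => t)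
    (continuous_Op_kerSym hτ hδ σ hN) continuous_id
  exact (((continuous_Op_propSym hτ hδ σ 0 X₀).add (continuous_Op_propSym hτ hδ σ 1 G₀)).add
    (continuous_Op_propSym hτ hδ σ 2 W₀)).add (h.const_smul κ)

lemma Op_cutSym_Op {f : ℝ → ℝ} (hσ : 0 < σ) (R : ℝ)
    (hm : IsSymbol fun x => f (x ^ σ)) (u : RealL2 n) :
    Op (cutSym σ R fun _ => 1) (Op (fun x => f (x ^ σ)) u) = Op (cutSym σ R f) u := by
  rw [Op_Op (isSymbol_cutSym continuous_const hσ R) hm]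
  congr 2
  ext x
  unfold cutSym
  split_ifs <;> simp

lemma integral_sum_clm {E : Type*} [NormedAddCommGroup E] [NormedSpace ℝ E] [CompleteSpace E]
    (A : Fin 3 → E →L[ℝ] E) {B : Fin 3 → ℝ → E} (hB : ∀ j, Continuous (B j)) (a b : ℝ) :
    ∫ s in a..b, ∑ j, A j (B j s) = ∑ j, A j (∫ s in a..b, B j s) := by
  rw [intervalIntegral.integral_finsetSum (f := fun j s => A j (B j s))
    fun j _ => ((A j).continuous.comp (hB j)).intervalIntegrable _ _]
  exact Finset.sum_congr rfl fun j _ =>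
    (A j).intervalIntegral_comp_comm ((hB j).intervalIntegrable _ _)

/-- Below the cut-off, the formula with forward kernels at `t - s` agrees with the form in which `t`
and `s` are separated; the latter can be differentiated in `t`. -/
lemma cut_mild (hτ : 0 < τ) (hδ : 0 < δ) (hσ : 0 < σ) (R : ℝ) (y₀ : Fin 3 → RealL2 n)
    {N : ℝ → RealL2 n} (hN : Continuous N) {t : ℝ} (ht : 0 ≤ t) :
    Op (cutSym σ R fun _ => 1) (mild τ δ σ κ (y₀ 0) (y₀ 1) (y₀ 2) N t)
      = cutSol τ δ σ κ R y₀ N 2 t := by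
  have hp : ∀ j u, Op (cutSym σ R fun _ => 1) (Op (propSym τ δ σ j t) u)
      = Op (cutSym σ R fun q => prop τ δ t q 2 j) (u : RealL2 n) := by
    intro j u
    have e : propSym τ δ σ j t = fun x => (fun q => prop τ δ t q 2 j) (x ^ σ) := by
      ext x; simp [propSym, max_eq_left ht]
    have hs := isSymbol_propSym hτ hδ σ j t
    rw [e] at hs ⊢
    exact Op_cutSym_Op (f := fun q => prop τ δ t q 2 j) hσ R hs u
  have hk : ∀ s ∈ uIcc 0 t, Op (cutSym σ R fun _ => 1) (Op (kerSym τ δ σ (t - s)) (N s))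
      = ∑ j, Op (cutSym σ R fun q => prop τ δ t q 2 j) (Op (cutSym σ R fun q =>
      prop τ δ (-s) q j 0 + 1 / τ * prop τ δ (-s) q j 2) (N s)) := by
    intro s hs
    rw [uIcc_of_le ht] at hs
    rw [sum_Op_cutSym_forcing hσ]
    have e : kerSym τ δ σ (t - s) = fun x => (fun q => prop τ δ (t - s) q 2 0
        + 1 / τ * prop τ δ (t - s) q 2 2) (x ^ σ) := by
      ext x; simp [kerSym, duhamelKer, max_eq_left (sub_nonneg.mpr hs.2)]
    have hs := isSymbol_kerSym hτ hδ σ (t - s)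
    rw [e] at hs ⊢
    exact Op_cutSym_Op (f := fun q => prop τ δ (t - s) q 2 0
      + 1 / τ * prop τ δ (t - s) q 2 2) hσ R hs _
  have hc : ∀ j, Continuous fun s => Op (cutSym σ R fun q =>
      prop τ δ (-s) q j 0 + 1 / τ * prop τ δ (-s) q j 2) (N s) := fun j =>
    continuous_Op_cutSym (continuous_forcing_symbol τ δ j) hσ R hN
  have hi : Continuous fun s => Op (kerSym τ δ σ (t - s)) (N s) :=
    (continuous_Op_kerSym hτ hδ σ hN).comp (f := fun s => (t, s)) (by fun_prop)
  unfold mild cutSol cutCoeff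
  simp only [map_add, map_smul, hp, Finset.sum_add_distrib, Fin.sum_univ_three]
  rw [← ContinuousLinearMap.intervalIntegral_comp_comm _ (hi.intervalIntegrable _ _),
    intervalIntegral.integral_congr hk,
    integral_sum_clm (fun j => Op (cutSym σ R fun q => prop τ δ t q 2 j)) hc]
  simp_rw [intervalIntegral.integral_smul, map_smul, Fin.sum_univ_three, smul_add]

lemma cut_cutSol (hσ : 0 < σ) (R : ℝ) (y₀ : Fin 3 → RealL2 n) (N : ℝ → RealL2 n) (i : Fin 3)
    (t : ℝ) : Op (cutSym σ R fun _ => 1) (cutSol τ δ σ κ R y₀ N i t)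
      = cutSol τ δ σ κ R y₀ N i t := by
  unfold cutSol
  rw [map_sum]
  refine Finset.sum_congr rfl fun j _ => ?_
  rw [Op_cutSym_mul continuous_const (continuous_prop_right τ δ t i j) hσ]
  simp

lemma cutSol_zero (σ R : ℝ) (y₀ : Fin 3 → RealL2 n) (N : ℝ → RealL2 n) (i : Fin 3) :
    cutSol τ δ σ κ R y₀ N i 0 = Op (cutSym σ R fun _ => 1) (y₀ i) := by
  unfold cutSol cutCoeff
  simp only [prop_zero, intervalIntegral.integral_same, add_zero, Matrix.one_apply]
  rw [Finset.sum_eq_single i]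
  · simp
  · intro j _ hj
    simp only [hj.symm, if_false]
    exact Op_cutSym_zero σ R _
  · simp

lemma hasDerivAt_cutSol_zero (hσ : 0 < σ) (R : ℝ) (y₀ : Fin 3 → RealL2 n) {N : ℝ → RealL2 n}
    (hN : Continuous N) (t : ℝ) : HasDerivAt (cutSol τ δ σ κ R y₀ N 0)
      (cutSol τ δ σ κ R y₀ N 1 t + κ • Op (cutSym σ R fun _ => 1) (N t)) t :=
  (hasDerivAt_cutSol hσ y₀ hN 0 t).congr_deriv (by
    simp [Fin.sum_univ_three, genMat, Op_cutSym_zero, cut_cutSol hσ])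

lemma hasDerivAt_cutSol_one (hσ : 0 < σ) (R : ℝ) (y₀ : Fin 3 → RealL2 n) {N : ℝ → RealL2 n}
    (hN : Continuous N) (t : ℝ) : HasDerivAt (cutSol τ δ σ κ R y₀ N 1)
      (Op (cutSym σ R fun q => -q ^ 2)
        (cutSol τ δ σ κ R y₀ N 0 t + δ • cutSol τ δ σ κ R y₀ N 2 t)) t :=
  (hasDerivAt_cutSol hσ y₀ hN 1 t).congr_deriv (by
    have e : (fun q : ℝ => -(δ * q ^ 2)) = fun q => δ * -q ^ 2 := by ext q; ring
    simp only [Fin.sum_univ_three, genMat, Matrix.of_apply, Matrix.cons_val', Matrix.cons_val_zero,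
      Matrix.cons_val_one, Matrix.cons_val, Op_cutSym_zero, e]
    rw [Op_cutSym_smul (by fun_prop) hσ]
    simp [Op_cutSym_zero])

lemma hasDerivAt_cutSol_two (hσ : 0 < σ) (R : ℝ) (y₀ : Fin 3 → RealL2 n)
    {N : ℝ → RealL2 n} (hN : Continuous N) (t : ℝ) : HasDerivAt (cutSol τ δ σ κ R y₀ N 2)
      ((1 / τ) • (cutSol τ δ σ κ R y₀ N 1 t - cutSol τ δ σ κ R y₀ N 2 t
        + κ • Op (cutSym σ R fun _ => 1) (N t))) t :=
  (hasDerivAt_cutSol hσ y₀ hN 2 t).congr_deriv (by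
    have h : ∀ (c : ℝ) (u : RealL2 n), Op (cutSym σ R fun _ => c) u
        = c • Op (cutSym σ R fun _ => 1) u := by
      intro c u
      rw [← Op_cutSym_smul continuous_const hσ]; simp
    simp [Fin.sum_univ_three, genMat, Op_cutSym_zero, h (τ⁻¹), h (-τ⁻¹), cut_cutSol hσ]
    module)

end Mild

/-! ### Existence and uniqueness for the twice integrated equation. -/

section VolterraEquation

variable {n : ℕ} {τ δ σ κ : ℝ}

lemma Op_cutSym_of_ae (hσ : 0 < σ) {f g : RealL2 n} {p : ℝ → ℝ} (hp : Continuous p)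
    (h : fourierL2 f =ᵐ[volume] fun ξ => (p (freq ξ ^ σ) : ℂ) * fourierL2 g ξ) (R : ℝ) :
    Op (cutSym σ R fun _ => 1) f = Op (cutSym σ R p) g := by
  apply eq_Op_of_ae (isSymbol_cutSym hp hσ R)
  filter_upwards [h, fourierL2_Op (isSymbol_cutSym (continuous_const (y := (1 : ℝ))) hσ R) f]
    with ξ h1 h2
  rw [h2, h1]
  unfold cutSym
  split_ifs <;> simp

lemma cut_integral {E F : Type*} [NormedAddCommGroup E] [NormedSpace ℝ E] [CompleteSpace E]
    [NormedAddCommGroup F] [NormedSpace ℝ F] [CompleteSpace F]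
    (P : E →L[ℝ] F) {f : ℝ → E} {g : ℝ → F} (hf : Continuous f) {t : ℝ} (ht : 0 ≤ t)
    (h : ∀ s, 0 ≤ s → P (f s) = g s) :
    P (∫ s in (0 : ℝ)..t, f s) = ∫ s in (0 : ℝ)..t, g s := by
  rw [← P.intervalIntegral_comp_comm (hf.intervalIntegrable _ _)]
  refine intervalIntegral.integral_congr fun s hs => h s ?_
  rw [uIcc_of_le ht] at hs
  exact hs.1

lemma cut_stress (P : RealL2 n →L[ℝ] RealL2 n) {w₀ : RealL2 n} {W Y : ℝ → RealL2 n}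
    (hW : Continuous W) (h : ∀ s, 0 ≤ s → P (W s) = Y s) {t : ℝ} (ht : 0 ≤ t) :
    P (stress τ δ w₀ W t) = stress τ δ (P w₀) Y t := by
  refine cut_integral P (by have := continuous_position (w₀ := w₀) hW; fun_prop) ht fun s hs => ?_
  rw [map_add, map_smul, position, map_add, cut_integral P hW hs h, h s hs]
  rfl

/-- The solution formula solves the twice integrated equation. -/
lemma solvesVolterra_mild (hτ : 0 < τ) (hδ : 0 < δ) (hσ : 0 < σ) (w₀ W₀ G₀ : RealL2 n)
    {N : ℝ → RealL2 n} (hN : Continuous N) :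
    SolvesVolterra τ δ σ κ w₀ W₀ G₀ (mild τ δ σ κ (w₀ + τ • W₀) G₀ W₀ N) N := by
  intro t ht
  have hWc : Continuous (mild τ δ σ κ (w₀ + τ • W₀) G₀ W₀ N) := continuous_mild hτ hδ σ κ _ _ _ hN
  apply ae_of_forall_cut hσ (fun q => -q ^ 2) (by fun_prop)
  intro R
  set P : RealL2 n →L[ℝ] RealL2 n := Op (cutSym σ R fun _ => 1) with hP
  set Q : RealL2 n →L[ℝ] RealL2 n := Op (cutSym σ R fun q => -q ^ 2) with hQ
  set y₀ : Fin 3 → RealL2 n := ![w₀ + τ • W₀, G₀, W₀] with hy₀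
  set y := cutSol τ δ σ κ R y₀ N with hy
  have hPW : ∀ s, 0 ≤ s → P (mild τ δ σ κ (w₀ + τ • W₀) G₀ W₀ N s) = y 2 s := fun s hs =>
    cut_mild hτ hδ hσ R y₀ hN hs
  have hyc : Continuous (y 2) := continuous_iff_continuousAt.mpr fun s =>
    (hasDerivAt_cutSol_two hσ R y₀ hN s).continuousAt
  have hPN : Continuous fun s => P (N s) := P.continuous.comp hN
  -- The first component is `w + τW`: both sides have derivative `G + κN`.
  have h0 : ∀ s, y 0 s = position (P w₀) (y 2) s + τ • y 2 s := by
    refine eq_of_hasDerivAt_eq (hasDerivAt_cutSol_zero hσ R y₀ hN) (fun s => ?_) ?_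
    · refine (((hasDerivAt_primitive hyc s).const_add _).add
        ((hasDerivAt_cutSol_two hσ R y₀ hN s).const_smul τ)).congr_deriv ?_
      rw [smul_smul, mul_one_div_cancel hτ.ne', one_smul]
      abel
    · simp [hy, cutSol_zero, position, hy₀, hP]
  -- The second component integrates `-𝒜(X + δW)`, and `X + δW = w + (δ + τ)W` is the integrand of
  -- `stress`.
  have h1 : ∀ s, y 1 s = P G₀ + Q (stress τ δ (P w₀) (y 2) s) := by
    refine eq_of_hasDerivAt_eq (hasDerivAt_cutSol_one hσ R y₀ hN) (fun s => ?_) ?_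
    · have hc : Continuous fun s => position (P w₀) (y 2) s + (δ + τ) • y 2 s := by
        have := continuous_position (w₀ := P w₀) hyc
        fun_prop
      refine ((Q.hasFDerivAt.comp_hasDerivAt s (hasDerivAt_primitive hc s)).const_add _).congr_deriv
        ?_
      rw [← hy, h0 s]
      congr 1
      module
    · simp [hy, cutSol_zero, stress, hy₀, hP]
  -- Integrating `τW' = G - W + κN`, with the formula for `G` inserted, gives the truncated Volterra
  -- equation.
  have h2 : ∀ s, τ • y 2 s = τ • P W₀ + s • P G₀ - (∫ r in (0 : ℝ)..s, y 2 r)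
      + κ • (∫ r in (0 : ℝ)..s, P (N r)) + Q (∫ r in (0 : ℝ)..s, stress τ δ (P w₀) (y 2) r) := by
    refine eq_of_hasDerivAt_eq
      (fun s => (hasDerivAt_cutSol_two hσ R y₀ hN s).const_smul τ) (fun s => ?_) ?_
    · refine ((((((hasDerivAt_id s).smul_const (P G₀)).const_add (τ • P W₀)).sub
        (hasDerivAt_primitive hyc s)).add ((hasDerivAt_primitive hPN s).const_smul κ)).add
        (Q.hasFDerivAt.comp_hasDerivAt s
          (hasDerivAt_primitive (continuous_stress hyc) s))).congr_deriv ?_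
      rw [smul_smul, mul_one_div_cancel hτ.ne', one_smul, ← hy, h1 s]
      module
    · simp [hy, cutSol_zero, hy₀, hP]
  have hQP : ∀ u, Q (P u) = Q u := fun u => by
    rw [hQ, hP, Op_cutSym_mul (by fun_prop) continuous_const hσ]; simp
  rw [map_sub, map_add, map_sub, map_smul, map_smul, map_smul, map_sub, hPW t ht,
    cut_integral P hWc ht hPW, cut_integral P hN ht (fun s _ => rfl), smul_sub, h2 t,
    ← hQP (∫ s in (0 : ℝ)..t, stress τ δ w₀ (mild τ δ σ κ (w₀ + τ • W₀) G₀ W₀ N) s),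
    cut_integral P (continuous_stress hWc) ht (fun s hs => cut_stress P hWc hPW hs)]
  abel

/-- A continuous nonnegative function bounded by a multiple of its primitive vanishes. -/
lemma eq_zero_of_le_mul_integral {f : ℝ → ℝ} (hf : Continuous f) (h0 : ∀ t, 0 ≤ f t) {T C : ℝ}
    (hC : 0 ≤ C) (h : ∀ t, 0 ≤ t → t ≤ T → f t ≤ C * ∫ s in (0 : ℝ)..t, f s) {t : ℝ} (ht : 0 ≤ t)
    (htT : t ≤ T) : f t = 0 := by
  have hd : ∀ s, HasDerivAt (fun s => Real.exp (-C * s) * ∫ r in (0 : ℝ)..s, f r)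
      (Real.exp (-C * s) * (f s - C * ∫ r in (0 : ℝ)..s, f r)) s := by
    intro s
    have h1 : HasDerivAt (fun s => Real.exp (-C * s)) (Real.exp (-C * s) * -C) s := by
      simpa using ((hasDerivAt_id s).const_mul (-C)).exp
    exact (h1.mul (hasDerivAt_primitive hf s)).congr_deriv (by ring)
  have hanti : AntitoneOn (fun s => Real.exp (-C * s) * ∫ r in (0 : ℝ)..s, f r) (Icc 0 T) := by
    apply antitoneOn_of_deriv_nonpos (convex_Icc 0 T)
    · exact fun s _ => (hd s).continuousAt.continuousWithinAt
    · exact fun s _ => (hd s).differentiableAt.differentiableWithinAt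
    · intro s hs
      rw [interior_Icc] at hs
      rw [(hd s).deriv]
      exact mul_nonpos_of_nonneg_of_nonpos (Real.exp_pos _).le
        (by linarith [h s hs.1.le hs.2.le])
  have h1 := hanti ⟨le_rfl, ht.trans htT⟩ ⟨ht, htT⟩ ht
  simp only [intervalIntegral.integral_same, mul_zero] at h1
  have h2 : ∫ s in (0 : ℝ)..t, f s ≤ 0 := by
    by_contra! h3
    exact absurd h1 (not_le.mpr (mul_pos (Real.exp_pos _) h3))
  have h3 := h t ht htT
  exact le_antisymm (h3.trans (mul_nonpos_of_nonneg_of_nonpos hC h2)) (h0 t)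

lemma norm_integral_le_mul_of_le {E : Type*} [NormedAddCommGroup E] [NormedSpace ℝ E] {g : ℝ → E}
    {M t : ℝ} (ht : 0 ≤ t) (h : ∀ s, 0 ≤ s → s ≤ t → ‖g s‖ ≤ M) :
    ‖∫ s in (0 : ℝ)..t, g s‖ ≤ M * t := by
  have := intervalIntegral.norm_integral_le_of_norm_le_const (a := 0) (b := t) (f := g) (C := M)
    (fun s hs => by
      rw [uIoc_of_le ht] at hs
      exact h s hs.1.le hs.2)
  rwa [sub_zero, abs_of_nonneg ht] at this

/-- Every inner time integral is bounded by the largest one, so the iterated integrals reduce to a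
single `∫₀ᵗ ‖Y‖` times powers of `t`, in the form Gronwall requires. -/
lemma norm_integral_stress_le {Y : ℝ → RealL2 n} (hY : Continuous Y) {t : ℝ} (hc : 0 ≤ δ + τ)
    (ht : 0 ≤ t) :
    ‖∫ s in (0 : ℝ)..t, stress τ δ 0 Y s‖ ≤ (t * t + (δ + τ) * t) * ∫ s in (0 : ℝ)..t, ‖Y s‖ := by
  have hmono : ∀ s, 0 ≤ s → s ≤ t → ∫ r in (0 : ℝ)..s, ‖Y r‖ ≤ ∫ r in (0 : ℝ)..t, ‖Y r‖ :=
    fun s hs hst => intervalIntegral.integral_mono_interval le_rfl hs hst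
      (ae_of_all _ fun _ => norm_nonneg _) (hY.norm.intervalIntegrable _ _)
  have hF : 0 ≤ ∫ r in (0 : ℝ)..t, ‖Y r‖ :=
    intervalIntegral.integral_nonneg ht fun _ _ => norm_nonneg _
  have hprim : ∀ s, 0 ≤ s → s ≤ t → ‖∫ r in (0 : ℝ)..s, Y r‖ ≤ ∫ r in (0 : ℝ)..t, ‖Y r‖ :=
    fun s hs hst => (intervalIntegral.norm_integral_le_integral_norm hs).trans (hmono s hs hst)
  have hs1 : ∀ s, 0 ≤ s → s ≤ t → ‖stress τ δ 0 Y s‖ ≤ (t + (δ + τ)) * ∫ r in (0 : ℝ)..t, ‖Y r‖ := by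
    intro s hs hst
    unfold stress
    have hc1 : Continuous (position 0 Y) := continuous_position hY
    rw [intervalIntegral.integral_add (hc1.intervalIntegrable _ _)
      ((by fun_prop : Continuous fun s => (δ + τ) • Y s).intervalIntegrable _ _), intervalIntegral.integral_smul]
    refine (norm_add_le _ _).trans ?_
    have a1 := norm_integral_le_mul_of_le (g := position 0 Y) hs
      fun r hr hrs => by simpa [position] using hprim r hr (hrs.trans hst)
    have a2 : ‖(δ + τ) • ∫ r in (0 : ℝ)..s, Y r‖ ≤ (δ + τ) * ∫ r in (0 : ℝ)..t, ‖Y r‖ := by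
      rw [norm_smul, Real.norm_eq_abs, abs_of_nonneg hc]
      exact mul_le_mul_of_nonneg_left (hprim s hs hst) hc
    have a3 : (∫ r in (0 : ℝ)..t, ‖Y r‖) * s ≤ (∫ r in (0 : ℝ)..t, ‖Y r‖) * t :=
      mul_le_mul_of_nonneg_left hst hF
    linarith
  refine (norm_integral_le_mul_of_le ht hs1).trans (le_of_eq (by ring))

lemma stress_sub {w₀ : RealL2 n} {W W' : ℝ → RealL2 n} (hW : Continuous W) (hW' : Continuous W')
    (t : ℝ) : stress τ δ w₀ W t - stress τ δ w₀ W' t = stress τ δ 0 (fun s => W s - W' s) t := by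
  unfold stress
  have h1 : Continuous fun s => position w₀ W s + (δ + τ) • W s := by
    have := continuous_position (w₀ := w₀) hW; fun_prop
  have h2 : Continuous fun s => position w₀ W' s + (δ + τ) • W' s := by
    have := continuous_position (w₀ := w₀) hW'; fun_prop
  rw [← intervalIntegral.integral_sub (h1.intervalIntegrable _ _) (h2.intervalIntegrable _ _)]
  congr 1
  ext1 s
  unfold position
  rw [intervalIntegral.integral_sub (hW.intervalIntegrable _ _) (hW'.intervalIntegrable _ _)]
  module

/-- The twice integrated equation has at most one continuous solution. -/
lemma SolvesVolterra.unique (hτ : 0 < τ) (hδ : 0 < δ) (hσ : 0 < σ) {w₀ W₀ G₀ : RealL2 n}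
    {N W W' : ℝ → RealL2 n} (hW : Continuous W) (hW' : Continuous W')
    (h : SolvesVolterra τ δ σ κ w₀ W₀ G₀ W N) (h' : SolvesVolterra τ δ σ κ w₀ W₀ G₀ W' N)
    {t : ℝ} (ht : 0 ≤ t) : W t = W' t := by
  have hD : Continuous fun s => W s - W' s := hW.sub hW'
  -- Below frequency `R` the operator `𝒜` becomes the bounded operator `Q`, so the difference of the
  -- solutions satisfies a linear Gronwall inequality.
  have hcut : ∀ R : ℝ, Op (cutSym σ R fun _ => 1) (W t - W' t) = 0 := by
    intro R
    set P : RealL2 n →L[ℝ] RealL2 n := Op (cutSym σ R fun _ => 1) with hP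
    set Q : RealL2 n →L[ℝ] RealL2 n := Op (cutSym σ R fun q => -q ^ 2) with hQ
    have hQP : ∀ u, Q (P u) = Q u := fun u => by
      rw [hQ, hP, Op_cutSym_mul (by fun_prop) continuous_const hσ]; simp
    set d : ℝ → RealL2 n := fun s => P (W s - W' s) with hd
    have hdc : Continuous d := P.continuous.comp hD
    have key : ∀ s, 0 ≤ s → τ • d s = Q (∫ r in (0 : ℝ)..s, stress τ δ 0 d r)
        - ∫ r in (0 : ℝ)..s, d r := by
      intro s hs
      have e1 := Op_cutSym_of_ae hσ (p := fun q => -q ^ 2) (by fun_prop) (h s hs) R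
      have e2 := Op_cutSym_of_ae hσ (p := fun q => -q ^ 2) (by fun_prop) (h' s hs) R
      have e3 := congrArg₂ (· - ·) e1 e2
      simp only [← hP, ← hQ] at e3
      rw [← map_sub, ← map_sub, ← intervalIntegral.integral_sub
        ((continuous_stress hW).intervalIntegrable _ _)
        ((continuous_stress hW').intervalIntegrable _ _), ← hQP] at e3
      simp_rw [stress_sub hW hW'] at e3
      rw [cut_integral P (continuous_stress hD) hs
        (fun r hr => cut_stress P hD (Y := d) (fun _ _ => rfl) hr), map_zero] at e3
      rw [← e3]
      have e4 : (τ • (W s - W₀) - s • G₀ + (∫ r in (0 : ℝ)..s, W r) - κ • ∫ r in (0 : ℝ)..s, N r)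
          - (τ • (W' s - W₀) - s • G₀ + (∫ r in (0 : ℝ)..s, W' r) - κ • ∫ r in (0 : ℝ)..s, N r)
          = τ • (W s - W' s) + ∫ r in (0 : ℝ)..s, (W r - W' r) := by
        rw [intervalIntegral.integral_sub (hW.intervalIntegrable _ _)
          (hW'.intervalIntegrable _ _)]
        module
      rw [e4, map_add, map_smul, cut_integral P hD hs (fun _ _ => rfl)]
      simp [hd]
    have hc : 0 ≤ δ + τ := by positivity
    have hz := eq_zero_of_le_mul_integral (f := fun s => ‖d s‖) (T := t)
      (C := (‖Q‖ * (t * t + (δ + τ) * t) + 1) / τ) hdc.norm (fun _ => norm_nonneg _)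
      (by positivity) (fun s hs hst => ?_) ht le_rfl
    · exact norm_eq_zero.mp hz
    · have hF : 0 ≤ ∫ r in (0 : ℝ)..s, ‖d r‖ :=
        intervalIntegral.integral_nonneg hs fun _ _ => norm_nonneg _
      have b1 : ‖τ • d s‖ ≤ ‖Q‖ * ((t * t + (δ + τ) * t) * ∫ r in (0 : ℝ)..s, ‖d r‖)
          + ∫ r in (0 : ℝ)..s, ‖d r‖ := by
        rw [key s hs]
        refine (norm_sub_le _ _).trans (add_le_add ((Q.le_opNorm _).trans ?_)
          (intervalIntegral.norm_integral_le_integral_norm hs))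
        refine mul_le_mul_of_nonneg_left ?_ (norm_nonneg _)
        refine (norm_integral_stress_le hdc hc hs).trans ?_
        gcongr
      rw [norm_smul, Real.norm_eq_abs, abs_of_pos hτ] at b1
      rw [div_mul_eq_mul_div, le_div_iff₀ hτ]
      linarith
  have := ae_of_forall_cut hσ (f := W t - W' t) (g := 0) (fun _ => 0) continuous_const
    (fun R => by rw [hcut R]; simp)
  rw [← sub_eq_zero]
  apply ext_fourierL2
  filter_upwards [this, fourierL2_smul_ae 0 (0 : RealL2 n)] with ξ h1 h2
  rw [zero_smul] at h2
  rw [h1, h2]; simp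

end VolterraEquation

/-! ### Equivalence of the weak formulation and the twice integrated equation. -/

section WeakForm

variable {n : ℕ} {τ δ σ κ : ℝ}

lemma freq_rpow_two_mul (σ : ℝ) (ξ : Sp n) : (freq ξ : ℝ) ^ (2 * σ) = (freq ξ ^ σ) ^ 2 := by
  rw [mul_comm, Real.rpow_mul (freq_nonneg ξ)]; norm_cast

lemma rpow_le_one_add_pow {x a : ℝ} (hx : 0 ≤ x) (ha : 0 ≤ a) : x ^ a ≤ 1 + x ^ ⌈a⌉₊ := by
  rcases le_total x 1 with h | h
  · have := Real.rpow_le_one hx h ha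
    have : 0 ≤ x ^ ⌈a⌉₊ := by positivity
    linarith
  · have h1 : x ^ a ≤ x ^ (⌈a⌉₊ : ℝ) := Real.rpow_le_rpow_of_exponent_le h (Nat.le_ceil a)
    rw [Real.rpow_natCast] at h1
    linarith

/-- `|ξ|^{2σ} 𝓕 φ` for a Schwartz function `φ`. -/
def fracSymbol (σ : ℝ) (φ : 𝓢(Sp n, ℂ)) : Sp n → ℂ :=
  fun ξ => (((freq ξ ^ σ) ^ 2 : ℝ) : ℂ) * 𝓕 φ ξ

lemma fracLaplacian_eq (σ : ℝ) (φ : 𝓢(Sp n, ℂ)) : fracLaplacian σ φ = 𝓕⁻ (fracSymbol σ φ) := by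
  unfold fracLaplacian fracSymbol
  congr 1
  ext ξ
  rw [← freq_rpow_two_mul]
  rfl

lemma continuous_freq_rpow (hσ : 0 < σ) : Continuous fun ξ : Sp n => freq ξ ^ σ :=
  continuous_freq.rpow_const fun _ => Or.inr hσ.le

lemma continuous_fracSymbol (hσ : 0 < σ) (φ : 𝓢(Sp n, ℂ)) : Continuous (fracSymbol σ φ) := by
  unfold fracSymbol
  exact (Complex.continuous_ofReal.comp ((continuous_freq_rpow hσ).pow 2)).mul (𝓕 φ).continuous

/-- The symbol `|ξ|^(2σ)` need not be smooth at the origin, so `𝒜φ` need not be a Schwartz function.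
Polynomial growth of the symbol suffices to place the transform of `𝒜φ` in `L¹ ∩ L²`, where
Parseval's formula applies. -/
lemma norm_fracSymbol_le (hσ : 0 < σ) (φ : 𝓢(Sp n, ℂ)) (ξ : Sp n) :
    ‖fracSymbol σ φ ξ‖ ≤ ‖ξ‖ ^ 0 * ‖𝓕 φ ξ‖ +
      (2 * Real.pi) ^ ⌈2 * σ⌉₊ * (‖ξ‖ ^ ⌈2 * σ⌉₊ * ‖𝓕 φ ξ‖) := by
  unfold fracSymbol
  rw [norm_mul, Complex.norm_real, Real.norm_eq_abs, abs_of_nonneg (by positivity),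
    ← freq_rpow_two_mul]
  have h := rpow_le_one_add_pow (freq_nonneg ξ) (show 0 ≤ 2 * σ by positivity)
  have h1 := mul_le_mul_of_nonneg_right h (norm_nonneg (𝓕 φ ξ))
  refine h1.trans (le_of_eq ?_)
  rw [freq, mul_pow]; ring

lemma integrable_fracSymbol (hσ : 0 < σ) (φ : 𝓢(Sp n, ℂ)) : Integrable (fracSymbol σ φ) :=
  Integrable.mono' (((𝓕 φ).integrable_pow_mul volume 0).add
    (((𝓕 φ).integrable_pow_mul volume ⌈2 * σ⌉₊).const_mul _))
    (continuous_fracSymbol hσ φ).aestronglyMeasurable (ae_of_all _ (norm_fracSymbol_le hσ φ))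

lemma memLp_fracSymbol (hσ : 0 < σ) (φ : 𝓢(Sp n, ℂ)) : MemLp (fracSymbol σ φ) 2 volume := by
  rw [memLp_two_iff_integrable_sq_norm (continuous_fracSymbol hσ φ).aestronglyMeasurable]
  obtain ⟨C₁, hC₁, h1⟩ := (𝓕 φ).decay 0 0
  obtain ⟨C₂, hC₂, h2⟩ := (𝓕 φ).decay ⌈2 * σ⌉₊ 0
  simp only [norm_iteratedFDeriv_zero] at h1 h2
  have hb : ∀ ξ, ‖fracSymbol σ φ ξ‖ ≤ C₁ + (2 * Real.pi) ^ ⌈2 * σ⌉₊ * C₂ := fun ξ =>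
    (norm_fracSymbol_le hσ φ ξ).trans (add_le_add (h1 ξ)
      (mul_le_mul_of_nonneg_left (h2 ξ) (by positivity)))
  refine Integrable.mono' ((integrable_fracSymbol hσ φ).norm.const_mul
    (C₁ + (2 * Real.pi) ^ ⌈2 * σ⌉₊ * C₂))
    ((continuous_fracSymbol hσ φ).norm.pow 2).aestronglyMeasurable (ae_of_all _ fun ξ => ?_)
  rw [norm_pow, norm_norm, pow_two]
  exact mul_le_mul_of_nonneg_right (hb ξ) (norm_nonneg _)

/-- The real-linear functional `f ↦ ⟪𝓕 f, ψ⟫`. -/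
def testCLM (ψ : Lp (α := Sp n) ℂ 2 volume) : RealL2 n →L[ℝ] ℂ :=
  LinearMap.mkContinuous
    { toFun := fun f => inner ℂ (fourierL2 f) ψ
      map_add' := fun f g => by rw [fourierL2_add, inner_add_left]
      map_smul' := fun c f => by
        rw [fourierL2_smul, inner_smul_left_eq_star_smul]
        simp }
    ‖ψ‖ (fun f => by
      rw [mul_comm ‖ψ‖, ← norm_fourierL2 f]
      exact norm_inner_le_norm (𝕜 := ℂ) (fourierL2 f) ψ)

lemma testCLM_apply (ψ : Lp (α := Sp n) ℂ 2 volume) (f : RealL2 n) :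
    testCLM ψ f = inner ℂ (fourierL2 f) ψ := rfl

lemma pairing_schwartz_eq (f : RealL2 n) (φ : 𝓢(Sp n, ℂ)) :
    pairing f φ = testCLM ((𝓕 φ).toLp 2) f := pairing_eq_inner f φ

lemma pairing_fracLaplacian_eq (hσ : 0 < σ) (f : RealL2 n) (φ : 𝓢(Sp n, ℂ)) :
    pairing f (fracLaplacian σ φ) = testCLM ((memLp_fracSymbol hσ φ).toLp _) f := by
  rw [fracLaplacian_eq]
  exact pairing_fourierInv_eq_inner f _ (integrable_fracSymbol hσ φ) (memLp_fracSymbol hσ φ)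

lemma testCLM_fracSymbol (hσ : 0 < σ) (f : RealL2 n) (φ : 𝓢(Sp n, ℂ)) :
    testCLM ((memLp_fracSymbol hσ φ).toLp _) f
      = ∫ ξ, 𝓕 φ ξ * (starRingEnd ℂ) ((((freq ξ ^ σ) ^ 2 : ℝ) : ℂ) * fourierL2 f ξ) := by
  rw [testCLM_apply, L2.inner_def]
  apply integral_congr_ae
  filter_upwards [(memLp_fracSymbol hσ φ).coeFn_toLp] with ξ h
  rw [h, fracSymbol]
  simp only [RCLike.inner_apply, map_mul, Complex.conj_ofReal]
  ring

lemma testCLM_schwartz (f : RealL2 n) (φ : 𝓢(Sp n, ℂ)) :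
    testCLM ((𝓕 φ).toLp 2) f = ∫ ξ, 𝓕 φ ξ * (starRingEnd ℂ) (fourierL2 f ξ) :=
  inner_L2_schwartz _ _

/-- The relation `𝓕 f = -|ξ|^{2σ} 𝓕 g` in weak form. -/
lemma fourierL2_ae_eq_iff (hσ : 0 < σ) (f g : RealL2 n) :
    (fourierL2 f =ᵐ[volume] fun ξ => ((-(freq ξ ^ σ) ^ 2 : ℝ) : ℂ) * fourierL2 g ξ) ↔
      ∀ φ : 𝓢(Sp n, ℂ), testCLM ((𝓕 φ).toLp 2) f
        = -testCLM ((memLp_fracSymbol hσ φ).toLp _) g := by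
  have hneg : ∀ φ : 𝓢(Sp n, ℂ), -testCLM ((memLp_fracSymbol hσ φ).toLp _) g
      = ∫ ξ, 𝓕 φ ξ * (starRingEnd ℂ) (((-(freq ξ ^ σ) ^ 2 : ℝ) : ℂ) * fourierL2 g ξ) := by
    intro φ
    rw [testCLM_fracSymbol hσ, ← integral_neg]
    congr 1
    ext ξ
    push_cast
    simp
  constructor
  · intro h φ
    rw [hneg, testCLM_schwartz]
    apply integral_congr_ae
    filter_upwards [h] with ξ hξ
    rw [hξ]
  · intro h
    have hg : LocallyIntegrable (fun ξ : Sp n =>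
        ((-(freq ξ ^ σ) ^ 2 : ℝ) : ℂ) * fourierL2 g ξ) :=
      (locallyIntegrable_L2 (fourierL2 g)).continuous_mul
        (Complex.continuous_ofReal.comp ((continuous_freq_rpow hσ).pow 2).neg)
    have := ae_eq_of_integral_schwartz (locallyIntegrable_conj (locallyIntegrable_L2 (fourierL2 f)))
      (locallyIntegrable_conj hg) (fun φ => by
        -- Testing with an inverse transform makes an arbitrary Schwartz function appear on the
        -- Fourier side.
        have h1 := h (𝓕⁻ φ)
        rw [hneg, testCLM_schwartz] at h1
        simpa using h1)
    filter_upwards [this] with ξ hξ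
    exact (starRingEnd ℂ).injective hξ

lemma eqOn_Ici_of_hasDerivWithinAt {E : Type*} [NormedAddCommGroup E] [NormedSpace ℝ E]
    {f g f' : ℝ → E} (hf : ∀ t ∈ Ici (0 : ℝ), HasDerivWithinAt f (f' t) (Ici 0) t)
    (hg : ∀ t ∈ Ici (0 : ℝ), HasDerivWithinAt g (f' t) (Ici 0) t) (h0 : f 0 = g 0) {t : ℝ}
    (ht : 0 ≤ t) : f t = g t := by
  have h : ∀ t ∈ Ici (0 : ℝ), HasDerivWithinAt (fun t => f t - g t) 0 (Ici 0) t := fun t ht =>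
    ((hf t ht).sub (hg t ht)).congr_deriv (sub_self _)
  have := constant_of_has_deriv_right_zero (a := 0) (b := t) (f := fun t => f t - g t)
    (fun s hs => ((h s hs.1).continuousWithinAt).mono Icc_subset_Ici_self)
    (fun s hs => (h s hs.1).mono (Ici_subset_Ici.mpr hs.1)) t ⟨ht, le_rfl⟩
  simp only [h0, sub_self] at this
  exact sub_eq_zero.mp this

lemma testCLM_smul (ψ : Lp (α := Sp n) ℂ 2 volume) (c : ℝ) (f : RealL2 n) :
    testCLM ψ (c • f) = (c : ℂ) * testCLM ψ f := by
  rw [map_smul]; simp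

lemma pairing_congr {f : Sp n → ℝ} {g : RealL2 n} (h : f =ᵐ[volume] g) (φ : Sp n → ℂ) :
    pairing f φ = pairing g φ := by
  apply integral_congr_ae
  filter_upwards [h] with x hx
  rw [hx]

/-- Solutions of the twice integrated equation are weak solutions. -/
lemma SolvesVolterra.solvesMGT (hτ : 0 < τ) (hσ : 0 < σ) {w₀ W₀ w₂ : RealL2 n}
    {W N : ℝ → RealL2 n} {N' : ℝ → Sp n → ℝ} (hW : Continuous W) (hN : Continuous N)
    (hN' : ∀ t, 0 ≤ t → N' t =ᵐ[volume] N t) (hW₀ : W 0 = W₀)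
    (h : SolvesVolterra τ δ σ κ w₀ W₀ (τ • w₂ + W₀ - κ • N 0) W N) :
    SolvesMGT τ δ σ κ w₂ (position w₀ W) W N' := by
  intro φ
  set L := testCLM ((𝓕 φ).toLp 2) with hL
  set M := testCLM ((memLp_fracSymbol hσ φ).toLp _) with hM
  set G₀ := τ • w₂ + W₀ - κ • N 0 with hG₀
  have hτ' : (τ : ℂ) ≠ 0 := by exact_mod_cast hτ.ne'
  -- The tested Volterra equation solved for the velocity; its right side is visibly differentiable
  -- in `t`.
  have key : ∀ t, 0 ≤ t → L (W t) = L W₀ + (τ : ℂ)⁻¹ * (L (t • G₀ - (∫ s in (0 : ℝ)..t, W s)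
      + κ • ∫ s in (0 : ℝ)..t, N s) - M (∫ s in (0 : ℝ)..t, stress τ δ w₀ W s)) := by
    intro t ht
    have h1 := (fourierL2_ae_eq_iff hσ _ _).mp (h t ht) φ
    rw [← hL, ← hM] at h1
    have h2 : M (∫ s in (0 : ℝ)..t, stress τ δ w₀ W s) = -L (τ • (W t - W₀) - t • G₀
      + (∫ s in (0 : ℝ)..t, W s) - κ • ∫ s in (0 : ℝ)..t, N s) := by rw [h1]; ring
    rw [h2, sub_neg_eq_add, ← map_add]
    have e : t • G₀ - (∫ s in (0 : ℝ)..t, W s) + κ • (∫ s in (0 : ℝ)..t, N s)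
        + (τ • (W t - W₀) - t • G₀ + (∫ s in (0 : ℝ)..t, W s) - κ • ∫ s in (0 : ℝ)..t, N s)
        = τ • (W t - W₀) := by module
    rw [e, hL, testCLM_smul, ← mul_assoc, inv_mul_cancel₀ hτ', one_mul, map_sub]
    ring
  -- The derivative of the right side of `key`, hence the value of `⟨∂ₜ²w, φ⟩`.
  set p : ℝ → ℂ := fun t => (τ : ℂ)⁻¹ * (L (G₀ - W t + κ • N t) - M (stress τ δ w₀ W t)) with hp
  refine ⟨p, ?_, fun t ht => ⟨?_, ?_⟩⟩
  · have e : G₀ - W 0 + κ • N 0 = τ • w₂ := by rw [hG₀, hW₀]; module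
    have e2 : stress τ δ w₀ W 0 = 0 := by simp [stress]
    simp only [hp]
    rw [e, e2, map_zero, sub_zero, hL, testCLM_smul, ← mul_assoc, inv_mul_cancel₀ hτ', one_mul,
      pairing_schwartz_eq]
  · have hd : HasDerivAt (fun t => L W₀ + (τ : ℂ)⁻¹ * (L (t • G₀ - (∫ s in (0 : ℝ)..t, W s)
      + κ • ∫ s in (0 : ℝ)..t, N s) - M (∫ s in (0 : ℝ)..t, stress τ δ w₀ W s))) (p t) t := by
      refine (((L.hasFDerivAt.comp_hasDerivAt t ((((hasDerivAt_id t).smul_const G₀).sub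
        (hasDerivAt_primitive hW t)).add ((hasDerivAt_primitive hN t).const_smul κ))).sub
        (M.hasFDerivAt.comp_hasDerivAt t
          (hasDerivAt_primitive (continuous_stress hW) t))).const_mul _ |>.const_add _).congr_deriv ?_
      simp [hp]
    refine hd.hasDerivWithinAt.congr (fun s hs => ?_) ?_
    · rw [pairing_schwartz_eq]; exact key s hs
    · rw [pairing_schwartz_eq]; exact key t ht
  · have hc : Continuous fun s => position w₀ W s + (δ + τ) • W s := by
      have := continuous_position (w₀ := w₀) hW; fun_prop
    have hWd := (show HasDerivWithinAt (fun r => L (W r)) (p t) (Ici 0) t from by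
      have hd : HasDerivAt (fun t => L W₀ + (τ : ℂ)⁻¹ * (L (t • G₀ - (∫ s in (0 : ℝ)..t, W s)
        + κ • ∫ s in (0 : ℝ)..t, N s) - M (∫ s in (0 : ℝ)..t, stress τ δ w₀ W s))) (p t) t := by
        refine (((L.hasFDerivAt.comp_hasDerivAt t ((((hasDerivAt_id t).smul_const G₀).sub
          (hasDerivAt_primitive hW t)).add ((hasDerivAt_primitive hN t).const_smul κ))).sub
          (M.hasFDerivAt.comp_hasDerivAt t (hasDerivAt_primitive
            (continuous_stress hW) t))).const_mul _ |>.const_add _).congr_deriv ?_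
        simp [hp]
      exact hd.hasDerivWithinAt.congr (fun s hs => key s hs) (key t ht))
    have hMd : HasDerivAt (fun r => M (stress τ δ w₀ W r))
        (M (position w₀ W t + (δ + τ) • W t)) t :=
      M.hasFDerivAt.comp_hasDerivAt t (hasDerivAt_primitive hc t)
    -- The contribution of `N` cancels in `τp - κ⟨N, φ⟩`, so this combination is differentiable
    -- although `N` is only continuous.
    have heq : ∀ r ∈ Ici (0 : ℝ), (τ : ℂ) * p r - (κ : ℂ) * pairing (N' r) φ
        = L G₀ - L (W r) - M (stress τ δ w₀ W r) := by
      intro r hr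
      rw [pairing_congr (hN' r hr), pairing_schwartz_eq, ← hL]
      simp only [hp]
      rw [← mul_assoc, mul_inv_cancel₀ hτ', one_mul, map_add, map_sub, hL, testCLM_smul]
      ring
    refine (((hWd.const_sub (L G₀)).sub hMd.hasDerivWithinAt).congr heq (heq t ht)).congr_deriv ?_
    rw [map_add, hM, testCLM_smul, pairing_fracLaplacian_eq hσ, pairing_fracLaplacian_eq hσ]
    ring

/-- Weak solutions solve the twice integrated equation. -/
lemma solvesVolterra_of_solvesMGT (hσ : 0 < σ) {w₀ w₂ : RealL2 n} {w W N : ℝ → RealL2 n}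
    {N' : ℝ → Sp n → ℝ} (hW : Continuous W) (hN : Continuous N)
    (hN' : ∀ t, 0 ≤ t → N' t =ᵐ[volume] N t) (hw : ∀ t, 0 ≤ t → w t = position w₀ W t)
    {W' : ℝ → RealL2 n} (hWW' : ∀ t, 0 ≤ t → W' t = W t)
    (h : SolvesMGT τ δ σ κ w₂ w W' N') :
    SolvesVolterra τ δ σ κ w₀ (W 0) (τ • w₂ + W 0 - κ • N 0) W N := by
  intro t ht
  rw [fourierL2_ae_eq_iff hσ]
  intro φ
  obtain ⟨p, hp0, hp⟩ := h φ
  set L := testCLM ((𝓕 φ).toLp 2) with hL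
  set M := testCLM ((memLp_fracSymbol hσ φ).toLp _) with hM
  obtain ⟨G₀, hG₀⟩ : ∃ g, g = τ • w₂ + W 0 - κ • N 0 := ⟨_, rfl⟩
  rw [← hG₀]
  have hc : Continuous fun s => position w₀ W s + (δ + τ) • W s := by
    have := continuous_position (w₀ := w₀) hW; fun_prop
  have hWd : ∀ t ∈ Ici (0 : ℝ), HasDerivWithinAt (fun r => L (W r)) (p t) (Ici 0) t := by
    intro t ht
    have hWL : ∀ s ∈ Ici (0 : ℝ), L (W s) = pairing (W' s) φ := fun s hs => by
      rw [pairing_schwartz_eq, hWW' s hs]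
    exact (hp t ht).1.congr hWL (hWL t ht)
  -- First integration in time, of `τ⟨∂ₜ²w, φ⟩ - κ⟨N, φ⟩`, starting from the value that the initial
  -- data prescribe.
  have hpt : ∀ t, 0 ≤ t → (τ : ℂ) * p t = L (G₀ - W t + κ • N t) - M (stress τ δ w₀ W t) := by
    intro t ht
    have := eqOn_Ici_of_hasDerivWithinAt (fun t ht => (hp t ht).2)
      (g := fun t => L G₀ - L (W t) - M (stress τ δ w₀ W t)) (fun t ht => ?_) ?_ ht
    · rw [pairing_congr (hN' t ht), pairing_schwartz_eq, ← hL, sub_eq_iff_eq_add] at this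
      rw [this, map_add, map_sub, hL, testCLM_smul]
      ring
    · have hMd : HasDerivAt (fun r => M (stress τ δ w₀ W r))
          (M (position w₀ W t + (δ + τ) • W t)) t :=
        M.hasFDerivAt.comp_hasDerivAt t (hasDerivAt_primitive hc t)
      refine (((hWd t ht).const_sub (L G₀)).sub hMd.hasDerivWithinAt).congr_deriv ?_
      rw [map_add, hM, testCLM_smul, pairing_fracLaplacian_eq hσ, pairing_fracLaplacian_eq hσ,
        hw t ht, hWW' t ht]
      ring
    · rw [pairing_congr (hN' 0 le_rfl), pairing_schwartz_eq, ← hL, hp0, pairing_schwartz_eq,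
        ← hL]
      have e2 : stress τ δ w₀ W 0 = 0 := by simp [stress]
      rw [e2, map_zero, hG₀, map_sub, map_add, hL, testCLM_smul, testCLM_smul]
      ring
  -- Second integration, now of `τ⟨∂ₜ²w, φ⟩`.
  have hint := eqOn_Ici_of_hasDerivWithinAt (f := fun t => (τ : ℂ) * L (W t))
    (g := fun t => (τ : ℂ) * L (W 0) + (L (t • G₀ - (∫ s in (0 : ℝ)..t, W s)
      + κ • ∫ s in (0 : ℝ)..t, N s) - M (∫ s in (0 : ℝ)..t, stress τ δ w₀ W s)))
    (fun t ht => (hWd t ht).const_mul (τ : ℂ)) (fun t ht => ?_) ?_ ht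
  · have e : τ • (W t - W 0) - t • G₀ + (∫ s in (0 : ℝ)..t, W s) - κ • (∫ s in (0 : ℝ)..t, N s)
        = τ • (W t - W 0) - (t • G₀ - (∫ s in (0 : ℝ)..t, W s) + κ • ∫ s in (0 : ℝ)..t, N s) := by
      module
    rw [e, map_sub, hL, testCLM_smul, ← hL, map_sub, mul_sub, hint]
    ring
  · rw [hpt t ht]
    refine HasDerivAt.hasDerivWithinAt ?_
    refine ((L.hasFDerivAt.comp_hasDerivAt t ((((hasDerivAt_id t).smul_const G₀).sub
        (hasDerivAt_primitive hW t)).add ((hasDerivAt_primitive hN t).const_smul κ))).sub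
        (M.hasFDerivAt.comp_hasDerivAt t
          (hasDerivAt_primitive (continuous_stress hW) t)) |>.const_add _).congr_deriv ?_
    simp
  · simp

end WeakForm

/-! ### Dilations, Young's inequality, and products as convolutions on the Fourier side. -/

section ConvolutionEstimates

variable {n : ℕ}

lemma eLpNorm_two_comp_freq_div {F : ℝ → ℝ} (hF : Measurable F) {R : ℝ} (hR : 0 < R) :
    eLpNorm (fun ξ : Sp n => F (freq ξ / R)) 2 volume
      = ENNReal.ofReal (R ^ ((n : ℝ) / 2)) * eLpNorm (fun ξ : Sp n => F (freq ξ)) 2 volume := by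
  have e : (fun ξ : Sp n => F (freq ξ / R)) = (fun ξ => F (freq ξ)) ∘ (R⁻¹ • ·) := by
    funext ξ
    simp only [Function.comp, freq, norm_smul, Real.norm_eq_abs, abs_inv, abs_of_pos hR]
    congr 1
    field_simp
  have hm : Measurable fun ξ : Sp n => F (freq ξ) := hF.comp measurable_freq
  rw [e, ← eLpNorm_map_measure hm.aestronglyMeasurable (by fun_prop),
    Measure.map_addHaar_smul _ (inv_ne_zero hR.ne'),
    eLpNorm_smul_measure_of_ne_top (by norm_num), smul_eq_mul]
  congr 1
  rw [ENNReal.ofReal_rpow_of_nonneg (abs_nonneg _) (by norm_num)]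
  congr 1
  rw [finrank_euclideanSpace_fin, inv_pow, inv_inv, abs_of_nonneg (by positivity),
    ← Real.rpow_natCast, ← Real.rpow_mul hR.le]
  congr 1
  simp [div_eq_mul_inv]

/-- Young's inequality `L¹ * L² ⊆ L²`. -/
lemma eLpNorm_lintegral_mul_sub_le {F G : Sp n → ℝ≥0∞} (hF : Measurable F) (hG : Measurable G) :
    eLpNorm (fun ξ => ∫⁻ η, F η * G (ξ - η)) 2 volume ≤ (∫⁻ η, F η) * eLpNorm G 2 volume := by
  have h2 : (2 : ℝ≥0∞).toReal = 2 := by norm_num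
  -- Cauchy–Schwarz with respect to the measure `F dη`; integrating in `ξ` and exchanging the
  -- integrals then finishes the proof.
  have hCS : ∀ ξ, (∫⁻ η, F η * G (ξ - η)) ^ (2 : ℝ)
      ≤ (∫⁻ η, F η) * ∫⁻ η, F η * G (ξ - η) ^ (2 : ℝ) := by
    intro ξ
    have h := ENNReal.lintegral_mul_le_Lp_mul_Lq volume Real.HolderConjugate.two_two
      (f := fun η => F η ^ (1 / 2 : ℝ)) (g := fun η => F η ^ (1 / 2 : ℝ) * G (ξ - η))
      (by fun_prop) (by fun_prop)
    have e1 : ∀ η, F η ^ (1 / 2 : ℝ) * (F η ^ (1 / 2 : ℝ) * G (ξ - η)) = F η * G (ξ - η) := by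
      intro η
      rw [← mul_assoc, ← ENNReal.rpow_add_of_nonneg _ _ (by norm_num) (by norm_num)]
      norm_num
    have e2 : ∀ η, (F η ^ (1 / 2 : ℝ)) ^ (2 : ℝ) = F η := by
      intro η
      rw [← ENNReal.rpow_mul]; norm_num
    have e3 : ∀ η, (F η ^ (1 / 2 : ℝ) * G (ξ - η)) ^ (2 : ℝ) = F η * G (ξ - η) ^ (2 : ℝ) := by
      intro η
      rw [ENNReal.mul_rpow_of_nonneg _ _ (by norm_num), e2]
    simp only [Pi.mul_apply, e1, e2, e3] at h
    calc _ ≤ ((∫⁻ η, F η) ^ (1 / 2 : ℝ) * (∫⁻ η, F η * G (ξ - η) ^ (2 : ℝ)) ^ (1 / 2 : ℝ))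
          ^ (2 : ℝ) := ENNReal.rpow_le_rpow h (by norm_num)
      _ = _ := by
        rw [ENNReal.mul_rpow_of_nonneg _ _ (by norm_num), ← ENNReal.rpow_mul, ← ENNReal.rpow_mul]
        norm_num
  have hsq : ∫⁻ ξ, (∫⁻ η, F η * G (ξ - η)) ^ (2 : ℝ)
      ≤ (∫⁻ η, F η) ^ (2 : ℝ) * ∫⁻ ξ, G ξ ^ (2 : ℝ) := by
    calc _ ≤ ∫⁻ ξ, (∫⁻ η, F η) * ∫⁻ η, F η * G (ξ - η) ^ (2 : ℝ) := lintegral_mono hCS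
      _ = (∫⁻ η, F η) * ∫⁻ ξ, ∫⁻ η, F η * G (ξ - η) ^ (2 : ℝ) :=
        lintegral_const_mul _ (by fun_prop)
      _ = (∫⁻ η, F η) * ∫⁻ η, ∫⁻ ξ, F η * G (ξ - η) ^ (2 : ℝ) := by
        rw [lintegral_lintegral_swap (by fun_prop)]
      _ = (∫⁻ η, F η) * ∫⁻ η, F η * ∫⁻ ξ, G ξ ^ (2 : ℝ) := by
        congr 1
        apply lintegral_congr
        intro η
        rw [lintegral_const_mul _ (by fun_prop)]
        congr 1
        exact lintegral_sub_right_eq_self (fun ξ => G ξ ^ (2 : ℝ)) η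
      _ = _ := by
        rw [lintegral_mul_const _ hF, ← mul_assoc]
        congr 1
        rw [ENNReal.rpow_two, sq]
  rw [eLpNorm_eq_lintegral_rpow_enorm_toReal (by norm_num) (by norm_num),
    eLpNorm_eq_lintegral_rpow_enorm_toReal (by norm_num) (by norm_num), h2]
  simp only [enorm_eq_self]
  calc _ ≤ ((∫⁻ η, F η) ^ (2 : ℝ) * ∫⁻ ξ, G ξ ^ (2 : ℝ)) ^ (1 / 2 : ℝ) :=
        ENNReal.rpow_le_rpow hsq (by norm_num)
    _ = _ := by
      rw [ENNReal.mul_rpow_of_nonneg _ _ (by norm_num), ← ENNReal.rpow_mul]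
      norm_num

lemma eLpNorm_lintegral_mul_sub_le' {F G : Sp n → ℝ≥0∞} (hF : Measurable F) (hG : Measurable G) :
    eLpNorm (fun ξ => ∫⁻ η, F η * G (ξ - η)) 2 volume ≤ eLpNorm F 2 volume * ∫⁻ η, G η := by
  have e : (fun ξ => ∫⁻ η, F η * G (ξ - η)) = fun ξ => ∫⁻ η, G η * F (ξ - η) := by
    funext ξ
    rw [← lintegral_sub_left_eq_self _ ξ]
    simp [mul_comm]
  rw [e, mul_comm]
  exact eLpNorm_lintegral_mul_sub_le hG hF

open scoped Convolution in
/-- The product of functions with integrable Fourier transforms. -/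
lemma exists_mul_of_integrable_fourierL2 (U V : RealL2 n) (hU : Integrable (fourierL2 U))
    (hV : Integrable (fourierL2 V)) : ∃ p : RealL2 n, (p =ᵐ[volume] fun x => U x * V x) ∧
      ∀ᵐ ξ, ‖fourierL2 p ξ‖ₑ ≤ ∫⁻ η, ‖fourierL2 U η‖ₑ * ‖fourierL2 V (ξ - η)‖ₑ := by
  set a : Sp n → ℂ := ⇑(fourierL2 U) with ha
  set b : Sp n → ℂ := ⇑(fourierL2 V) with hb
  set c : Sp n → ℂ := a ⋆[ContinuousLinearMap.mul ℂ ℂ] b with hc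
  have hcb : ∀ ξ, ‖c ξ‖ₑ ≤ ∫⁻ η, ‖a η‖ₑ * ‖b (ξ - η)‖ₑ := by
    intro ξ
    rw [hc, convolution_def]
    refine (enorm_integral_le_lintegral_enorm _).trans (le_of_eq ?_)
    simp [enorm_mul]
  have hci : Integrable c := hU.integrable_convolution _ hV
  have ham : Measurable a := (Lp.stronglyMeasurable _).measurable
  have hbm : Measurable b := (Lp.stronglyMeasurable _).measurable
  -- Young's inequality places the convolution in `L²` as well as in `L¹`, so its two inverse
  -- transforms can be identified.
  have hc2 : MemLp c 2 volume := by
    refine ⟨hci.aestronglyMeasurable, ?_⟩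
    refine lt_of_le_of_lt (eLpNorm_mono_enorm (g := fun ξ => ∫⁻ η, ‖a η‖ₑ * ‖b (ξ - η)‖ₑ)
      (fun ξ => by simpa using hcb ξ)) ?_
    refine (eLpNorm_lintegral_mul_sub_le ham.enorm hbm.enorm).trans_lt ?_
    refine ENNReal.mul_lt_top hU.2 ?_
    rw [eLpNorm_enorm]
    exact (Lp.memLp (fourierL2 V)).2
  have hinv : ∀ f : RealL2 n, Integrable (fourierL2 f) →
      complexify f =ᵐ[volume] 𝓕⁻ (fourierL2 f : Sp n → ℂ) := by
    intro f hf
    have h := fourierInv_ae_eq_of_integrable (fourierL2 f) hf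
    have e : (𝓕⁻ (fourierL2 f) : Lp (α := Sp n) ℂ 2 volume) = complexify f := by
      simp [fourierL2, complexify]
    rwa [e] at h
  have hcl : Integrable (hc2.toLp c : Sp n → ℂ) := hci.congr hc2.coeFn_toLp.symm
  -- The inverse transform turns the convolution into the product of the two real functions; this
  -- also shows that the product lies in `L²`.
  have hF : (𝓕⁻ (hc2.toLp c) : Lp (α := Sp n) ℂ 2 volume)
      =ᵐ[volume] fun x => ((U x * V x : ℝ) : ℂ) := by
    filter_upwards [fourierInv_ae_eq_of_integrable _ hcl, hinv U hU, hinv V hV,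
      complexify_coeFn U, complexify_coeFn V] with x h1 h2 h3 h4 h5
    have e : 𝓕⁻ (hc2.toLp c : Sp n → ℂ) x = 𝓕⁻ c x := by
      rw [Real.fourierInv_eq, Real.fourierInv_eq]
      apply integral_congr_ae
      filter_upwards [hc2.coeFn_toLp] with y hy
      rw [hy]
    rw [h1, e, Complex.ofReal_mul, ← h4, ← h5, h2, h3, Real.fourierInv_eq_fourier_neg,
      Real.fourierInv_eq_fourier_neg, Real.fourierInv_eq_fourier_neg, hc]
    exact Real.fourier_mul_convolution_eq hU hV _
  have hmem : MemLp (fun x => U x * V x) 2 volume := by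
    have h1 := (Lp.memLp (𝓕⁻ (hc2.toLp c) : Lp (α := Sp n) ℂ 2 volume)).ae_eq hF
    simpa using h1.re
  refine ⟨hmem.toLp _, hmem.coeFn_toLp, ?_⟩
  have e : fourierL2 (hmem.toLp _) = hc2.toLp c := by
    have : complexify (hmem.toLp _) = (𝓕⁻ (hc2.toLp c) : Lp (α := Sp n) ℂ 2 volume) := by
      apply Lp.ext
      filter_upwards [complexify_coeFn (hmem.toLp _), hmem.coeFn_toLp, hF] with x h1 h2 h3
      rw [h1, h2, h3]
    change 𝓕 (complexify (hmem.toLp _)) = _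
    rw [this]; simp
  rw [e]
  filter_upwards [hc2.coeFn_toLp] with ξ h
  rw [h]; exact hcb ξ

end ConvolutionEstimates

/-! ### The weights `1 + (|ξ|/R)^r` and their dependence on the scale `R`. -/

section Weights

variable {n : ℕ}

/-- The weight `1 + (x / R)^r` of the norm of `H^r`, rescaled to the frequency scale `R`. -/
def wt (r R x : ℝ) : ℝ := 1 + (x / R) ^ r

lemma measurable_wt (r R : ℝ) : Measurable (wt r R) := by unfold wt; fun_prop

lemma one_le_wt {r R x : ℝ} (hR : 0 < R) (hx : 0 ≤ x) : 1 ≤ wt r R x := by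
  unfold wt
  have : 0 ≤ (x / R) ^ r := by positivity
  linarith

lemma wt_pos {r R x : ℝ} (hR : 0 < R) (hx : 0 ≤ x) : 0 < wt r R x :=
  one_pos.trans_le (one_le_wt hR hx)

lemma wt_div (r R x : ℝ) : wt r 1 (x / R) = wt r R x := by simp [wt]

lemma wt_anti {r R R' x : ℝ} (hr : 0 ≤ r) (hR : 0 < R) (h : R ≤ R') (hx : 0 ≤ x) :
    wt r R' x ≤ wt r R x := by
  unfold wt
  have := hR.trans_le h
  gcongr

lemma wt_le_rpow_mul_wt_one {r R x : ℝ} (hr : 0 ≤ r) (hR : 0 < R) (h : R ≤ 1) (hx : 0 ≤ x) :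
    wt r R x ≤ R ^ (-r) * wt r 1 x := by
  unfold wt
  rw [div_one, Real.div_rpow hx hR.le, Real.rpow_neg hR.le, mul_add, mul_one, div_eq_inv_mul]
  have : 1 ≤ (R ^ r)⁻¹ := (one_le_inv₀ (by positivity)).mpr (Real.rpow_le_one hR.le h hr)
  linarith

lemma add_rpow_le_two_rpow_mul {r a b : ℝ} (hr : 0 ≤ r) (ha : 0 ≤ a) (hb : 0 ≤ b) :
    (a + b) ^ r ≤ 2 ^ r * (a ^ r + b ^ r) := by
  have h1 : a + b ≤ 2 * max a b := by linarith [le_max_left a b, le_max_right a b]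
  have h2 : (max a b) ^ r ≤ a ^ r + b ^ r := by
    have := Real.rpow_nonneg ha r
    have := Real.rpow_nonneg hb r
    rcases max_choice a b with h | h <;> rw [h] <;> linarith
  calc (a + b) ^ r ≤ (2 * max a b) ^ r := by gcongr
    _ = 2 ^ r * (max a b) ^ r := Real.mul_rpow (by norm_num) (le_max_of_le_left ha)
    _ ≤ _ := by gcongr

/-- Used with the triangle inequality for `ξ = η + (ξ - η)`, to distribute the weight over the two
factors of a convolution. -/
lemma wt_le_of_le_add {r R x y z : ℝ} (hr : 0 ≤ r) (hR : 0 < R) (hx : 0 ≤ x) (hy : 0 ≤ y)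
    (hz : 0 ≤ z) (h : x ≤ y + z) : wt r R x ≤ 2 ^ r * (wt r R y + wt r R z) := by
  unfold wt
  have h1 : (x / R) ^ r ≤ 2 ^ r * ((y / R) ^ r + (z / R) ^ r) := by
    refine le_trans ?_ (add_rpow_le_two_rpow_mul hr (by positivity) (by positivity))
    rw [← add_div]; gcongr
  have h2 : (1 : ℝ) ≤ 2 ^ r := Real.one_le_rpow (by norm_num) hr
  nlinarith

lemma isSymbol_inv_wt (r : ℝ) {R : ℝ} (hR : 0 < R) : IsSymbol fun x => (wt r R x)⁻¹ := by
  refine .of_le (C := 1) (measurable_wt r R).inv fun x hx => ?_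
  rw [abs_inv, abs_of_pos (wt_pos hR hx)]
  exact inv_le_one_of_one_le₀ (one_le_wt hR hx)

lemma abs_wt_div_le {r R x : ℝ} (hr : 0 ≤ r) (hR : 0 < R) (h : R ≤ 1) (hx : 0 ≤ x) :
    |wt r R x / wt r 1 x| ≤ R ^ (-r) := by
  rw [abs_of_pos (div_pos (wt_pos hR hx) (wt_pos one_pos hx)), div_le_iff₀ (wt_pos one_pos hx)]
  exact wt_le_rpow_mul_wt_one hr hR h hx

lemma isSymbol_wt_div {r R : ℝ} (hr : 0 ≤ r) (hR : 0 < R) (h : R ≤ 1) :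
    IsSymbol fun x => wt r R x / wt r 1 x :=
  .of_le ((measurable_wt r R).div (measurable_wt r 1)) fun _ hx => abs_wt_div_le hr hR h hx

lemma memLp_inv_wt {r : ℝ} (hr : (n : ℝ) / 2 < r) :
    MemLp (fun ξ : Sp n => (wt r 1 (freq ξ))⁻¹) 2 volume := by
  have hr0 : 0 < r := lt_of_le_of_lt (by positivity) hr
  have hm : Measurable fun ξ : Sp n => (wt r 1 (freq ξ))⁻¹ :=
    ((measurable_wt r 1).comp measurable_freq).inv
  rw [memLp_two_iff_integrable_sq hm.aestronglyMeasurable]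
  have hi : Integrable (fun ξ : Sp n => (1 + ‖ξ‖) ^ (-(2 * r))) volume :=
    integrable_one_add_norm (by rw [finrank_euclideanSpace_fin]; linarith)
  refine (hi.const_mul ((2 ^ r) ^ 2)).mono' (hm.pow_const 2).aestronglyMeasurable
    (ae_of_all _ fun ξ => ?_)
  have h1 : (1 + ‖ξ‖) ^ r ≤ 2 ^ r * wt r 1 (freq ξ) := by
    have h2 : ‖ξ‖ ≤ freq ξ := by
      unfold freq
      have := Real.pi_gt_three
      nlinarith [norm_nonneg ξ]
    have h3 := add_rpow_le_two_rpow_mul hr0.le zero_le_one (freq_nonneg ξ)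
    unfold wt
    rw [div_one]
    rw [Real.one_rpow] at h3
    exact (Real.rpow_le_rpow (by positivity) (by linarith) hr0.le).trans h3
  have hp : 0 < (1 + ‖ξ‖) ^ r := by positivity
  have hw := wt_pos (r := r) one_pos (freq_nonneg ξ)
  have e : (1 + ‖ξ‖) ^ (-(2 * r)) = (((1 + ‖ξ‖) ^ r)⁻¹) ^ 2 := by
    rw [Real.rpow_neg (by positivity), inv_pow, ← Real.rpow_mul_natCast (by positivity)]
    congr 2; push_cast; ring
  rw [Real.norm_eq_abs, abs_of_nonneg (by positivity), e, ← mul_pow]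
  refine pow_le_pow_left₀ (by positivity) ?_ 2
  rw [← div_eq_mul_inv, inv_le_comm₀ hw (by positivity), inv_div, div_le_iff₀ (by positivity)]
  linarith

/-- The inverse weight at scale `R` is a dilation of the one at scale `1`, which is square
integrable because `r > n/2`; the Jacobian contributes `R^(n/2)`. -/
lemma exists_eLpNorm_inv_wt_le {r : ℝ} (hr : (n : ℝ) / 2 < r) : ∃ K : ℝ, 0 < K ∧ ∀ R : ℝ, 0 < R →
    eLpNorm (fun ξ : Sp n => (wt r R (freq ξ))⁻¹) 2 volume
      ≤ ENNReal.ofReal (K * R ^ ((n : ℝ) / 2)) := by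
  have hfin := (memLp_inv_wt hr).2
  refine ⟨(eLpNorm (fun ξ : Sp n => (wt r 1 (freq ξ))⁻¹) 2 volume).toReal + 1, by positivity,
    fun R hR => ?_⟩
  have h := eLpNorm_two_comp_freq_div (n := n) (F := fun x => (wt r 1 x)⁻¹)
    (measurable_wt r 1).inv hR
  simp only [wt_div] at h
  rw [h, mul_comm, ENNReal.ofReal_mul (by positivity)]
  gcongr
  rw [ENNReal.le_ofReal_iff_toReal_le hfin.ne (by positivity)]
  linarith

/-- A function whose weighted Fourier transform is square integrable can be differentiated. -/
lemma exists_Op_inv_wt_eq {r R : ℝ} (hR : 0 < R) (p : RealL2 n)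
    (h : eLpNorm (fun ξ => (wt r R (freq ξ) : ℂ) * fourierL2 p ξ) 2 volume < ∞) :
    ∃ z : RealL2 n, Op (fun x => (wt r R x)⁻¹) z = p ∧
      fourierL2 z =ᵐ[volume] fun ξ => (wt r R (freq ξ) : ℂ) * fourierL2 p ξ := by
  have hmem : MemLp (fun ξ => (wt r R (freq ξ) : ℂ) * fourierL2 p ξ) 2 volume :=
    ⟨((Complex.measurable_ofReal.comp
        ((measurable_wt r R).comp measurable_freq)).aestronglyMeasurable).mul
        (Lp.memLp (fourierL2 p)).aestronglyMeasurable, h⟩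
  obtain ⟨z, hz⟩ := exists_fourierL2_eq (hmem.toLp _) (by
    have h1 := hmem.coeFn_toLp
    have h2 := (Measure.measurePreserving_neg (volume : Measure (Sp n))).quasiMeasurePreserving.ae h1
    filter_upwards [h1, h2, fourierL2_neg p] with ξ h1 h2 h3
    rw [h2, h1, h3, freq_neg]; simp)
  have hz' : fourierL2 z =ᵐ[volume] fun ξ => (wt r R (freq ξ) : ℂ) * fourierL2 p ξ := by
    rw [hz]; exact hmem.coeFn_toLp
  refine ⟨z, (eq_Op_of_ae (isSymbol_inv_wt r hR) ?_).symm, hz'⟩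
  filter_upwards [hz'] with ξ h
  have : (wt r R (freq ξ) : ℂ) ≠ 0 := by exact_mod_cast (wt_pos hR (freq_nonneg ξ)).ne'
  rw [h]; push_cast; field_simp

lemma Op_inv_wt_injective (r : ℝ) {R : ℝ} (hR : 0 < R) :
    Function.Injective (Op (fun x => (wt r R x)⁻¹) : RealL2 n →L[ℝ] RealL2 n) := by
  intro f g h
  apply ext_fourierL2
  filter_upwards [fourierL2_Op (isSymbol_inv_wt r hR) f, fourierL2_Op (isSymbol_inv_wt r hR) g]
    with ξ h1 h2
  have : (wt r R (freq ξ) : ℂ) ≠ 0 := by exact_mod_cast (wt_pos hR (freq_nonneg ξ)).ne'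
  rw [h, h2] at h1
  push_cast at h1
  exact (mul_left_cancel₀ (inv_ne_zero this) h1).symm

/-- Scaled bounds of the `L¹` norm of the Fourier transform by weighted `L²` norms. -/
lemma exists_lintegral_fourierL2_le {r : ℝ} (hr : (n : ℝ) / 2 < r) : ∃ K : ℝ, 0 < K ∧
    ∀ (u : RealL2 n) (R : ℝ), 0 < R → R ≤ 1 →
      ∫⁻ ξ, ‖fourierL2 (Op (fun x => (wt r 1 x)⁻¹) u) ξ‖ₑ
        ≤ ENNReal.ofReal (K * R ^ ((n : ℝ) / 2) * ‖Op (fun x => wt r R x / wt r 1 x) u‖) := by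
  have hr0 : 0 < r := lt_of_le_of_lt (by positivity) hr
  obtain ⟨K, hK, H⟩ := exists_eLpNorm_inv_wt_le hr
  refine ⟨K, hK, fun u R hR hR1 => ?_⟩
  set g := Op (fun x => wt r R x / wt r 1 x) u with hg
  have e : fourierL2 (Op (fun x => (wt r 1 x)⁻¹) u) =ᵐ[volume]
      (fun ξ : Sp n => (wt r R (freq ξ))⁻¹) • (fourierL2 g : Sp n → ℂ) := by
    filter_upwards [fourierL2_Op (isSymbol_inv_wt r one_pos) u,
      fourierL2_Op (isSymbol_wt_div hr0.le hR hR1) u] with ξ h1 h2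
    have : (wt r R (freq ξ) : ℂ) ≠ 0 := by exact_mod_cast (wt_pos hR (freq_nonneg ξ)).ne'
    rw [h1, Pi.smul_apply', hg, h2, Complex.real_smul]
    push_cast; field_simp
  rw [← eLpNorm_one_eq_lintegral_enorm, eLpNorm_congr_ae e]
  refine (eLpNorm_smul_le_mul_eLpNorm (p := 2) (q := 2) (Lp.aestronglyMeasurable _)
    ((measurable_wt r R).comp measurable_freq).inv.aestronglyMeasurable).trans ?_
  rw [ENNReal.ofReal_mul (by positivity)]
  gcongr
  · exact H R hR
  · rw [← Lp.enorm_def, ← ofReal_norm, norm_fourierL2]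

lemma integrable_fourierL2_Op_inv_wt {r : ℝ} (hr : (n : ℝ) / 2 < r) (u : RealL2 n) :
    Integrable (fourierL2 (Op (fun x => (wt r 1 x)⁻¹) u)) := by
  obtain ⟨K, hK, H⟩ := exists_lintegral_fourierL2_le (n := n) hr
  exact ⟨(Lp.aestronglyMeasurable _), (H u 1 one_pos le_rfl).trans_lt ENNReal.ofReal_lt_top⟩

end Weights

/-! ### The product estimate at all scales simultaneously. -/

section SobolevProduct

variable {n : ℕ}

/-- Elements of `H^r` are written as `Op (wt r 1)⁻¹` of an `L²` function, and `Op (wt r R / wt r 1)`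
of that function measures the norm at scale `R`. The weight passes to one factor of the convolution,
and Young's inequality leaves the other factor with an integrable transform, whose `L¹` norm costs
`R^(n/2)`. Plain Cauchy–Schwarz in the convolution gives the pointwise bound. One `q` serves all
`R`, so the scale may later move with time. -/
lemma exists_weighted_mul {r : ℝ} (hr : (n : ℝ) / 2 < r) : ∃ C : ℝ, 0 < C ∧
    ∀ u v : RealL2 n, ∃ q : RealL2 n,
      (Op (fun x => (wt r 1 x)⁻¹) q =ᵐ[volume]
        fun x => Op (fun x => (wt r 1 x)⁻¹) u x * Op (fun x => (wt r 1 x)⁻¹) v x) ∧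
      (∀ R, 0 < R → R ≤ 1 → ‖Op (fun x => wt r R x / wt r 1 x) q‖ ≤ C * R ^ ((n : ℝ) / 2) *
        ‖Op (fun x => wt r R x / wt r 1 x) u‖ * ‖Op (fun x => wt r R x / wt r 1 x) v‖) ∧
      ∀ᵐ ξ, ‖fourierL2 (Op (fun x => (wt r 1 x)⁻¹) q) ξ‖ ≤
        ‖Op (fun x => (wt r 1 x)⁻¹) u‖ * ‖Op (fun x => (wt r 1 x)⁻¹) v‖ := by
  have hr0 : 0 ≤ r := (lt_of_le_of_lt (by positivity) hr).le
  obtain ⟨K, hK, H⟩ := exists_lintegral_fourierL2_le (n := n) hr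
  refine ⟨2 ^ r * (2 * K), by positivity, fun u v => ?_⟩
  set U := Op (fun x => (wt r 1 x)⁻¹) u with hU
  set V := Op (fun x => (wt r 1 x)⁻¹) v with hV
  obtain ⟨p, hp, hpF⟩ := exists_mul_of_integrable_fourierL2 U V
    (integrable_fourierL2_Op_inv_wt hr u) (integrable_fourierL2_Op_inv_wt hr v)
  have hUm : Measurable fun ξ => ‖fourierL2 U ξ‖ₑ := (Lp.stronglyMeasurable _).measurable.enorm
  have hVm : Measurable fun ξ => ‖fourierL2 V ξ‖ₑ := (Lp.stronglyMeasurable _).measurable.enorm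
  have hwm : ∀ R, Measurable fun ξ : Sp n => ENNReal.ofReal (wt r R (freq ξ)) := fun R =>
    ((measurable_wt r R).comp measurable_freq).ennreal_ofReal
  have hw : ∀ R, 0 < R → ∀ (f : RealL2 n) ξ, ‖(wt r R (freq ξ) : ℂ) * fourierL2 f ξ‖ₑ
      = ENNReal.ofReal (wt r R (freq ξ)) * ‖fourierL2 f ξ‖ₑ := by
    intro R hR f ξ
    rw [enorm_mul, ← ofReal_norm (wt r R (freq ξ) : ℂ), Complex.norm_real, Real.norm_eq_abs,
      abs_of_pos (wt_pos hR (freq_nonneg ξ))]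
  have hratio : ∀ R, 0 < R → R ≤ 1 → ∀ (f g : RealL2 n), g = Op (fun x => (wt r 1 x)⁻¹) f →
      eLpNorm (fun ξ => ENNReal.ofReal (wt r R (freq ξ)) * ‖fourierL2 g ξ‖ₑ) 2 volume
        = ENNReal.ofReal ‖Op (fun x => wt r R x / wt r 1 x) f‖ := by
    rintro R hR hR1 f g rfl
    rw [ofReal_norm, enorm_Op (isSymbol_wt_div hr0 hR hR1)]
    apply eLpNorm_congr_enorm_ae
    filter_upwards [fourierL2_Op (isSymbol_inv_wt r one_pos) f] with ξ h
    rw [enorm_eq_self, ← hw R hR, h, ← mul_assoc]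
    congr 2
    push_cast; ring
  have key : ∀ R, 0 < R → R ≤ 1 →
      eLpNorm (fun ξ => (wt r R (freq ξ) : ℂ) * fourierL2 p ξ) 2 volume
        ≤ ENNReal.ofReal (2 ^ r * (2 * K) * R ^ ((n : ℝ) / 2) *
          ‖Op (fun x => wt r R x / wt r 1 x) u‖ * ‖Op (fun x => wt r R x / wt r 1 x) v‖) := by
    intro R hR hR1
    set F : Sp n → ℝ≥0∞ := fun ξ => ENNReal.ofReal (wt r R (freq ξ)) * ‖fourierL2 U ξ‖ₑ with hF
    set G : Sp n → ℝ≥0∞ := fun ξ => ENNReal.ofReal (wt r R (freq ξ)) * ‖fourierL2 V ξ‖ₑ with hG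
    have hFm : Measurable F := (hwm R).mul hUm
    have hGm : Measurable G := (hwm R).mul hVm
    have hpt : ∀ᵐ ξ, ‖(wt r R (freq ξ) : ℂ) * fourierL2 p ξ‖ₑ ≤ ‖ENNReal.ofReal (2 ^ r) *
        ((∫⁻ η, F η * ‖fourierL2 V (ξ - η)‖ₑ) + ∫⁻ η, ‖fourierL2 U η‖ₑ * G (ξ - η))‖ₑ := by
      filter_upwards [hpF] with ξ h
      rw [hw R hR, enorm_eq_self]
      calc _ ≤ ENNReal.ofReal (wt r R (freq ξ)) *
            ∫⁻ η, ‖fourierL2 U η‖ₑ * ‖fourierL2 V (ξ - η)‖ₑ := by gcongr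
        _ = ∫⁻ η, ENNReal.ofReal (wt r R (freq ξ)) *
            (‖fourierL2 U η‖ₑ * ‖fourierL2 V (ξ - η)‖ₑ) :=
          (lintegral_const_mul _ (by fun_prop)).symm
        _ ≤ ∫⁻ η, ENNReal.ofReal (2 ^ r) * (F η * ‖fourierL2 V (ξ - η)‖ₑ
              + ‖fourierL2 U η‖ₑ * G (ξ - η)) := by
          apply lintegral_mono
          intro η
          have h1 : ENNReal.ofReal (wt r R (freq ξ)) ≤ ENNReal.ofReal (2 ^ r) *
              (ENNReal.ofReal (wt r R (freq η)) + ENNReal.ofReal (wt r R (freq (ξ - η)))) := by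
            rw [← ENNReal.ofReal_add (wt_pos hR (freq_nonneg _)).le (wt_pos hR (freq_nonneg _)).le,
              ← ENNReal.ofReal_mul (by positivity)]
            apply ENNReal.ofReal_le_ofReal
            refine wt_le_of_le_add hr0 hR (freq_nonneg _) (freq_nonneg _) (freq_nonneg _) ?_
            unfold freq
            rw [← mul_add]
            have := norm_add_le η (ξ - η)
            rw [add_sub_cancel] at this
            gcongr
          calc _ ≤ (ENNReal.ofReal (2 ^ r) *
              (ENNReal.ofReal (wt r R (freq η)) + ENNReal.ofReal (wt r R (freq (ξ - η)))))
                * (‖fourierL2 U η‖ₑ * ‖fourierL2 V (ξ - η)‖ₑ) := mul_le_mul' h1 le_rfl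
            _ = _ := by simp only [hF, hG]; ring
        _ = _ := by
          rw [lintegral_const_mul _ (by fun_prop), lintegral_add_left (by fun_prop)]
    refine (eLpNorm_mono_enorm_ae hpt).trans ?_
    have hA : Measurable fun ξ => ∫⁻ η, F η * ‖fourierL2 V (ξ - η)‖ₑ :=
      Measurable.lintegral_prod_right' (f := fun z : Sp n × Sp n =>
        F z.2 * ‖fourierL2 V (z.1 - z.2)‖ₑ) (by fun_prop)
    have hB : Measurable fun ξ => ∫⁻ η, ‖fourierL2 U η‖ₑ * G (ξ - η) :=
      Measurable.lintegral_prod_right' (f := fun z : Sp n × Sp n =>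
        ‖fourierL2 U z.2‖ₑ * G (z.1 - z.2)) (by fun_prop)
    -- The two placements of the weight call for the two forms of Young's inequality.
    have h1 := eLpNorm_lintegral_mul_sub_le' hFm hVm
    have h2 := eLpNorm_lintegral_mul_sub_le hUm hGm
    have h3 : eLpNorm (fun ξ => ENNReal.ofReal (2 ^ r) *
        ((∫⁻ η, F η * ‖fourierL2 V (ξ - η)‖ₑ) + ∫⁻ η, ‖fourierL2 U η‖ₑ * G (ξ - η))) 2 volume
        ≤ ENNReal.ofReal (2 ^ r) *
          (eLpNorm (fun ξ => ∫⁻ η, F η * ‖fourierL2 V (ξ - η)‖ₑ) 2 volume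
            + eLpNorm (fun ξ => ∫⁻ η, ‖fourierL2 U η‖ₑ * G (ξ - η)) 2 volume) := by
      refine (eLpNorm_le_nnreal_smul_eLpNorm_of_ae_le_mul' (c := Real.toNNReal (2 ^ r))
        (g := (fun ξ => ∫⁻ η, F η * ‖fourierL2 V (ξ - η)‖ₑ) +
          fun ξ => ∫⁻ η, ‖fourierL2 U η‖ₑ * G (ξ - η)) (ae_of_all _ fun ξ => ?_) 2).trans ?_
      · simp [ENNReal.ofReal]
      · rw [ENNReal.smul_def, smul_eq_mul]
        exact mul_le_mul_right (eLpNorm_add_le hA.aestronglyMeasurable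
          hB.aestronglyMeasurable (by norm_num)) _
    refine h3.trans ?_
    have hu := H u R hR hR1
    have hv := H v R hR hR1
    rw [hratio R hR hR1 u U hU] at h1
    rw [hratio R hR hR1 v V hV] at h2
    calc _ ≤ ENNReal.ofReal (2 ^ r) * (ENNReal.ofReal ‖Op (fun x => wt r R x / wt r 1 x) u‖ *
            ENNReal.ofReal (K * R ^ ((n : ℝ) / 2) * ‖Op (fun x => wt r R x / wt r 1 x) v‖) +
            ENNReal.ofReal (K * R ^ ((n : ℝ) / 2) * ‖Op (fun x => wt r R x / wt r 1 x) u‖) *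
            ENNReal.ofReal ‖Op (fun x => wt r R x / wt r 1 x) v‖) := by
          gcongr
          · exact h1.trans (by gcongr)
          · exact h2.trans (by gcongr)
      _ = _ := by
          rw [← ENNReal.ofReal_mul (by positivity), ← ENNReal.ofReal_mul (by positivity),
            ← ENNReal.ofReal_add (by positivity) (by positivity),
            ← ENNReal.ofReal_mul (by positivity)]
          congr 1; ring
  obtain ⟨q, hq, hqF⟩ := exists_Op_inv_wt_eq one_pos p
    ((key 1 one_pos le_rfl).trans_lt ENNReal.ofReal_lt_top)
  refine ⟨q, by rw [hq]; exact hp, fun R hR hR1 => ?_, ?_⟩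
  · have h1 := hratio R hR hR1 q p hq.symm
    have h2 : eLpNorm (fun ξ => ENNReal.ofReal (wt r R (freq ξ)) * ‖fourierL2 p ξ‖ₑ) 2 volume
        = eLpNorm (fun ξ => (wt r R (freq ξ) : ℂ) * fourierL2 p ξ) 2 volume :=
      eLpNorm_congr_enorm_ae (ae_of_all _ fun ξ => by rw [enorm_eq_self, hw R hR])
    have h3 := key R hR hR1
    rw [← h2, h1] at h3
    exact (ENNReal.ofReal_le_ofReal_iff (by positivity)).mp h3
  · rw [hq]
    filter_upwards [hpF] with ξ h
    have h1 : ∫⁻ η, ‖fourierL2 U η‖ₑ * ‖fourierL2 V (ξ - η)‖ₑ ≤ ENNReal.ofReal (‖U‖ * ‖V‖) := by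
      refine (ENNReal.lintegral_mul_le_Lp_mul_Lq volume Real.HolderConjugate.two_two
        (f := fun η => ‖fourierL2 U η‖ₑ) (g := fun η => ‖fourierL2 V (ξ - η)‖ₑ)
        (by fun_prop) (by fun_prop)).trans ?_
      rw [lintegral_sub_left_eq_self (fun η => ‖fourierL2 V η‖ₑ ^ (2 : ℝ)) ξ,
        ENNReal.ofReal_mul (norm_nonneg _), ← norm_fourierL2 U, ← norm_fourierL2 V, ofReal_norm,
        ofReal_norm, Lp.enorm_def, Lp.enorm_def,
        eLpNorm_eq_lintegral_rpow_enorm_toReal (by norm_num) (by norm_num),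
        eLpNorm_eq_lintegral_rpow_enorm_toReal (by norm_num) (by norm_num)]
      simp
    have h2 := h.trans h1
    rw [← ofReal_norm] at h2
    exact (ENNReal.ofReal_le_ofReal_iff (by positivity)).mp h2

/-- The product `H^r × H^r → H^r` for `r > n / 2`, as a bounded bilinear map on `L²`. -/
lemma exists_sobolevMul {r : ℝ} (hr : (n : ℝ) / 2 < r) :
    ∃ Q : RealL2 n →L[ℝ] RealL2 n →L[ℝ] RealL2 n, ∃ C : ℝ, 0 < C ∧ ∀ u v : RealL2 n,
      (Op (fun x => (wt r 1 x)⁻¹) (Q u v) =ᵐ[volume]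
        fun x => Op (fun x => (wt r 1 x)⁻¹) u x * Op (fun x => (wt r 1 x)⁻¹) v x) ∧
      (∀ R, 0 < R → R ≤ 1 → ‖Op (fun x => wt r R x / wt r 1 x) (Q u v)‖ ≤ C * R ^ ((n : ℝ) / 2) *
        ‖Op (fun x => wt r R x / wt r 1 x) u‖ * ‖Op (fun x => wt r R x / wt r 1 x) v‖) ∧
      ∀ᵐ ξ, ‖fourierL2 (Op (fun x => (wt r 1 x)⁻¹) (Q u v)) ξ‖ ≤
        ‖Op (fun x => (wt r 1 x)⁻¹) u‖ * ‖Op (fun x => (wt r 1 x)⁻¹) v‖ := by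
  obtain ⟨C, hC, H⟩ := exists_weighted_mul (n := n) hr
  choose q hq1 hq2 hq3 using H
  -- The lift of a product is determined by the product, so bilinearity is inherited from pointwise
  -- multiplication.
  have hinj : ∀ f g : RealL2 n, (Op (fun x => (wt r 1 x)⁻¹) f : Sp n → ℝ) =ᵐ[volume]
      Op (fun x => (wt r 1 x)⁻¹) g → f = g := fun f g h =>
    Op_inv_wt_injective r one_pos (Lp.ext h)
  have e1 : (Op (fun x => wt r 1 x / wt r 1 x) : RealL2 n →L[ℝ] RealL2 n)
      = ContinuousLinearMap.id ℝ _ := by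
    rw [Op_congr (isSymbol_wt_div (lt_of_le_of_lt (by positivity) hr).le one_pos le_rfl)
      (IsSymbol.const 1) (fun x hx => div_self (wt_pos one_pos hx).ne'), Op_one]
  refine ⟨LinearMap.mkContinuous₂ (LinearMap.mk₂ ℝ q ?_ ?_ ?_ ?_) C ?_, C, hC,
    fun u v => ⟨hq1 u v, hq2 u v, hq3 u v⟩⟩
  · intro u u' v
    apply hinj
    rw [map_add]
    filter_upwards [hq1 (u + u') v, hq1 u v, hq1 u' v, Lp.coeFn_add
      (Op (fun x => (wt r 1 x)⁻¹) (q u v)) (Op (fun x => (wt r 1 x)⁻¹) (q u' v)),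
      Lp.coeFn_add (Op (fun x => (wt r 1 x)⁻¹) u) (Op (fun x => (wt r 1 x)⁻¹) u')]
      with x h1 h2 h3 h4 h5
    rw [h1, h4, Pi.add_apply, h2, h3, map_add, h5, Pi.add_apply]; ring
  · intro c u v
    apply hinj
    rw [map_smul]
    filter_upwards [hq1 (c • u) v, hq1 u v, Lp.coeFn_smul c
      (Op (fun x => (wt r 1 x)⁻¹) (q u v)), Lp.coeFn_smul c (Op (fun x => (wt r 1 x)⁻¹) u)]
      with x h1 h2 h3 h4
    rw [h1, h3, Pi.smul_apply, h2, map_smul, h4, Pi.smul_apply]; simp [mul_assoc]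
  · intro u v v'
    apply hinj
    rw [map_add]
    filter_upwards [hq1 u (v + v'), hq1 u v, hq1 u v', Lp.coeFn_add
      (Op (fun x => (wt r 1 x)⁻¹) (q u v)) (Op (fun x => (wt r 1 x)⁻¹) (q u v')),
      Lp.coeFn_add (Op (fun x => (wt r 1 x)⁻¹) v) (Op (fun x => (wt r 1 x)⁻¹) v')]
      with x h1 h2 h3 h4 h5
    rw [h1, h4, Pi.add_apply, h2, h3, map_add, h5, Pi.add_apply]; ring
  · intro c u v
    apply hinj
    rw [map_smul]
    filter_upwards [hq1 u (c • v), hq1 u v, Lp.coeFn_smul c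
      (Op (fun x => (wt r 1 x)⁻¹) (q u v)), Lp.coeFn_smul c (Op (fun x => (wt r 1 x)⁻¹) v)]
      with x h1 h2 h3 h4
    rw [h1, h3, Pi.smul_apply, h2, map_smul, h4, Pi.smul_apply]; simp; ring
  · intro u v
    have h := hq2 u v 1 one_pos le_rfl
    rw [e1] at h
    simpa using h

end SobolevProduct

/-! ### Low-frequency bounds for functions in `L^m` and for products. -/

section LowFrequencyEstimates

variable {n : ℕ}

lemma norm_Op_inv_wt_le {r R : ℝ} (hR : 0 < R) (f : RealL2 n) :
    ‖Op (fun x => (wt r R x)⁻¹) f‖ ≤ ‖f‖ := by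
  have h := norm_Op_le (n := n) (C := 1) (measurable_wt r R).inv (fun x hx => by
    rw [Pi.inv_apply, abs_inv, abs_of_pos (wt_pos hR hx)]
    exact inv_le_one_of_one_le₀ (one_le_wt hR hx)) f
  rw [one_mul] at h
  exact h

/-- The inverse weight is a soft low-pass filter at scale `R` whose `L²` norm is of order `R^(n/2)`;
a bounded Fourier transform stands in for membership in `L¹`. -/
lemma exists_norm_Op_inv_wt_le_of_bounded {r : ℝ} (hr : (n : ℝ) / 2 < r) : ∃ K : ℝ, 0 < K ∧
    ∀ (f : RealL2 n) (b : ℝ), 0 ≤ b → (∀ᵐ ξ, ‖fourierL2 f ξ‖ ≤ b) → ∀ R, 0 < R →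
      ‖Op (fun x => (wt r R x)⁻¹) f‖ ≤ K * R ^ ((n : ℝ) / 2) * b := by
  obtain ⟨K, hK, H⟩ := exists_eLpNorm_inv_wt_le (n := n) hr
  refine ⟨K, hK, fun f b hb hf R hR => ?_⟩
  have h1 : ‖Op (fun x => (wt r R x)⁻¹) f‖ₑ ≤ ENNReal.ofReal b *
      eLpNorm (fun ξ : Sp n => (wt r R (freq ξ))⁻¹) 2 volume := by
    rw [enorm_Op (isSymbol_inv_wt r hR)]
    refine eLpNorm_le_mul_eLpNorm_of_ae_le_mul ?_ 2
    filter_upwards [hf] with ξ h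
    rw [norm_mul, Complex.norm_real, mul_comm]
    gcongr
  have h2 := h1.trans (mul_le_mul' le_rfl (H R hR))
  rw [← ENNReal.ofReal_mul hb, ← ofReal_norm, ENNReal.ofReal_le_ofReal_iff (by positivity)] at h2
  linarith

lemma le_rpow_mul_rpow {x a b l : ℝ} (hx : 0 ≤ x) (hl0 : 0 ≤ l) (hl1 : l ≤ 1) (ha : x ≤ a)
    (hb : x ≤ b) : x ≤ a ^ l * b ^ (1 - l) := by
  rcases hx.eq_or_lt with rfl | hx
  · positivity
  calc x = x ^ l * x ^ (1 - l) := by rw [← Real.rpow_add hx]; simp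
    _ ≤ a ^ l * b ^ (1 - l) := by
      have := Real.rpow_le_rpow hx.le ha hl0
      have := Real.rpow_le_rpow hx.le hb (sub_nonneg.mpr hl1)
      have := Real.rpow_nonneg (hx.le.trans ha) l
      gcongr

/-- The estimate of low frequencies by interpolation between bounded and square integrable
Fourier transforms. -/
lemma exists_norm_Op_inv_wt_le_interpolate {r : ℝ} (hr : (n : ℝ) / 2 < r) : ∃ K : ℝ, 0 < K ∧
    ∀ m : ℝ, 1 ≤ m → m < 2 → ∀ (f : RealL2 n) (b c : ℝ), 0 ≤ b → ‖f‖ ≤ c →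
      (∀ᵐ ξ, ‖fourierL2 f ξ‖ ≤ b) → ∀ R, 0 < R →
      ‖Op (fun x => (wt r R x)⁻¹) f‖ ≤
        K * R ^ ((n : ℝ) * (1 / m - 1 / 2)) * (b ^ (2 / m - 1) * c ^ (2 - 2 / m)) := by
  obtain ⟨K, hK, H⟩ := exists_norm_Op_inv_wt_le_of_bounded (n := n) hr
  refine ⟨max K 1, by positivity, fun m hm1 hm2 f b c hb hc hf R hR => ?_⟩
  have hm : 0 < m := by linarith
  have hl0 : 0 ≤ 2 / m - 1 := by rw [sub_nonneg, le_div_iff₀ hm]; linarith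
  have hl1 : 2 / m - 1 ≤ 1 := by
    have : 2 / m ≤ 2 := div_le_self (by norm_num) hm1
    linarith
  have h := le_rpow_mul_rpow (norm_nonneg _) hl0 hl1 (H f b hb hf R hR)
    ((norm_Op_inv_wt_le (r := r) hR f).trans hc)
  rw [show 1 - (2 / m - 1) = 2 - 2 / m by ring] at h
  refine h.trans ?_
  have hK1 : K ^ (2 / m - 1) ≤ max K 1 := by
    calc K ^ (2 / m - 1) ≤ (max K 1) ^ (2 / m - 1) := by gcongr; exact le_max_left _ _
      _ ≤ (max K 1) ^ (1 : ℝ) := Real.rpow_le_rpow_of_exponent_le (le_max_right _ _) hl1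
      _ = _ := Real.rpow_one _
  rw [Real.mul_rpow (by positivity) hb, Real.mul_rpow hK.le (by positivity), ← Real.rpow_mul hR.le,
    show (n : ℝ) / 2 * (2 / m - 1) = n * (1 / m - 1 / 2) by ring, mul_assoc]
  have hc0 : 0 ≤ c := (norm_nonneg _).trans hc
  gcongr

lemma norm_sq_eq_integral_sq (f : RealL2 n) : ‖f‖ ^ 2 = ∫ x, ‖f x‖ ^ 2 := by
  rw [← @inner_self_eq_norm_sq ℝ, L2.inner_def]
  simp

/-- The estimate of low frequencies of `L^m` functions. -/
lemma exists_norm_Op_inv_wt_le_lebesgue {r : ℝ} (hr : (n : ℝ) / 2 < r) : ∃ K : ℝ, 0 < K ∧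
    ∀ m : ℝ, 1 ≤ m → m < 2 → ∀ (f : RealL2 n) (M : ℝ), 0 ≤ M →
      lebesgueENorm m f ≤ ENNReal.ofReal M → ∀ R, 0 < R →
      ‖Op (fun x => (wt r R x)⁻¹) f‖ ≤ K * R ^ ((n : ℝ) * (1 / m - 1 / 2)) * M := by
  obtain ⟨K, hK, H⟩ := exists_norm_Op_inv_wt_le_of_bounded (n := n) hr
  refine ⟨K + 1, by positivity, fun m hm1 hm2 f M hM hf R hR => ?_⟩
  have hm : 0 < m := by linarith
  have hp0 : ENNReal.ofReal m ≠ 0 := by simpa using hm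
  have hmem : MemLp (f : Sp n → ℝ) (ENNReal.ofReal m) volume :=
    ⟨Lp.aestronglyMeasurable f, hf.trans_lt ENNReal.ofReal_lt_top⟩
  -- The case `M = 0` is separate because the truncation height below must be positive.
  rcases hM.eq_or_lt with rfl | hM
  · have h0 : f = 0 := by
      apply Lp.ext
      have : eLpNorm (f : Sp n → ℝ) (ENNReal.ofReal m) volume = 0 := by simpa [lebesgueENorm] using hf
      rw [eLpNorm_eq_zero_iff (Lp.aestronglyMeasurable f) hp0] at this
      exact this.trans (Lp.coeFn_zero ℝ 2 volume).symm
    simp [h0]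
  have hint : Integrable fun x => ‖f x‖ ^ m := by
    simpa [ENNReal.toReal_ofReal hm.le] using
      hmem.integrable_norm_rpow hp0 ENNReal.ofReal_ne_top
  have hintM : ∫ x, ‖f x‖ ^ m ≤ M ^ m := by
    have h1 := hmem.eLpNorm_eq_integral_rpow_norm hp0 ENNReal.ofReal_ne_top
    rw [ENNReal.toReal_ofReal hm.le] at h1
    rw [lebesgueENorm, h1, ENNReal.ofReal_le_ofReal_iff hM.le] at hf
    have h0 : 0 ≤ ∫ x, ‖f x‖ ^ m := integral_nonneg fun x => by positivity
    calc ∫ x, ‖f x‖ ^ m = ((∫ x, ‖f x‖ ^ m) ^ m⁻¹) ^ m := by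
          rw [← Real.rpow_mul h0, inv_mul_cancel₀ hm.ne', Real.rpow_one]
      _ ≤ M ^ m := by gcongr
  -- Truncation at height `lam` avoids interpolation theorems: the part above lies in `L¹` with norm
  -- at most `lam^(1-m) M^m`, the part below in `L²` with squared norm at most `lam^(2-m) M^m`. This
  -- height makes both contributions `R^(n(1/m-1/2)) M`, up to a constant.
  set lam : ℝ := M * R ^ ((n : ℝ) / m) with hlam
  have hlam0 : 0 < lam := by positivity
  set S : Set (Sp n) := {x | lam < ‖f x‖} with hS
  have hSm : MeasurableSet S :=
    measurableSet_lt measurable_const (Lp.stronglyMeasurable f).measurable.norm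
  have hm₁ : MemLp (S.indicator f) 2 volume := (Lp.memLp f).indicator hSm
  have hm₂ : MemLp (Sᶜ.indicator f) 2 volume := (Lp.memLp f).indicator hSm.compl
  set f₁ : RealL2 n := hm₁.toLp _ with hf₁
  set f₂ : RealL2 n := hm₂.toLp _ with hf₂
  have hsum : f = f₁ + f₂ := by
    apply Lp.ext
    filter_upwards [Lp.coeFn_add f₁ f₂, hm₁.coeFn_toLp, hm₂.coeFn_toLp] with x h1 h2 h3
    rw [h1, Pi.add_apply, h2, h3]
    exact (congrFun (Set.indicator_self_add_compl S f) x).symm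
  have hb₁ : ∀ᵐ x, ‖f₁ x‖ ≤ lam ^ (1 - m) * ‖f x‖ ^ m := by
    filter_upwards [hm₁.coeFn_toLp] with x h
    rw [h]
    by_cases hx : x ∈ S
    · rw [Set.indicator_of_mem hx]
      have hx' : lam < ‖f x‖ := hx
      have hfx : 0 < ‖f x‖ := hlam0.trans hx'
      calc ‖f x‖ = ‖f x‖ ^ (1 - m) * ‖f x‖ ^ m := by rw [← Real.rpow_add hfx]; simp
        _ ≤ _ := by
          gcongr 1
          exact Real.rpow_le_rpow_of_nonpos hlam0 hx'.le (by linarith)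
    · rw [Set.indicator_of_notMem hx, norm_zero]; positivity
  have hb₂ : ∀ᵐ x, ‖f₂ x‖ ^ 2 ≤ lam ^ (2 - m) * ‖f x‖ ^ m := by
    filter_upwards [hm₂.coeFn_toLp] with x h
    rw [h]
    by_cases hx : x ∈ S
    · rw [Set.indicator_of_notMem (by simpa using hx), norm_zero, zero_pow two_ne_zero]; positivity
    · rw [Set.indicator_of_mem hx]
      have hx' : ‖f x‖ ≤ lam := not_lt.mp hx
      rcases (norm_nonneg (f x)).eq_or_lt with h0 | hfx
      · rw [← h0]
        simp only [ne_eq, OfNat.ofNat_ne_zero, not_false_eq_true, zero_pow]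
        positivity
      calc ‖f x‖ ^ 2 = ‖f x‖ ^ (2 - m) * ‖f x‖ ^ m := by
            rw [← Real.rpow_add hfx, ← Real.rpow_natCast]; congr 1; push_cast; ring
        _ ≤ _ := by
          gcongr 1
          exact Real.rpow_le_rpow hfx.le hx' (by linarith)
  have hi₁ : Integrable f₁ := (hint.const_mul _).mono' (Lp.aestronglyMeasurable _) hb₁
  have hF : ∀ᵐ ξ, ‖fourierL2 f₁ ξ‖ ≤ lam ^ (1 - m) * M ^ m := by
    have hic : Integrable (complexify f₁) := by
      refine (integrable_congr (complexify_coeFn f₁)).mpr hi₁.ofReal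
    filter_upwards [fourier_ae_eq_of_integrable (complexify f₁) hic] with ξ h
    change ‖(𝓕 (complexify f₁) : Lp (α := Sp n) ℂ 2 volume) ξ‖ ≤ _
    rw [h]
    refine (VectorFourier.norm_fourierIntegral_le_integral_norm _ _ _ _ _).trans ?_
    calc ∫ x, ‖complexify f₁ x‖ = ∫ x, ‖f₁ x‖ := by
          apply integral_congr_ae
          filter_upwards [complexify_coeFn f₁] with x hx
          rw [hx, Complex.norm_real]
      _ ≤ ∫ x, lam ^ (1 - m) * ‖f x‖ ^ m := integral_mono_ae hi₁.norm (hint.const_mul _) hb₁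
      _ ≤ _ := by
        rw [integral_const_mul]; gcongr
  have hN₂ : ‖f₂‖ ≤ R ^ ((n : ℝ) * (1 / m - 1 / 2)) * M := by
    refine le_of_sq_le_sq ?_ (by positivity)
    rw [norm_sq_eq_integral_sq]
    calc ∫ x, ‖f₂ x‖ ^ 2 ≤ ∫ x, lam ^ (2 - m) * ‖f x‖ ^ m :=
          integral_mono_ae ((memLp_two_iff_integrable_sq_norm
            (Lp.aestronglyMeasurable _)).mp (Lp.memLp _)) (hint.const_mul _) hb₂
      _ ≤ lam ^ (2 - m) * M ^ m := by rw [integral_const_mul]; gcongr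
      _ = _ := by
        rw [hlam, Real.mul_rpow hM.le (by positivity), ← Real.rpow_mul hR.le, mul_right_comm,
          ← Real.rpow_add hM, mul_pow, ← Real.rpow_mul_natCast hR.le, ← Real.rpow_natCast M 2,
          mul_comm]
        congr 2
        · push_cast; field_simp
        · push_cast; ring
  calc ‖Op (fun x => (wt r R x)⁻¹) f‖
      ≤ ‖Op (fun x => (wt r R x)⁻¹) f₁‖ + ‖Op (fun x => (wt r R x)⁻¹) f₂‖ := by
        conv_lhs => rw [hsum, map_add]
        exact norm_add_le _ _
    _ ≤ K * R ^ ((n : ℝ) / 2) * (lam ^ (1 - m) * M ^ m) + R ^ ((n : ℝ) * (1 / m - 1 / 2)) * M :=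
        add_le_add (H f₁ _ (by positivity) hF R hR) ((norm_Op_inv_wt_le hR f₂).trans hN₂)
    _ = _ := by
        have e : R ^ ((n : ℝ) / 2) * (lam ^ (1 - m) * M ^ m)
            = R ^ ((n : ℝ) * (1 / m - 1 / 2)) * M := by
          rw [hlam, Real.mul_rpow hM.le (by positivity), ← Real.rpow_mul hR.le,
            show R ^ ((n : ℝ) / 2) * (M ^ (1 - m) * R ^ ((n : ℝ) / m * (1 - m)) * M ^ m)
              = (R ^ ((n : ℝ) / 2) * R ^ ((n : ℝ) / m * (1 - m))) * (M ^ (1 - m) * M ^ m) by ring,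
            ← Real.rpow_add hR, ← Real.rpow_add hM]
          congr 2
          · field_simp; ring
          · rw [sub_add_cancel, Real.rpow_one]
        rw [mul_assoc, e]; ring

end LowFrequencyEstimates

/-! ### The diffusive scale and the decay of low-frequency symbols. -/

section SymbolDecay

lemma exists_one_add_rpow_mul_exp_le {p c : ℝ} (hp : 0 ≤ p) (hc : 0 < c) :
    ∃ A : ℝ, 0 < A ∧ ∀ x : ℝ, 0 ≤ x → (1 + x) ^ p * Real.exp (-c * x) ≤ A := by
  set K : ℝ := max 1 ((p + 1) / c) with hK
  refine ⟨K ^ (p + 1), by positivity, fun x hx => ?_⟩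
  have h1 : 1 + x ≤ K * Real.exp (c * x / (p + 1)) := by
    have h2 := Real.add_one_le_exp (c * x / (p + 1))
    have h3 : x ≤ K * (c * x / (p + 1)) := by
      calc x = (p + 1) / c * (c * x / (p + 1)) := by field_simp
        _ ≤ _ := by gcongr; exact le_max_right _ _
    have h4 : 1 ≤ K := le_max_left _ _
    nlinarith [mul_le_mul_of_nonneg_left h2 (by positivity : 0 ≤ K)]
  calc (1 + x) ^ p * Real.exp (-c * x) ≤ (1 + x) ^ (p + 1) * Real.exp (-c * x) := by
        gcongr 1
        exact Real.rpow_le_rpow_of_exponent_le (by linarith) (by linarith)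
    _ ≤ (K * Real.exp (c * x / (p + 1))) ^ (p + 1) * Real.exp (-c * x) := by gcongr
    _ = _ := by
      rw [Real.mul_rpow (by positivity) (by positivity), ← Real.exp_mul, mul_assoc, ← Real.exp_add]
      rw [div_mul_cancel₀ _ (by positivity)]
      simp

/-- In the diffusive variable `y = |ξ|/R` the exponential beats every polynomial weight. The square
leaves one weight over, which becomes the filter `(wt)⁻¹`; the factor `1 + y^σ` covers symbols with
and without the gain `q`. -/
lemma exists_wt_sq_mul_exp_le {r σ c : ℝ} (hr : 0 ≤ r) (hσ : 0 < σ) (hc : 0 < c) :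
    ∃ A : ℝ, 0 < A ∧ ∀ y : ℝ, 0 ≤ y →
      wt r 1 y ^ 2 * ((1 + y ^ σ) * Real.exp (-c * y ^ (2 * σ))) ≤ A := by
  obtain ⟨A, hA, H⟩ := exists_one_add_rpow_mul_exp_le (p := 2 * (r / (2 * σ)) + 1 / 2)
    (by positivity) hc
  refine ⟨8 * A, by positivity, fun y hy => ?_⟩
  set z : ℝ := y ^ (2 * σ) with hz
  have hz0 : 0 ≤ z := by positivity
  have hpow : ∀ p : ℝ, 0 ≤ p → 1 + y ^ p ≤ 2 * (1 + z) ^ (p / (2 * σ)) := by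
    intro p hp
    have e : y ^ p = z ^ (p / (2 * σ)) := by
      rw [hz, ← Real.rpow_mul hy]; congr 1; field_simp
    have h1 : z ^ (p / (2 * σ)) ≤ (1 + z) ^ (p / (2 * σ)) := by
      gcongr; linarith
    have h2 : 1 ≤ (1 + z) ^ (p / (2 * σ)) := Real.one_le_rpow (by linarith) (by positivity)
    rw [e]; linarith
  have h1 : wt r 1 y ≤ 2 * (1 + z) ^ (r / (2 * σ)) := by
    rw [wt, div_one]; exact hpow r hr
  have h2 : 1 + y ^ σ ≤ 2 * (1 + z) ^ (1 / 2 : ℝ) := by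
    have := hpow σ hσ.le
    rwa [show σ / (2 * σ) = 1 / 2 by field_simp] at this
  have h0 := wt_pos (r := r) one_pos hy
  calc wt r 1 y ^ 2 * ((1 + y ^ σ) * Real.exp (-c * z))
      ≤ (2 * (1 + z) ^ (r / (2 * σ))) ^ 2 * ((2 * (1 + z) ^ (1 / 2 : ℝ)) * Real.exp (-c * z)) := by
        gcongr
    _ = 8 * ((1 + z) ^ (2 * (r / (2 * σ)) + 1 / 2) * Real.exp (-c * z)) := by
        rw [Real.rpow_add (by positivity), mul_comm 2 (r / (2 * σ)),
          Real.rpow_mul (by positivity)]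
        norm_num
        ring
    _ ≤ 8 * A := by gcongr; exact H z hz0

/-- The frequency scale at time `t`. -/
def scale (σ t : ℝ) : ℝ := (1 + max t 0) ^ (-(1 / (2 * σ)))

lemma one_le_one_add_max (t : ℝ) : 1 ≤ 1 + max t 0 := by linarith [le_max_right t 0]

lemma one_add_max_pos (t : ℝ) : 0 < 1 + max t 0 := one_pos.trans_le (one_le_one_add_max t)

lemma scale_pos (σ t : ℝ) : 0 < scale σ t := Real.rpow_pos_of_pos (one_add_max_pos t) _

lemma scale_le_one {σ : ℝ} (hσ : 0 < σ) (t : ℝ) : scale σ t ≤ 1 :=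
  Real.rpow_le_one_of_one_le_of_nonpos (one_le_one_add_max t) (by
    rw [neg_nonpos]; positivity)

lemma scale_rpow (σ t p : ℝ) : scale σ t ^ p = (1 + max t 0) ^ (-(p / (2 * σ))) := by
  rw [scale, ← Real.rpow_mul (one_add_max_pos t).le]
  congr 1; ring

lemma continuous_scale (σ : ℝ) : Continuous (scale σ) := by
  unfold scale
  exact Continuous.rpow_const (by fun_prop) fun t => Or.inl (one_add_max_pos t).ne'

lemma continuous_wt_scale {σ r x : ℝ} (hr : 0 ≤ r) : Continuous fun t => wt r (scale σ t) x := by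
  unfold wt
  refine continuous_const.add (Continuous.rpow_const ?_ fun t => Or.inr hr)
  exact continuous_const.div (continuous_scale σ) fun t => (scale_pos σ t).ne'

/-- Low frequencies decay like a bump at the scale of time `t`. -/
lemma exists_wt_mul_lowExp_le {r σ μ : ℝ} (hr : 0 ≤ r) (hσ : 0 < σ) (hμ : 0 < μ) :
    ∃ A : ℝ, 0 < A ∧ ∀ t d x : ℝ, 0 ≤ t → t / 2 ≤ d → 0 ≤ x →
      wt r (scale σ t) x * lowExp μ d (x ^ σ) ≤ A * (wt r (scale σ t) x)⁻¹ ∧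
      wt r (scale σ t) x * (x ^ σ * lowExp μ d (x ^ σ))
        ≤ A * (1 + t) ^ (-(1 / 2) : ℝ) * (wt r (scale σ t) x)⁻¹ := by
  obtain ⟨A, hA, H⟩ := exists_wt_sq_mul_exp_le hr hσ (half_pos hμ)
  -- For `q ≤ 1` and `d ≥ t/2`, `exp(-μq²d)` is at most `exp(μ/2) exp(-(μ/2)(1+t)q²)`, and `(1+t)q²
  -- = y^(2σ)`.
  refine ⟨A * Real.exp (μ / 2), by positivity, fun t d x ht hd hx => ?_⟩
  set R := scale σ t with hR
  have hR0 : 0 < R := scale_pos σ t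
  have hmax : max t 0 = t := max_eq_left ht
  set y := x / R with hy
  have hy0 : 0 ≤ y := by positivity
  have hw : wt r R x = wt r 1 y := (wt_div r R x).symm
  have hw0 := wt_pos (r := r) one_pos hy0
  have hxy : x ^ σ = (1 + t) ^ (-(1 / 2) : ℝ) * y ^ σ := by
    have : x = R * y := by rw [hy]; field_simp
    rw [this, Real.mul_rpow hR0.le hy0, hR, scale_rpow, hmax]
    congr 3; field_simp
  have hlow : lowExp μ d (x ^ σ) ≤ Real.exp (μ / 2) * Real.exp (-(μ / 2) * y ^ (2 * σ)) := by
    unfold lowExp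
    split_ifs with hq
    · rw [← Real.exp_add]
      apply Real.exp_le_exp.mpr
      have e : y ^ (2 * σ) = (1 + t) * (x ^ σ) ^ 2 := by
        rw [hxy, mul_pow, ← Real.rpow_natCast ((1 + t) ^ _), ← Real.rpow_mul (by linarith), mul_comm 2 σ,
          Real.rpow_mul hy0, ← mul_assoc]
        have : (1 + t) * (1 + t) ^ (-(1 / 2) * ((2 : ℕ) : ℝ)) = 1 := by
          rw [show (-(1 / 2) * ((2 : ℕ) : ℝ) : ℝ) = -1 by norm_num, Real.rpow_neg_one,
            mul_inv_cancel₀ (by linarith)]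
        rw [this, one_mul]; norm_num
      rw [e]
      have hq0 : 0 ≤ x ^ σ := by positivity
      have h1 : (x ^ σ) ^ 2 ≤ 1 := pow_le_one₀ hq0 hq
      have h2 : (x ^ σ) ^ 2 * (t / 2) ≤ (x ^ σ) ^ 2 * d := by gcongr
      nlinarith
    · positivity
  have hH := H y hy0
  have hys : 0 ≤ y ^ σ := by positivity
  rw [hw]
  constructor
  · rw [le_mul_inv_iff₀ hw0]
    calc wt r 1 y * lowExp μ d (x ^ σ) * wt r 1 y
        = wt r 1 y ^ 2 * (1 * lowExp μ d (x ^ σ)) := by ring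
      _ ≤ wt r 1 y ^ 2 * ((1 + y ^ σ) * (Real.exp (μ / 2) * Real.exp (-(μ / 2) * y ^ (2 * σ)))) := by
          have := lowExp_nonneg μ d (x ^ σ)
          gcongr
          linarith
      _ = (wt r 1 y ^ 2 * ((1 + y ^ σ) * Real.exp (-(μ / 2) * y ^ (2 * σ)))) * Real.exp (μ / 2) := by
          ring
      _ ≤ _ := by gcongr
  · rw [le_mul_inv_iff₀ hw0]
    calc wt r 1 y * (x ^ σ * lowExp μ d (x ^ σ)) * wt r 1 y
        = (1 + t) ^ (-(1 / 2) : ℝ) * (wt r 1 y ^ 2 * (y ^ σ * lowExp μ d (x ^ σ))) := by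
          conv_lhs => enter [1, 2, 1]; rw [hxy]
          ring
      _ ≤ (1 + t) ^ (-(1 / 2) : ℝ) * (wt r 1 y ^ 2 *
            ((1 + y ^ σ) * (Real.exp (μ / 2) * Real.exp (-(μ / 2) * y ^ (2 * σ))))) := by
          have := lowExp_nonneg μ d (x ^ σ)
          gcongr
          linarith
      _ = (wt r 1 y ^ 2 * ((1 + y ^ σ) * Real.exp (-(μ / 2) * y ^ (2 * σ)))) *
            (Real.exp (μ / 2) * (1 + t) ^ (-(1 / 2) : ℝ)) := by ring
      _ ≤ A * (Real.exp (μ / 2) * (1 + t) ^ (-(1 / 2) : ℝ)) := by gcongr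
      _ = _ := by ring

lemma exists_exp_le_rpow {μ p : ℝ} (hp : 0 ≤ p) (hμ : 0 < μ) : ∃ A : ℝ, 0 < A ∧ ∀ t : ℝ, 0 ≤ t →
    Real.exp (-μ * t) ≤ A * (1 + t) ^ (-p) := by
  obtain ⟨A, hA, H⟩ := exists_one_add_rpow_mul_exp_le hp hμ
  refine ⟨A, hA, fun t ht => ?_⟩
  have h1 : 0 < (1 + t) ^ p := by positivity
  rw [Real.rpow_neg (by linarith), le_mul_inv_iff₀ h1]
  linarith [H t ht]

/-- This is the case `r = 0`, `σ = 1` of the previous estimate: there `wt` is the constant `2`, also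
at frequency `0` because `0 ^ 0 = 1`. -/
lemma exists_mul_lowExp_le_rpow {μ : ℝ} (hμ : 0 < μ) : ∃ A : ℝ, 0 < A ∧ ∀ d q : ℝ, 0 ≤ d → 0 ≤ q →
    q * lowExp μ d q ≤ A * (1 + d) ^ (-(1 / 2) : ℝ) := by
  obtain ⟨A, hA, H⟩ := exists_wt_mul_lowExp_le (r := 0) le_rfl one_pos hμ
  refine ⟨A, hA, fun d q hd hq => ?_⟩
  have h := (H d d q hd (by linarith) hq).2
  have e : wt 0 (scale 1 d) q = 2 := by simp [wt]; norm_num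
  rw [e, Real.rpow_one] at h
  have h1 := lowExp_nonneg μ d q
  have h2 : 0 ≤ A * (1 + d) ^ (-(1 / 2) : ℝ) := by positivity
  have h3 : 0 ≤ q * lowExp μ d q := by positivity
  linarith

/-- The power `(x/R)^r` grows from time `s` to time `t` by exactly this factor, which is at least
`1` and therefore also covers the constant term of the weight. -/
lemma wt_scale_le {r σ s t x : ℝ} (hr : 0 ≤ r) (hσ : 0 < σ) (hs : 0 ≤ s) (hst : s ≤ t)
    (hx : 0 ≤ x) :
    wt r (scale σ t) x ≤ ((1 + t) / (1 + s)) ^ (r / (2 * σ)) * wt r (scale σ s) x := by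
  have ht := hs.trans hst
  have hq : 1 ≤ ((1 + t) / (1 + s)) ^ (r / (2 * σ)) :=
    Real.one_le_rpow ((one_le_div (by linarith)).mpr (by linarith)) (by positivity)
  have e : (x / scale σ t) ^ r = ((1 + t) / (1 + s)) ^ (r / (2 * σ)) * (x / scale σ s) ^ r := by
    rw [Real.div_rpow hx (scale_pos σ t).le, Real.div_rpow hx (scale_pos σ s).le, scale_rpow,
      scale_rpow, max_eq_left ht, max_eq_left hs, Real.rpow_neg (by linarith),
      Real.rpow_neg (by linarith), Real.div_rpow (by linarith) (by linarith)]
    field_simp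
  unfold wt
  rw [e]
  nlinarith

lemma div_one_add_le {s t : ℝ} (hs : 0 ≤ s) (hst : s ≤ t) : (1 + t) / (1 + s) ≤ 1 + (t - s) := by
  rw [div_le_iff₀ (by linarith)]
  nlinarith

end SymbolDecay

/-! ### Decay of the linear evolution in the weighted norms. -/

section OperatorDecay

variable {n : ℕ} {τ δ σ : ℝ}

lemma norm_Op_le_add {m m₁ m₂ : ℝ → ℝ} (hm : IsSymbol m) (h₁ : IsSymbol m₁) (h₂ : IsSymbol m₂)
    {a b : ℝ} (ha : 0 ≤ a) (hb : 0 ≤ b) (h : ∀ x, 0 ≤ x → |m x| ≤ a * |m₁ x| + b * |m₂ x|)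
    (f : RealL2 n) : ‖Op m f‖ ≤ a * ‖Op m₁ f‖ + b * ‖Op m₂ f‖ := by
  have habs : ∀ {m : ℝ → ℝ}, IsSymbol m → IsSymbol fun x => |m x| := fun {m} hm => by
    obtain ⟨C, hC⟩ := hm.bounded
    exact .of_le (measurable_norm.comp hm.measurable) fun x hx => by rw [abs_abs]; exact hC x hx
  have hs₁ := (IsSymbol.const a).mul (habs h₁)
  have hs₂ := (IsSymbol.const b).mul (habs h₂)
  have e₁ : ‖Op (fun x => |m₁ x|) f‖ ≤ ‖Op m₁ f‖ := by
    simpa using norm_Op_le_Op (C := 1) (habs h₁) h₁ (fun x _ => by simp) f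
  have e₂ : ‖Op (fun x => |m₂ x|) f‖ ≤ ‖Op m₂ f‖ := by
    simpa using norm_Op_le_Op (C := 1) (habs h₂) h₂ (fun x _ => by simp) f
  calc ‖Op m f‖ ≤ 1 * ‖Op (fun x => a * |m₁ x| + b * |m₂ x|) f‖ :=
        norm_Op_le_Op hm (hs₁.add hs₂) (fun x hx => by
          rw [one_mul]; exact (h x hx).trans (le_abs_self _)) f
    _ ≤ a * ‖Op (fun x => |m₁ x|) f‖ + b * ‖Op (fun x => |m₂ x|) f‖ := by
        rw [one_mul, Op_add hs₁ hs₂, Op_smul (habs h₁), Op_smul (habs h₂)]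
        refine (norm_add_le _ _).trans ?_
        rw [norm_smul, norm_smul, Real.norm_of_nonneg ha, Real.norm_of_nonneg hb]
    _ ≤ _ := by gcongr

lemma continuous_Op_of_le {X : Type*} [TopologicalSpace X] [FirstCountableTopology X]
    {m : X → ℝ → ℝ} (hm : ∀ p, Measurable (m p)) (hlim : ∀ y, 0 ≤ y → Continuous fun p => m p y)
    {F : X → ℝ} (hF : Continuous F) (hmF : ∀ p y, 0 ≤ y → |m p y| ≤ F p) {f : X → RealL2 n}
    (hf : Continuous f) : Continuous fun p => Op (m p) (f p) := by
  refine continuous_Op (fun p => .of_le (hm p) (hmF p)) hlim (fun p₀ => ⟨F p₀ + 1, ?_⟩) hf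
  filter_upwards [hF.continuousAt.eventually_lt continuousAt_const (lt_add_one (F p₀))]
    with p hp y hy
  exact (hmF p y hy).trans hp.le

/-- The weight of the solution space at time `t`. -/
def decayWt (σ r α t x : ℝ) : ℝ := (1 + max t 0) ^ α * wt r (scale σ t) x

lemma measurable_decayWt (σ r α t : ℝ) : Measurable (decayWt σ r α t) :=
  (measurable_wt r _).const_mul _

lemma continuous_decayWt {r : ℝ} (hr : 0 ≤ r) (σ α x : ℝ) :
    Continuous fun t => decayWt σ r α t x :=
  (Continuous.rpow_const (by fun_prop) fun t => Or.inl (one_add_max_pos t).ne').mul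
    (continuous_wt_scale hr)

lemma wt_le_decayWt {r α : ℝ} (hα : 0 ≤ α) (t : ℝ) {x : ℝ} (hx : 0 ≤ x) :
    wt r (scale σ t) x ≤ decayWt σ r α t x :=
  le_mul_of_one_le_left (wt_pos (scale_pos σ t) hx).le
    (Real.one_le_rpow (one_le_one_add_max t) hα)

lemma decayWt_pos (r α t : ℝ) {x : ℝ} (hx : 0 ≤ x) : 0 < decayWt σ r α t x :=
  mul_pos (Real.rpow_pos_of_pos (one_add_max_pos t) _) (wt_pos (scale_pos σ t) hx)

lemma wt_one_le_decayWt {r α : ℝ} (hσ : 0 < σ) (hr : 0 ≤ r) (hα : 0 ≤ α) (t : ℝ) {x : ℝ}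
    (hx : 0 ≤ x) : wt r 1 x ≤ decayWt σ r α t x :=
  (wt_anti hr (scale_pos σ t) (scale_le_one hσ t) hx).trans (wt_le_decayWt hα t hx)

/-- The growth of the weight relative to the weight at time `0`. -/
def growth (σ r α t : ℝ) : ℝ := (1 + max t 0) ^ α * scale σ t ^ (-r)

lemma continuous_growth (σ r α : ℝ) : Continuous (growth σ r α) :=
  (Continuous.rpow_const (by fun_prop) fun t => Or.inl (one_add_max_pos t).ne').mul
    ((continuous_scale σ).rpow_const fun t => Or.inl (scale_pos σ t).ne')

lemma growth_nonneg (σ r α t : ℝ) : 0 ≤ growth σ r α t :=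
  mul_nonneg (Real.rpow_nonneg (one_add_max_pos t).le _) (Real.rpow_nonneg (scale_pos σ t).le _)

/-- At high frequencies the weight at time `t` exceeds that of `H^r` by a power of `1 + t`, which
exponential decay will pay for. -/
lemma decayWt_mul_inv_le {r α : ℝ} (hσ : 0 < σ) (hr : 0 ≤ r) (t : ℝ) {x : ℝ} (hx : 0 ≤ x) :
    decayWt σ r α t x * (wt r 1 x)⁻¹ ≤ growth σ r α t := by
  rw [← div_eq_mul_inv, div_le_iff₀ (wt_pos one_pos hx), decayWt, growth, mul_assoc]
  have := Real.rpow_nonneg (one_add_max_pos t).le α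
  gcongr
  exact wt_le_rpow_mul_wt_one hr (scale_pos σ t) (scale_le_one hσ t) hx

/-- The symbol of the loss of derivatives allowed for the three initial data. -/
def baseSym (σ r : ℝ) (j : Fin 3) (x : ℝ) : ℝ :=
  (if j = 1 then 1 + x ^ σ else 1) * (wt r 1 x)⁻¹

lemma measurable_baseSym (σ r : ℝ) (j : Fin 3) : Measurable (baseSym σ r j) := by
  unfold baseSym
  have := measurable_wt r 1
  split_ifs <;> fun_prop

lemma one_add_rpow_le_wt {r : ℝ} (hσ : 0 ≤ σ) (hr : σ ≤ r) {x : ℝ} (hx : 0 ≤ x) :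
    1 + x ^ σ ≤ 2 * wt r 1 x := by
  unfold wt
  rw [div_one]
  have h0 := Real.rpow_nonneg hx r
  rcases le_total x 1 with h | h
  · have := Real.rpow_le_one hx h hσ
    linarith
  · have := Real.rpow_le_rpow_of_exponent_le h hr
    linarith

lemma abs_baseSym_le {r : ℝ} (hσ : 0 ≤ σ) (hr : σ ≤ r) (j : Fin 3) {x : ℝ} (hx : 0 ≤ x) :
    |baseSym σ r j x| ≤ 2 := by
  have hw := wt_pos (r := r) one_pos hx
  have h1 := one_le_wt (r := r) one_pos hx
  have hs := Real.rpow_nonneg hx σ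
  unfold baseSym
  rw [abs_of_nonneg (by split_ifs <;> positivity), mul_inv_le_iff₀ hw]
  split_ifs
  · exact one_add_rpow_le_wt hσ hr hx
  · linarith

lemma isSymbol_baseSym {r : ℝ} (hσ : 0 ≤ σ) (hr : σ ≤ r) (j : Fin 3) :
    IsSymbol (baseSym σ r j) :=
  .of_le (measurable_baseSym σ r j) fun _ hx => abs_baseSym_le hσ hr j hx

/-- Rewrites `exists_prop_bounds` for data in their own spaces: the extra `1 + x^σ` in `baseSym σ r
1` is compensated by the decay in `q` of the `G` entry. -/
lemma exists_propSym_bounds (hτ : 0 < τ) (hδ : 0 < δ) (σ r : ℝ) :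
    ∃ C > 0, ∃ μ > 0, ∀ (j : Fin 3) (t x : ℝ), 0 ≤ t → 0 ≤ x →
      |propSym τ δ σ j t x| ≤ C * (Real.exp (-μ * t) + lowExp μ t (x ^ σ)) ∧
      |propSym τ δ σ j t x * baseSym σ r j x|
        ≤ C * (Real.exp (-μ * t) + lowExp μ t (x ^ σ)) * (wt r 1 x)⁻¹ ∧
      |kerSym τ δ σ t x| ≤ C * (Real.exp (-μ * t) + x ^ σ * lowExp μ t (x ^ σ)) := by
  obtain ⟨C, hC, μ, hμ, H⟩ := exists_prop_bounds hτ hδ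
  refine ⟨C, hC, μ, hμ, fun j t x ht hx => ?_⟩
  have hq := Real.rpow_nonneg hx σ
  obtain ⟨h0, h1, h2, h3⟩ := H t ht (x ^ σ) hq
  have hw := wt_pos (r := r) one_pos hx
  have hB : |propSym τ δ σ j t x| * (if j = 1 then 1 + x ^ σ else 1)
      ≤ C * (Real.exp (-μ * t) + lowExp μ t (x ^ σ)) := by
    unfold propSym
    rw [max_eq_left ht]
    fin_cases j
    · simpa using h0
    · simpa using h1
    · simpa using h2
  have hg : 1 ≤ (if j = 1 then 1 + x ^ σ else 1) := by split_ifs <;> linarith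
  refine ⟨?_, ?_, ?_⟩
  · exact (le_mul_of_one_le_right (abs_nonneg _) hg).trans hB
  · unfold baseSym
    rw [abs_mul, abs_of_nonneg (mul_nonneg (zero_le_one.trans hg) (inv_nonneg.mpr hw.le)),
      ← mul_assoc]
    gcongr
  · unfold kerSym
    rw [max_eq_left ht]; exact h3

lemma continuous_Op_data (hτ : 0 < τ) (hδ : 0 < δ) (hσ : 0 < σ) {r α : ℝ} (hr : 0 ≤ r)
    (j : Fin 3) (z : RealL2 n) :
    Continuous fun t => Op (fun x => decayWt σ r α t x *
      (propSym τ δ σ j t x * baseSym σ r j x)) z := by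
  obtain ⟨C, hC, μ, hμ, H⟩ := exists_propSym_bounds hτ hδ σ r
  refine continuous_Op_of_le (F := fun t => growth σ r α t * (C * 2)) (fun t => ?_)
    (fun x _ => ?_) ((continuous_growth σ r α).mul_const _) (fun t x hx => ?_) continuous_const
  · exact (measurable_decayWt σ r α t).mul
      ((measurable_propSym τ δ σ j t).mul (measurable_baseSym σ r j))
  · exact (continuous_decayWt hr σ α x).mul ((continuous_propSym τ δ σ j x).mul_const _)
  · have e : propSym τ δ σ j t x = propSym τ δ σ j (max t 0) x := by simp [propSym]
    have ht : 0 ≤ max t 0 := le_max_right _ _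
    have h := (H j (max t 0) x ht hx).2.1
    have hw := wt_pos (r := r) one_pos hx
    have hE : Real.exp (-μ * max t 0) ≤ 1 := by
      apply Real.exp_le_one_iff.mpr
      have : 0 ≤ μ * max t 0 := by positivity
      linarith
    have hL := lowExp_le_one (q := x ^ σ) hμ.le ht
    rw [abs_mul, abs_of_pos (decayWt_pos r α t hx), e]
    calc _ ≤ decayWt σ r α t x * (C * (1 + 1) * (wt r 1 x)⁻¹) := by
          have := decayWt_pos (σ := σ) r α t hx
          gcongr
          refine h.trans ?_
          gcongr
      _ = decayWt σ r α t x * (wt r 1 x)⁻¹ * (C * 2) := by ring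
      _ ≤ _ := by
          gcongr
          exact decayWt_mul_inv_le hσ hr t hx

/-- Decay of the linear evolution in the weighted spaces. -/
lemma exists_norm_data_le (hτ : 0 < τ) (hδ : 0 < δ) (hσ : 0 < σ) {r α : ℝ} (hr : σ ≤ r)
    (hα : 0 ≤ α) : ∃ C : ℝ, 0 < C ∧ ∀ (j : Fin 3) (z : RealL2 n) (ε : ℝ), ‖z‖ ≤ ε →
      (∀ R, 0 < R → R ≤ 1 →
        ‖Op (fun x => (wt r R x)⁻¹) (Op (baseSym σ r j) z)‖ ≤ R ^ (2 * σ * α) * ε) →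
      ∀ t, ‖Op (fun x => decayWt σ r α t x * (propSym τ δ σ j t x * baseSym σ r j x)) z‖
        ≤ C * ε := by
  have hr0 : 0 ≤ r := hσ.le.trans hr
  obtain ⟨C, hC, μ, hμ, H⟩ := exists_propSym_bounds hτ hδ σ r
  obtain ⟨A, hA, HA⟩ := exists_wt_mul_lowExp_le hr0 hσ hμ
  -- The exponent is exactly that of `growth` as a power of `1 + t`.
  obtain ⟨A', hA', HA'⟩ := exists_exp_le_rpow (p := α + r / (2 * σ)) (by positivity) hμ
  refine ⟨C * A' + C * A, by positivity, fun j z ε hz hlow t' => ?_⟩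
  -- At negative times all symbols are frozen at their value at `0`.
  wlog ht' : 0 ≤ t' generalizing t'
  · have e : (fun x => decayWt σ r α t' x * (propSym τ δ σ j t' x * baseSym σ r j x))
        = fun x => decayWt σ r α 0 x * (propSym τ δ σ j 0 x * baseSym σ r j x) := by
      have : max t' 0 = 0 := max_eq_right (not_le.mp ht').le
      simp [decayWt, propSym, scale, this]
    rw [e]; exact this 0 le_rfl
  set t := t' with htt
  have hmax : max t 0 = t := max_eq_left ht'
  have hR := scale_pos σ t
  have hR1 := scale_le_one hσ t
  have h1t : 0 < 1 + t := by linarith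
  have hb := isSymbol_baseSym hσ.le hr j
  have hmeas : Measurable fun x => decayWt σ r α t x * (propSym τ δ σ j t x * baseSym σ r j x) :=
    (measurable_decayWt σ r α t).mul
      ((measurable_propSym τ δ σ j t).mul (measurable_baseSym σ r j))
  -- The exponential part of the propagator gives the constant. The diffusive part gives `(1+t)^α`
  -- times the filter at the current scale acting on the datum; with `R = scale σ t` in the
  -- hypothesis, `R^(2σα)` cancels `(1+t)^α`.
  have hpt : ∀ x, 0 ≤ x → |decayWt σ r α t x * (propSym τ δ σ j t x * baseSym σ r j x)|
      ≤ C * A' * |(1 : ℝ)|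
        + C * A * (1 + t) ^ α * |(wt r (scale σ t) x)⁻¹ * baseSym σ r j x| := by
    intro x hx
    obtain ⟨h1, h2, -⟩ := H j t x ht' hx
    have hw1 := wt_pos (r := r) one_pos hx
    have hwR := wt_pos (r := r) hR hx
    have hD := decayWt_pos (σ := σ) r α t hx
    have hl := lowExp_nonneg μ t (x ^ σ)
    have hbase : 0 ≤ baseSym σ r j x * wt r 1 x - 1 := by
      unfold baseSym
      rw [inv_mul_cancel_right₀ hw1.ne']
      have := Real.rpow_nonneg hx σ
      split_ifs <;> linarith
    have hbase' : (wt r 1 x)⁻¹ ≤ |baseSym σ r j x| := by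
      refine le_trans ?_ (le_abs_self _)
      rw [inv_le_iff_one_le_mul₀ hw1]; linarith
    have hexp : decayWt σ r α t x * (wt r 1 x)⁻¹ * Real.exp (-μ * t) ≤ A' := by
      calc _ ≤ growth σ r α t * (A' * (1 + t) ^ (-(α + r / (2 * σ)))) := by
            gcongr
            · exact growth_nonneg _ _ _ _
            · exact decayWt_mul_inv_le hσ hr0 t hx
            · exact HA' t ht'
        _ = A' := by
            rw [growth, scale_rpow, hmax, show (1 + t) ^ α * (1 + t) ^ (-(-r / (2 * σ))) *
              (A' * (1 + t) ^ (-(α + r / (2 * σ)))) = A' * ((1 + t) ^ α *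
                (1 + t) ^ (-(-r / (2 * σ))) * (1 + t) ^ (-(α + r / (2 * σ)))) by ring,
              ← Real.rpow_add h1t, ← Real.rpow_add h1t]
            rw [show α + -(-r / (2 * σ)) + -(α + r / (2 * σ)) = 0 by ring, Real.rpow_zero, mul_one]
    have hlow : decayWt σ r α t x * lowExp μ t (x ^ σ)
        ≤ (1 + t) ^ α * (A * (wt r (scale σ t) x)⁻¹) := by
      rw [decayWt, hmax, mul_assoc]
      exact mul_le_mul_of_nonneg_left (HA t t x ht' (by linarith) hx).1 (by positivity)
    rw [abs_mul, abs_of_pos hD]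
    calc _ ≤ decayWt σ r α t x * (C * (Real.exp (-μ * t) + lowExp μ t (x ^ σ)) * (wt r 1 x)⁻¹) := by
          gcongr
      _ = C * (decayWt σ r α t x * (wt r 1 x)⁻¹ * Real.exp (-μ * t))
          + C * (decayWt σ r α t x * lowExp μ t (x ^ σ)) * (wt r 1 x)⁻¹ := by ring
      _ ≤ C * A' + C * ((1 + t) ^ α * (A * (wt r (scale σ t) x)⁻¹)) * |baseSym σ r j x| := by
          gcongr
      _ = _ := by
          rw [abs_one, mul_one, abs_mul, abs_of_pos (inv_pos.mpr hwR)]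
          ring
  have hsym2 := (isSymbol_inv_wt r hR).mul hb
  have hsym : IsSymbol fun x => decayWt σ r α t x * (propSym τ δ σ j t x * baseSym σ r j x) := by
    obtain ⟨D, hD⟩ := hsym2.bounded
    refine .of_le hmeas (C := C * A' * |(1 : ℝ)| + C * A * (1 + t) ^ α * D) fun x hx =>
      (hpt x hx).trans ?_
    gcongr
    exact hD x hx
  refine (norm_Op_le_add hsym (IsSymbol.const 1) hsym2 (by positivity) (by positivity) hpt z).trans ?_
  have h2 := hlow _ hR hR1
  rw [Op_Op (isSymbol_inv_wt r hR) hb, scale_rpow, hmax,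
    show 2 * σ * α / (2 * σ) = α by field_simp, Real.rpow_neg h1t.le] at h2
  rw [Op_one]
  calc _ ≤ C * A' * ε + C * A * (1 + t) ^ α * (((1 + t) ^ α)⁻¹ * ε) := by
        gcongr
        exact hz
    _ = _ := by
        have : (1 + t) ^ α ≠ 0 := by positivity
        field_simp

end OperatorDecay

/-! ### Decay of the Duhamel kernel acting on products. -/

section KernelDecay

variable {n : ℕ} {τ δ σ : ℝ}

/-- The rate of decay in `L²` of solutions with data in `L^m`. -/
def rate (n : ℕ) (σ m : ℝ) : ℝ := n * (2 - m) / (4 * m * σ)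

lemma rate_nonneg (n : ℕ) (hσ : 0 < σ) {m : ℝ} (hm : 1 ≤ m) (hm2 : m < 2) : 0 ≤ rate n σ m := by
  unfold rate
  have : 0 ≤ 2 - m := by linarith
  positivity

/-- Decay of the Duhamel kernel between the weighted spaces. -/
lemma exists_norm_kernel_le (hτ : 0 < τ) (hδ : 0 < δ) (hσ : 0 < σ) {r : ℝ}
    (hr : (n : ℝ) / 2 < r) {a b m : ℝ} (ha : 1 ≤ a) (hb : 1 ≤ b) (hm : 1 ≤ m)
    (hm2 : m < 2) (hθ : σ ≤ n * (1 / a + 1 / b - 1 / m)) :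
    ∃ C : ℝ, 0 < C ∧ ∀ (q : RealL2 n) (Γ s t : ℝ), 0 ≤ Γ → 0 ≤ s → s ≤ t →
      ‖Op (fun x => wt r (scale σ s) x / wt r 1 x) q‖ ≤
        Γ * (1 + s) ^ (-(rate n σ a + rate n σ b)) * scale σ s ^ ((n : ℝ) / 2) →
      (∀ᵐ ξ, ‖fourierL2 (Op (fun x => (wt r 1 x)⁻¹) q) ξ‖ ≤
        Γ * (1 + s) ^ (-(rate n σ a + rate n σ b))) →
      ‖Op (fun x => decayWt σ r (rate n σ m) t x * (kerSym τ δ σ (t - s) x * (wt r 1 x)⁻¹)) q‖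
        ≤ C * Γ * ((1 + (t - s)) ^ (-(1 / 2) : ℝ) * (1 + s) ^ (-(1 / 2) : ℝ)) := by
  have hr0 : 0 ≤ r := (lt_of_le_of_lt (by positivity) hr).le
  set α := rate n σ m with hα
  have hα0 : 0 ≤ α := rate_nonneg n hσ hm hm2
  set p := r / (2 * σ) + α with hp
  have hp0 : 0 ≤ p := by positivity
  -- The net decay of the source at time `s`; the condition on the exponents enters as `θ ≥ 1/2`.
  set θ := (n : ℝ) * (1 / a + 1 / b - 1 / m) / (2 * σ) with hθd
  have hθ2 : 1 / 2 ≤ θ := by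
    rw [hθd, le_div_iff₀ (by positivity)]; linarith
  obtain ⟨C, hC, μ, hμ, H⟩ := exists_propSym_bounds hτ hδ σ r
  obtain ⟨A, hA, HA⟩ := exists_wt_mul_lowExp_le hr0 hσ hμ
  obtain ⟨A₁, hA₁, HA₁⟩ := exists_mul_lowExp_le_rpow hμ
  obtain ⟨A₂, hA₂, HA₂⟩ := exists_exp_le_rpow (p := p + 1 / 2) (by positivity) hμ
  obtain ⟨K, hK, HK⟩ := exists_norm_Op_inv_wt_le_interpolate (n := n) hr
  refine ⟨C * (A₂ + A₁ * 2 ^ p) + C * A * K, by positivity,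
    fun q Γ s t hΓ hs hst hq hqF => ?_⟩
  have ht := hs.trans hst
  have hd : 0 ≤ t - s := by linarith
  have h1s : 0 < 1 + s := by linarith
  have h1t : 0 < 1 + t := by linarith
  have h1d : 0 < 1 + (t - s) := by linarith
  have hmaxs : max s 0 = s := max_eq_left hs
  have hmaxt : max t 0 = t := max_eq_left ht
  have hRs := scale_pos σ s
  have hRt := scale_pos σ t
  have hRs1 := scale_le_one hσ s
  have hRt1 := scale_le_one hσ t
  set P := (1 + s) ^ (-(rate n σ a + rate n σ b)) with hP
  have hP0 : 0 < P := by positivity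
  set ρ := (1 + t) / (1 + s) with hρ
  have hρ0 : 0 < ρ := by positivity
  have hρd : ρ ≤ 1 + (t - s) := div_one_add_le hs hst
  have hsymS := isSymbol_wt_div hr0 hRs hRs1
  have hsymT := (isSymbol_inv_wt r hRt).mul (isSymbol_inv_wt r one_pos)
  have hsym : IsSymbol fun x =>
      decayWt σ r α t x * (kerSym τ δ σ (t - s) x * (wt r 1 x)⁻¹) := by
    obtain ⟨D, hD⟩ := (isSymbol_kerSym hτ hδ σ (t - s)).bounded
    refine .of_le ((measurable_decayWt σ r α t).mul
      ((measurable_kerSym τ δ σ (t - s)).mul (measurable_wt r 1).inv)) (C := growth σ r α t * D)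
      fun x hx => ?_
    rw [abs_mul, abs_mul, abs_of_pos (decayWt_pos r α t hx),
      abs_of_pos (inv_pos.mpr (wt_pos one_pos hx)), mul_left_comm, mul_comm]
    have := decayWt_mul_inv_le (α := α) hσ hr0 t hx
    gcongr
    · exact growth_nonneg _ _ _ _
    · exact hD x hx
  have hratio : ∀ x, 0 ≤ x → decayWt σ r α t x * (wt r 1 x)⁻¹
      ≤ ρ ^ p * (1 + s) ^ α * |wt r (scale σ s) x / wt r 1 x| := by
    intro x hx
    have hw1 := wt_pos (r := r) one_pos hx
    have hws := wt_pos (r := r) hRs hx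
    rw [abs_of_pos (div_pos hws hw1), decayWt, hmaxt, div_eq_mul_inv, ← mul_assoc]
    refine mul_le_mul_of_nonneg_right ?_ (inv_pos.mpr hw1).le
    calc (1 + t) ^ α * wt r (scale σ t) x
        ≤ (ρ * (1 + s)) ^ α * (ρ ^ (r / (2 * σ)) * wt r (scale σ s) x) := by
          rw [hρ, div_mul_cancel₀ _ h1s.ne']
          have := wt_scale_le hr0 hσ hs hst hx
          gcongr
      _ = _ := by
          rw [Real.mul_rpow hρ0.le h1s.le, hp, Real.rpow_add hρ0]; ring
  have hexp : Real.exp (-μ * (t - s)) * ρ ^ p ≤ A₂ * (1 + (t - s)) ^ (-(1 / 2) : ℝ) := by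
    calc _ ≤ A₂ * (1 + (t - s)) ^ (-(p + 1 / 2)) * (1 + (t - s)) ^ p := by
          gcongr; exact HA₂ _ hd
      _ = _ := by
          rw [mul_assoc, ← Real.rpow_add h1d]; congr 2; ring
  -- Decay of the two factors, gain `R^(n/2)` of the product and weight `(1+s)^α` of the target
  -- combine to the exponent `-θ`.
  have hqS : (1 + s) ^ α * ‖Op (fun x => wt r (scale σ s) x / wt r 1 x) q‖
      ≤ Γ * (1 + s) ^ (-(1 / 2) : ℝ) := by
    calc _ ≤ (1 + s) ^ α * (Γ * P * scale σ s ^ ((n : ℝ) / 2)) := by gcongr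
      _ = Γ * (1 + s) ^ (-θ) := by
          rw [scale_rpow, hmaxs, hP, show (1 + s) ^ α * (Γ * (1 + s) ^ (-(rate n σ a + rate n σ b)) *
            (1 + s) ^ (-((n : ℝ) / 2 / (2 * σ)))) = Γ * ((1 + s) ^ α *
            (1 + s) ^ (-(rate n σ a + rate n σ b)) * (1 + s) ^ (-((n : ℝ) / 2 / (2 * σ)))) by ring,
            ← Real.rpow_add h1s, ← Real.rpow_add h1s]
          congr 2
          rw [hα, hθd]; unfold rate
          field_simp; ring
      _ ≤ _ := by
          gcongr 2
          · linarith
          · linarith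
  -- The exponential part of the kernel pays for the growth of the weight from `s` to `t` in all
  -- cases; the diffusive part is left for the case distinction.
  have hker : ∀ x, 0 ≤ x → |decayWt σ r α t x * (kerSym τ δ σ (t - s) x * (wt r 1 x)⁻¹)|
      ≤ C * A₂ * (1 + (t - s)) ^ (-(1 / 2) : ℝ) * (1 + s) ^ α
          * |wt r (scale σ s) x / wt r 1 x|
        + C * (decayWt σ r α t x * (wt r 1 x)⁻¹) *
          (x ^ σ * lowExp μ (t - s) (x ^ σ)) := by
    intro x hx
    have hw1 := wt_pos (r := r) one_pos hx
    have hD := decayWt_pos (σ := σ) r α t hx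
    rw [abs_mul, abs_mul, abs_of_pos hD, abs_of_pos (inv_pos.mpr hw1)]
    calc _ ≤ decayWt σ r α t x * (C * (Real.exp (-μ * (t - s)) +
            x ^ σ * lowExp μ (t - s) (x ^ σ)) * (wt r 1 x)⁻¹) := by
          gcongr; exact (H 0 (t - s) x hd hx).2.2
      _ = C * Real.exp (-μ * (t - s)) * (decayWt σ r α t x * (wt r 1 x)⁻¹)
          + C * (decayWt σ r α t x * (wt r 1 x)⁻¹) *
          (x ^ σ * lowExp μ (t - s) (x ^ σ)) := by ring
      _ ≤ C * Real.exp (-μ * (t - s)) * (ρ ^ p * (1 + s) ^ α * |wt r (scale σ s) x / wt r 1 x|)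
          + C * (decayWt σ r α t x * (wt r 1 x)⁻¹) *
          (x ^ σ * lowExp μ (t - s) (x ^ σ)) := by
          have := hratio x hx
          gcongr
      _ = C * (Real.exp (-μ * (t - s)) * ρ ^ p) * (1 + s) ^ α * |wt r (scale σ s) x / wt r 1 x|
          + C * (decayWt σ r α t x * (wt r 1 x)⁻¹) *
          (x ^ σ * lowExp μ (t - s) (x ^ σ)) := by ring
      _ ≤ _ := by
          rw [mul_assoc C A₂]
          gcongr
  have hfirst : C * A₂ * (1 + (t - s)) ^ (-(1 / 2) : ℝ) * (1 + s) ^ α *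
      ‖Op (fun x => wt r (scale σ s) x / wt r 1 x) q‖
      ≤ C * A₂ * Γ * ((1 + (t - s)) ^ (-(1 / 2) : ℝ) * (1 + s) ^ (-(1 / 2) : ℝ)) := by
    calc _ = C * A₂ * (1 + (t - s)) ^ (-(1 / 2) : ℝ) * ((1 + s) ^ α *
      ‖Op (fun x => wt r (scale σ s) x / wt r 1 x) q‖) := by ring
      _ ≤ C * A₂ * (1 + (t - s)) ^ (-(1 / 2) : ℝ) * (Γ * (1 + s) ^ (-(1 / 2) : ℝ)) := by gcongr
      _ = _ := by ring
  have hX : 0 ≤ Γ * ((1 + (t - s)) ^ (-(1 / 2) : ℝ) * (1 + s) ^ (-(1 / 2) : ℝ)) := by positivity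
  -- For early sources `t - s` is comparable to `t`, so the diffusive kernel filters at the scale of
  -- time `t`. For late sources the weights at `s` and `t` are comparable and only the gain `q` is
  -- used.
  rcases le_total s (t / 2) with hcase | hcase
  · have hpt : ∀ x, 0 ≤ x → |decayWt σ r α t x * (kerSym τ δ σ (t - s) x * (wt r 1 x)⁻¹)|
        ≤ C * A₂ * (1 + (t - s)) ^ (-(1 / 2) : ℝ) * (1 + s) ^ α
            * |wt r (scale σ s) x / wt r 1 x|
          + C * A * (1 + t) ^ (-(1 / 2) : ℝ) * (1 + t) ^ α *
            |(wt r (scale σ t) x)⁻¹ * (wt r 1 x)⁻¹| := by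
      intro x hx
      have hw1 := wt_pos (r := r) one_pos hx
      have hwt := wt_pos (r := r) hRt hx
      refine (hker x hx).trans ?_
      have h := (HA t (t - s) x ht (by linarith) hx).2
      have e : C * (decayWt σ r α t x * (wt r 1 x)⁻¹) * (x ^ σ * lowExp μ (t - s) (x ^ σ))
          = C * (1 + t) ^ α * (wt r 1 x)⁻¹ *
            (wt r (scale σ t) x * (x ^ σ * lowExp μ (t - s) (x ^ σ))) := by
        rw [decayWt, hmaxt]; ring
      rw [e, abs_of_pos (mul_pos (inv_pos.mpr hwt) (inv_pos.mpr hw1))]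
      have h2 := mul_le_mul_of_nonneg_left h
        (by positivity : 0 ≤ C * (1 + t) ^ α * (wt r 1 x)⁻¹)
      refine (add_le_add_right h2 _).trans (le_of_eq ?_)
      ring
    refine (norm_Op_le_add hsym hsymS hsymT (by positivity) (by positivity) hpt q).trans ?_
    rw [← Op_Op (isSymbol_inv_wt r hRt) (isSymbol_inv_wt r one_pos)]
    have hN : ‖Op (fun x => (wt r 1 x)⁻¹) q‖ ≤ Γ * P * scale σ s ^ ((n : ℝ) / 2) := by
      refine le_trans ?_ hq
      have := norm_Op_le_Op (C := 1) (isSymbol_inv_wt r one_pos) hsymS (fun x hx => ?_) q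
      · simpa using this
      · have hw1 := wt_pos (r := r) one_pos hx
        have hws := one_le_wt (r := r) hRs hx
        rw [one_mul, abs_div, abs_inv, div_eq_mul_inv]
        exact le_mul_of_one_le_left (by positivity) (hws.trans (le_abs_self _))
    -- Interpolates between the sup bound of the transform and the `L²` bound of the product, so
    -- that it behaves like an `L^m` function of size `Γ(1+s)^(-θ)`.
    have hK2 := HK m hm hm2 (Op (fun x => (wt r 1 x)⁻¹) q) (Γ * P)
      (Γ * P * scale σ s ^ ((n : ℝ) / 2)) (by positivity) hN hqF _ hRt
    have hl0 : 0 ≤ 2 / m - 1 := by rw [sub_nonneg, le_div_iff₀ (by linarith)]; linarith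
    have hl1 : 0 ≤ 2 - 2 / m := by
      have : 2 / m ≤ 2 := div_le_self (by norm_num) hm
      linarith
    have hprod : (Γ * P) ^ (2 / m - 1) * (Γ * P * scale σ s ^ ((n : ℝ) / 2)) ^ (2 - 2 / m)
        = Γ * (1 + s) ^ (-θ) := by
      rw [Real.mul_rpow (x := Γ * P) (by positivity) (by positivity), ← mul_assoc,
        ← Real.rpow_add_of_nonneg (by positivity) hl0 hl1,
        show 2 / m - 1 + (2 - 2 / m) = 1 by ring, Real.rpow_one, ← Real.rpow_mul hRs.le, scale_rpow,
        hmaxs, mul_assoc, hP, ← Real.rpow_add h1s]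
      congr 2
      rw [hθd]; unfold rate
      field_simp; ring
    have hscale : (1 + t) ^ α * scale σ t ^ ((n : ℝ) * (1 / m - 1 / 2)) = 1 := by
      rw [scale_rpow, hmaxt, ← Real.rpow_add h1t]
      have : α + -((n : ℝ) * (1 / m - 1 / 2) / (2 * σ)) = 0 := by
        rw [hα]; unfold rate
        field_simp; ring
      rw [this, Real.rpow_zero]
    rw [hprod] at hK2
    have hsecond : C * A * (1 + t) ^ (-(1 / 2) : ℝ) * (1 + t) ^ α *
        ‖Op (fun x => (wt r (scale σ t) x)⁻¹) (Op (fun x => (wt r 1 x)⁻¹) q)‖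
        ≤ C * A * K * (Γ * ((1 + (t - s)) ^ (-(1 / 2) : ℝ) * (1 + s) ^ (-(1 / 2) : ℝ))) := by
      calc _ ≤ C * A * (1 + t) ^ (-(1 / 2) : ℝ) * (1 + t) ^ α *
            (K * scale σ t ^ ((n : ℝ) * (1 / m - 1 / 2)) * (Γ * (1 + s) ^ (-θ))) := by gcongr
        _ = C * A * K * (1 + t) ^ (-(1 / 2) : ℝ) *
            ((1 + t) ^ α * scale σ t ^ ((n : ℝ) * (1 / m - 1 / 2))) * (Γ * (1 + s) ^ (-θ)) := by
            ring
        _ = C * A * K * (Γ * ((1 + t) ^ (-(1 / 2) : ℝ) * (1 + s) ^ (-θ))) := by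
            rw [hscale]; ring
        _ ≤ _ := by
            have h1 : (1 + t) ^ (-(1 / 2) : ℝ) ≤ (1 + (t - s)) ^ (-(1 / 2) : ℝ) :=
              Real.rpow_le_rpow_of_nonpos h1d (by linarith) (by norm_num)
            have h2 : (1 + s) ^ (-θ) ≤ (1 + s) ^ (-(1 / 2) : ℝ) :=
              Real.rpow_le_rpow_of_exponent_le (by linarith) (by linarith)
            gcongr
    have hpos : 0 ≤ C * A₁ * 2 ^ p * (Γ * ((1 + (t - s)) ^ (-(1 / 2) : ℝ) *
      (1 + s) ^ (-(1 / 2) : ℝ))) := by positivity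
    linarith
  · have hρ2 : ρ ≤ 2 := by
      rw [hρ, div_le_iff₀ h1s]; linarith
    have hpt : ∀ x, 0 ≤ x → |decayWt σ r α t x * (kerSym τ δ σ (t - s) x * (wt r 1 x)⁻¹)|
        ≤ C * (A₂ + A₁ * 2 ^ p) * (1 + (t - s)) ^ (-(1 / 2) : ℝ) * (1 + s) ^ α
            * |wt r (scale σ s) x / wt r 1 x| := by
      intro x hx
      refine (hker x hx).trans ?_
      have h1 := HA₁ (t - s) (x ^ σ) hd (Real.rpow_nonneg hx σ)
      have hl := lowExp_nonneg μ (t - s) (x ^ σ)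
      have h2 : C * (decayWt σ r α t x * (wt r 1 x)⁻¹) * (x ^ σ * lowExp μ (t - s) (x ^ σ))
          ≤ C * (2 ^ p * (1 + s) ^ α * |wt r (scale σ s) x / wt r 1 x|) *
            (A₁ * (1 + (t - s)) ^ (-(1 / 2) : ℝ)) := by
        have h3 : decayWt σ r α t x * (wt r 1 x)⁻¹
            ≤ 2 ^ p * (1 + s) ^ α * |wt r (scale σ s) x / wt r 1 x| := by
          refine (hratio x hx).trans ?_
          gcongr
        have hxs := Real.rpow_nonneg hx σ
        refine mul_le_mul (mul_le_mul_of_nonneg_left h3 hC.le) h1 (by positivity) (by positivity)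
      linarith
    have hop := norm_Op_le_Op hsym hsymS hpt q
    refine hop.trans ?_
    calc _ = C * (A₂ + A₁ * 2 ^ p) * (1 + (t - s)) ^ (-(1 / 2) : ℝ) * ((1 + s) ^ α *
          ‖Op (fun x => wt r (scale σ s) x / wt r 1 x) q‖) := by ring
      _ ≤ C * (A₂ + A₁ * 2 ^ p) * (1 + (t - s)) ^ (-(1 / 2) : ℝ) *
          (Γ * (1 + s) ^ (-(1 / 2) : ℝ)) := by gcongr
      _ = C * (A₂ + A₁ * 2 ^ p) * (Γ * ((1 + (t - s)) ^ (-(1 / 2) : ℝ) *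
          (1 + s) ^ (-(1 / 2) : ℝ))) := by ring
      _ ≤ _ := by
          rw [mul_assoc (C * (A₂ + A₁ * 2 ^ p) + C * A * K)]
          gcongr
          have : 0 ≤ C * A * K := by positivity
          linarith

/-- The exponents add up to `-1`, so the integral is bounded by scaling. On each half of the
interval one factor is at most `(1+t/2)^(-1/2)`, while the other integrates to at most
`2(1+t)^(1/2)`. -/
lemma integral_rpow_mul_rpow_le {t : ℝ} (ht : 0 ≤ t) :
    ∫ s in (0 : ℝ)..t, (1 + (t - s)) ^ (-(1 / 2) : ℝ) * (1 + s) ^ (-(1 / 2) : ℝ) ≤ 8 := by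
  have hcont : ∀ a : ℝ, ContinuousOn (fun s : ℝ => (1 + |s - a|) ^ (-(1 / 2) : ℝ)) Set.univ := by
    intro a
    exact (Continuous.rpow_const (by fun_prop) fun s => Or.inl (by positivity)).continuousOn
  have hc1 : IntervalIntegrable (fun s : ℝ => (1 + (t - s)) ^ (-(1 / 2) : ℝ)) volume 0 t := by
    apply ContinuousOn.intervalIntegrable
    rw [Set.uIcc_of_le ht]
    exact ContinuousOn.rpow_const (by fun_prop) fun s hs => Or.inl (by linarith [hs.2])
  have hc2 : IntervalIntegrable (fun s : ℝ => (1 + s) ^ (-(1 / 2) : ℝ)) volume 0 t := by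
    apply ContinuousOn.intervalIntegrable
    rw [Set.uIcc_of_le ht]
    exact ContinuousOn.rpow_const (by fun_prop) fun s hs => Or.inl (by linarith [hs.1])
  have hc3 : IntervalIntegrable (fun s : ℝ =>
      (1 + (t - s)) ^ (-(1 / 2) : ℝ) * (1 + s) ^ (-(1 / 2) : ℝ)) volume 0 t := by
    apply ContinuousOn.intervalIntegrable
    rw [Set.uIcc_of_le ht]
    exact (ContinuousOn.rpow_const (by fun_prop) fun s hs => Or.inl (by linarith [hs.2])).mul
      (ContinuousOn.rpow_const (by fun_prop) fun s hs => Or.inl (by linarith [hs.1]))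
  set h : ℝ := (1 + t / 2) ^ (-(1 / 2) : ℝ) with hh
  have hh0 : 0 ≤ h := by positivity
  have hpt : ∀ s ∈ Set.Icc 0 t, (1 + (t - s)) ^ (-(1 / 2) : ℝ) * (1 + s) ^ (-(1 / 2) : ℝ)
      ≤ h * ((1 + (t - s)) ^ (-(1 / 2) : ℝ) + (1 + s) ^ (-(1 / 2) : ℝ)) := by
    intro s hs
    have h1 : 0 ≤ (1 + (t - s)) ^ (-(1 / 2) : ℝ) :=
      Real.rpow_nonneg (by linarith [hs.2]) _
    have h2 : 0 ≤ (1 + s) ^ (-(1 / 2) : ℝ) := Real.rpow_nonneg (by linarith [hs.1]) _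
    rcases le_total s (t / 2) with hc | hc
    · have : (1 + (t - s)) ^ (-(1 / 2) : ℝ) ≤ h :=
        Real.rpow_le_rpow_of_nonpos (by linarith) (by linarith) (by norm_num)
      nlinarith
    · have : (1 + s) ^ (-(1 / 2) : ℝ) ≤ h :=
        Real.rpow_le_rpow_of_nonpos (by linarith) (by linarith) (by norm_num)
      nlinarith
  have hI : ∫ s in (0 : ℝ)..t, (1 + s) ^ (-(1 / 2) : ℝ) ≤ 2 * (1 + t) ^ (1 / 2 : ℝ) := by
    have e := intervalIntegral.integral_comp_add_left (a := 0) (b := t)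
      (fun s : ℝ => s ^ (-(1 / 2) : ℝ)) 1
    rw [e, integral_rpow (Or.inl (by norm_num))]
    norm_num
    linarith
  have hI' : ∫ s in (0 : ℝ)..t, (1 + (t - s)) ^ (-(1 / 2) : ℝ) ≤ 2 * (1 + t) ^ (1 / 2 : ℝ) := by
    have e := intervalIntegral.integral_comp_sub_left (a := 0) (b := t)
      (fun s : ℝ => (1 + s) ^ (-(1 / 2) : ℝ)) t
    rw [e, sub_self, sub_zero]; exact hI
  have hfin : h * (1 + t) ^ (1 / 2 : ℝ) ≤ 2 := by
    rw [hh, Real.rpow_neg (by positivity), inv_mul_le_iff₀ (by positivity)]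
    calc (1 + t) ^ (1 / 2 : ℝ) ≤ (4 * (1 + t / 2)) ^ (1 / 2 : ℝ) := by gcongr; linarith
      _ = (1 + t / 2) ^ (1 / 2 : ℝ) * 2 := by
        rw [Real.mul_rpow (by norm_num) (by positivity), show (4 : ℝ) = 2 ^ (2 : ℝ) by norm_num,
          ← Real.rpow_mul (by norm_num)]
        norm_num [mul_comm]
  calc _ ≤ ∫ s in (0 : ℝ)..t, h * ((1 + (t - s)) ^ (-(1 / 2) : ℝ) + (1 + s) ^ (-(1 / 2) : ℝ)) :=
        intervalIntegral.integral_mono_on ht hc3 ((hc1.add hc2).const_mul h) hpt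
    _ = h * ((∫ s in (0 : ℝ)..t, (1 + (t - s)) ^ (-(1 / 2) : ℝ))
        + ∫ s in (0 : ℝ)..t, (1 + s) ^ (-(1 / 2) : ℝ)) := by
        rw [intervalIntegral.integral_const_mul, intervalIntegral.integral_add hc1 hc2]
    _ ≤ h * (2 * (1 + t) ^ (1 / 2 : ℝ) + 2 * (1 + t) ^ (1 / 2 : ℝ)) := by gcongr
    _ = 4 * (h * (1 + t) ^ (1 / 2 : ℝ)) := by ring
    _ ≤ 8 := by linarith

end KernelDecay

/-! ### A contraction argument for quadratic equations. -/

section QuadraticEquation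

/-- A quadratic equation in a Banach space has a small solution for small right-hand sides. -/
lemma exists_eq_add_quadratic {Y : Type*} [NormedAddCommGroup Y] [CompleteSpace Y] {b : Y → Y}
    {M : ℝ} (hM : 0 < M) (h0 : b 0 = 0)
    (hb : ∀ y y', ‖b y - b y'‖ ≤ M * (‖y‖ + ‖y'‖) * ‖y - y'‖) {a : Y} (ha : ‖a‖ ≤ 1 / (8 * M)) :
    ∃ y, y = a + b y ∧ ‖y‖ ≤ 2 * ‖a‖ := by
  -- On the ball of radius `2‖a‖` the map has Lipschitz constant `4M‖a‖ ≤ 1/2`.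
  set S : Set Y := Metric.closedBall 0 (2 * ‖a‖) with hS
  have hmem : ∀ y, y ∈ S ↔ ‖y‖ ≤ 2 * ‖a‖ := fun y => by simp [hS]
  have ha' : M * ‖a‖ ≤ 1 / 8 := by
    rw [le_div_iff₀ (by positivity)] at ha
    linarith
  have hmaps : MapsTo (fun y => a + b y) S S := by
    intro y hy
    rw [hmem] at hy ⊢
    have h1 := hb y 0
    rw [h0, sub_zero, norm_zero, add_zero, sub_zero] at h1
    have h2 : ‖b y‖ ≤ ‖a‖ := by
      calc ‖b y‖ ≤ M * ‖y‖ * ‖y‖ := h1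
        _ ≤ M * (2 * ‖a‖) * (2 * ‖a‖) := by gcongr
        _ = 4 * (M * ‖a‖) * ‖a‖ := by ring
        _ ≤ 4 * (1 / 8) * ‖a‖ := by gcongr
        _ ≤ ‖a‖ := by linarith [norm_nonneg a]
    linarith [norm_add_le a (b y)]
  have hcontr : ContractingWith (1 / 2) (hmaps.restrict (fun y => a + b y) S S) := by
    refine ⟨by rw [← NNReal.coe_lt_coe]; norm_num, LipschitzWith.of_dist_le_mul fun y y' => ?_⟩
    rw [Subtype.dist_eq, Subtype.dist_eq, MapsTo.val_restrict_apply, MapsTo.val_restrict_apply,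
      dist_eq_norm, dist_eq_norm, add_sub_add_left_eq_sub]
    have hy := (hmem _).mp y.2
    have hy' := (hmem _).mp y'.2
    calc _ ≤ M * (‖(y : Y)‖ + ‖(y' : Y)‖) * ‖(y : Y) - y'‖ := hb _ _
      _ ≤ M * (2 * ‖a‖ + 2 * ‖a‖) * ‖(y : Y) - y'‖ := by gcongr
      _ = 4 * (M * ‖a‖) * ‖(y : Y) - y'‖ := by ring
      _ ≤ 4 * (1 / 8) * ‖(y : Y) - y'‖ := by gcongr
      _ = _ := by norm_num
  obtain ⟨y, hy, hfix, -⟩ := hcontr.exists_fixedPoint' (x := (0 : Y)) Metric.isClosed_closedBall.isComplete hmaps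
    ((hmem 0).mpr (by simp)) (edist_ne_top _ _)
  exact ⟨y, hfix.symm, (hmem y).mp hy⟩

end QuadraticEquation

/-! ### The Duhamel integral as a bilinear map on bounded continuous paths. -/

section DuhamelBilinear

open scoped BoundedContinuousFunction

variable {n : ℕ} {τ δ σ : ℝ}

/-- The symbol converting a weighted velocity to a velocity measured in `H^r`. -/
def liftSym (σ r α t x : ℝ) : ℝ := wt r 1 x * (decayWt σ r α t x)⁻¹

lemma measurable_liftSym (σ r α t : ℝ) : Measurable (liftSym σ r α t) :=
  (measurable_wt r 1).mul (measurable_decayWt σ r α t).inv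

lemma abs_liftSym_le {r α : ℝ} (hσ : 0 < σ) (hr : 0 ≤ r) (hα : 0 ≤ α) (t : ℝ) {x : ℝ}
    (hx : 0 ≤ x) : |liftSym σ r α t x| ≤ 1 := by
  have h := decayWt_pos (σ := σ) r α t hx
  rw [liftSym, abs_of_pos (mul_pos (wt_pos one_pos hx) (inv_pos.mpr h)), mul_inv_le_iff₀ h, one_mul]
  exact wt_one_le_decayWt hσ hr hα t hx

lemma isSymbol_liftSym {r α : ℝ} (hσ : 0 < σ) (hr : 0 ≤ r) (hα : 0 ≤ α) (t : ℝ) :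
    IsSymbol (liftSym σ r α t) :=
  .of_le (measurable_liftSym σ r α t) fun _ hx => abs_liftSym_le hσ hr hα t hx

lemma continuous_Op_liftSym {r α : ℝ} (hσ : 0 < σ) (hr : 0 ≤ r) (hα : 0 ≤ α) {f : ℝ → RealL2 n}
    (hf : Continuous f) : Continuous fun t => Op (liftSym σ r α t) (f t) :=
  continuous_Op_of_le (F := fun _ => 1) (measurable_liftSym σ r α)
    (fun x hx => continuous_const.mul ((continuous_decayWt hr σ α x).inv₀ fun t =>
      (decayWt_pos r α t hx).ne')) continuous_const (fun t _ hx => abs_liftSym_le hσ hr hα t hx) hf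

/-- The composed symbol is exactly `(1 + max t 0)^(-α)`: a bounded path has velocity of that size in
the norm at the current scale. -/
lemma norm_wt_div_liftSym_le {r α : ℝ} (hσ : 0 < σ) (hr : 0 ≤ r) (hα : 0 ≤ α) (t : ℝ)
    (f : RealL2 n) :
    ‖Op (fun x => wt r (scale σ t) x / wt r 1 x) (Op (liftSym σ r α t) f)‖
      ≤ (1 + max t 0) ^ (-α) * ‖f‖ := by
  rw [Op_Op (isSymbol_wt_div hr (scale_pos σ t) (scale_le_one hσ t))
    (isSymbol_liftSym hσ hr hα t)]
  refine norm_Op_le (((isSymbol_wt_div hr (scale_pos σ t) (scale_le_one hσ t)).mul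
    (isSymbol_liftSym hσ hr hα t)).measurable) (fun x hx => le_of_eq ?_) f
  have h1 := wt_pos (r := r) one_pos hx
  have h2 := wt_pos (r := r) (scale_pos σ t) hx
  have h3 := Real.rpow_pos_of_pos (one_add_max_pos t) α
  rw [liftSym, decayWt, Real.rpow_neg (one_add_max_pos t).le]
  rw [abs_of_pos (by positivity)]
  field_simp

lemma norm_inv_wt_liftSym_le {r α : ℝ} (hσ : 0 < σ) (hr : 0 ≤ r) (hα : 0 ≤ α) (t : ℝ)
    (f : RealL2 n) :
    ‖Op (fun x => (wt r 1 x)⁻¹) (Op (liftSym σ r α t) f)‖ ≤ (1 + max t 0) ^ (-α) * ‖f‖ := by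
  refine le_trans ?_ (norm_wt_div_liftSym_le hσ hr hα t f)
  have := norm_Op_le_Op (C := 1) (isSymbol_inv_wt r one_pos)
    (isSymbol_wt_div hr (scale_pos σ t) (scale_le_one hσ t)) (fun x hx => ?_)
    (Op (liftSym σ r α t) f)
  · simpa using this
  · have hw1 := wt_pos (r := r) one_pos hx
    have hws := one_le_wt (r := r) (scale_pos σ t) hx
    rw [one_mul, abs_div, abs_inv, div_eq_mul_inv]
    exact le_mul_of_one_le_left (by positivity) (hws.trans (le_abs_self _))

/-- The product of two velocities, lifted to `H^r`. -/
def liftMul (Q : RealL2 n →L[ℝ] RealL2 n →L[ℝ] RealL2 n) (σ r α β : ℝ) (f g : ℝ → RealL2 n)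
    (s : ℝ) : RealL2 n :=
  Q (Op (liftSym σ r α s) (f s)) (Op (liftSym σ r β s) (g s))

lemma continuous_liftMul (Q : RealL2 n →L[ℝ] RealL2 n →L[ℝ] RealL2 n) {r α β : ℝ} (hσ : 0 < σ)
    (hr : 0 ≤ r) (hα : 0 ≤ α) (hβ : 0 ≤ β) {f g : ℝ → RealL2 n} (hf : Continuous f)
    (hg : Continuous g) : Continuous (liftMul Q σ r α β f g) :=
  (Q.continuous.comp (continuous_Op_liftSym hσ hr hα hf)).clm_apply
    (continuous_Op_liftSym hσ hr hβ hg)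

/-- The symbol of the weighted Duhamel kernel. -/
def wtKerSym (τ δ σ r α t s x : ℝ) : ℝ :=
  decayWt σ r α t x * (kerSym τ δ σ (t - s) x * (wt r 1 x)⁻¹)

lemma measurable_wtKerSym (τ δ σ r α t s : ℝ) : Measurable (wtKerSym τ δ σ r α t s) :=
  (measurable_decayWt σ r α t).mul
    ((measurable_kerSym τ δ σ (t - s)).mul (measurable_wt r 1).inv)

lemma exists_abs_wtKerSym_le (hτ : 0 < τ) (hδ : 0 < δ) (hσ : 0 < σ) {r : ℝ} (α : ℝ) (hr : 0 ≤ r) :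
    ∃ C : ℝ, ∀ t s x, 0 ≤ x → |wtKerSym τ δ σ r α t s x| ≤ growth σ r α t * C := by
  obtain ⟨C, -, H⟩ := exists_sym_bound hτ hδ σ
  refine ⟨C, fun t s x hx => ?_⟩
  rw [wtKerSym, abs_mul, abs_mul, abs_of_pos (decayWt_pos r α t hx),
    abs_of_pos (inv_pos.mpr (wt_pos one_pos hx)), mul_left_comm, mul_comm]
  have := decayWt_mul_inv_le (α := α) hσ hr t hx
  gcongr
  · exact growth_nonneg _ _ _ _
  · exact (H _ x hx).2

lemma isSymbol_wtKerSym (hτ : 0 < τ) (hδ : 0 < δ) (hσ : 0 < σ) {r : ℝ} (α : ℝ) (hr : 0 ≤ r)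
    (t s : ℝ) : IsSymbol (wtKerSym τ δ σ r α t s) := by
  obtain ⟨C, H⟩ := exists_abs_wtKerSym_le hτ hδ hσ α hr
  exact .of_le (measurable_wtKerSym τ δ σ r α t s) (H t s)

lemma continuous_Op_wtKerSym (hτ : 0 < τ) (hδ : 0 < δ) (hσ : 0 < σ) {r : ℝ} (α : ℝ) (hr : 0 ≤ r)
    {q : ℝ → RealL2 n} (hq : Continuous q) :
    Continuous fun p : ℝ × ℝ => Op (wtKerSym τ δ σ r α p.1 p.2) (q p.2) := by
  obtain ⟨C, H⟩ := exists_abs_wtKerSym_le hτ hδ hσ α hr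
  refine continuous_Op_of_le (m := fun p : ℝ × ℝ => wtKerSym τ δ σ r α p.1 p.2)
    (F := fun p => growth σ r α p.1 * C) (fun p => measurable_wtKerSym _ _ _ _ _ _ _)
    (fun x _ => ?_) (((continuous_growth σ r α).comp continuous_fst).mul_const _)
    (fun p x hx => H _ _ x hx) (hq.comp continuous_snd)
  exact ((continuous_decayWt hr σ α x).comp continuous_fst).mul
    (((continuous_kerSym τ δ σ x).comp (continuous_fst.sub continuous_snd)).mul_const _)

/-- The Duhamel integral as a bounded bilinear map on the solution space. -/
lemma exists_duhamelBilin (hτ : 0 < τ) (hδ : 0 < δ) (hσ : 0 < σ) {r : ℝ}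
    (hr : (n : ℝ) / 2 < r) (Q : RealL2 n →L[ℝ] RealL2 n →L[ℝ] RealL2 n) {CQ : ℝ} (hCQ : 0 < CQ)
    (hQ : ∀ u v : RealL2 n,
      (∀ R, 0 < R → R ≤ 1 → ‖Op (fun x => wt r R x / wt r 1 x) (Q u v)‖ ≤ CQ * R ^ ((n : ℝ) / 2) *
        ‖Op (fun x => wt r R x / wt r 1 x) u‖ * ‖Op (fun x => wt r R x / wt r 1 x) v‖) ∧
      ∀ᵐ ξ, ‖fourierL2 (Op (fun x => (wt r 1 x)⁻¹) (Q u v)) ξ‖ ≤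
        ‖Op (fun x => (wt r 1 x)⁻¹) u‖ * ‖Op (fun x => (wt r 1 x)⁻¹) v‖)
    {a b m : ℝ} (ha : 1 ≤ a ∧ a < 2) (hb : 1 ≤ b ∧ b < 2) (hm : 1 ≤ m ∧ m < 2)
    (hθ : σ ≤ n * (1 / a + 1 / b - 1 / m)) :
    ∃ D : (ℝ →ᵇ RealL2 n) →L[ℝ] (ℝ →ᵇ RealL2 n) →L[ℝ] (ℝ →ᵇ RealL2 n), ∀ f g t,
      D f g t = ∫ s in (0 : ℝ)..max t 0, Op (wtKerSym τ δ σ r (rate n σ m) (max t 0) s)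
        (liftMul Q σ r (rate n σ a) (rate n σ b) f g s) := by
  have hr0 : 0 ≤ r := (lt_of_le_of_lt (by positivity) hr).le
  have hα := rate_nonneg n hσ ha.1 ha.2
  have hβ := rate_nonneg n hσ hb.1 hb.2
  obtain ⟨C, hC, H⟩ := exists_norm_kernel_le hτ hδ hσ hr ha.1 hb.1 hm.1 hm.2 hθ
  -- Time is frozen at `max t 0`, so that `J` takes values in paths on the whole line.
  set J : (ℝ → RealL2 n) → (ℝ → RealL2 n) → ℝ → RealL2 n := fun f g t =>
    ∫ s in (0 : ℝ)..max t 0, Op (wtKerSym τ δ σ r (rate n σ m) (max t 0) s)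
        (liftMul Q σ r (rate n σ a) (rate n σ b) f g s) with hJ
  have hqc : ∀ f g : ℝ →ᵇ RealL2 n,
      Continuous (liftMul Q σ r (rate n σ a) (rate n σ b) f g) := fun f g =>
    continuous_liftMul Q hσ hr0 hα hβ f.continuous g.continuous
  have hint : ∀ (f g : ℝ →ᵇ RealL2 n) (t : ℝ), Continuous fun s =>
      Op (wtKerSym τ δ σ r (rate n σ m) t s)
        (liftMul Q σ r (rate n σ a) (rate n σ b) f g s) := fun f g t =>
    (continuous_Op_wtKerSym hτ hδ hσ (rate n σ m) hr0 (hqc f g)).comp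
      (continuous_const.prodMk continuous_id)
  have hJc : ∀ f g : ℝ →ᵇ RealL2 n, Continuous (J f g) := by
    intro f g
    have h := intervalIntegral.continuous_parametric_intervalIntegral_of_continuous (μ := volume)
      (a₀ := (0 : ℝ)) (f := fun t s => Op (wtKerSym τ δ σ r (rate n σ m) t s)
        (liftMul Q σ r (rate n σ a) (rate n σ b) f g s)) (s := fun t => t)
      (continuous_Op_wtKerSym hτ hδ hσ (rate n σ m) hr0 (hqc f g)) continuous_id
    exact h.comp (continuous_id.max continuous_const)
  have hbound : ∀ (f g : ℝ →ᵇ RealL2 n) t, ‖J f g t‖ ≤ C * (CQ + 1) * 8 * ‖f‖ * ‖g‖ := by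
    intro f g t
    have ht : 0 ≤ max t 0 := le_max_right _ _
    set T := max t 0 with hT
    -- The constant `CQ + 1` dominates both the algebra constant `CQ` and the constant `1` of the
    -- sup bound, so one `Γ` serves both hypotheses of the kernel estimate.
    have hpt : ∀ s ∈ Set.Icc 0 T, ‖Op (wtKerSym τ δ σ r (rate n σ m) T s)
        (liftMul Q σ r (rate n σ a) (rate n σ b) f g s)‖ ≤ C * ((CQ + 1) * ‖f‖ * ‖g‖) *
          ((1 + (T - s)) ^ (-(1 / 2) : ℝ) * (1 + s) ^ (-(1 / 2) : ℝ)) := by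
      intro s hs
      have hs0 : max s 0 = s := max_eq_left hs.1
      have h1s : 0 < 1 + s := by linarith [hs.1]
      have e : (1 + s) ^ (-(rate n σ a + rate n σ b))
          = (1 + s) ^ (-rate n σ a) * (1 + s) ^ (-rate n σ b) := by
        rw [← Real.rpow_add h1s]; congr 1; ring
      have hu := norm_wt_div_liftSym_le hσ hr0 hα s (f s)
      have hv := norm_wt_div_liftSym_le hσ hr0 hβ s (g s)
      have hu' := norm_inv_wt_liftSym_le hσ hr0 hα s (f s)
      have hv' := norm_inv_wt_liftSym_le hσ hr0 hβ s (g s)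
      rw [hs0] at hu hv hu' hv'
      have hf := f.norm_coe_le_norm s
      have hg := g.norm_coe_le_norm s
      have hRs := scale_pos σ s
      obtain ⟨hQ1, hQ2⟩ := hQ (Op (liftSym σ r (rate n σ a) s) (f s))
        (Op (liftSym σ r (rate n σ b) s) (g s))
      refine H _ _ s T (by positivity) hs.1 hs.2 ?_ ?_
      · refine (hQ1 _ hRs (scale_le_one hσ s)).trans ?_
        calc _ ≤ CQ * scale σ s ^ ((n : ℝ) / 2) * ((1 + s) ^ (-rate n σ a) * ‖f‖) *
              ((1 + s) ^ (-rate n σ b) * ‖g‖) := by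
              gcongr
              · exact hu.trans (by gcongr)
              · exact hv.trans (by gcongr)
          _ = CQ * (‖f‖ * ‖g‖ * (1 + s) ^ (-(rate n σ a + rate n σ b)) *
              scale σ s ^ ((n : ℝ) / 2)) := by rw [e]; ring
          _ ≤ (CQ + 1) * (‖f‖ * ‖g‖ * (1 + s) ^ (-(rate n σ a + rate n σ b)) *
              scale σ s ^ ((n : ℝ) / 2)) := by
              gcongr; linarith
          _ = _ := by ring
      · filter_upwards [hQ2] with ξ hξ
        refine hξ.trans ?_
        calc _ ≤ ((1 + s) ^ (-rate n σ a) * ‖f‖) * ((1 + s) ^ (-rate n σ b) * ‖g‖) := by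
              gcongr
              · exact hu'.trans (by gcongr)
              · exact hv'.trans (by gcongr)
          _ = 1 * (‖f‖ * ‖g‖ * (1 + s) ^ (-(rate n σ a + rate n σ b))) := by rw [e]; ring
          _ ≤ (CQ + 1) * (‖f‖ * ‖g‖ * (1 + s) ^ (-(rate n σ a + rate n σ b))) := by
              gcongr; linarith
          _ = _ := by ring
    have hci : IntervalIntegrable (fun s : ℝ => C * ((CQ + 1) * ‖f‖ * ‖g‖) *
        ((1 + (T - s)) ^ (-(1 / 2) : ℝ) * (1 + s) ^ (-(1 / 2) : ℝ))) volume 0 T := by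
      apply ContinuousOn.intervalIntegrable
      rw [Set.uIcc_of_le ht]
      refine continuousOn_const.mul ?_
      exact (ContinuousOn.rpow_const (by fun_prop) fun s hs => Or.inl (by linarith [hs.2])).mul
        (ContinuousOn.rpow_const (by fun_prop) fun s hs => Or.inl (by linarith [hs.1]))
    calc ‖J f g t‖ ≤ ∫ s in (0 : ℝ)..T, C * ((CQ + 1) * ‖f‖ * ‖g‖) *
          ((1 + (T - s)) ^ (-(1 / 2) : ℝ) * (1 + s) ^ (-(1 / 2) : ℝ)) :=
          intervalIntegral.norm_integral_le_of_norm_le ht (ae_of_all _ fun s hs =>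
            hpt s (Set.Ioc_subset_Icc_self hs)) hci
      _ ≤ C * ((CQ + 1) * ‖f‖ * ‖g‖) * 8 := by
          rw [intervalIntegral.integral_const_mul]
          gcongr
          exact integral_rpow_mul_rpow_le ht
      _ = _ := by ring
  have hadd : ∀ (f f' g : ℝ →ᵇ RealL2 n) t, J (f + f') g t = J f g t + J f' g t := by
    intro f f' g t
    rw [hJ]
    simp only
    rw [← intervalIntegral.integral_add ((hint f g _).intervalIntegrable _ _)
      ((hint f' g _).intervalIntegrable _ _)]
    congr 1
    funext s
    simp [liftMul]
  have hsmul : ∀ (c : ℝ) (f g : ℝ →ᵇ RealL2 n) t, J (c • f) g t = c • J f g t := by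
    intro c f g t
    rw [hJ]
    simp only
    rw [← intervalIntegral.integral_smul]
    congr 1
    funext s
    simp [liftMul]
  have hadd' : ∀ (f g g' : ℝ →ᵇ RealL2 n) t, J f (g + g') t = J f g t + J f g' t := by
    intro f g g' t
    rw [hJ]
    simp only
    rw [← intervalIntegral.integral_add ((hint f g _).intervalIntegrable _ _)
      ((hint f g' _).intervalIntegrable _ _)]
    congr 1
    funext s
    simp [liftMul]
  have hsmul' : ∀ (c : ℝ) (f g : ℝ →ᵇ RealL2 n) t, J f (c • g) t = c • J f g t := by
    intro c f g t
    rw [hJ]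
    simp only
    rw [← intervalIntegral.integral_smul]
    congr 1
    funext s
    simp [liftMul]
  refine ⟨LinearMap.mkContinuous₂ (LinearMap.mk₂ ℝ
    (fun f g => BoundedContinuousFunction.ofNormedAddCommGroup (J f g) (hJc f g) _ (hbound f g))
    (fun f f' g => ?_) (fun c f g => ?_) (fun f g g' => ?_) (fun c f g => ?_))
    (C * (CQ + 1) * 8) (fun f g => ?_), fun f g t => rfl⟩
  · ext1 t; exact hadd f f' g t
  · ext1 t; exact hsmul c f g t
  · ext1 t; exact hadd' f g g' t
  · ext1 t; exact hsmul' c f g t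
  · rw [BoundedContinuousFunction.norm_le (by positivity)]
    exact hbound f g

end DuhamelBilinear

/-! ### The coupled quadratic system. -/

section QuadraticSystem

variable {E : Type*} [NormedAddCommGroup E] [NormedSpace ℝ E]

lemma norm_bilin_sub_le (D : E →L[ℝ] E →L[ℝ] E) {u v u' v' : E} {A A' d : ℝ} (hv : ‖v‖ ≤ A)
    (hu' : ‖u'‖ ≤ A') (hd : ‖u - u'‖ ≤ d) (hd' : ‖v - v'‖ ≤ d) :
    ‖D u v - D u' v'‖ ≤ ‖D‖ * ((A + A') * d) := by
  have e : D u v - D u' v' = D (u - u') v + D u' (v - v') := by simp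
  have hd0 : 0 ≤ d := (norm_nonneg _).trans hd
  have hA : 0 ≤ A := (norm_nonneg _).trans hv
  have hA' : 0 ≤ A' := (norm_nonneg _).trans hu'
  rw [e]
  calc _ ≤ ‖D‖ * ‖u - u'‖ * ‖v‖ + ‖D‖ * ‖u'‖ * ‖v - v'‖ :=
        (norm_add_le _ _).trans (add_le_add (D.le_opNorm₂ _ _) (D.le_opNorm₂ _ _))
    _ ≤ ‖D‖ * d * A + ‖D‖ * A' * d := by gcongr
    _ = _ := by ring

/-- Small solutions of a coupled system of quadratic equations. -/
lemma exists_quadratic_system [CompleteSpace E] (D₁ D₂ D₃ : E →L[ℝ] E →L[ℝ] E) (κ₁ κ₂ : ℝ) :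
    ∃ η : ℝ, 0 < η ∧ ∀ (u v : E) (e : ℝ), ‖u‖ ≤ e → ‖v‖ ≤ e → e ≤ η →
      ∃ f g, f = u + κ₁ • (D₁ f f - D₂ g g) ∧ g = v + κ₂ • D₃ f g ∧ ‖f‖ ≤ 2 * e ∧
        ‖g‖ ≤ 2 * e := by
  -- The system is one quadratic equation on `E × E` with the sup norm.
  set B : E × E → E × E :=
    fun p => (κ₁ • (D₁ p.1 p.1 - D₂ p.2 p.2), κ₂ • D₃ p.1 p.2) with hB
  set M : ℝ := |κ₁| * (‖D₁‖ + ‖D₂‖) + |κ₂| * ‖D₃‖ + 1 with hM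
  have hM0 : 0 < M := by positivity
  have hlip : ∀ p p', ‖B p - B p'‖ ≤ M * (‖p‖ + ‖p'‖) * ‖p - p'‖ := by
    intro p p'
    have f1 : ‖p.1‖ ≤ ‖p‖ := norm_fst_le p
    have f2 : ‖p.2‖ ≤ ‖p‖ := norm_snd_le p
    have f1' : ‖p'.1‖ ≤ ‖p'‖ := norm_fst_le p'
    have f2' : ‖p'.2‖ ≤ ‖p'‖ := norm_snd_le p'
    have d1 : ‖p.1 - p'.1‖ ≤ ‖p - p'‖ := norm_fst_le (p - p')
    have d2 : ‖p.2 - p'.2‖ ≤ ‖p - p'‖ := norm_snd_le (p - p')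
    have b1 := norm_bilin_sub_le D₁ f1 f1' d1 d1
    have b2 := norm_bilin_sub_le D₂ f2 f2' d2 d2
    have b3 := norm_bilin_sub_le D₃ f2 f1' d1 d2
    set S := (‖p‖ + ‖p'‖) * ‖p - p'‖ with hS
    have hS0 : 0 ≤ S := by positivity
    have hc1 : ‖(B p - B p').1‖ ≤ |κ₁| * (‖D₁‖ + ‖D₂‖) * S := by
      have e : (B p - B p').1 = κ₁ • ((D₁ p.1 p.1 - D₁ p'.1 p'.1) - (D₂ p.2 p.2 - D₂ p'.2 p'.2)) := by
        rw [hB, Prod.fst_sub, ← smul_sub]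
        congr 1; abel
      rw [e, norm_smul, Real.norm_eq_abs, mul_assoc]
      gcongr
      refine (norm_sub_le _ _).trans ?_
      linarith
    have hc2 : ‖(B p - B p').2‖ ≤ |κ₂| * ‖D₃‖ * S := by
      have e : (B p - B p').2 = κ₂ • (D₃ p.1 p.2 - D₃ p'.1 p'.2) := by
        rw [hB, Prod.snd_sub, ← smul_sub]
      rw [e, norm_smul, Real.norm_eq_abs, mul_assoc]
      gcongr
    have g1 : 0 ≤ |κ₁| * (‖D₁‖ + ‖D₂‖) * S := by positivity
    have g2 : 0 ≤ |κ₂| * ‖D₃‖ * S := by positivity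
    rw [mul_assoc, ← hS, Prod.norm_def]
    refine max_le (hc1.trans ?_) (hc2.trans ?_) <;> rw [hM] <;> linarith
  refine ⟨1 / (8 * M), by positivity, fun u v e hu hv he => ?_⟩
  have huv : ‖(u, v)‖ ≤ e := by rw [Prod.norm_def]; exact max_le hu hv
  obtain ⟨⟨f, g⟩, hfg, hle⟩ := exists_eq_add_quadratic hM0 (by simp [hB]) hlip (huv.trans he)
  exact ⟨f, g, congrArg Prod.fst hfg, congrArg Prod.snd hfg,
    by linarith [norm_fst_le (f, g)], by linarith [norm_snd_le (f, g)]⟩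

end QuadraticSystem

/-! ### Global solutions of the weighted integral equations. -/

section GlobalPaths

open scoped BoundedContinuousFunction

variable {n : ℕ} {τ δ σ : ℝ}

/-- The velocity corresponding to a path in the solution space. -/
def velocity (σ r α : ℝ) (f : ℝ → RealL2 n) (t : ℝ) : RealL2 n :=
  Op (fun x => (decayWt σ r α t x)⁻¹) (f t)

lemma abs_inv_decayWt_le (r α t : ℝ) {x : ℝ} (hx : 0 ≤ x) :
    |(decayWt σ r α t x)⁻¹| ≤ (1 + max t 0) ^ (-α) := by
  have h1 := one_le_wt (r := r) (scale_pos σ t) hx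
  have h2 := Real.rpow_pos_of_pos (one_add_max_pos t) α
  rw [abs_of_pos (inv_pos.mpr (decayWt_pos r α t hx)), Real.rpow_neg (one_add_max_pos t).le]
  exact inv_anti₀ h2 (le_mul_of_one_le_right h2.le h1)

lemma isSymbol_inv_decayWt (σ r α t : ℝ) : IsSymbol fun x => (decayWt σ r α t x)⁻¹ :=
  .of_le (measurable_decayWt σ r α t).inv fun _ hx => abs_inv_decayWt_le r α t hx

/-- Factors the velocity through its lift to `H^r`, where the bilinear product acts. -/
lemma velocity_eq {r α : ℝ} (hσ : 0 < σ) (hr : 0 ≤ r) (hα : 0 ≤ α) (f : ℝ → RealL2 n) (t : ℝ) :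
    velocity σ r α f t = Op (fun x => (wt r 1 x)⁻¹) (Op (liftSym σ r α t) (f t)) := by
  rw [Op_Op (isSymbol_inv_wt r one_pos) (isSymbol_liftSym hσ hr hα t), velocity,
    Op_congr (isSymbol_inv_decayWt σ r α t)
      ((isSymbol_inv_wt r one_pos).mul (isSymbol_liftSym hσ hr hα t))]
  intro x hx
  rw [liftSym, inv_mul_cancel_left₀ (wt_pos one_pos hx).ne']

/-- The linear evolution in the solution space. -/
lemma exists_linear_path (n : ℕ) (hτ : 0 < τ) (hδ : 0 < δ) (hσ : 0 < σ) {r α : ℝ} (hr : σ ≤ r)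
    (hα : 0 ≤ α) : ∃ C : ℝ, 0 < C ∧ ∀ (z : Fin 3 → RealL2 n) (ε : ℝ), (∀ j, ‖z j‖ ≤ ε) →
      (∀ j R, 0 < R → R ≤ 1 →
        ‖Op (fun x => (wt r R x)⁻¹) (Op (baseSym σ r j) (z j))‖ ≤ R ^ (2 * σ * α) * ε) →
      ∃ a : ℝ →ᵇ RealL2 n, ‖a‖ ≤ C * ε ∧ ∀ t, a t = ∑ j, Op (fun x => decayWt σ r α t x *
        (propSym τ δ σ j t x * baseSym σ r j x)) (z j) := by
  obtain ⟨C, hC, H⟩ := exists_norm_data_le (n := n) hτ hδ hσ hr hα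
  refine ⟨3 * C, by positivity, fun z ε hz hlow => ?_⟩
  have hb : ∀ t, ‖∑ j, Op (fun x => decayWt σ r α t x *
        (propSym τ δ σ j t x * baseSym σ r j x)) (z j)‖ ≤ 3 * C * ε := by
    intro t
    refine (norm_sum_le_of_le _ fun j _ => H j (z j) ε (hz j) (hlow j) t).trans (le_of_eq ?_)
    simp; ring
  refine ⟨BoundedContinuousFunction.ofNormedAddCommGroup _
    (continuous_finsetSum _ fun j _ => continuous_Op_data hτ hδ hσ (hσ.le.trans hr) j (z j)) _ hb,
    ?_, fun t => rfl⟩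
  rw [BoundedContinuousFunction.norm_le ((norm_nonneg _).trans (hb 0))]
  exact hb

lemma velocity_data (hτ : 0 < τ) (hδ : 0 < δ) (hσ : 0 < σ) {r α : ℝ} (hr : σ ≤ r) (j : Fin 3)
    (z : RealL2 n) (t : ℝ) :
    Op (fun x => (decayWt σ r α t x)⁻¹) (Op (fun x => decayWt σ r α t x *
      (propSym τ δ σ j t x * baseSym σ r j x)) z)
      = Op (propSym τ δ σ j t) (Op (baseSym σ r j) z) := by
  have hr0 : 0 ≤ r := hσ.le.trans hr
  have hb := isSymbol_baseSym hσ.le hr j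
  have hp := isSymbol_propSym hτ hδ σ j t
  have hs : IsSymbol fun x => decayWt σ r α t x * (propSym τ δ σ j t x * baseSym σ r j x) := by
    obtain ⟨C, hC, μ, hμ, H⟩ := exists_propSym_bounds hτ hδ σ r
    have e : propSym τ δ σ j t = propSym τ δ σ j (max t 0) := by funext x; simp [propSym]
    refine .of_le (C := growth σ r α t * (C * (Real.exp (-μ * max t 0) + 1)))
      ((measurable_decayWt σ r α t).mul (hp.measurable.mul hb.measurable)) fun x hx => ?_
    have hD := decayWt_pos (σ := σ) r α t hx
    have hl := lowExp_le_one (q := x ^ σ) hμ.le (le_max_right t 0)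
    have hw := wt_pos (r := r) one_pos hx
    rw [abs_mul, abs_of_pos hD, e]
    calc _ ≤ decayWt σ r α t x * (C * (Real.exp (-μ * max t 0) + 1) * (wt r 1 x)⁻¹) := by
          gcongr
          refine (H j _ x (le_max_right t 0) hx).2.1.trans ?_
          gcongr
      _ = decayWt σ r α t x * (wt r 1 x)⁻¹ * (C * (Real.exp (-μ * max t 0) + 1)) := by ring
      _ ≤ _ := by
          gcongr
          exact decayWt_mul_inv_le hσ hr0 t hx
  rw [Op_Op (isSymbol_inv_decayWt σ r α t) hs, Op_Op hp hb,
    Op_congr ((isSymbol_inv_decayWt σ r α t).mul hs) (hp.mul hb)]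
  intro x hx
  rw [inv_mul_cancel_left₀ (decayWt_pos r α t hx).ne']

/-- Dividing by the weight at time `t` strips it from the kernel; the factor `(wt r 1)⁻¹` left over
turns the lifted product into the product itself. -/
lemma velocity_kernel (hτ : 0 < τ) (hδ : 0 < δ) (hσ : 0 < σ) {r : ℝ} (α : ℝ) (hr : 0 ≤ r)
    (q : RealL2 n) (t s : ℝ) :
    Op (fun x => (decayWt σ r α t x)⁻¹) (Op (wtKerSym τ δ σ r α t s) q)
      = Op (kerSym τ δ σ (t - s)) (Op (fun x => (wt r 1 x)⁻¹) q) := by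
  have hk := isSymbol_kerSym hτ hδ σ (t - s)
  have hw := isSymbol_inv_wt r one_pos
  have hwk := isSymbol_wtKerSym hτ hδ hσ α hr t s
  rw [Op_Op (isSymbol_inv_decayWt σ r α t) hwk, Op_Op hk hw,
    Op_congr ((isSymbol_inv_decayWt σ r α t).mul hwk) (hk.mul hw)]
  intro x hx
  rw [wtKerSym, inv_mul_cancel_left₀ (decayWt_pos r α t hx).ne']

/-- Solutions of the integral equation in the solution space are mild solutions. -/
lemma velocity_eq_mild (hτ : 0 < τ) (hδ : 0 < δ) (hσ : 0 < σ) {r : ℝ} (α : ℝ) (hr : σ ≤ r)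
    (κ : ℝ) (z : Fin 3 → RealL2 n) {q f : ℝ → RealL2 n} (hq : Continuous q) {t : ℝ} (ht : 0 ≤ t)
    (h : f t = ∑ j, Op (fun x => decayWt σ r α t x *
        (propSym τ δ σ j t x * baseSym σ r j x)) (z j)
      + κ • ∫ s in (0 : ℝ)..max t 0, Op (wtKerSym τ δ σ r α (max t 0) s) (q s)) :
    velocity σ r α f t = mild τ δ σ κ (Op (baseSym σ r 0) (z 0)) (Op (baseSym σ r 1) (z 1))
      (Op (baseSym σ r 2) (z 2)) (fun s => Op (fun x => (wt r 1 x)⁻¹) (q s)) t := by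
  have hr0 : 0 ≤ r := hσ.le.trans hr
  have hc : Continuous fun s => Op (wtKerSym τ δ σ r α t s) (q s) :=
    (continuous_Op_wtKerSym hτ hδ hσ α hr0 hq).comp (continuous_const.prodMk continuous_id)
  rw [max_eq_left ht] at h
  rw [velocity, h, map_add, map_smul, map_sum,
    ← ContinuousLinearMap.intervalIntegral_comp_comm _ (hc.intervalIntegrable _ _), mild]
  simp only [velocity_data hτ hδ hσ hr, velocity_kernel hτ hδ hσ α hr0, Fin.sum_univ_three]

/-- Global solvability of the integral equations for small data. -/
lemma exists_global_paths (hτ : 0 < τ) (hδ : 0 < δ) (hσ : 0 < σ) {r : ℝ}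
    (hr : (n : ℝ) / 2 < r) (hσr : σ ≤ r) (Q : RealL2 n →L[ℝ] RealL2 n →L[ℝ] RealL2 n) {CQ : ℝ}
    (hCQ : 0 < CQ) (hQ : ∀ u v : RealL2 n,
      (∀ R, 0 < R → R ≤ 1 → ‖Op (fun x => wt r R x / wt r 1 x) (Q u v)‖ ≤ CQ * R ^ ((n : ℝ) / 2) *
        ‖Op (fun x => wt r R x / wt r 1 x) u‖ * ‖Op (fun x => wt r R x / wt r 1 x) v‖) ∧
      ∀ᵐ ξ, ‖fourierL2 (Op (fun x => (wt r 1 x)⁻¹) (Q u v)) ξ‖ ≤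
        ‖Op (fun x => (wt r 1 x)⁻¹) u‖ * ‖Op (fun x => (wt r 1 x)⁻¹) v‖)
    {a b : ℝ} (ha : 1 ≤ a ∧ a < 2) (hb : 1 ≤ b ∧ b < 2)
    (h₁ : σ ≤ n * (1 / a + 1 / a - 1 / a)) (h₂ : σ ≤ n * (1 / b + 1 / b - 1 / a))
    (h₃ : σ ≤ n * (1 / a + 1 / b - 1 / b)) (κ₁ κ₂ : ℝ) :
    ∃ ε₁ : ℝ, 0 < ε₁ ∧ ∃ C : ℝ, 0 < C ∧ ∀ (z y : Fin 3 → RealL2 n) (ε : ℝ), ε ≤ ε₁ →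
      (∀ j, ‖z j‖ ≤ ε) → (∀ j R, 0 < R → R ≤ 1 →
        ‖Op (fun x => (wt r R x)⁻¹) (Op (baseSym σ r j) (z j))‖
          ≤ R ^ (2 * σ * rate n σ a) * ε) →
      (∀ j, ‖y j‖ ≤ ε) → (∀ j R, 0 < R → R ≤ 1 →
        ‖Op (fun x => (wt r R x)⁻¹) (Op (baseSym σ r j) (y j))‖
          ≤ R ^ (2 * σ * rate n σ b) * ε) →
      ∃ f g : ℝ →ᵇ RealL2 n, ‖f‖ ≤ C * ε ∧ ‖g‖ ≤ C * ε ∧ ∀ t, 0 ≤ t →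
        velocity σ r (rate n σ a) f t = mild τ δ σ κ₁ (Op (baseSym σ r 0) (z 0))
          (Op (baseSym σ r 1) (z 1)) (Op (baseSym σ r 2) (z 2))
          (fun s => Op (fun x => (wt r 1 x)⁻¹)
            (liftMul Q σ r (rate n σ a) (rate n σ a) f f s
              - liftMul Q σ r (rate n σ b) (rate n σ b) g g s)) t ∧
        velocity σ r (rate n σ b) g t = mild τ δ σ κ₂ (Op (baseSym σ r 0) (y 0))
          (Op (baseSym σ r 1) (y 1)) (Op (baseSym σ r 2) (y 2))
          (fun s => Op (fun x => (wt r 1 x)⁻¹)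
            (liftMul Q σ r (rate n σ a) (rate n σ b) f g s)) t := by
  have hr0 : 0 ≤ r := hσ.le.trans hσr
  have hα := rate_nonneg n hσ ha.1 ha.2
  have hβ := rate_nonneg n hσ hb.1 hb.2
  -- `D₁` and `D₂` carry the two squares in the first equation, `D₂` passing from the decay rate of
  -- `v` to that of `u`; `D₃` carries the mixed product in the second.
  obtain ⟨D₁, hD₁⟩ := exists_duhamelBilin hτ hδ hσ hr Q hCQ hQ ha ha ha h₁
  obtain ⟨D₂, hD₂⟩ := exists_duhamelBilin hτ hδ hσ hr Q hCQ hQ hb hb ha h₂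
  obtain ⟨D₃, hD₃⟩ := exists_duhamelBilin hτ hδ hσ hr Q hCQ hQ ha hb hb h₃
  obtain ⟨C₁, hC₁, H₁⟩ := exists_linear_path n hτ hδ hσ hσr hα
  obtain ⟨C₂, hC₂, H₂⟩ := exists_linear_path n hτ hδ hσ hσr hβ
  obtain ⟨η, hη, H⟩ := exists_quadratic_system D₁ D₂ D₃ κ₁ κ₂
  -- The linear parts have size at most `max C₁ C₂ * ε`, which must not exceed `η`; the fixed point
  -- at most doubles it.
  refine ⟨η / (max C₁ C₂), by positivity, 2 * max C₁ C₂, by positivity,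
    fun z y ε hε hz hzl hy hyl => ?_⟩
  obtain ⟨u, hu, hut⟩ := H₁ z ε hz hzl
  obtain ⟨v, hv, hvt⟩ := H₂ y ε hy hyl
  have hε0 : 0 ≤ ε := (norm_nonneg _).trans (hz 0)
  rw [le_div_iff₀ (by positivity)] at hε
  obtain ⟨f, g, hf, hg, hfn, hgn⟩ := H u v (max C₁ C₂ * ε)
    (hu.trans (by gcongr; exact le_max_left _ _)) (hv.trans (by gcongr; exact le_max_right _ _))
    (by linarith)
  refine ⟨f, g, ?_, ?_, fun t ht => ⟨?_, ?_⟩⟩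
  · linarith
  · linarith
  · have hq1 := continuous_liftMul Q hσ hr0 hα hα f.continuous f.continuous
    have hq2 := continuous_liftMul Q hσ hr0 hβ hβ g.continuous g.continuous
    refine velocity_eq_mild hτ hδ hσ _ hσr κ₁ z
      (q := fun s => liftMul Q σ r (rate n σ a) (rate n σ a) f f s
        - liftMul Q σ r (rate n σ b) (rate n σ b) g g s) (hq1.sub hq2) ht ?_
    have h := DFunLike.congr_fun hf t
    simp only [BoundedContinuousFunction.coe_add, Pi.add_apply,
      BoundedContinuousFunction.coe_smul, BoundedContinuousFunction.coe_sub, Pi.sub_apply,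
      hD₁, hD₂, hut] at h
    rw [h]
    congr 2
    have hi : ∀ {q : ℝ → RealL2 n}, Continuous q → IntervalIntegrable (fun s =>
        Op (wtKerSym τ δ σ r (rate n σ a) (max t 0) s) (q s)) volume 0 (max t 0) := fun hq =>
      ((continuous_Op_wtKerSym hτ hδ hσ (rate n σ a) hr0 hq).comp
        (continuous_const.prodMk continuous_id)).intervalIntegrable _ _
    rw [← intervalIntegral.integral_sub (hi hq1) (hi hq2)]
    simp only [map_sub]
  · refine velocity_eq_mild hτ hδ hσ _ hσr κ₂ y
      (continuous_liftMul Q hσ hr0 hα hβ f.continuous g.continuous) ht ?_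
    have h := DFunLike.congr_fun hg t
    simp only [BoundedContinuousFunction.coe_add, Pi.add_apply,
      BoundedContinuousFunction.coe_smul, hD₃, hvt] at h
    exact h

end GlobalPaths

/-! ### Comparison with the Sobolev norms of the statement. -/

section SobolevNorms

variable {n : ℕ} {σ : ℝ}

lemma lebesgueENorm_two (f : RealL2 n) : lebesgueENorm 2 f = ‖f‖ₑ := by
  rw [lebesgueENorm, Lp.enorm_def]; norm_num

/-- With `wt_one_le`, this makes `wt r 1` equivalent to `⟨ξ⟩^r`. -/
lemma one_add_sq_rpow_le {r x : ℝ} (hr : 0 ≤ r) (hx : 0 ≤ x) :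
    (1 + x ^ 2) ^ (r / 2) ≤ 2 ^ r * wt r 1 x := by
  have h := add_rpow_le_two_rpow_mul hr zero_le_one hx
  rw [Real.one_rpow] at h
  rw [wt, div_one]
  refine le_trans ?_ h
  calc (1 + x ^ 2) ^ (r / 2) ≤ ((1 + x) ^ 2) ^ (r / 2) := by gcongr; nlinarith
    _ = (1 + x) ^ r := by
      rw [← Real.rpow_natCast, ← Real.rpow_mul (by positivity)]; congr 1; push_cast; ring

lemma wt_one_le {r x : ℝ} (hr : 0 ≤ r) (hx : 0 ≤ x) : wt r 1 x ≤ 2 * (1 + x ^ 2) ^ (r / 2) := by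
  have h1 : 1 ≤ (1 + x ^ 2) ^ (r / 2) := Real.one_le_rpow (by nlinarith) (by positivity)
  have h2 : x ^ r ≤ (1 + x ^ 2) ^ (r / 2) := by
    calc x ^ r = (x ^ 2) ^ (r / 2) := by
          rw [← Real.rpow_natCast, ← Real.rpow_mul hx]; congr 1; push_cast; ring
      _ ≤ _ := by gcongr; linarith
  rw [wt, div_one]; linarith

lemma sobolevENorm_Op_inv_wt_le {r : ℝ} (hr : 0 ≤ r) (y : RealL2 n) :
    sobolevENorm r (Op (fun x => (wt r 1 x)⁻¹) y) ≤ ENNReal.ofReal (2 ^ r) * ‖y‖ₑ := by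
  have e : ‖y‖ₑ = eLpNorm (fourierL2 y) 2 volume := by
    rw [← Lp.enorm_def, ← ofReal_norm, ← ofReal_norm, norm_fourierL2]
  rw [e, sobolevENorm]
  refine eLpNorm_le_mul_eLpNorm_of_ae_le_mul ?_ 2
  filter_upwards [fourierL2_Op (isSymbol_inv_wt r one_pos) y] with ξ h
  have hf := freq_nonneg ξ
  have hw := wt_pos (r := r) one_pos hf
  rw [h, ← mul_assoc, norm_mul, ← Complex.ofReal_mul, Complex.norm_real, Real.norm_eq_abs]
  gcongr
  rw [abs_of_nonneg (by positivity), mul_inv_le_iff₀ hw]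
  exact one_add_sq_rpow_le hr hf

/-- Functions in `H^r` are potentials of square integrable functions. -/
lemma exists_Op_inv_wt_of_sobolevENorm {r : ℝ} (hr : 0 ≤ r) {w : RealL2 n}
    (hw : sobolevENorm r w < ∞) : ∃ z : RealL2 n, Op (fun x => (wt r 1 x)⁻¹) z = w ∧
      ‖z‖ₑ ≤ 2 * sobolevENorm r w := by
  have hle : eLpNorm (fun ξ => (wt r 1 (freq ξ) : ℂ) * fourierL2 w ξ) 2 volume
      ≤ 2 * sobolevENorm r w := by
    refine le_of_le_of_eq (b := ENNReal.ofReal 2 * sobolevENorm r w) ?_ (by simp)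
    rw [sobolevENorm]
    refine eLpNorm_le_mul_eLpNorm_of_ae_le_mul (ae_of_all _ fun ξ => ?_) _
    have hf := freq_nonneg ξ
    rw [norm_mul, norm_mul, Complex.norm_real, Complex.norm_real, Real.norm_eq_abs,
      Real.norm_eq_abs, ← mul_assoc, abs_of_pos (wt_pos one_pos hf)]
    gcongr
    exact (wt_one_le hr hf).trans (by gcongr; exact le_abs_self _)
  obtain ⟨z, hz, hzF⟩ := exists_Op_inv_wt_eq one_pos w
    (hle.trans_lt (ENNReal.mul_lt_top (by simp) hw))
  refine ⟨z, hz, ?_⟩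
  have e : ‖z‖ₑ = eLpNorm (fourierL2 z) 2 volume := by
    rw [← Lp.enorm_def, ← ofReal_norm, ← ofReal_norm, norm_fourierL2]
  rw [e, eLpNorm_congr_ae hzF]
  exact hle

lemma continuousInSobolev_Op_inv_wt {r : ℝ} (hr : 0 ≤ r) {y : ℝ → RealL2 n} (hy : Continuous y) :
    ContinuousInSobolev r fun t => Op (fun x => (wt r 1 x)⁻¹) (y t) := by
  intro t _
  refine ⟨(sobolevENorm_Op_inv_wt_le hr _).trans_lt (ENNReal.mul_lt_top (by simp) (by simp)), ?_⟩
  have h1 : Tendsto (fun t' => ENNReal.ofReal (2 ^ r) * ‖y t' - y t‖ₑ) (𝓝[Ici 0] t) (𝓝 0) := by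
    have h2 : Tendsto (fun t' => ‖y t' - y t‖ₑ) (𝓝[Ici 0] t) (𝓝 ‖y t - y t‖ₑ) :=
      ((hy.sub continuous_const).enorm.tendsto t).mono_left nhdsWithin_le_nhds
    rw [sub_self, enorm_zero] at h2
    simpa using ENNReal.Tendsto.const_mul (a := ENNReal.ofReal (2 ^ r)) h2
      (Or.inr ENNReal.ofReal_ne_top)
  refine tendsto_of_tendsto_of_tendsto_of_le_of_le tendsto_const_nhds h1 (fun _ => zero_le)
    fun t' => ?_
  simp only
  rw [← map_sub]
  exact sobolevENorm_Op_inv_wt_le hr _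

/-- Continuous paths in `H^r` are potentials of continuous paths in `L²`. -/
lemma exists_continuous_lift {r : ℝ} (hr : 0 ≤ r) {W : ℝ → RealL2 n}
    (hW : ContinuousInSobolev r W) : ∃ y : ℝ → RealL2 n, Continuous y ∧
      ∀ t, Op (fun x => (wt r 1 x)⁻¹) (y t) = W (max t 0) := by
  -- Pointwise choice is harmless: the lift is unique, and its increments are controlled by the
  -- `H^r` norm of the increments of `W`.
  choose y hy _ using fun t : ℝ =>
    exists_Op_inv_wt_of_sobolevENorm hr (hW (max t 0) (le_max_right t 0)).1
  refine ⟨y, ?_, hy⟩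
  rw [continuous_iff_continuousAt]
  intro t
  have hmax : Tendsto (fun t' : ℝ => max t' 0) (𝓝 t) (𝓝[Ici 0] (max t 0)) := by
    refine tendsto_nhdsWithin_iff.mpr ⟨?_, Eventually.of_forall fun t' => le_max_right t' 0⟩
    exact (continuous_id.max continuous_const).tendsto t
  have h1 := (hW (max t 0) (le_max_right t 0)).2.comp hmax
  have h2 : Tendsto (fun t' => 2 * sobolevENorm r (W (max t' 0) - W (max t 0))) (𝓝 t) (𝓝 0) := by
    simpa using ENNReal.Tendsto.const_mul (a := 2) h1 (Or.inr (by simp))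
  have hfin : ∀ t', sobolevENorm r (W (max t' 0) - W (max t 0)) < ∞ := by
    intro t'
    rw [← hy, ← hy, ← map_sub]
    exact (sobolevENorm_Op_inv_wt_le hr _).trans_lt (ENNReal.mul_lt_top (by simp) (by simp))
  have h3 : Tendsto (fun t' => ‖y t' - y t‖ₑ) (𝓝 t) (𝓝 0) := by
    refine tendsto_of_tendsto_of_tendsto_of_le_of_le tendsto_const_nhds h2 (fun _ => zero_le)
      fun t' => ?_
    obtain ⟨z, hz, hzn⟩ := exists_Op_inv_wt_of_sobolevENorm hr (hfin t')
    have : z = y t' - y t := by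
      apply Op_inv_wt_injective r one_pos
      rw [hz, map_sub, hy, hy]
    rw [← this]; exact hzn
  rw [ContinuousAt, tendsto_iff_edist_tendsto_0]
  simpa [edist_eq_enorm_sub] using h3

/-- Bounded paths in the solution space have the asserted decay. -/
lemma decayBounds_velocity {s m C : ℝ} {ε : ℝ≥0∞} (hσ : 0 < σ) (hr : 0 ≤ s + σ) (hC : 0 ≤ C)
    {f : ℝ → RealL2 n} (hf : ∀ t, ‖f t‖ₑ ≤ ENNReal.ofReal C * ε) :
    DecayBounds s σ m C ε (velocity σ (s + σ) (rate n σ m) f) := by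
  intro t ht
  have h1t : 0 < 1 + t := by linarith [show (0 : ℝ) ≤ t from ht]
  have hmax : max t 0 = t := max_eq_left ht
  set g := velocity σ (s + σ) (rate n σ m) f t with hg
  have hF := fourierL2_Op (isSymbol_inv_decayWt σ (s + σ) (rate n σ m) t) (f t)
  have e : ‖f t‖ₑ = eLpNorm (fourierL2 (f t)) 2 volume := by
    rw [← Lp.enorm_def, ← ofReal_norm, ← ofReal_norm, norm_fourierL2]
  have key : ∀ (c : Sp n → ℝ) (A : ℝ), 0 ≤ A →
      (∀ ξ, |c ξ * (decayWt σ (s + σ) (rate n σ m) t (freq ξ))⁻¹| ≤ A) →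
      eLpNorm (fun ξ => (c ξ : ℂ) * fourierL2 g ξ) 2 volume ≤ ENNReal.ofReal (C * A) * ε := by
    intro c A hA hcA
    have h1 : eLpNorm (fun ξ => (c ξ : ℂ) * fourierL2 g ξ) 2 volume
        ≤ ENNReal.ofReal A * ‖f t‖ₑ := by
      rw [e]
      refine eLpNorm_le_mul_eLpNorm_of_ae_le_mul ?_ 2
      filter_upwards [hF] with ξ h
      rw [hg, velocity, h, ← mul_assoc, norm_mul, ← Complex.ofReal_mul, Complex.norm_real,
        Real.norm_eq_abs]
      gcongr
      exact hcA ξ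
    refine h1.trans ?_
    rw [mul_comm C A, ENNReal.ofReal_mul hA, mul_assoc]
    exact mul_le_mul' le_rfl (hf t)
  constructor
  · rw [lebesgueENorm_two, ← ofReal_norm, ← norm_fourierL2, ofReal_norm, Lp.enorm_def]
    have h := key (fun _ => 1) ((1 + t) ^ (-rate n σ m)) (by positivity) (fun ξ => by
      have h := abs_inv_decayWt_le (σ := σ) (s + σ) (rate n σ m) t (freq_nonneg ξ)
      rwa [hmax, ← one_mul (decayWt σ (s + σ) (rate n σ m) t (freq ξ))⁻¹] at h)
    simpa using! h
  · refine key (fun ξ => (2 * Real.pi * ‖ξ‖) ^ (s + σ)) _ (by positivity) fun ξ => ?_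
    have hx := freq_nonneg ξ
    change |freq ξ ^ (s + σ) * _| ≤ _
    have hR := scale_pos σ t
    have hD := decayWt_pos (σ := σ) (s + σ) (rate n σ m) t hx
    rw [abs_of_nonneg (by positivity), mul_inv_le_iff₀ hD, decayWt, hmax, wt, ← mul_assoc]
    -- The claimed rate times `(1+t)^α` is `R^r` with `R = scale σ t`, and `x^r ≤ R^r (1 +
    -- (x/R)^r)`.
    have e2 : (1 + t) ^ (-(n * (2 - m) / (4 * m * σ)) - (s + σ) / (2 * σ)) * (1 + t) ^ rate n σ m
        = scale σ t ^ (s + σ) := by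
      rw [scale_rpow, hmax, ← Real.rpow_add h1t]
      congr 1
      unfold rate; ring
    rw [e2, Real.div_rpow hx hR.le, mul_add, mul_one, mul_div_cancel₀ _ (by positivity)]
    have : 0 ≤ scale σ t ^ (s + σ) := by positivity
    linarith

end SobolevNorms

/-! ### Equivalence of mild and Sobolev solutions, and uniqueness. -/

section MildSolutions

variable {n : ℕ} {τ δ σ κ : ℝ}

lemma mild_zero (τ δ σ κ : ℝ) (X₀ G₀ W₀ : RealL2 n) (N : ℝ → RealL2 n) :
    mild τ δ σ κ X₀ G₀ W₀ N 0 = W₀ := by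
  have e : ∀ j : Fin 3, propSym τ δ σ j 0 = fun _ => (1 : Matrix (Fin 3) (Fin 3) ℝ) 2 j := by
    intro j
    funext x
    simp [propSym, prop_zero]
  have h0 : ∀ u : RealL2 n, Op (fun _ => 0) u = 0 := fun u => by
    have := Op_smul (IsSymbol.const 0) 0 u
    simpa using this
  rw [mild, e, e, e]
  simp [h0, Op_one]

lemma SolvesVolterra.congr {w₀ W₀ G₀ : RealL2 n} {W W' N : ℝ → RealL2 n}
    (h : SolvesVolterra τ δ σ κ w₀ W₀ G₀ W N) (hW : ∀ t, 0 ≤ t → W' t = W t) :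
    SolvesVolterra τ δ σ κ w₀ W₀ G₀ W' N := by
  have hint : ∀ t, 0 ≤ t → ∫ s in (0 : ℝ)..t, W' s = ∫ s in (0 : ℝ)..t, W s := fun t ht =>
    intervalIntegral.integral_congr fun s hs => by
      rw [uIcc_of_le ht] at hs
      exact hW s hs.1
  have hstress : ∀ t, 0 ≤ t → stress τ δ w₀ W' t = stress τ δ w₀ W t := fun t ht =>
    intervalIntegral.integral_congr fun s hs => by
      rw [uIcc_of_le ht] at hs
      simp only [position, hint s hs.1, hW s hs.1]
  intro t ht
  have h3 : ∫ s in (0 : ℝ)..t, stress τ δ w₀ W' s = ∫ s in (0 : ℝ)..t, stress τ δ w₀ W s :=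
    intervalIntegral.integral_congr fun s hs => by
      rw [uIcc_of_le ht] at hs
      exact hstress s hs.1
  rw [hW t ht, hint t ht, h3]
  exact h t ht

/-- The nonlinearity `(∂ₜu)² - (∂ₜv)²` in terms of the lifted velocities. -/
def squareDiff (Q : RealL2 n →L[ℝ] RealL2 n →L[ℝ] RealL2 n) (r : ℝ) (y z : ℝ → RealL2 n) (t : ℝ) :
    RealL2 n :=
  Op (fun x => (wt r 1 x)⁻¹) (Q (y t) (y t) - Q (z t) (z t))

/-- The nonlinearity `∂ₜu ∂ₜv` in terms of the lifted velocities. -/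
def prodMul (Q : RealL2 n →L[ℝ] RealL2 n →L[ℝ] RealL2 n) (r : ℝ) (y z : ℝ → RealL2 n) (t : ℝ) :
    RealL2 n :=
  Op (fun x => (wt r 1 x)⁻¹) (Q (y t) (z t))

variable {Q : RealL2 n →L[ℝ] RealL2 n →L[ℝ] RealL2 n} {r : ℝ}

lemma continuous_squareDiff {y z : ℝ → RealL2 n} (hy : Continuous y) (hz : Continuous z) :
    Continuous (squareDiff Q r y z) :=
  (Op _).continuous.comp (((Q.continuous.comp hy).clm_apply hy).sub
    ((Q.continuous.comp hz).clm_apply hz))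

lemma continuous_prodMul {y z : ℝ → RealL2 n} (hy : Continuous y) (hz : Continuous z) :
    Continuous (prodMul Q r y z) :=
  (Op _).continuous.comp ((Q.continuous.comp hy).clm_apply hz)

/-- The pair of lifted velocities satisfies the integral equations with the given data. -/
structure SolvesMild (Q : RealL2 n →L[ℝ] RealL2 n →L[ℝ] RealL2 n) (τ δ σ r κ₁ κ₂ : ℝ)
    (u₀ u₁ u₂ v₀ v₁ v₂ : RealL2 n) (y z : ℝ → RealL2 n) : Prop where
  continuous_fst : Continuous y
  continuous_snd : Continuous z
  eq_fst : ∀ t, 0 ≤ t → Op (fun x => (wt r 1 x)⁻¹) (y t) = mild τ δ σ κ₁ (u₀ + τ • u₁)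
    (τ • u₂ + u₁ - κ₁ • squareDiff Q r y z 0) u₁ (squareDiff Q r y z) t
  eq_snd : ∀ t, 0 ≤ t → Op (fun x => (wt r 1 x)⁻¹) (z t) = mild τ δ σ κ₂ (v₀ + τ • v₁)
    (τ • v₂ + v₁ - κ₂ • prodMul Q r y z 0) v₁ (prodMul Q r y z) t

/-- The sense in which `Q` is the pointwise product. -/
def IsProduct (Q : RealL2 n →L[ℝ] RealL2 n →L[ℝ] RealL2 n) (r : ℝ) : Prop :=
  ∀ u v : RealL2 n, Op (fun x => (wt r 1 x)⁻¹) (Q u v) =ᵐ[volume]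
    fun x => Op (fun x => (wt r 1 x)⁻¹) u x * Op (fun x => (wt r 1 x)⁻¹) v x

lemma IsProduct.squareDiff_ae (hQ : IsProduct Q r) (y z : ℝ → RealL2 n) (t : ℝ) :
    (fun x => Op (fun x => (wt r 1 x)⁻¹) (y t) x ^ 2 - Op (fun x => (wt r 1 x)⁻¹) (z t) x ^ 2)
      =ᵐ[volume] squareDiff Q r y z t := by
  rw [squareDiff, map_sub]
  filter_upwards [hQ (y t) (y t), hQ (z t) (z t), Lp.coeFn_sub
    (Op (fun x => (wt r 1 x)⁻¹) (Q (y t) (y t))) (Op (fun x => (wt r 1 x)⁻¹) (Q (z t) (z t)))]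
    with x h1 h2 h3
  rw [h3, Pi.sub_apply, h1, h2]; ring

lemma IsProduct.prodMul_ae (hQ : IsProduct Q r) (y z : ℝ → RealL2 n) (t : ℝ) :
    (fun x => Op (fun x => (wt r 1 x)⁻¹) (y t) x * Op (fun x => (wt r 1 x)⁻¹) (z t) x)
      =ᵐ[volume] prodMul Q r y z t := (hQ (y t) (z t)).symm

/-- Mild solutions are Sobolev solutions. -/
lemma SolvesMild.isSobolevSolution {BA : ℝ} (hτ : 0 < τ) (hδ : 0 < δ) (hσ : 0 < σ) (hr : 0 ≤ r)
    (hQ : IsProduct Q r) {u₀ u₁ u₂ v₀ v₁ v₂ : RealL2 n} {y z : ℝ → RealL2 n}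
    (h : SolvesMild Q τ δ σ r (1 + BA / 2) (2 + BA) u₀ u₁ u₂ v₀ v₁ v₂ y z) :
    IsSobolevSolution τ δ BA σ r u₀ u₁ u₂ v₀ v₁ v₂
      (position u₀ fun t => Op (fun x => (wt r 1 x)⁻¹) (y t))
      (position v₀ fun t => Op (fun x => (wt r 1 x)⁻¹) (z t))
      (fun t => Op (fun x => (wt r 1 x)⁻¹) (y t)) (fun t => Op (fun x => (wt r 1 x)⁻¹) (z t)) := by
  have hU : Continuous fun t => Op (fun x => (wt r 1 x)⁻¹) (y t) :=
    (Op _).continuous.comp h.continuous_fst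
  have hV : Continuous fun t => Op (fun x => (wt r 1 x)⁻¹) (z t) :=
    (Op _).continuous.comp h.continuous_snd
  have hN₁ := continuous_squareDiff (Q := Q) (r := r) h.continuous_fst h.continuous_snd
  have hN₂ := continuous_prodMul (Q := Q) (r := r) h.continuous_fst h.continuous_snd
  have hU0 : Op (fun x => (wt r 1 x)⁻¹) (y 0) = u₁ := by rw [h.eq_fst 0 le_rfl, mild_zero]
  have hV0 : Op (fun x => (wt r 1 x)⁻¹) (z 0) = v₁ := by rw [h.eq_snd 0 le_rfl, mild_zero]
  refine ⟨fun t _ => ?_, fun t _ => ?_, continuousInSobolev_Op_inv_wt hr h.continuous_fst,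
    continuousInSobolev_Op_inv_wt hr h.continuous_snd, by simp [position], hU0,
    by simp [position], hV0, ?_, ?_⟩
  · exact ((hasDerivAt_primitive hU t).const_add u₀).hasDerivWithinAt
  · exact ((hasDerivAt_primitive hV t).const_add v₀).hasDerivWithinAt
  · refine SolvesVolterra.solvesMGT hτ hσ hU hN₁ (fun t _ => hQ.squareDiff_ae y z t) hU0 ?_
    exact (solvesVolterra_mild hτ hδ hσ u₀ u₁ _ hN₁).congr h.eq_fst
  · refine SolvesVolterra.solvesMGT hτ hσ hV hN₂ (fun t _ => hQ.prodMul_ae y z t) hV0 ?_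
    exact (solvesVolterra_mild hτ hδ hσ v₀ v₁ _ hN₂).congr h.eq_snd

/-- The velocities lift to continuous paths in `L²`, so the nonlinear terms are continuous in `L²`
as well. With these as given forcing, the mild formula solves the same linear Volterra equation,
whose solution is unique. No smallness is involved. -/
lemma IsProduct.mild_of_isSobolevSolution {BA : ℝ} (hτ : 0 < τ) (hδ : 0 < δ) (hσ : 0 < σ)
    (hr : 0 ≤ r) (hQ : IsProduct Q r) {u₀ u₁ u₂ v₀ v₁ v₂ : RealL2 n} {u v U V : ℝ → RealL2 n}
    (h : IsSobolevSolution τ δ BA σ r u₀ u₁ u₂ v₀ v₁ v₂ u v U V) :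
    ∃ y z : ℝ → RealL2 n, SolvesMild Q τ δ σ r (1 + BA / 2) (2 + BA) u₀ u₁ u₂ v₀ v₁ v₂ y z ∧
      ∀ t, 0 ≤ t → U t = Op (fun x => (wt r 1 x)⁻¹) (y t) ∧
        V t = Op (fun x => (wt r 1 x)⁻¹) (z t) ∧
        u t = position u₀ (fun t => Op (fun x => (wt r 1 x)⁻¹) (y t)) t ∧
        v t = position v₀ (fun t => Op (fun x => (wt r 1 x)⁻¹) (z t)) t := by
  obtain ⟨y, hy, hyU⟩ := exists_continuous_lift hr h.continuous_U
  obtain ⟨z, hz, hzV⟩ := exists_continuous_lift hr h.continuous_V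
  have hUe : ∀ t, 0 ≤ t → U t = Op (fun x => (wt r 1 x)⁻¹) (y t) := fun t ht => by
    rw [hyU, max_eq_left ht]
  have hVe : ∀ t, 0 ≤ t → V t = Op (fun x => (wt r 1 x)⁻¹) (z t) := fun t ht => by
    rw [hzV, max_eq_left ht]
  have hU : Continuous fun t => Op (fun x => (wt r 1 x)⁻¹) (y t) := (Op _).continuous.comp hy
  have hV : Continuous fun t => Op (fun x => (wt r 1 x)⁻¹) (z t) := (Op _).continuous.comp hz
  have hN₁ := continuous_squareDiff (Q := Q) (r := r) hy hz
  have hN₂ := continuous_prodMul (Q := Q) (r := r) hy hz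
  have hpos : ∀ (w₀ : RealL2 n) (w W Y : ℝ → RealL2 n), Continuous Y →
      (∀ t, 0 ≤ t → W t = Y t) → (∀ t ∈ Ici (0 : ℝ), HasDerivWithinAt w (W t) (Ici 0) t) →
      w 0 = w₀ → ∀ t, 0 ≤ t → w t = position w₀ Y t := by
    intro w₀ w W Y hY hWY hw h0 t ht
    refine eqOn_Ici_of_hasDerivWithinAt hw (fun t ht => ?_) (by rw [h0]; simp [position]) ht
    rw [hWY t ht]
    exact ((hasDerivAt_primitive hY t).const_add w₀).hasDerivWithinAt
  have hup := hpos u₀ u U _ hU hUe h.deriv_u h.init_u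
  have hvp := hpos v₀ v V _ hV hVe h.deriv_v h.init_v
  have hU0 : Op (fun x => (wt r 1 x)⁻¹) (y 0) = u₁ := by rw [← hUe 0 le_rfl, h.init_U]
  have hV0 : Op (fun x => (wt r 1 x)⁻¹) (z 0) = v₁ := by rw [← hVe 0 le_rfl, h.init_V]
  refine ⟨y, z, ⟨hy, hz, fun t ht => ?_, fun t ht => ?_⟩, fun t ht =>
    ⟨hUe t ht, hVe t ht, hup t ht, hvp t ht⟩⟩
  · have h1 := solvesVolterra_of_solvesMGT hσ hU hN₁ (fun t ht => by
      have := hQ.squareDiff_ae y z t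
      rwa [← hUe t ht, ← hVe t ht] at this) hup hUe h.eq_u
    simp only [hU0] at h1
    exact h1.unique hτ hδ hσ hU (continuous_mild hτ hδ σ _ _ _ _ hN₁)
      (solvesVolterra_mild hτ hδ hσ u₀ u₁ _ hN₁) ht
  · have h1 := solvesVolterra_of_solvesMGT hσ hV hN₂ (fun t ht => by
      have := hQ.prodMul_ae y z t
      rwa [← hUe t ht, ← hVe t ht] at this) hvp hVe h.eq_v
    simp only [hV0] at h1
    exact h1.unique hτ hδ hσ hV (continuous_mild hτ hδ σ _ _ _ _ hN₂)
      (solvesVolterra_mild hτ hδ hσ v₀ v₁ _ hN₂) ht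

/-- The data terms cancel, and the Duhamel kernel is bounded on `L²` and commutes with the lifting,
so the estimate holds for the lifts without loss of derivatives. -/
lemma exists_norm_sub_le_of_mild (hτ : 0 < τ) (hδ : 0 < δ) (σ r κ : ℝ) :
    ∃ C : ℝ, 0 ≤ C ∧ ∀ (X₀ G₀ W₀ : RealL2 n) (y y' q q' : ℝ → RealL2 n), Continuous q →
      Continuous q' → ∀ t, 0 ≤ t →
      Op (fun x => (wt r 1 x)⁻¹) (y t) = mild τ δ σ κ X₀ G₀ W₀
        (fun s => Op (fun x => (wt r 1 x)⁻¹) (q s)) t →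
      Op (fun x => (wt r 1 x)⁻¹) (y' t) = mild τ δ σ κ X₀ G₀ W₀
        (fun s => Op (fun x => (wt r 1 x)⁻¹) (q' s)) t →
      ‖y t - y' t‖ ≤ C * ∫ s in (0 : ℝ)..t, ‖q s - q' s‖ := by
  obtain ⟨C, hC, H⟩ := exists_sym_bound hτ hδ σ
  refine ⟨|κ| * C, by positivity, fun X₀ G₀ W₀ y y' q q' hq hq' t ht h h' => ?_⟩
  have hw := isSymbol_inv_wt r one_pos
  have hk := fun s => isSymbol_kerSym hτ hδ σ (t - s)
  have hcont : ∀ {g : ℝ → RealL2 n}, Continuous g →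
      Continuous fun s => Op (kerSym τ δ σ (t - s)) (g s) := fun hg =>
    (continuous_Op_kerSym hτ hδ σ hg).comp (continuous_const.prodMk continuous_id)
  have hcomm : ∀ (g : RealL2 n) s, Op (kerSym τ δ σ (t - s)) (Op (fun x => (wt r 1 x)⁻¹) g)
      = Op (fun x => (wt r 1 x)⁻¹) (Op (kerSym τ δ σ (t - s)) g) := by
    intro g s
    rw [Op_Op (hk s) hw, Op_Op hw (hk s)]
    simp only [mul_comm]
  have hqq : Continuous fun s => q s - q' s := hq.sub hq'
  have hA : Continuous fun s => Op (fun x => (wt r 1 x)⁻¹) (q s) := (Op _).continuous.comp hq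
  have hA' : Continuous fun s => Op (fun x => (wt r 1 x)⁻¹) (q' s) := (Op _).continuous.comp hq'
  have e : y t - y' t = κ • ∫ s in (0 : ℝ)..t, Op (kerSym τ δ σ (t - s)) (q s - q' s) := by
    apply Op_inv_wt_injective r one_pos
    rw [map_sub, h, h', mild, mild, add_sub_add_left_eq_sub, ← smul_sub, map_smul,
      ← ContinuousLinearMap.intervalIntegral_comp_comm _ ((hcont hqq).intervalIntegrable _ _),
      ← intervalIntegral.integral_sub ((hcont hA).intervalIntegrable _ _)
        ((hcont hA').intervalIntegrable _ _)]
    simp only [hcomm, ← map_sub]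
  rw [e, norm_smul, Real.norm_eq_abs, mul_assoc, ← intervalIntegral.integral_const_mul]
  gcongr
  refine intervalIntegral.norm_integral_le_of_norm_le ht (ae_of_all _ fun s _ =>
    norm_Op_le (hk s).measurable (fun x hx => (H _ x hx).2) _) ?_
  exact (((hq.sub hq').norm.const_mul C : Continuous fun s => C * ‖q s - q' s‖)).intervalIntegrable _ _

/-- Mild solutions are unique. -/
lemma SolvesMild.unique (hτ : 0 < τ) (hδ : 0 < δ) {κ₁ κ₂ : ℝ} {u₀ u₁ u₂ v₀ v₁ v₂ : RealL2 n}
    {y z y' z' : ℝ → RealL2 n} (h : SolvesMild Q τ δ σ r κ₁ κ₂ u₀ u₁ u₂ v₀ v₁ v₂ y z)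
    (h' : SolvesMild Q τ δ σ r κ₁ κ₂ u₀ u₁ u₂ v₀ v₁ v₂ y' z') {t : ℝ} (ht : 0 ≤ t) :
    y t = y' t ∧ z t = z' t := by
  obtain ⟨C₁, hC₁, H₁⟩ := exists_norm_sub_le_of_mild (n := n) hτ hδ σ r κ₁
  obtain ⟨C₂, hC₂, H₂⟩ := exists_norm_sub_le_of_mild (n := n) hτ hδ σ r κ₂
  -- Needed because the datum `G(0)` contains the nonlinearity at time `0`, which must coincide for
  -- both solutions.
  have hy0 : y 0 = y' 0 := Op_inv_wt_injective r one_pos (by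
    rw [h.eq_fst 0 le_rfl, h'.eq_fst 0 le_rfl, mild_zero, mild_zero])
  have hz0 : z 0 = z' 0 := Op_inv_wt_injective r one_pos (by
    rw [h.eq_snd 0 le_rfl, h'.eq_snd 0 le_rfl, mild_zero, mild_zero])
  have hy := h.continuous_fst
  have hz := h.continuous_snd
  have hy' := h'.continuous_fst
  have hz' := h'.continuous_snd
  have hbc : Continuous fun s => ‖y s‖ + ‖y' s‖ + ‖z s‖ + ‖z' s‖ := by fun_prop
  -- Boundedness on the compact interval replaces smallness: it makes the nonlinearity Lipschitz
  -- along both solutions.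
  obtain ⟨A, hA⟩ := (isCompact_Icc (a := (0 : ℝ)) (b := t)).exists_bound_of_continuousOn
    hbc.continuousOn
  have hbd : ∀ s ∈ Set.Icc 0 t, ‖y s‖ ≤ A ∧ ‖y' s‖ ≤ A ∧ ‖z s‖ ≤ A ∧ ‖z' s‖ ≤ A := by
    intro s hs
    have h1 := (le_abs_self _).trans (hA s hs)
    refine ⟨?_, ?_, ?_, ?_⟩ <;>
      linarith [norm_nonneg (y s), norm_nonneg (y' s), norm_nonneg (z s), norm_nonneg (z' s)]
  have hA0 : 0 ≤ A := (norm_nonneg _).trans (hbd 0 ⟨le_rfl, ht⟩).1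
  set φ : ℝ → ℝ := fun s => ‖y s - y' s‖ + ‖z s - z' s‖ with hφ
  have hφc : Continuous φ := by fun_prop
  have hQc : ∀ {f g : ℝ → RealL2 n}, Continuous f → Continuous g →
      Continuous fun s => Q (f s) (g s) := fun hf hg => (Q.continuous.comp hf).clm_apply hg
  have hq₁ := (hQc hy hy).sub (hQc hz hz)
  have hq₁' := (hQc hy' hy').sub (hQc hz' hz')
  have hq₂ := hQc hy hz
  have hq₂' := hQc hy' hz'
  have hd₁ : ∀ s ∈ Set.Icc 0 t, ‖(Q (y s) (y s) - Q (z s) (z s)) -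
      (Q (y' s) (y' s) - Q (z' s) (z' s))‖ ≤ 4 * ‖Q‖ * A * φ s := by
    intro s hs
    obtain ⟨b1, b2, b3, b4⟩ := hbd s hs
    have g1 := norm_bilin_sub_le Q b1 b2 (le_refl ‖y s - y' s‖) le_rfl
    have g2 := norm_bilin_sub_le Q b3 b4 (le_refl ‖z s - z' s‖) le_rfl
    have e : (Q (y s) (y s) - Q (z s) (z s)) - (Q (y' s) (y' s) - Q (z' s) (z' s))
        = (Q (y s) (y s) - Q (y' s) (y' s)) - (Q (z s) (z s) - Q (z' s) (z' s)) := by abel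
    rw [e]
    refine (norm_sub_le _ _).trans ((add_le_add g1 g2).trans ?_)
    have p1 : 0 ≤ ‖Q‖ * A * ‖y s - y' s‖ := by positivity
    have p2 : 0 ≤ ‖Q‖ * A * ‖z s - z' s‖ := by positivity
    simp only [hφ]
    linarith
  have hd₂ : ∀ s ∈ Set.Icc 0 t, ‖Q (y s) (z s) - Q (y' s) (z' s)‖ ≤ 4 * ‖Q‖ * A * φ s := by
    intro s hs
    obtain ⟨b1, b2, b3, b4⟩ := hbd s hs
    have g1 := norm_bilin_sub_le Q b3 b2 (d := φ s) (u := y s) (v' := z' s)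
      (by simp only [hφ]; linarith [norm_nonneg (z s - z' s)])
      (by simp only [hφ]; linarith [norm_nonneg (y s - y' s)])
    refine g1.trans ?_
    have p1 : 0 ≤ ‖Q‖ * A * φ s := by positivity
    linarith
  have hmono : ∀ (p : ℝ → RealL2 n), Continuous p →
      (∀ s ∈ Set.Icc 0 t, ‖p s‖ ≤ 4 * ‖Q‖ * A * φ s) → ∀ s, 0 ≤ s → s ≤ t →
      ∫ a in (0 : ℝ)..s, ‖p a‖ ≤ 4 * ‖Q‖ * A * ∫ a in (0 : ℝ)..s, φ a := by
    intro p hp hle s hs hst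
    rw [← intervalIntegral.integral_const_mul]
    refine intervalIntegral.integral_mono_on hs (hp.norm.intervalIntegrable _ _)
      ((hφc.const_mul _ : Continuous fun a => 4 * ‖Q‖ * A * φ a).intervalIntegrable _ _)
      fun a ha => hle a ⟨ha.1, ha.2.trans hst⟩
  have key := eq_zero_of_le_mul_integral (f := φ) (T := t) (C := (C₁ + C₂) * (4 * ‖Q‖ * A)) hφc
    (fun s => by positivity) (by positivity) (fun s hs hst => ?_) ht le_rfl
  · have k1 := norm_nonneg (y t - y' t)
    have k2 := norm_nonneg (z t - z' t)
    simp only [hφ] at key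
    exact ⟨sub_eq_zero.mp (norm_eq_zero.mp (by linarith)),
      sub_eq_zero.mp (norm_eq_zero.mp (by linarith))⟩
  · have e₁ := H₁ _ _ _ y y' _ _ hq₁ hq₁' s hs (h.eq_fst s hs) (by
      have := h'.eq_fst s hs
      rwa [show squareDiff Q r y' z' 0 = squareDiff Q r y z 0 by
        rw [squareDiff, squareDiff, hy0, hz0]] at this)
    have e₂ := H₂ _ _ _ z z' _ _ hq₂ hq₂' s hs (h.eq_snd s hs) (by
      have := h'.eq_snd s hs
      rwa [show prodMul Q r y' z' 0 = prodMul Q r y z 0 by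
        rw [prodMul, prodMul, hy0, hz0]] at this)
    have m₁ := hmono _ (hq₁.sub hq₁') hd₁ s hs hst
    have m₂ := hmono _ (hq₂.sub hq₂') hd₂ s hs hst
    calc φ s ≤ C₁ * (4 * ‖Q‖ * A * ∫ a in (0 : ℝ)..s, φ a)
          + C₂ * (4 * ‖Q‖ * A * ∫ a in (0 : ℝ)..s, φ a) :=
          add_le_add (e₁.trans (mul_le_mul_of_nonneg_left m₁ hC₁))
            (e₂.trans (mul_le_mul_of_nonneg_left m₂ hC₂))
      _ = _ := by ring

end MildSolutions

/-! ### Lifting the initial data. -/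

section InitialData

variable {n : ℕ} {σ : ℝ}

lemma Op_baseSym_eq {j : Fin 3} (hj : j ≠ 1) (σ r : ℝ) :
    (Op (baseSym σ r j) : RealL2 n →L[ℝ] RealL2 n) = Op fun x => (wt r 1 x)⁻¹ := by
  congr 1
  funext x
  simp [baseSym, hj]

/-- For an element of `H^r` the extra factor `1 + x^σ` of the middle base symbol can be divided out
at no cost. -/
lemma exists_Op_baseSym_one_eq {r : ℝ} (hσ : 0 ≤ σ) (hr : σ ≤ r) (q : RealL2 n) :
    ∃ a : RealL2 n, Op (baseSym σ r 1) a = Op (fun x => (wt r 1 x)⁻¹) q ∧ ‖a‖ ≤ ‖q‖ := by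
  have hle : ∀ x : ℝ, 0 ≤ x → |(1 + x ^ σ)⁻¹| ≤ 1 := fun x hx => by
    have := Real.rpow_nonneg hx σ
    rw [abs_of_nonneg (by positivity)]
    exact inv_le_one_of_one_le₀ (by linarith)
  have hm : IsSymbol fun x : ℝ => (1 + x ^ σ)⁻¹ := .of_le (by fun_prop) hle
  refine ⟨Op (fun x => (1 + x ^ σ)⁻¹) q, ?_, by simpa using norm_Op_le hm.measurable hle q⟩
  have hb := isSymbol_baseSym hσ hr 1
  rw [Op_Op hb hm, Op_congr (hb.mul hm) (isSymbol_inv_wt r one_pos)]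
  intro x hx
  have := Real.rpow_nonneg hx σ
  simp only [baseSym, if_true]
  field_simp

/-- Regularity `H^s` is enough for the middle component because `1 + x^(s+σ) ≤ (1 + x^σ)(1 + x^s)`.
-/
lemma exists_Op_baseSym_one_of_sobolevENorm {s : ℝ} (hσ : 0 ≤ σ) (hs : 0 ≤ s) {w : RealL2 n}
    (hw : sobolevENorm s w < ∞) :
    ∃ a : RealL2 n, Op (baseSym σ (s + σ) 1) a = w ∧ ‖a‖ₑ ≤ 2 * sobolevENorm s w := by
  obtain ⟨z, hz, hzn⟩ := exists_Op_inv_wt_of_sobolevENorm hs hw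
  have hle : ∀ x : ℝ, 0 ≤ x → |wt (s + σ) 1 x * ((1 + x ^ σ)⁻¹ * (wt s 1 x)⁻¹)| ≤ 1 := by
    intro x hx
    have h1 := Real.rpow_nonneg hx σ
    have h2 := Real.rpow_nonneg hx s
    have h3 : x ^ (s + σ) = x ^ s * x ^ σ := Real.rpow_add_of_nonneg hx hs hσ
    simp only [wt, div_one]
    rw [abs_of_nonneg (by positivity), ← mul_inv, mul_inv_le_iff₀ (by positivity), h3]
    nlinarith
  have hm : IsSymbol fun x : ℝ => wt (s + σ) 1 x * ((1 + x ^ σ)⁻¹ * (wt s 1 x)⁻¹) :=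
    .of_le ((measurable_wt _ _).mul
      (((by fun_prop : Measurable fun x : ℝ => (1 + x ^ σ)⁻¹)).mul (measurable_wt _ _).inv)) hle
  refine ⟨Op (fun x => wt (s + σ) 1 x * ((1 + x ^ σ)⁻¹ * (wt s 1 x)⁻¹)) z, ?_,
    le_trans ?_ hzn⟩
  · have hb := isSymbol_baseSym hσ (le_add_of_nonneg_left hs) 1
    rw [Op_Op hb hm, Op_congr (hb.mul hm) (isSymbol_inv_wt s one_pos), hz]
    intro x hx
    have h1 := Real.rpow_nonneg hx σ
    have h2 := (wt_pos (r := s + σ) one_pos hx).ne'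
    have h3 := (wt_pos (r := s) one_pos hx).ne'
    have h4 : 1 + x ^ σ ≠ 0 := by positivity
    simp only [baseSym, if_true]
    field_simp
  · rw [← ofReal_norm, ← ofReal_norm]
    exact ENNReal.ofReal_le_ofReal (by simpa using norm_Op_le hm.measurable hle z)

lemma norm_le_of_enorm_le {z : RealL2 n} {e : ℝ≥0∞} {ε : ℝ} (hε : 0 ≤ ε) (hz : ‖z‖ₑ ≤ 2 * e)
    (he : e ≤ ENNReal.ofReal ε) : ‖z‖ ≤ 2 * ε := by
  have h : ‖z‖ₑ ≤ ENNReal.ofReal (2 * ε) := by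
    rw [ENNReal.ofReal_mul zero_le_two]
    exact hz.trans (mul_le_mul' (by simp) he)
  rw [← ofReal_norm] at h
  exact (ENNReal.ofReal_le_ofReal_iff (by positivity)).mp h

lemma norm_smul_add_sub_smul_le {E : Type*} [NormedAddCommGroup E] [NormedSpace ℝ E] {a b c : E}
    (τ κ : ℝ) {A : ℝ} (ha : ‖a‖ ≤ A) (hb : ‖b‖ ≤ A) (hc : ‖c‖ ≤ A) :
    ‖τ • a + b - κ • c‖ ≤ (|τ| + 1 + |κ|) * A := by
  refine (norm_sub_le _ _).trans ?_
  refine (add_le_add (norm_add_le _ _) le_rfl).trans ?_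
  rw [norm_smul, norm_smul, Real.norm_eq_abs, Real.norm_eq_abs]
  have h1 := mul_le_mul_of_nonneg_left ha (abs_nonneg τ)
  have h2 := mul_le_mul_of_nonneg_left hc (abs_nonneg κ)
  linarith

lemma norm_add_smul_le {E : Type*} [NormedAddCommGroup E] [NormedSpace ℝ E] {a b : E} (τ κ : ℝ)
    {A : ℝ} (ha : ‖a‖ ≤ A) (hb : ‖b‖ ≤ A) : ‖a + τ • b‖ ≤ (|τ| + 1 + |κ|) * A := by
  have hA : 0 ≤ A := (norm_nonneg _).trans ha
  have h := norm_smul_add_sub_smul_le τ κ hb ha (c := 0) (by simpa using hA)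
  simpa [add_comm] using h

/-- The data of the integral equation in terms of the data of the Cauchy problem. -/
lemma exists_data_lift {s m : ℝ} (hσ : 0 < σ) (hs : 0 ≤ s) (hr : (n : ℝ) / 2 < s + σ) (hm : 1 ≤ m)
    (hm2 : m < 2) (τ κ : ℝ) : ∃ K : ℝ, 0 < K ∧ ∀ (w₀ w₁ w₂ q : RealL2 n) (ε : ℝ), 0 ≤ ε →
      dataENorm s σ m w₀ w₁ w₂ ≤ ENNReal.ofReal ε → ‖q‖ ≤ ε →
      (∀ᵐ ξ, ‖fourierL2 (Op (fun x => (wt (s + σ) 1 x)⁻¹) q) ξ‖ ≤ ε) →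
      ∃ z : Fin 3 → RealL2 n, Op (baseSym σ (s + σ) 0) (z 0) = w₀ + τ • w₁ ∧
        Op (baseSym σ (s + σ) 1) (z 1) =
          τ • w₂ + w₁ - κ • Op (fun x => (wt (s + σ) 1 x)⁻¹) q ∧
        Op (baseSym σ (s + σ) 2) (z 2) = w₁ ∧ (∀ j, ‖z j‖ ≤ K * ε) ∧
        ∀ j R, 0 < R → R ≤ 1 →
          ‖Op (fun x => (wt (s + σ) R x)⁻¹) (Op (baseSym σ (s + σ) j) (z j))‖
            ≤ R ^ (2 * σ * rate n σ m) * (K * ε) := by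
  obtain ⟨K₁, hK₁, H₁⟩ := exists_norm_Op_inv_wt_le_lebesgue (n := n) hr
  obtain ⟨K₂, hK₂, H₂⟩ := exists_norm_Op_inv_wt_le_of_bounded (n := n) hr
  set A : ℝ := K₁ + K₂ + 2 with hA
  have hm0 : 0 < m := by linarith
  refine ⟨(|τ| + 1 + |κ|) * A, by positivity, fun w₀ w₁ w₂ q ε hε hd hq hqF => ?_⟩
  unfold dataENorm at hd
  have e₀ := (le_self_add.trans le_self_add).trans (le_self_add.trans hd)
  have l₀ := (le_add_self.trans le_self_add).trans (le_self_add.trans hd)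
  have e₁ := (le_self_add.trans le_add_self).trans (le_self_add.trans hd)
  have l₁ := (le_add_self.trans le_add_self).trans (le_self_add.trans hd)
  have e₂ := le_self_add.trans (le_add_self.trans hd)
  have l₂ := le_add_self.trans (le_add_self.trans hd)
  have hrσ : σ ≤ s + σ := le_add_of_nonneg_left hs
  have hr0 : 0 ≤ s + σ := by linarith
  obtain ⟨z₀, hz₀, n₀⟩ := exists_Op_inv_wt_of_sobolevENorm hr0 (e₀.trans_lt ENNReal.ofReal_lt_top)
  obtain ⟨z₁, hz₁, n₁⟩ := exists_Op_inv_wt_of_sobolevENorm hr0 (e₁.trans_lt ENNReal.ofReal_lt_top)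
  obtain ⟨a₂, ha₂, n₂⟩ := exists_Op_baseSym_one_of_sobolevENorm hσ.le hs
    (e₂.trans_lt ENNReal.ofReal_lt_top)
  obtain ⟨a₁, ha₁, n₁'⟩ := exists_Op_baseSym_one_eq hσ.le hrσ z₁
  obtain ⟨b, hb, nb⟩ := exists_Op_baseSym_one_eq hσ.le hrσ q
  have h2A : 2 * ε ≤ A * ε := by gcongr; linarith
  have g₀ : ‖z₀‖ ≤ A * ε := (norm_le_of_enorm_le hε n₀ e₀).trans h2A
  have g₁ : ‖z₁‖ ≤ A * ε := (norm_le_of_enorm_le hε n₁ e₁).trans h2A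
  have g₂ : ‖a₂‖ ≤ A * ε := (norm_le_of_enorm_le hε n₂ e₂).trans h2A
  have gb : ‖b‖ ≤ A * ε := by linarith
  have hone : (1 : ℝ) ≤ |τ| + 1 + |κ| := by linarith [abs_nonneg τ, abs_nonneg κ]
  have hself : A * ε ≤ (|τ| + 1 + |κ|) * (A * ε) := le_mul_of_one_le_left (by positivity) hone
  have hrate : 2 * σ * rate n σ m = n * (1 / m - 1 / 2) := by
    unfold rate; field_simp; ring
  have hlow : ∀ w : RealL2 n, lebesgueENorm m w ≤ ENNReal.ofReal ε → ∀ R : ℝ, 0 < R →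
      ‖Op (fun x => (wt (s + σ) R x)⁻¹) w‖ ≤ R ^ (2 * σ * rate n σ m) * (A * ε) := by
    intro w hw R hR
    have h := H₁ m hm hm2 w ε hε hw R hR
    rw [hrate]
    refine h.trans ?_
    rw [mul_comm K₁, mul_assoc]
    gcongr
    linarith
  have hlowq : ∀ R : ℝ, 0 < R → R ≤ 1 →
      ‖Op (fun x => (wt (s + σ) R x)⁻¹) (Op (fun x => (wt (s + σ) 1 x)⁻¹) q)‖
        ≤ R ^ (2 * σ * rate n σ m) * (A * ε) := by
    intro R hR hR1
    refine (H₂ _ ε hε hqF R hR).trans ?_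
    -- The initial product has a bounded transform, like an `L¹` function; for `R ≤ 1` this is at
    -- least as good as data in `L^m`.
    have hp : R ^ ((n : ℝ) / 2) ≤ R ^ (2 * σ * rate n σ m) := by
      refine Real.rpow_le_rpow_of_exponent_ge hR hR1 ?_
      rw [hrate]
      have : 1 / m ≤ 1 := by rw [div_le_one hm0]; exact hm
      have hn : (0 : ℝ) ≤ n := Nat.cast_nonneg n
      nlinarith
    rw [mul_comm K₂, mul_assoc]
    gcongr
    linarith
  have E₀ : Op (baseSym σ (s + σ) 0) (z₀ + τ • z₁) = w₀ + τ • w₁ := by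
    rw [Op_baseSym_eq (by decide), map_add, map_smul, hz₀, hz₁]
  have E₁ : Op (baseSym σ (s + σ) 1) (τ • a₂ + a₁ - κ • b) =
      τ • w₂ + w₁ - κ • Op (fun x => (wt (s + σ) 1 x)⁻¹) q := by
    rw [map_sub, map_add, map_smul, map_smul, ha₂, ha₁, hb, hz₁]
  have E₂ : Op (baseSym σ (s + σ) 2) z₁ = w₁ := by rw [Op_baseSym_eq (by decide), hz₁]
  refine ⟨![z₀ + τ • z₁, τ • a₂ + a₁ - κ • b, z₁], E₀, E₁, E₂, fun j => ?_, fun j R hR hR1 => ?_⟩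
  · rw [mul_assoc]
    fin_cases j
    · exact norm_add_smul_le τ κ g₀ g₁
    · exact norm_smul_add_sub_smul_le τ κ g₂ (n₁'.trans g₁) gb
    · exact g₁.trans hself
  · have eq : R ^ (2 * σ * rate n σ m) * ((|τ| + 1 + |κ|) * A * ε)
        = (|τ| + 1 + |κ|) * (R ^ (2 * σ * rate n σ m) * (A * ε)) := by ring
    rw [eq]
    fin_cases j
    · change ‖Op _ (Op (baseSym σ (s + σ) 0) (z₀ + τ • z₁))‖ ≤ _
      rw [E₀, map_add, map_smul]
      exact norm_add_smul_le τ κ (hlow _ l₀ R hR) (hlow _ l₁ R hR)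
    · change ‖Op _ (Op (baseSym σ (s + σ) 1) (τ • a₂ + a₁ - κ • b))‖ ≤ _
      rw [E₁, map_sub, map_add, map_smul, map_smul]
      exact norm_smul_add_sub_smul_le τ κ (hlow _ l₂ R hR) (hlow _ l₁ R hR) (hlowq R hR hR1)
    · change ‖Op _ (Op (baseSym σ (s + σ) 2) z₁)‖ ≤ _
      rw [E₂]
      exact (hlow _ l₁ R hR).trans (le_mul_of_one_le_left (by positivity) hone)

end InitialData

/-! ### Global existence with decay for small data. -/

section GlobalSolutions

variable {n : ℕ} {τ δ σ : ℝ}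

lemma enorm_le_of_norm_le {E : Type*} [NormedAddCommGroup E] {x : E} {C : ℝ} {ε : ℝ≥0∞}
    (hε : ε ≠ ∞) (hC : 0 ≤ C) (hx : ‖x‖ ≤ C * ε.toReal) : ‖x‖ₑ ≤ ENNReal.ofReal C * ε := by
  rw [← ofReal_norm]
  refine (ENNReal.ofReal_le_ofReal hx).trans_eq ?_
  rw [ENNReal.ofReal_mul hC, ENNReal.ofReal_toReal hε]

/-- The condition on the exponents gives the three inequalities used for the nonlinear terms. -/
lemma exponent_conditions (hn : 0 < n) {m₁ m₂ : ℝ} (h₁ : 1 ≤ m₁) (h₂ : 1 ≤ m₂)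
    (hm : 1 / min m₁ m₂ + σ / (n : ℝ) ≤ 2 / max m₁ m₂) :
    σ ≤ n * (1 / m₁ + 1 / m₁ - 1 / m₁) ∧ σ ≤ n * (1 / m₂ + 1 / m₂ - 1 / m₁) ∧
      σ ≤ n * (1 / m₁ + 1 / m₂ - 1 / m₂) := by
  have hn' : (0 : ℝ) < n := Nat.cast_pos.mpr hn
  have p₁ : 0 < m₁ := by linarith
  have p₂ : 0 < m₂ := by linarith
  have e : (2 : ℝ) / max m₁ m₂ = 2 * (1 / max m₁ m₂) := by ring
  rw [e] at hm
  have key : ∀ x : ℝ, σ / n ≤ x → σ ≤ n * x := fun x hx => by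
    rw [div_le_iff₀ hn'] at hx; linarith
  rcases le_total m₁ m₂ with h | h
  · have h3 := one_div_le_one_div_of_le p₁ h
    rw [min_eq_left h, max_eq_right h] at hm
    exact ⟨key _ (by linarith), key _ (by linarith), key _ (by linarith)⟩
  · have h3 := one_div_le_one_div_of_le p₂ h
    rw [min_eq_right h, max_eq_left h] at hm
    exact ⟨key _ (by linarith), key _ (by linarith), key _ (by linarith)⟩

/-- Bounds of the initial values of the nonlinear terms. -/
lemma norm_initial_product_le {r : ℝ} (Q : RealL2 n →L[ℝ] RealL2 n →L[ℝ] RealL2 n)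
    (hQ : ∀ u v : RealL2 n, ∀ᵐ ξ, ‖fourierL2 (Op (fun x => (wt r 1 x)⁻¹) (Q u v)) ξ‖ ≤
        ‖Op (fun x => (wt r 1 x)⁻¹) u‖ * ‖Op (fun x => (wt r 1 x)⁻¹) v‖)
    {p p' : RealL2 n} {ε : ℝ} (hp : (‖p‖ + ‖p'‖) ^ 2 ≤ ε) :
    (‖Q p p - Q p' p'‖ ≤ (1 + ‖Q‖) * ε ∧
      ∀ᵐ ξ, ‖fourierL2 (Op (fun x => (wt r 1 x)⁻¹) (Q p p - Q p' p')) ξ‖ ≤ (1 + ‖Q‖) * ε) ∧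
    ‖Q p p'‖ ≤ (1 + ‖Q‖) * ε ∧
      ∀ᵐ ξ, ‖fourierL2 (Op (fun x => (wt r 1 x)⁻¹) (Q p p')) ξ‖ ≤ (1 + ‖Q‖) * ε := by
  have hn := norm_nonneg p
  have hn' := norm_nonneg p'
  have hQn := norm_nonneg Q
  have hε : 0 ≤ ε := (sq_nonneg _).trans hp
  have h1 : ‖p‖ * ‖p‖ + ‖p'‖ * ‖p'‖ ≤ ε := by nlinarith
  have h2 : ‖p‖ * ‖p'‖ ≤ ε := by nlinarith
  have hle : ∀ f g : RealL2 n, ‖Op (fun x => (wt r 1 x)⁻¹) f‖ * ‖Op (fun x => (wt r 1 x)⁻¹) g‖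
      ≤ ‖f‖ * ‖g‖ := fun f g => by
    gcongr <;> exact norm_Op_inv_wt_le one_pos _
  have hεQ : ε ≤ (1 + ‖Q‖) * ε := by nlinarith
  have hQε : ‖Q‖ * ε ≤ (1 + ‖Q‖) * ε := by nlinarith
  refine ⟨⟨?_, ?_⟩, ?_, ?_⟩
  · refine (norm_sub_le _ _).trans ((add_le_add (Q.le_opNorm₂ p p) (Q.le_opNorm₂ p' p')).trans ?_)
    refine le_trans ?_ hQε
    have := mul_le_mul_of_nonneg_left h1 hQn
    linarith
  · rw [map_sub]
    filter_upwards [hQ p p, hQ p' p', fourierL2_sub_ae (Op (fun x => (wt r 1 x)⁻¹) (Q p p))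
      (Op (fun x => (wt r 1 x)⁻¹) (Q p' p'))] with ξ k1 k2 k3
    rw [k3]
    exact (norm_sub_le _ _).trans (by linarith [hle p p, hle p' p'])
  · refine (Q.le_opNorm₂ p p').trans ((le_trans ?_ hQε))
    have := mul_le_mul_of_nonneg_left h2 hQn
    linarith
  · filter_upwards [hQ p p'] with ξ k1
    linarith [hle p p']

/-- Global existence and decay of mild solutions with small data. -/
lemma exists_solvesMild {s m₁ m₂ : ℝ} (hτ : 0 < τ) (hδ : 0 < δ) (hσ : 0 < σ) (hs : 0 ≤ s)
    (hr : (n : ℝ) / 2 < s + σ) (Q : RealL2 n →L[ℝ] RealL2 n →L[ℝ] RealL2 n) {CQ : ℝ}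
    (hCQ : 0 < CQ) (hQ : ∀ u v : RealL2 n,
      (∀ R, 0 < R → R ≤ 1 → ‖Op (fun x => wt (s + σ) R x / wt (s + σ) 1 x) (Q u v)‖ ≤
        CQ * R ^ ((n : ℝ) / 2) * ‖Op (fun x => wt (s + σ) R x / wt (s + σ) 1 x) u‖ *
          ‖Op (fun x => wt (s + σ) R x / wt (s + σ) 1 x) v‖) ∧
      ∀ᵐ ξ, ‖fourierL2 (Op (fun x => (wt (s + σ) 1 x)⁻¹) (Q u v)) ξ‖ ≤
        ‖Op (fun x => (wt (s + σ) 1 x)⁻¹) u‖ * ‖Op (fun x => (wt (s + σ) 1 x)⁻¹) v‖)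
    (hm₁ : 1 ≤ m₁ ∧ m₁ < 2) (hm₂ : 1 ≤ m₂ ∧ m₂ < 2)
    (h₁ : σ ≤ n * (1 / m₁ + 1 / m₁ - 1 / m₁)) (h₂ : σ ≤ n * (1 / m₂ + 1 / m₂ - 1 / m₁))
    (h₃ : σ ≤ n * (1 / m₁ + 1 / m₂ - 1 / m₂)) (κ₁ κ₂ : ℝ) :
    ∃ ε₀ : ℝ, 0 < ε₀ ∧ ∃ C : ℝ, 0 < C ∧ ∀ u₀ u₁ u₂ v₀ v₁ v₂ : RealL2 n,
      dataSize s σ m₁ m₂ u₀ u₁ u₂ v₀ v₁ v₂ ≤ ENNReal.ofReal ε₀ →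
      ∃ y z : ℝ → RealL2 n,
        SolvesMild Q τ δ σ (s + σ) κ₁ κ₂ u₀ u₁ u₂ v₀ v₁ v₂ y z ∧
        DecayBounds s σ m₁ C (dataSize s σ m₁ m₂ u₀ u₁ u₂ v₀ v₁ v₂)
          (fun t => Op (fun x => (wt (s + σ) 1 x)⁻¹) (y t)) ∧
        DecayBounds s σ m₂ C (dataSize s σ m₁ m₂ u₀ u₁ u₂ v₀ v₁ v₂)
          (fun t => Op (fun x => (wt (s + σ) 1 x)⁻¹) (z t)) := by
  have hr0 : 0 ≤ s + σ := by linarith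
  have hα := rate_nonneg n hσ hm₁.1 hm₁.2
  have hβ := rate_nonneg n hσ hm₂.1 hm₂.2
  obtain ⟨ε₁, hε₁, C, hC, H⟩ := exists_global_paths hτ hδ hσ hr (le_add_of_nonneg_left hs) Q hCQ hQ
    hm₁ hm₂ h₁ h₂ h₃ κ₁ κ₂
  obtain ⟨K₁, hK₁, D₁⟩ := exists_data_lift (n := n) hσ hs hr hm₁.1 hm₁.2 τ κ₁
  obtain ⟨K₂, hK₂, D₂⟩ := exists_data_lift (n := n) hσ hs hr hm₂.1 hm₂.2 τ κ₂
  -- The initial products are at most `(1 + ‖Q‖) * 4 * ε`; since `L ≥ 1`, the same bound serves for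
  -- the data.
  set L : ℝ := (1 + ‖Q‖) * 4 with hL
  have hL0 : 0 < L := by positivity
  have hL1 : 1 ≤ L := by linarith [norm_nonneg Q]
  set K : ℝ := max K₁ K₂ * L with hK
  have hK0 : 0 < K := by positivity
  refine ⟨ε₁ / K, by positivity, C * K, by positivity, fun u₀ u₁ u₂ v₀ v₁ v₂ hd => ?_⟩
  set e := dataSize s σ m₁ m₂ u₀ u₁ u₂ v₀ v₁ v₂ with he
  have hfin : e ≠ ∞ := ne_top_of_le_ne_top ENNReal.ofReal_ne_top hd
  set ε : ℝ := e.toReal with hε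
  have hε0 : 0 ≤ ε := ENNReal.toReal_nonneg
  have heε : e = ENNReal.ofReal ε := (ENNReal.ofReal_toReal hfin).symm
  have hKε : K * ε ≤ ε₁ := by
    have h := ENNReal.toReal_le_of_le_ofReal (by positivity) hd
    rwa [le_div_iff₀ hK0, mul_comm] at h
  have hdu : dataENorm s σ m₁ u₀ u₁ u₂ ≤ e := le_self_add.trans le_self_add
  have hdv : dataENorm s σ m₂ v₀ v₁ v₂ ≤ e := le_add_self.trans le_self_add
  have hd2 : (sobolevENorm (s + σ) u₁ + sobolevENorm (s + σ) v₁) ^ 2 ≤ e := le_add_self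
  have hfu : sobolevENorm (s + σ) u₁ < ∞ :=
    ((le_self_add.trans le_add_self).trans (le_self_add.trans hdu)).trans_lt hfin.lt_top
  have hfv : sobolevENorm (s + σ) v₁ < ∞ :=
    ((le_self_add.trans le_add_self).trans (le_self_add.trans hdv)).trans_lt hfin.lt_top
  obtain ⟨p, hp, hpn⟩ := exists_Op_inv_wt_of_sobolevENorm hr0 hfu
  obtain ⟨p', hp', hpn'⟩ := exists_Op_inv_wt_of_sobolevENorm hr0 hfv
  -- Lifting costs a factor `2`, and the squared term in `ε` makes the initial nonlinearity linear
  -- in `ε`.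
  have hpp : (‖p‖ + ‖p'‖) ^ 2 ≤ 4 * ε := by
    have h : (‖p‖ₑ + ‖p'‖ₑ) ^ 2 ≤ 4 * e := by
      calc (‖p‖ₑ + ‖p'‖ₑ) ^ 2
          ≤ (2 * sobolevENorm (s + σ) u₁ + 2 * sobolevENorm (s + σ) v₁) ^ 2 := by gcongr
        _ = 4 * (sobolevENorm (s + σ) u₁ + sobolevENorm (s + σ) v₁) ^ 2 := by ring
        _ ≤ 4 * e := by gcongr
    have h' := ENNReal.toReal_mono (ENNReal.mul_ne_top (by simp) hfin) h
    simpa [ENNReal.toReal_mul, ENNReal.toReal_pow, ENNReal.toReal_add] using h'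
  obtain ⟨⟨q1, q2⟩, q3, q4⟩ := norm_initial_product_le Q (fun u v => (hQ u v).2) hpp
  rw [← mul_assoc] at q1 q2 q3 q4
  have hLε : e ≤ ENNReal.ofReal (L * ε) := by
    rw [heε]; exact ENNReal.ofReal_le_ofReal (le_mul_of_one_le_left hε0 hL1)
  obtain ⟨z, hz0, hz1, hz2, hzn, hzl⟩ := D₁ u₀ u₁ u₂ (Q p p - Q p' p') (L * ε) (by positivity)
    (hdu.trans hLε) q1 q2
  obtain ⟨y, hy0, hy1, hy2, hyn, hyl⟩ := D₂ v₀ v₁ v₂ (Q p p') (L * ε) (by positivity)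
    (hdv.trans hLε) q3 q4
  have hle₁ : K₁ * (L * ε) ≤ K * ε := by
    rw [← mul_assoc]
    exact mul_le_mul_of_nonneg_right
      (mul_le_mul_of_nonneg_right (le_max_left K₁ K₂) hL0.le) hε0
  have hle₂ : K₂ * (L * ε) ≤ K * ε := by
    rw [← mul_assoc]
    exact mul_le_mul_of_nonneg_right
      (mul_le_mul_of_nonneg_right (le_max_right K₁ K₂) hL0.le) hε0
  obtain ⟨f, g, hf, hg, hfg⟩ := H z y (K * ε) hKε (fun j => (hzn j).trans hle₁)
    (fun j R hR hR1 => (hzl j R hR hR1).trans (by gcongr)) (fun j => (hyn j).trans hle₂)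
    (fun j R hR hR1 => (hyl j R hR hR1).trans (by gcongr))
  rw [hz0, hz1, hz2, hy0, hy1, hy2] at hfg
  have hvf := velocity_eq hσ hr0 hα f
  have hvg := velocity_eq hσ hr0 hβ g
  set Y : ℝ → RealL2 n := fun t => Op (liftSym σ (s + σ) (rate n σ m₁) t) (f t) with hY
  set Z : ℝ → RealL2 n := fun t => Op (liftSym σ (s + σ) (rate n σ m₂) t) (g t) with hZ
  -- The datum `G(0)` was built from the lifts `p` and `p'` before the solution was known; the
  -- solution does start at them, so its own nonlinearity at time `0` is the one used.
  have hY0 : Y 0 = p := Op_inv_wt_injective (s + σ) one_pos (by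
    rw [hp, ← hvf, (hfg 0 le_rfl).1, mild_zero])
  have hZ0 : Z 0 = p' := Op_inv_wt_injective (s + σ) one_pos (by
    rw [hp', ← hvg, (hfg 0 le_rfl).2, mild_zero])
  refine ⟨Y, Z, ⟨continuous_Op_liftSym hσ hr0 hα f.continuous,
    continuous_Op_liftSym hσ hr0 hβ g.continuous, fun t ht => ?_, fun t ht => ?_⟩, ?_, ?_⟩
  · rw [squareDiff, hY0, hZ0, ← hvf, (hfg t ht).1]
    rfl
  · rw [prodMul, hY0, hZ0, ← hvg, (hfg t ht).2]
    rfl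
  · rw [← funext hvf]
    refine decayBounds_velocity hσ hr0 (by positivity) fun t => enorm_le_of_norm_le hfin
      (by positivity) ((f.norm_coe_le_norm t).trans (by rw [mul_assoc]; exact hf))
  · rw [← funext hvg]
    refine decayBounds_velocity hσ hr0 (by positivity) fun t => enorm_le_of_norm_le hfin
      (by positivity) ((g.norm_coe_le_norm t).trans (by rw [mul_assoc]; exact hg))

lemma position_congr {w₀ : RealL2 n} {W W' : ℝ → RealL2 n} (h : ∀ t, 0 ≤ t → W t = W' t) {t : ℝ}
    (ht : 0 ≤ t) : position w₀ W t = position w₀ W' t := by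
  rw [position, position]
  congr 1
  refine intervalIntegral.integral_congr fun s hs => ?_
  rw [uIcc_of_le ht] at hs
  exact h s hs.1

end GlobalSolutions

end

theorem theorem2p2 (n : ℕ) (hn : 0 < n) (τ δ BA σ s m₁ m₂ : ℝ)
    (hτ : 0 < τ) (hδ : 0 < δ) (hBA : 0 < BA) (hσ : 0 < σ)
    (hm₁ : 1 ≤ m₁ ∧ m₁ < 2) (hm₂ : 1 ≤ m₂ ∧ m₂ < 2)
    (hs : max ((n : ℝ) / 2 - σ) 0 < s)
    (hm : 1 / min m₁ m₂ + σ / (n : ℝ) ≤ 2 / max m₁ m₂) :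
    ∃ ε₀ : ℝ, 0 < ε₀ ∧ ∃ C : ℝ, 0 < C ∧
      ∀ u₀ u₁ u₂ v₀ v₁ v₂ : RealL2 n,
        MemDataSpace s σ m₁ u₀ u₁ u₂ → MemDataSpace s σ m₂ v₀ v₁ v₂ →
        dataSize s σ m₁ m₂ u₀ u₁ u₂ v₀ v₁ v₂ ≤ ENNReal.ofReal ε₀ →
        ∃ u v U V : ℝ → RealL2 n,
          IsSobolevSolution τ δ BA σ (s + σ) u₀ u₁ u₂ v₀ v₁ v₂ u v U V ∧
          (∀ u' v' U' V' : ℝ → RealL2 n,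
            IsSobolevSolution τ δ BA σ (s + σ) u₀ u₁ u₂ v₀ v₁ v₂ u' v' U' V' →
            ∀ t ∈ Ici (0 : ℝ), u' t = u t ∧ v' t = v t ∧ U' t = U t ∧ V' t = V t) ∧
          DecayBounds s σ m₁ C (dataSize s σ m₁ m₂ u₀ u₁ u₂ v₀ v₁ v₂) U ∧
          DecayBounds s σ m₂ C (dataSize s σ m₁ m₂ u₀ u₁ u₂ v₀ v₁ v₂) V := by
  have hs0 : 0 ≤ s := (le_max_right _ _).trans hs.le
  have hr : (n : ℝ) / 2 < s + σ := by linarith [(le_max_left ((n : ℝ) / 2 - σ) 0).trans_lt hs]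
  have hr0 : 0 ≤ s + σ := by linarith
  obtain ⟨h₁, h₂, h₃⟩ := exponent_conditions hn hm₁.1 hm₂.1 hm
  obtain ⟨Q, CQ, hCQ, hQ⟩ := exists_sobolevMul (n := n) hr
  have hprod : IsProduct Q (s + σ) := fun u v => (hQ u v).1
  obtain ⟨ε₀, hε₀, C, hC, H⟩ := exists_solvesMild hτ hδ hσ hs0 hr Q hCQ (fun u v => (hQ u v).2)
    hm₁ hm₂ h₁ h₂ h₃ (1 + BA / 2) (2 + BA)
  refine ⟨ε₀, hε₀, C, hC, fun u₀ u₁ u₂ v₀ v₁ v₂ _ _ hd => ?_⟩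
  obtain ⟨y, z, hyz, hU, hV⟩ := H u₀ u₁ u₂ v₀ v₁ v₂ hd
  refine ⟨_, _, _, _, hyz.isSobolevSolution hτ hδ hσ hr0 hprod, ?_, hU, hV⟩
  intro u' v' U' V' h' t ht
  obtain ⟨y', z', hyz', e⟩ := hprod.mild_of_isSobolevSolution hτ hδ hσ hr0 h'
  -- Equality of the lifts at all times is needed, since the positions are time integrals of the
  -- velocities.
  have huniq := fun s (hs : 0 ≤ s) => hyz'.unique hτ hδ hyz (t := s) hs
  obtain ⟨e₁, e₂, e₃, e₄⟩ := e t ht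
  refine ⟨e₃.trans (position_congr (fun s hs => ?_) ht),
    e₄.trans (position_congr (fun s hs => ?_) ht), ?_, ?_⟩
  · rw [(huniq s hs).1]
  · rw [(huniq s hs).2]
  · rw [e₁, (huniq t ht).1]
  · rw [e₂, (huniq t ht).2]
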